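/- **Model.** Inventory is managed over replenishment cycles of $T\ge 1$ periods. In each period, independently, a customer of type $j\in\{1,\dots,M\}$ ($M\ge 2$) arrives with probability $\lambda_j\ge 0$ and nobody arrives with probability $\lambda_0=1-\sum_{j=1}^M\lambda_j>0$. Serving a type-$j$ customer uses one unit of inventory and earns $r_j$, where $0<r_1<\dots<r_M$; unserved customers are lost. Each unit left at the end of a cycle costs $h>0$. At the start of every cycle, under the base-stock policy with level $S\in\mathbb{N}$, one orders $S$ minus the inventory position (on-hand inventory plus outstanding orders); the order arrives $L\ge 1$ cycles later. Initial states have nonnegative integer components and inventory position at most $S$. The *myopic offline* algorithm knows all arrivals of the current cycle and serves its customers from the highest type to the lowest until the on-hand inventory is used up. The *greedy* algorithm serves every arriving customer while inventory is available. For $\mathrm{alg}\in\{\mathrm{off},\mathrm{greedy}\}$ let $\pi^{\mathrm{alg}}(T,S)$ be the limit, as $N\to\infty$, of the expected average profit per cycle over the first $N$ cycles. For each $T\ge1$ let $S^{\mathrm{off}}_T,S^{\mathrm{greedy}}_T\in\mathbb{N}$ maximize $\pi^{\mathrm{off}}(T,\cdot)$ and $\pi^{\mathrm{greedy}}(T,\cdot)$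 over all base-stock levels. Write $\pi^{\mathrm{off}}_T=\pi^{\mathrm{off}}(T,S_T^{\mathrm{off}})$, $\pi^{\mathrm{greedy}}_T=\pi^{\mathrm{greedy}}(T,S_T^{\mathrm{greedy}})$, $\Delta_T=(L+1)T(1-\lambda_0)-S_T^{\mathrm{greedy}}$, and call $T$ *interior* if $(L+1)T\lambda_M<S_T^{\mathrm{greedy}}<(L+1)T(1-\lambda_0)$. Let $I_T$ be the on-hand inventory at the start of a cycle in stationarity under base-stock level $S_T^{\mathrm{greedy}}$. Put $$A_k=\sum_{j=k}^M r_j\lambda_j-r_{k-1}\sum_{j=k}^M\lambda_j,\qquad A=\min_{2\le k\le M}A_k,\qquad M_1=\sum_{j=1}^M\sqrt{\lambda_j(1-\lambda_j)} .$$ **Theorem.** (0) For all $T\ge1$ and $S\in\mathbb{N}$, the start-of-cycle inventory and pipeline have exactly one stationary distribution on the states with inventory position at most $S$, the same for both algorithms. The limits $\pi^{\mathrm{off}}(T,S)$ and $\pi^{\mathrm{greedy}}(T,S)$ exist and do not depend on the initial state. If $\lambda_M>0$, then $A>0$. (1) For every interior $T\ge1$, $$\pi^{\mathrm{off}}_T-\pi^{\mathrm{greedy}}_T\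 \ge\ \frac{A}{1-\lambda_0}\cdot\frac{\Delta_T}{4(L+1)}\,\Pr\!\Big(T\lambda_M<I_T\le T(1-\lambda_0)-\frac{\Delta_T}{4(L+1)}\Big)-M_1\sqrt T .$$ (2) Suppose that all sufficiently large $T$ are interior. Then there is a constant $K_2$ with $$\mathbb{E}\Big|I_T-\frac{S_T^{\mathrm{greedy}}}{L+1}\Big|\le K_2\sqrt T\qquad\text{for all interior }T\ge1,$$ and for every such $K_2$ there is $T_1<\infty$ such that for all $T\ge T_1$ $$\pi^{\mathrm{off}}_T-\pi^{\mathrm{greedy}}_T\ \ge\ \frac{A}{2(1-\lambda_0)(L+1)}\,\Delta_T-\Big(\frac{AK_2}{1-\lambda_0}+M_1\Big)\sqrt T .$$ If moreover $\lambda_M>0$ and $\Delta_T=\Theta(T^\beta)$ for some $\beta\in[0,1]$, then the first term on the right is $\Theta(T^\beta)$ and the subtracted term is $\Theta(\sqrt T)$. -/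

import Mathlib

open MeasureTheory Filter Topology

noncomputable section

namespace InvFul

/-- Primitives of the inventory system: `M` customer types, lead time `L`, arrival probabilities
`lam 1, …, lam M` (and `lam 0` for no arrival), rewards `r 1 < … < r M`, unit holding cost `h`.
Values of `lam` and `r` outside these index ranges play no role. -/
structure Model where
  M : ℕ
  L : ℕ
  lam : ℕ → ℝ
  r : ℕ → ℝ
  h : ℝ
  two_le_M : 2 ≤ M
  one_le_L : 1 ≤ L
  lam_nonneg : ∀ j, j ≤ M → 0 ≤ lam j
  lam_sum : ∑ j ∈ Finset.range (M + 1), lam j = 1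
  lam_zero_pos : 0 < lam 0
  r_one_pos : 0 < r 1
  r_lt : ∀ j, 1 ≤ j → j < M → r j < r (j + 1)
  h_pos : 0 < h

/-- The two fulfillment algorithms: myopic offline and online greedy. -/
inductive Alg where
  | offline
  | greedy

variable (P : Model)

/-- Arrivals of one cycle of `T` periods; the value `0` means that nobody arrives. -/
abbrev Model.Arrivals (T : ℕ) : Type := Fin T → Fin (P.M + 1)

/-- On-hand inventory at the beginning of each period under greedy fulfillment, which serves every
arriving customer as long as inventory is available. -/
def Model.greedyInv {T : ℕ} (I : ℕ) (H : P.Arrivals T) : ℕ → ℕ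
  | 0 => I
  | t + 1 =>
    if ∃ ht : t < T, H ⟨t, ht⟩ ≠ 0 ∧ 0 < Model.greedyInv I H t then Model.greedyInv I H t - 1
    else Model.greedyInv I H t

open Classical in
/-- Acceptance indicator of the customer of period `t` in a cycle that starts with `I` units.
Offline: the customers of the cycle are served from the highest type to the lowest (within a type
in order of arrival) until the `I` units are used. Greedy: serve whenever stock is available. -/
def Model.accept {T : ℕ} : Alg → ℕ → P.Arrivals T → Fin T → ℕ
  | Alg.offline, I, H, t =>
    if H t ≠ 0 ∧ (Finset.univ.filter fun s => H t < H s ∨ (H s = H t ∧ s < t)).card < I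
    then 1 else 0
  | Alg.greedy, I, H, t => if H t ≠ 0 ∧ 0 < P.greedyInv I H t then 1 else 0

/-- End-of-cycle inventory. -/
def Model.leftover {T : ℕ} (a : Alg) (I : ℕ) (H : P.Arrivals T) : ℕ :=
  I - ∑ t, P.accept a I H t

/-- Profit of one cycle: collected rewards minus the holding cost of the leftover inventory. -/
def Model.profit {T : ℕ} (a : Alg) (I : ℕ) (H : P.Arrivals T) : ℝ :=
  (∑ t, P.r (H t) * (P.accept a I H t : ℝ)) - P.h * (P.leftover a I H : ℝ)

/-- State at the start of a cycle, before ordering: entry `0` is the on-hand inventory and entry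
`l`, for `1 ≤ l ≤ L - 1`, is the order that arrives `l` cycles later. -/
abbrev Model.State : Type := Fin P.L → ℕ

def Model.onHand (x : P.State) : ℕ := x ⟨0, P.one_le_L⟩

/-- The inventory position does not exceed the base-stock level `S`. -/
def Model.Feasible (S : ℕ) (x : P.State) : Prop := ∑ l, x l ≤ S

/-- The base-stock order, which raises the inventory position to `S` and arrives `L` cycles later.
(On feasible states the subtraction is not truncated.) -/
def Model.order (S : ℕ) (x : P.State) : ℕ := S - ∑ l, x l

/-- State at the start of the next cycle: the pipeline, extended by the new order, shifts by one,
and the leftover inventory is added to the on-hand entry. -/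
def Model.step {T : ℕ} (a : Alg) (S : ℕ) (x : P.State) (H : P.Arrivals T) : P.State := fun l =>
  (if hl : (l : ℕ) + 1 < P.L then x ⟨(l : ℕ) + 1, hl⟩ else P.order S x) +
    (if (l : ℕ) = 0 then P.leftover a (P.onHand x) H else 0)

/-- State at the start of the cycle with index `n` (counted from `0`) along the arrival path `ω`. -/
def Model.state {T : ℕ} (a : Alg) (S : ℕ) (x₀ : P.State) (ω : ℕ → P.Arrivals T) : ℕ → P.State
  | 0 => x₀
  | n + 1 => P.step a S (Model.state a S x₀ ω n) (ω n)

theorem Model.sum_arrival :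
    ∑ j : Fin (P.M + 1), ENNReal.ofReal (P.lam j) = 1 := by
  rw [Fin.sum_univ_eq_sum_range (fun j => ENNReal.ofReal (P.lam j)) (P.M + 1),
    ← ENNReal.ofReal_sum_of_nonneg
      (fun j hj => P.lam_nonneg j (Nat.lt_succ_iff.mp (Finset.mem_range.mp hj))),
    P.lam_sum, ENNReal.ofReal_one]

/-- Law of the arrival of one period. -/
def Model.arrivalLaw : PMF (Fin (P.M + 1)) :=
  PMF.ofFintype (fun j => ENNReal.ofReal (P.lam j)) P.sum_arrival

/-- Law of the arrivals of one cycle: independent over the periods. -/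
abbrev Model.cycleLaw (T : ℕ) : Measure (P.Arrivals T) :=
  Measure.pi fun _ => P.arrivalLaw.toMeasure

/-- Law of the arrivals of all cycles: independent over the cycles. -/
abbrev Model.pathLaw (T : ℕ) : Measure (ℕ → P.Arrivals T) :=
  Measure.infinitePi fun _ => P.cycleLaw T

/-- Expected average profit per cycle over the first `N` cycles, from the initial state `x₀`. -/
def Model.avgProfit (a : Alg) (T S : ℕ) (x₀ : P.State) (N : ℕ) : ℝ :=
  (1 / (N : ℝ)) *
    ∫ ω, ∑ n ∈ Finset.range N, P.profit a (P.onHand (P.state a S x₀ ω n)) (ω n) ∂(P.pathLaw T)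

/-- Long-run average profit per cycle with base-stock level `S` (system started empty). -/
def Model.longRunProfit (a : Alg) (T S : ℕ) : ℝ :=
  limUnder atTop fun N => P.avgProfit a T S 0 N

/-- `S` maximizes the long-run average profit over all base-stock levels. -/
def Model.IsOptimal (a : Alg) (T S : ℕ) : Prop :=
  ∀ S' : ℕ, P.longRunProfit a T S' ≤ P.longRunProfit a T S

/-- `ν` is a stationary distribution of the start-of-cycle state with base-stock level `S`. -/
structure Model.IsStationary (a : Alg) (T S : ℕ) (ν : Measure P.State) : Prop where
  isProbabilityMeasure : IsProbabilityMeasure ν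
  feasible : ∀ᵐ x ∂ν, P.Feasible S x
  invariant : (ν.prod (P.cycleLaw T)).map (fun z => P.step a S z.1 z.2) = ν

/-- The slack `(L + 1) T (1 - λ₀) - S`. -/
def Model.slack (T S : ℕ) : ℝ := ((P.L : ℝ) + 1) * T * (1 - P.lam 0) - S

/-- The interior regime `(L + 1) T λ_M < S < (L + 1) T (1 - λ₀)`. -/
def Model.Interior (T S : ℕ) : Prop :=
  ((P.L : ℝ) + 1) * T * P.lam P.M < S ∧ (S : ℝ) < ((P.L : ℝ) + 1) * T * (1 - P.lam 0)

def Model.Ak (k : ℕ) : ℝ :=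
  (∑ j ∈ Finset.Icc k P.M, P.r j * P.lam j) - P.r (k - 1) * ∑ j ∈ Finset.Icc k P.M, P.lam j

/-- `A = min_{2 ≤ k ≤ M} A_k`. -/
def Model.A : ℝ :=
  (Finset.Icc 2 P.M).inf' ⟨2, Finset.mem_Icc.mpr ⟨le_rfl, P.two_le_M⟩⟩ P.Ak

/-- `M₁ = ∑_j √(λ_j (1 - λ_j))`. -/
def Model.M₁ : ℝ := ∑ j ∈ Finset.Icc 1 P.M, Real.sqrt (P.lam j * (1 - P.lam j))

/-- For the base-stock levels `S T`, the stationary start-of-cycle inventory is within `K₂ √T` of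
`S T / (L + 1)` in mean, for every cycle length `T ≥ 1` at which `S T` is interior. -/
def Model.Concentration (S : ℕ → ℕ) (K₂ : ℝ) : Prop :=
  ∀ T : ℕ, 1 ≤ T → P.Interior T (S T) → ∀ ν : Measure P.State,
    P.IsStationary Alg.greedy T (S T) ν →
      ∫ x, |(P.onHand x : ℝ) - (S T : ℝ) / ((P.L : ℝ) + 1)| ∂ν ≤ K₂ * Real.sqrt T

end InvFul

end

noncomputable section

namespace InvFul

/-! ### Product expectations and the law of binomial counts -/

section

/-! Both algorithms sell the minimum of stock and demand in every cycle, so they drive the same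
inventory chain and differ only in which customers earn the reward. From every feasible state, L
cycles without customers lead to the state with all stock on hand. This Doeblin condition on a
finite state space gives the unique stationary law and the convergence of all averages.

Write q = 1 - λ₀, p = λ_M, and let B_s be binomial with T trials and success probability s.
Splitting rewards into increments between neighbouring classes, the expected gain of offline over
greedy in a cycle that starts with I units is the sum over classes k of the increment times (tail_k
/ q) E(B_q - I)⁺ - E(B_{tail_k} - I)⁺. Every term is nonnegative because E(B_s - I)⁺ / s is
nondecreasing in s (`excess_div_mono`). Keeping only the top class leaves A / q times `advantage`,
that is E(B_q - I)⁺ - (q / p) E(B_p - I)⁺, whose stationary mean must be bounded below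
(`Model.reward_gain`, `Model.longRun_gain`). If λ_M = 0 then A = 0 and the bounds only need a
nonnegative gain.

Long cycles. Here E(B_q - I)⁺ ≥ Tq - I is used. Comparing the optimal greedy level with one near (L
+ 1)Tq shows that the slack and the fluctuations of I are of order √T. Consequently the top-class
excess has bounded mean, and M₁√T eventually absorbs it (`Model.long_cycles`).

Every interior T. Put b = S / (L + 1) and δ = (Tq - b) / 4, which is the slack divided by 4(L + 1).
The goal is that the mean advantage is at least δ times the probability of Tp < I ≤ Tq - δ; the term
M₁√T is not needed for this. Pointwise, for Tp < I ≤ b the advantage is at least δ because a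
binomial variable with integer mean I, 1 ≤ I < T, exceeds its mean with probability at least 1/4
(`upper_ge_quarter`). For I > b one replaces p by b / T and compares the shortfall of one binomial
variable with the rescaled excess of another (`inflated_le_shortfall`); the proof of this comparison
depends on the size of T - I relative to I.

The pointwise bound is not available when T - I is small relative to I and I is far above b. There
linear programming duality takes over. Stationarity gives a mean inventory of at least b, and an
exponential estimate of cumulative sales bounds the mean leftover (`Model.leftover_le`). A
nonnegative multiple of these two constraints lies below the advantage minus its target for every I
(`exists_dual`), and taking stationary means finishes the proof. -/

/-- Expectation of `g` when the coordinates of `H` are independent with weights `w`. -/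
def prodE {α : Type*} [Fintype α] (w : α → ℝ) (T : ℕ) (g : (Fin T → α) → ℝ) : ℝ :=
  ∑ H : Fin T → α, (∏ t, w (H t)) * g H

section ProdE
variable {α : Type*} [Fintype α] {w : α → ℝ}

theorem prodE_zero (g : (Fin 0 → α) → ℝ) : prodE w 0 g = g Fin.elim0 := by
  simp [prodE, Subsingleton.elim (default : Fin 0 → α) Fin.elim0]

theorem prodE_succ (T : ℕ) (g : (Fin (T + 1) → α) → ℝ) :
    prodE w (T + 1) g = ∑ j, w j * prodE w T (fun H => g (Fin.cons j H)) := by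
  unfold prodE
  rw [← (Fin.consEquiv (fun _ : Fin (T + 1) => α)).sum_comp, Fintype.sum_prod_type]
  refine Finset.sum_congr rfl fun j _ => ?_
  rw [Finset.mul_sum]
  refine Finset.sum_congr rfl fun H _ => ?_
  simp [Fin.consEquiv, Fin.prod_univ_succ, mul_assoc]

theorem prodE_add (T : ℕ) (f g : (Fin T → α) → ℝ) :
    prodE w T (fun H => f H + g H) = prodE w T f + prodE w T g := by
  simp [prodE, mul_add, Finset.sum_add_distrib]

theorem prodE_sub (T : ℕ) (f g : (Fin T → α) → ℝ) :
    prodE w T (fun H => f H - g H) = prodE w T f - prodE w T g := by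
  simp [prodE, mul_sub, Finset.sum_sub_distrib]

theorem prodE_const_mul (T : ℕ) (c : ℝ) (f : (Fin T → α) → ℝ) :
    prodE w T (fun H => c * f H) = c * prodE w T f := by
  simp only [prodE, Finset.mul_sum]
  exact Finset.sum_congr rfl fun H _ => by ring

theorem prodE_sum {ι : Type*} (s : Finset ι) (T : ℕ) (f : ι → (Fin T → α) → ℝ) :
    prodE w T (fun H => ∑ i ∈ s, f i H) = ∑ i ∈ s, prodE w T (f i) := by
  simp only [prodE, Finset.mul_sum]
  exact Finset.sum_comm

theorem prodE_const (hw : ∑ j, w j = 1) (T : ℕ) (c : ℝ) : prodE w T (fun _ => c) = c := by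
  induction T with
  | zero => exact prodE_zero _
  | succ T ih => rw [prodE_succ]; simp only [ih]; rw [← Finset.sum_mul, hw, one_mul]

theorem prodE_mono (hw : ∀ j, 0 ≤ w j) (T : ℕ) {f g : (Fin T → α) → ℝ} (h : ∀ H, f H ≤ g H) :
    prodE w T f ≤ prodE w T g :=
  Finset.sum_le_sum fun H _ =>
    mul_le_mul_of_nonneg_left (h H) (Finset.prod_nonneg fun t _ => hw (H t))

end ProdE

/-- Expectation of `f` at the number of successes in `T` independent trials of probability `s`. -/
def bern (s : ℝ) : ℕ → (ℕ → ℝ) → ℝ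
  | 0, f => f 0
  | T + 1, f => s * bern s T (fun k => f (k + 1)) + (1 - s) * bern s T f

theorem bern_succ (s : ℝ) (T : ℕ) (f : ℕ → ℝ) :
    bern s (T + 1) f = s * bern s T (fun k => f (k + 1)) + (1 - s) * bern s T f := rfl

/-- Only whether each coordinate satisfies `p` matters, and conditioning on the first coordinate
reproduces the recursion of `bern`. Expectations of customer counts are reduced to binomial ones
through this. -/
theorem prodE_card {α : Type*} [Fintype α] {w : α → ℝ} (hw : ∑ j, w j = 1)
    (p : α → Prop) [DecidablePred p] (T : ℕ) (f : ℕ → ℝ) :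
    prodE w T (fun H => f (Finset.univ.filter fun t => p (H t)).card) =
      bern (∑ j with p j, w j) T f := by
  induction T generalizing f with
  | zero => rw [prodE_zero]; simp [bern]
  | succ T ih =>
    have hcard : ∀ (j : α) (H : Fin T → α),
        (Finset.univ.filter fun t => p ((Fin.cons j H : Fin (T + 1) → α) t)).card =
          (if p j then 1 else 0) + (Finset.univ.filter fun t => p (H t)).card := by
      intro j H
      simp only [Finset.card_filter, Fin.sum_univ_succ, Fin.cons_zero, Fin.cons_succ]
    rw [prodE_succ, bern_succ]
    simp only [hcard]
    have hc : ∑ j with ¬ p j, w j = 1 - ∑ j with p j, w j := by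
      rw [← hw, ← Finset.sum_filter_add_sum_filter_not Finset.univ p]; ring
    rw [← Finset.sum_filter_add_sum_filter_not Finset.univ p, ← hc, Finset.sum_mul, Finset.sum_mul]
    congr 1
    · refine Finset.sum_congr rfl fun j hj => ?_
      rw [← ih]; simp [(Finset.mem_filter.mp hj).2, add_comm]
    · refine Finset.sum_congr rfl fun j hj => ?_
      rw [← ih]; simp [(Finset.mem_filter.mp hj).2]

variable (P : Model)

theorem Model.lam_fin_nonneg (j : Fin (P.M + 1)) : 0 ≤ P.lam j :=
  P.lam_nonneg j (Nat.lt_succ_iff.mp j.2)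

theorem Model.sum_lam_fin : ∑ j : Fin (P.M + 1), P.lam j = 1 := by
  rw [Fin.sum_univ_eq_sum_range P.lam (P.M + 1), P.lam_sum]

theorem Model.cycleLaw_real_singleton (T : ℕ) (H : P.Arrivals T) :
    (P.cycleLaw T).real {H} = ∏ t, P.lam (H t) := by
  unfold Model.cycleLaw
  rw [measureReal_def, Measure.pi_singleton, ENNReal.toReal_prod]
  refine Finset.prod_congr rfl fun t _ => ?_
  rw [PMF.toMeasure_apply_singleton _ _ (MeasurableSet.singleton _), Model.arrivalLaw,
    PMF.ofFintype_apply, ENNReal.toReal_ofReal (P.lam_fin_nonneg _)]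

/-- Expectation over the arrivals of one cycle. -/
def Model.cycleE (T : ℕ) (g : P.Arrivals T → ℝ) : ℝ := prodE (fun j : Fin (P.M + 1) => P.lam j) T g

theorem Model.integral_cycleLaw (T : ℕ) (g : P.Arrivals T → ℝ) :
    ∫ H, g H ∂(P.cycleLaw T) = P.cycleE T g := by
  rw [integral_fintype (Integrable.of_finite)]
  simp [Model.cycleE, prodE, P.cycleLaw_real_singleton]

/-- Number of customers of type at least `k` in a cycle. -/
def Model.count {T : ℕ} (k : ℕ) (H : P.Arrivals T) : ℕ :=
  (Finset.univ.filter fun t => k ≤ (H t : ℕ)).card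

/-- Probability that a customer of type at least `k` arrives in a period. -/
def Model.tail (k : ℕ) : ℝ := ∑ j ∈ Finset.univ.filter (fun j : Fin (P.M + 1) => k ≤ (j : ℕ)), P.lam j

theorem Model.cycleE_count (T k : ℕ) (f : ℕ → ℝ) :
    P.cycleE T (fun H => f (P.count k H)) = bern (P.tail k) T f :=
  prodE_card (α := Fin (P.M + 1)) P.sum_lam_fin (fun j => k ≤ (j : ℕ)) T f

theorem Model.tail_one : P.tail 1 = 1 - P.lam 0 := by
  have h := P.sum_lam_fin
  rw [Fin.sum_univ_succ] at h
  rw [Model.tail, Finset.sum_filter, Fin.sum_univ_succ]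
  simp at h ⊢
  linarith

theorem Model.tail_M : P.tail P.M = P.lam P.M := by
  rw [Model.tail, Finset.sum_eq_single (Fin.last P.M)]
  · simp
  · intro b hb hne
    have h1 := (Finset.mem_filter.mp hb).2
    exact absurd (Fin.ext (le_antisymm (Nat.lt_succ_iff.mp b.2) h1)) hne
  · simp

end

/-! ### Sales of the two algorithms within one cycle -/

section

/-- `U` contains all `R`-predecessors of its elements, so ranks taken in the whole type agree with
ranks within `U`, and the elements of `U` occupy exactly the ranks below `U.card`. -/
theorem card_filter_rank_lt {ι : Type*} [Fintype ι] [DecidableEq ι] (R : ι → ι → Prop)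
    [DecidableRel R] (hirr : ∀ s, ¬ R s s) (htr : ∀ s t u, R s t → R t u → R s u)
    (htot : ∀ s t, s ≠ t → R s t ∨ R t s) (U : Finset ι) (hU : ∀ s t, R s t → t ∈ U → s ∈ U)
    (I : ℕ) :
    (U.filter fun t => (Finset.univ.filter fun s => R s t).card < I).card = min I U.card := by
  set rk : ι → ℕ := fun t => (Finset.univ.filter fun s => R s t).card with hrk
  have hlt : ∀ s t, R s t → rk s < rk t := by
    intro s t hst
    refine Finset.card_lt_card ⟨?_, ?_⟩
    · intro u hu
      simp only [Finset.mem_filter, Finset.mem_univ, true_and] at hu ⊢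
      exact htr _ _ _ hu hst
    · intro h
      have := h (by simpa using hst : s ∈ Finset.univ.filter fun u => R u t)
      simp only [Finset.mem_filter, Finset.mem_univ, true_and] at this
      exact hirr s this
  have hinj : Set.InjOn rk U := by
    intro s _ t _ hst
    by_contra hne
    rcases htot s t hne with h | h
    · exact absurd hst (hlt _ _ h).ne
    · exact absurd hst (hlt _ _ h).ne'
  have hsub : U.image rk ⊆ Finset.range U.card := by
    intro n hn
    obtain ⟨t, ht, rfl⟩ := Finset.mem_image.mp hn
    rw [Finset.mem_range]
    refine Finset.card_lt_card ⟨?_, ?_⟩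
    · intro u hu
      simp only [Finset.mem_filter, Finset.mem_univ, true_and] at hu
      exact hU _ _ hu ht
    · intro h
      have := h ht
      simp only [Finset.mem_filter, Finset.mem_univ, true_and] at this
      exact hirr t this
  have himg : U.image rk = Finset.range U.card :=
    Finset.eq_of_subset_of_card_le hsub (by rw [Finset.card_image_of_injOn hinj]; simp)
  have h1 : ((U.filter fun t => rk t < I).image rk).card = (U.filter fun t => rk t < I).card :=
    Finset.card_image_of_injOn (hinj.mono (by intro x hx; exact (Finset.mem_filter.mp hx).1))
  rw [← h1, ← Finset.filter_image (p := fun n => n < I), himg]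
  have : (Finset.range U.card).filter (fun n => n < I) = Finset.range (min I U.card) := by
    ext n; simp; tauto
  rw [this, Finset.card_range]

theorem sum_range_succ_eq_Icc (M : ℕ) (f : ℕ → ℝ) :
    ∑ j ∈ Finset.range (M + 1), f j = f 0 + ∑ j ∈ Finset.Icc 1 M, f j := by
  rw [Finset.range_eq_Ico, Finset.sum_eq_sum_Ico_succ_bot (Nat.succ_pos M)]
  congr 1

variable (P : Model)

/-- Customers of type at least `k` precede all others in the offline service order, so they form a
set closed under predecessors and `card_filter_rank_lt` applies. With `1 ≤ k` the empty periods stay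
outside this set. -/
theorem Model.offline_accept_count {T : ℕ} (I : ℕ) (H : P.Arrivals T) {k : ℕ} (hk : 1 ≤ k) :
    ∑ t ∈ Finset.univ.filter (fun t => k ≤ (H t : ℕ)), P.accept Alg.offline I H t =
      min I (P.count k H) := by
  classical
  have := card_filter_rank_lt (fun s t => H t < H s ∨ (H s = H t ∧ s < t))
    (by simp) (by
      rintro s t u (h | ⟨h, h'⟩) (g | ⟨g, g'⟩)
      · exact Or.inl (g.trans h)
      · exact Or.inl (g ▸ h)
      · exact Or.inl (h ▸ g)
      · exact Or.inr ⟨h.trans g, h'.trans g'⟩)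
    (by
      intro s t hst
      rcases lt_trichotomy (H s) (H t) with h | h | h
      · exact Or.inr (Or.inl h)
      · rcases lt_or_gt_of_ne hst with h' | h'
        · exact Or.inl (Or.inr ⟨h, h'⟩)
        · exact Or.inr (Or.inr ⟨h.symm, h'⟩)
      · exact Or.inl (Or.inl h))
    (Finset.univ.filter fun t => k ≤ (H t : ℕ)) (by
      rintro s t (h | ⟨h, -⟩) ht
      · simp only [Finset.mem_filter, Finset.mem_univ, true_and] at ht ⊢
        exact ht.trans h.le
      · simp only [Finset.mem_filter, Finset.mem_univ, true_and] at ht ⊢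
        rw [h]; exact ht) I
  rw [Model.count, ← this, Finset.card_filter]
  refine Finset.sum_congr rfl fun t ht => ?_
  have h0 : H t ≠ 0 := by
    intro h
    have := (Finset.mem_filter.mp ht).2
    rw [h] at this
    simp at this
    omega
  simp only [Model.accept, h0, ne_eq, not_false_eq_true, true_and]

theorem Model.offline_accept_sum {T : ℕ} (I : ℕ) (H : P.Arrivals T) :
    ∑ t, P.accept Alg.offline I H t = min I (P.count 1 H) := by
  rw [← P.offline_accept_count I H le_rfl, Finset.sum_filter]
  refine Finset.sum_congr rfl fun t _ => ?_
  split_ifs with h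
  · rfl
  · have h0 : H t = 0 := by
      apply Fin.ext
      simp only [Fin.val_zero]
      omega
    simp [Model.accept, h0]

theorem Model.greedyInv_cons_succ {T : ℕ} (I : ℕ) (h : Fin (P.M + 1)) (H : P.Arrivals T) (n : ℕ) :
    P.greedyInv I (Fin.cons h H : P.Arrivals (T + 1)) (n + 1) =
      P.greedyInv (if h ≠ 0 then I - 1 else I) H n := by
  induction n with
  | zero =>
    rcases Nat.eq_zero_or_pos I with rfl | hI
    · simp [Model.greedyInv]
    · by_cases h0 : h = 0 <;> simp [Model.greedyInv, h0, hI]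
  | succ n ih =>
    rw [Model.greedyInv, ih]
    conv_rhs => rw [Model.greedyInv]
    have : (∃ ht : n + 1 < T + 1, (Fin.cons h H : P.Arrivals (T + 1)) ⟨n + 1, ht⟩ ≠ 0 ∧
        0 < P.greedyInv (if h ≠ 0 then I - 1 else I) H n) ↔
        (∃ ht : n < T, H ⟨n, ht⟩ ≠ 0 ∧ 0 < P.greedyInv (if h ≠ 0 then I - 1 else I) H n) := by
      constructor
      · rintro ⟨ht, h1, h2⟩
        exact ⟨by omega, h1, h2⟩
      · rintro ⟨ht, h1, h2⟩
        exact ⟨by omega, h1, h2⟩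
    simp only [this]

/-- After its first period a greedy cycle continues as a shorter greedy cycle with the remaining
stock. The inductions over the cycle length rest on this. -/
theorem Model.greedy_sum_cons {T : ℕ} (c : ℕ → ℝ) (I : ℕ) (h : Fin (P.M + 1)) (H : P.Arrivals T) :
    ∑ t, c ((Fin.cons h H : P.Arrivals (T + 1)) t) *
        (P.accept Alg.greedy I (Fin.cons h H : P.Arrivals (T + 1)) t : ℝ) =
      (if h ≠ 0 ∧ 0 < I then c h else 0) +
        ∑ t, c (H t) * (P.accept Alg.greedy (if h ≠ 0 then I - 1 else I) H t : ℝ) := by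
  rw [Fin.sum_univ_succ]
  congr 1
  · simp only [Model.accept, Fin.cons_zero, Fin.val_zero, Model.greedyInv]
    split_ifs <;> simp
  · refine Finset.sum_congr rfl fun t _ => ?_
    simp only [Model.accept, Fin.cons_succ, Fin.val_succ, P.greedyInv_cons_succ]

theorem Model.count_cons {T : ℕ} (k : ℕ) (h : Fin (P.M + 1)) (H : P.Arrivals T) :
    P.count k (Fin.cons h H : P.Arrivals (T + 1)) = (if k ≤ (h : ℕ) then 1 else 0) + P.count k H := by
  simp only [Model.count, Finset.card_filter, Fin.sum_univ_succ, Fin.cons_zero, Fin.cons_succ]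

theorem Model.greedy_accept_sum {T : ℕ} (I : ℕ) (H : P.Arrivals T) :
    ∑ t, P.accept Alg.greedy I H t = min I (P.count 1 H) := by
  induction T generalizing I with
  | zero => simp [Model.count]
  | succ T ih =>
    obtain ⟨h, H, rfl⟩ : ∃ h G, H = (Fin.cons h G : P.Arrivals (T + 1)) :=
      ⟨H 0, Fin.tail H, (Fin.cons_self_tail H).symm⟩
    have := P.greedy_sum_cons (fun _ => 1) I h H
    simp only [one_mul] at this
    rw [← Nat.cast_sum, ← Nat.cast_sum, ih] at this
    rw [P.count_cons]
    have h1 : (1 ≤ (h : ℕ)) ↔ h ≠ 0 := by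
      rw [Nat.one_le_iff_ne_zero, ne_eq, ne_eq, Fin.ext_iff, Fin.val_zero]
    have h2 : ((∑ t, P.accept Alg.greedy I (Fin.cons h H : P.Arrivals (T + 1)) t : ℕ) : ℝ) =
        ((if h ≠ 0 ∧ 0 < I then 1 else 0 : ℕ) + min (if h ≠ 0 then I - 1 else I) (P.count 1 H) : ℕ) := by
      rw [this]; push_cast; rfl
    rw [Nat.cast_inj.mp h2]
    simp only [h1]
    by_cases h0 : h = 0
    · simp [h0]
    · rcases Nat.eq_zero_or_pos I with rfl | hI
      · simp
      · simp only [h0, hI, ne_eq, not_false_eq_true, and_self, if_true]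
        omega

theorem Model.accept_sum {T : ℕ} (a : Alg) (I : ℕ) (H : P.Arrivals T) :
    ∑ t, P.accept a I H t = min I (P.count 1 H) := by
  cases a
  · exact P.offline_accept_sum I H
  · exact P.greedy_accept_sum I H

theorem Model.leftover_eq {T : ℕ} (a : Alg) (I : ℕ) (H : P.Arrivals T) :
    P.leftover a I H = I - P.count 1 H := by
  rw [Model.leftover, P.accept_sum]; omega

/-- Equal total sales give equal leftovers, so the state process can be analysed for greedy alone.
-/
theorem Model.step_eq {T : ℕ} (a b : Alg) (S : ℕ) (x : P.State) (H : P.Arrivals T) :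
    P.step a S x H = P.step b S x H := by
  funext l
  simp only [Model.step, P.leftover_eq]

theorem Model.isStationary_iff (a b : Alg) (T S : ℕ) (ν : Measure P.State) :
    P.IsStationary a T S ν ↔ P.IsStationary b T S ν := by
  have : ∀ a b, P.IsStationary a T S ν → P.IsStationary b T S ν := fun a b h =>
    ⟨h.1, h.2, by
      have h3 := h.3
      simpa only [fun x (H : P.Arrivals T) => P.step_eq a b S x H] using h3⟩
  exact ⟨this a b, this b a⟩

/-- The expected greedy reward is the mean reward per customer times the expected sales. -/
theorem Model.greedy_reward (T I : ℕ) :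
    P.cycleE T (fun H => ∑ t, P.r (H t) * (P.accept Alg.greedy I H t : ℝ)) * (1 - P.lam 0) =
      (∑ j ∈ Finset.Icc 1 P.M, P.r j * P.lam j) *
        P.cycleE T (fun H => ((min I (P.count 1 H) : ℕ) : ℝ)) := by
  -- the expected accepted value is linear in the mean value of a customer
  have key : ∀ T : ℕ, ∃ Z : ℕ → ℝ, ∀ (c : ℕ → ℝ) (I : ℕ),
      P.cycleE T (fun H => ∑ t, c (H t) * (P.accept Alg.greedy I H t : ℝ)) =
        (∑ j ∈ Finset.Icc 1 P.M, c j * P.lam j) * Z I := by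
    intro T
    induction T with
    | zero => exact ⟨fun _ => 0, fun c I => by simp [Model.cycleE, prodE_zero]⟩
    | succ T ih =>
      obtain ⟨Z, hZ⟩ := ih
      -- `Z I` is the expected number of periods that start with stock on hand; the type arriving in
      -- a period is independent of whether stock is left at its start.
      refine ⟨fun I => (if 0 < I then 1 else 0) +
        ∑ j : Fin (P.M + 1), P.lam j * Z (if j ≠ 0 then I - 1 else I), fun c I => ?_⟩
      rw [Model.cycleE, prodE_succ]
      simp only [P.greedy_sum_cons, prodE_add, prodE_const P.sum_lam_fin, mul_add,
        Finset.sum_add_distrib]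
      congr 1
      · have : ∑ j ∈ Finset.Icc 1 P.M, c j * P.lam j =
            ∑ j : Fin (P.M + 1), (if (j : ℕ) = 0 then 0 else c j * P.lam j) := by
          rw [Fin.sum_univ_eq_sum_range (fun j => if j = 0 then 0 else c j * P.lam j) (P.M + 1),
            sum_range_succ_eq_Icc, if_pos rfl, zero_add]
          refine Finset.sum_congr rfl fun j hj => ?_
          rw [if_neg (by have := (Finset.mem_Icc.mp hj).1; omega)]
        rw [this, Finset.sum_mul]
        refine Finset.sum_congr rfl fun j _ => ?_
        have hj : j = 0 ↔ (j : ℕ) = 0 := by rw [Fin.ext_iff, Fin.val_zero]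
        by_cases h0 : (j : ℕ) = 0
        · simp [hj, h0]
        · simp only [ne_eq, hj, h0, not_false_eq_true, true_and, if_false]
          split_ifs <;> ring
      · rw [Finset.mul_sum]
        refine Finset.sum_congr rfl fun j _ => ?_
        have := hZ c (if j ≠ 0 then I - 1 else I)
        rw [Model.cycleE] at this
        rw [this]; ring
  obtain ⟨Z, hZ⟩ := key T
  -- Giving every customer the value 1 expresses `Z I` through the expected sales and so eliminates
  -- it.
  have h1 := hZ (fun _ => 1) I
  have h2 : ∀ H : P.Arrivals T, ∑ t, (1 : ℝ) * (P.accept Alg.greedy I H t : ℝ) =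
      ((min I (P.count 1 H) : ℕ) : ℝ) := by
    intro H
    rw [← P.greedy_accept_sum I H]; push_cast; simp
  simp only [h2] at h1
  rw [hZ, h1]
  have h3 : ∑ j ∈ Finset.Icc 1 P.M, (1 : ℝ) * P.lam j = 1 - P.lam 0 := by
    have := P.lam_sum
    rw [sum_range_succ_eq_Icc] at this
    simp only [one_mul]
    linarith
  rw [h3]; ring

end

/-! ### Binomial expectations as functions of the success probability -/

section

theorem bern_add (s : ℝ) (T : ℕ) (f g : ℕ → ℝ) :
    bern s T (fun k => f k + g k) = bern s T f + bern s T g := by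
  induction T generalizing f g with
  | zero => rfl
  | succ T ih => simp only [bern_succ, ih]; ring

theorem bern_const_mul (s : ℝ) (T : ℕ) (c : ℝ) (f : ℕ → ℝ) :
    bern s T (fun k => c * f k) = c * bern s T f := by
  induction T generalizing f with
  | zero => rfl
  | succ T ih => simp only [bern_succ, ih]; ring

theorem bern_sub (s : ℝ) (T : ℕ) (f g : ℕ → ℝ) :
    bern s T (fun k => f k - g k) = bern s T f - bern s T g := by
  induction T generalizing f g with
  | zero => rfl
  | succ T ih => simp only [bern_succ, ih]; ring

theorem bern_const (s : ℝ) (T : ℕ) (c : ℝ) : bern s T (fun _ => c) = c := by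
  induction T with
  | zero => rfl
  | succ T ih => rw [bern_succ, ih]; ring

theorem bern_congr (s : ℝ) (T : ℕ) {f g : ℕ → ℝ} (h : ∀ k ≤ T, f k = g k) :
    bern s T f = bern s T g := by
  induction T generalizing f g with
  | zero => exact h 0 le_rfl
  | succ T ih =>
    rw [bern_succ, bern_succ, ih fun k hk => h (k + 1) (by omega), ih fun k hk => h k (by omega)]

theorem bern_mono {s : ℝ} (h0 : 0 ≤ s) (h1 : s ≤ 1) (T : ℕ) {f g : ℕ → ℝ}
    (h : ∀ k ≤ T, f k ≤ g k) : bern s T f ≤ bern s T g := by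
  induction T generalizing f g with
  | zero => exact h 0 le_rfl
  | succ T ih =>
    rw [bern_succ, bern_succ]
    exact add_le_add (mul_le_mul_of_nonneg_left (ih fun k hk => h (k + 1) (by omega)) h0)
      (mul_le_mul_of_nonneg_left (ih fun k hk => h k (by omega)) (by linarith))

theorem bern_nonneg {s : ℝ} (h0 : 0 ≤ s) (h1 : s ≤ 1) (T : ℕ) {f : ℕ → ℝ}
    (h : ∀ k ≤ T, 0 ≤ f k) : 0 ≤ bern s T f := by
  have := bern_mono h0 h1 T h
  rwa [bern_const] at this

/-- Size biasing. -/
theorem bern_size_bias (s : ℝ) (T : ℕ) (f : ℕ → ℝ) :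
    bern s (T + 1) (fun k => k * f k) = (T + 1) * s * bern s T (fun k => f (k + 1)) := by
  induction T generalizing f with
  | zero => simp [bern]
  | succ T ih =>
    have h1 : bern s (T + 1) (fun k => ((k + 1 : ℕ) : ℝ) * f (k + 1)) =
        (T + 1) * s * bern s T (fun k => f (k + 2)) + bern s (T + 1) (fun k => f (k + 1)) := by
      have := ih (fun k => f (k + 1))
      rw [← this, ← bern_add]
      exact bern_congr _ _ fun k _ => by push_cast; ring
    rw [bern_succ, h1, ih, bern_succ s T (fun k => f (k + 1))]
    push_cast; ring

theorem bern_id (s : ℝ) (T : ℕ) : bern s T (fun k => (k : ℝ)) = T * s := by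
  cases T with
  | zero => simp [bern]
  | succ T =>
    have := bern_size_bias s T (fun _ => 1)
    simp only [mul_one, bern_const] at this
    rw [this]; push_cast; ring

/-- Raising the success probability of one trial turns a failure into a success, which changes `f k`
into `f (k + 1)`; the `T + 1` trials contribute equally. -/
theorem hasDerivAt_bern (T : ℕ) (f : ℕ → ℝ) (s : ℝ) :
    HasDerivAt (fun s => bern s (T + 1) f)
      ((T + 1) * bern s T (fun k => f (k + 1) - f k)) s := by
  induction T generalizing f with
  | zero =>
    simp only [bern]
    have h := ((hasDerivAt_id s).mul_const (f 1)).add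
      (((hasDerivAt_const s (1 : ℝ)).sub (hasDerivAt_id s)).mul_const (f 0))
    refine h.congr_deriv ?_
    simp; ring
  | succ T ih =>
    have h := ((hasDerivAt_id s).mul (ih (fun k => f (k + 1)))).add
      (((hasDerivAt_const s (1 : ℝ)).sub (hasDerivAt_id s)).mul (ih f))
    have he : (fun s => bern s (T + 1 + 1) f) =
        fun s => s * bern s (T + 1) (fun k => f (k + 1)) + (1 - s) * bern s (T + 1) f := rfl
    rw [he]
    refine h.congr_deriv ?_
    simp only [id, Pi.sub_apply, bern_sub, bern_succ s T]
    push_cast; ring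

/-- Expected excess of a binomial variable over `I`. -/
def excess (T I : ℕ) (s : ℝ) : ℝ := bern s T (fun k => ((k - I : ℕ) : ℝ))

/-- Probability that a binomial variable exceeds `I`. -/
def exceed (T I : ℕ) (s : ℝ) : ℝ := bern s T (fun k => if I < k then 1 else 0)

theorem exceed_nonneg {T I : ℕ} {s : ℝ} (h0 : 0 ≤ s) (h1 : s ≤ 1) : 0 ≤ exceed T I s :=
  bern_nonneg h0 h1 _ fun _ _ => by split_ifs <;> norm_num

theorem exceed_le_one {T I : ℕ} {s : ℝ} (h0 : 0 ≤ s) (h1 : s ≤ 1) : exceed T I s ≤ 1 := by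
  rw [← bern_const s T 1]
  exact bern_mono h0 h1 _ fun _ _ => by split_ifs <;> norm_num

theorem bern_min (T I : ℕ) (s : ℝ) :
    bern s T (fun k => ((min I k : ℕ) : ℝ)) = T * s - excess T I s := by
  rw [← bern_id, excess, ← bern_sub]
  refine bern_congr _ _ fun k _ => ?_
  rcases le_total I k with h | h
  · rw [min_eq_left h, Nat.cast_sub h]; ring
  · rw [min_eq_right h, Nat.sub_eq_zero_of_le h]; simp

theorem bern_sub_min (T I : ℕ) (s : ℝ) :
    bern s T (fun k => ((I - k : ℕ) : ℝ)) = I - T * s + excess T I s := by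
  rw [← bern_id, excess, ← bern_const s T (I : ℝ), ← bern_sub, ← bern_add]
  refine bern_congr _ _ fun k _ => ?_
  rcases le_total I k with h | h
  · rw [Nat.sub_eq_zero_of_le h, Nat.cast_sub h]; simp
  · rw [Nat.sub_eq_zero_of_le h, Nat.cast_sub h]; simp

theorem hasDerivAt_excess (T I : ℕ) (s : ℝ) :
    HasDerivAt (excess (T + 1) I) ((T + 1) * bern s T (fun k => if I ≤ k then 1 else 0)) s := by
  have h := hasDerivAt_bern T (fun k => ((k - I : ℕ) : ℝ)) s
  refine h.congr_deriv ?_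
  congr 1
  refine bern_congr _ _ fun k _ => ?_
  split_ifs with hk
  · rw [Nat.cast_sub (by omega), Nat.cast_sub hk]; push_cast; ring
  · rw [Nat.sub_eq_zero_of_le (by omega), Nat.sub_eq_zero_of_le (by omega)]; simp

/-- By size biasing, `s` times the derivative of the excess is E[B; B > I]. Subtracting E(B - I)⁺ in
the quotient rule leaves I · P(B > I). -/
theorem hasDerivAt_excess_div (T I : ℕ) {s : ℝ} (hs : s ≠ 0) :
    HasDerivAt (fun s => excess T I s / s) (I * exceed T I s / s ^ 2) s := by
  cases T with
  | zero =>
    have : (fun s => excess 0 I s / s) = fun _ => (0 : ℝ) := by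
      funext s; simp [excess, bern]
    rw [this]
    refine (hasDerivAt_const s (0 : ℝ)).congr_deriv ?_
    simp [exceed, bern]
  | succ T =>
    have h := (hasDerivAt_excess T I s).div (hasDerivAt_id s) hs
    refine h.congr_deriv ?_
    have hb := bern_size_bias s T (fun k => if I < k then (1 : ℝ) else 0)
    have h2 : (I : ℝ) * exceed (T + 1) I s =
        bern s (T + 1) (fun k => k * (if I < k then (1 : ℝ) else 0)) - excess (T + 1) I s := by
      rw [exceed, excess, ← bern_const_mul, ← bern_sub]
      refine bern_congr _ _ fun k _ => ?_
      split_ifs with hk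
      · rw [Nat.cast_sub hk.le]; ring
      · rw [Nat.sub_eq_zero_of_le (by omega)]; simp
    rw [h2, hb]
    simp only [Order.lt_add_one_iff, id, mul_one]
    congr 1
    ring

theorem continuous_bern (T : ℕ) (f : ℕ → ℝ) : Continuous fun s => bern s T f := by
  induction T generalizing f with
  | zero => exact continuous_const
  | succ T ih =>
    simp only [bern_succ]
    exact (continuous_id.mul (ih _)).add ((continuous_const.sub continuous_id).mul (ih _))

theorem bern_monotoneOn (T : ℕ) {f : ℕ → ℝ} (hf : Monotone f) :
    MonotoneOn (fun s => bern s T f) (Set.Icc 0 1) := by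
  cases T with
  | zero => intro _ _ _ _ _; exact le_rfl
  | succ T =>
    refine monotoneOn_of_deriv_nonneg (convex_Icc 0 1) (continuous_bern _ _).continuousOn
      (fun s _ => (hasDerivAt_bern T f s).differentiableAt.differentiableWithinAt) fun s hs => ?_
    rw [interior_Icc] at hs
    rw [(hasDerivAt_bern T f s).deriv]
    exact mul_nonneg (by positivity)
      (bern_nonneg hs.1.le hs.2.le _ fun k _ => sub_nonneg.mpr (hf (Nat.le_succ k)))

theorem exceed_mono {T I : ℕ} {p q : ℝ} (hp : 0 ≤ p) (hpq : p ≤ q) (hq : q ≤ 1) :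
    exceed T I p ≤ exceed T I q :=
  bern_monotoneOn T (f := fun k => if I < k then (1 : ℝ) else 0)
    (by intro a b hab; dsimp only; split_ifs <;> first | omega | norm_num)
    ⟨hp, hpq.trans hq⟩ ⟨hp.trans hpq, hq⟩ hpq

/-- The derivative just computed is nonnegative. All comparisons between customer classes come from
this monotonicity. -/
theorem excess_div_mono {T I : ℕ} {p q : ℝ} (hp : 0 < p) (hpq : p ≤ q) (hq : q ≤ 1) :
    excess T I p / p ≤ excess T I q / q := by
  have hm : MonotoneOn (fun s => excess T I s / s) (Set.Icc p q) := by
    refine monotoneOn_of_deriv_nonneg (convex_Icc p q) ?_ ?_ ?_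
    · exact fun s hs => ((hasDerivAt_excess_div T I (hp.trans_le hs.1).ne').continuousAt).continuousWithinAt
    · intro s hs
      rw [interior_Icc] at hs
      exact (hasDerivAt_excess_div T I (hp.trans hs.1).ne').differentiableAt.differentiableWithinAt
    · intro s hs
      rw [interior_Icc] at hs
      rw [(hasDerivAt_excess_div T I (hp.trans hs.1).ne').deriv]
      have := exceed_nonneg (T := T) (I := I) (hp.trans hs.1).le (hs.2.le.trans hq)
      positivity
  exact hm ⟨le_rfl, hpq⟩ ⟨hpq, le_rfl⟩ hpq

/-- Mean advantage, per unit of top-class demand share `p / q`, of knowing the demand in advance. -/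
def advantage (T : ℕ) (p q : ℝ) (I : ℕ) : ℝ := excess T I q - q / p * excess T I p

theorem advantage_nonneg {T I : ℕ} {p q : ℝ} (hp : 0 < p) (hpq : p ≤ q) (hq : q ≤ 1) :
    0 ≤ advantage T p q I := by
  have h := excess_div_mono (T := T) (I := I) hp hpq hq
  have hq0 := hp.trans_le hpq
  rw [advantage]
  have h2 : q / p * excess T I p = q * (excess T I p / p) := by ring
  have h3 : excess T I q = q * (excess T I q / q) := by field_simp
  rw [h2, h3]
  have := mul_le_mul_of_nonneg_left h hq0.le
  linarith

/-- Allows `p` to be raised to `I / T` or to `b / T`, where the smaller binomial mean has a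
convenient position relative to `I`. -/
theorem advantage_anti {T I : ℕ} {p p' q : ℝ} (hp : 0 < p) (hpp : p ≤ p') (hp1 : p' ≤ 1)
    (hq : 0 ≤ q) : advantage T p' q I ≤ advantage T p q I := by
  have h := excess_div_mono (T := T) (I := I) hp hpp hp1
  simp only [advantage]
  have h2 : ∀ p, q / p * excess T I p = q * (excess T I p / p) := fun p => by ring
  rw [h2, h2]
  have := mul_le_mul_of_nonneg_left h hq
  linarith

end

/-! ### Rewards by classes and the gain of offline over greedy -/

section

variable (P : Model)

/-- Reward increment from class `k - 1` to class `k`, with reward `0` for no customer. -/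
def Model.rewardInc (k : ℕ) : ℝ := if k = 1 then P.r 1 else P.r k - P.r (k - 1)

theorem Model.sum_rewardInc {j : ℕ} (hj : 1 ≤ j) :
    ∑ k ∈ Finset.Icc 1 j, P.rewardInc k = P.r j := by
  induction j, hj using Nat.le_induction with
  | base => simp [Model.rewardInc]
  | succ j hj ih =>
    rw [Finset.sum_Icc_succ_top (by omega), ih, Model.rewardInc, if_neg (by omega)]
    simp

theorem Model.rewardInc_pos {k : ℕ} (hk : 1 ≤ k) (hkM : k ≤ P.M) : 0 < P.rewardInc k := by
  rw [Model.rewardInc]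
  split_ifs with h
  · exact P.r_one_pos
  · have := P.r_lt (k - 1) (by omega) (by omega)
    rw [Nat.sub_add_cancel hk] at this
    linarith

theorem Model.sum_rewardInc_ite {j : ℕ} (hj : 1 ≤ j) (hjM : j ≤ P.M) :
    ∑ k ∈ Finset.Icc 1 P.M, (if k ≤ j then P.rewardInc k else 0) = P.r j := by
  rw [← P.sum_rewardInc hj, ← Finset.sum_filter]
  congr 1
  ext k; simp; omega

/-- Summation by parts: a customer of type `j` earns the increments of all classes up to `j`, and of
the customers of type at least `k` the offline algorithm serves as many as the stock permits. -/
theorem Model.offline_reward {T : ℕ} (I : ℕ) (H : P.Arrivals T) :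
    ∑ t, P.r (H t) * (P.accept Alg.offline I H t : ℝ) =
      ∑ k ∈ Finset.Icc 1 P.M, P.rewardInc k * ((min I (P.count k H) : ℕ) : ℝ) := by
  have h1 : ∀ t, P.r (H t) * (P.accept Alg.offline I H t : ℝ) =
      ∑ k ∈ Finset.Icc 1 P.M, P.rewardInc k *
        (if k ≤ (H t : ℕ) then (P.accept Alg.offline I H t : ℝ) else 0) := by
    intro t
    by_cases h0 : H t = 0
    · simp [Model.accept, h0]
    · have hj : 1 ≤ (H t : ℕ) := by
        rw [Nat.one_le_iff_ne_zero]
        intro h; exact h0 (Fin.ext (by simpa using h))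
      rw [← P.sum_rewardInc_ite hj (Nat.lt_succ_iff.mp (H t).2), Finset.sum_mul]
      exact Finset.sum_congr rfl fun k _ => by split_ifs <;> simp
  simp only [h1]
  rw [Finset.sum_comm]
  refine Finset.sum_congr rfl fun k hk => ?_
  rw [← P.offline_accept_count I H (Finset.mem_Icc.mp hk).1, ← Finset.mul_sum, Finset.sum_filter]
  push_cast
  rfl

theorem Model.tail_eq (k : ℕ) (_hk : 1 ≤ k) : P.tail k = ∑ j ∈ Finset.Icc k P.M, P.lam j := by
  rw [Model.tail, Finset.sum_filter,
    Fin.sum_univ_eq_sum_range (fun j => if k ≤ j then P.lam j else 0) (P.M + 1), ← Finset.sum_filter]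
  congr 1
  ext j; simp; omega

theorem Model.sum_reward_eq :
    ∑ j ∈ Finset.Icc 1 P.M, P.r j * P.lam j = ∑ k ∈ Finset.Icc 1 P.M, P.rewardInc k * P.tail k := by
  have h1 : ∀ j ∈ Finset.Icc 1 P.M, P.r j * P.lam j =
      ∑ k ∈ Finset.Icc 1 P.M, P.rewardInc k * (if k ≤ j then P.lam j else 0) := by
    intro j hj
    rw [Finset.mem_Icc] at hj
    rw [← P.sum_rewardInc_ite hj.1 hj.2, Finset.sum_mul]
    exact Finset.sum_congr rfl fun k _ => by split_ifs <;> simp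
  rw [Finset.sum_congr rfl h1, Finset.sum_comm]
  refine Finset.sum_congr rfl fun k hk => ?_
  rw [Finset.mem_Icc] at hk
  rw [← Finset.mul_sum, ← Finset.sum_filter, P.tail_eq k hk.1]
  congr 2
  ext j; simp; omega

/-- Summation by parts writes A_k as a sum of nonnegative terms over the classes from `k` on, so A_k
is nonincreasing in `k`. -/
theorem Model.Ak_eq {k : ℕ} (hk : 2 ≤ k) (hkM : k ≤ P.M) :
    P.Ak k = ∑ i ∈ Finset.Icc k P.M, P.rewardInc i * P.tail i := by
  -- downward induction on `k`
  obtain ⟨d, hd⟩ := Nat.exists_eq_add_of_le hkM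
  induction d generalizing k with
  | zero =>
    obtain rfl : P.M = k := by omega
    rw [Model.Ak]
    simp only [Finset.Icc_self, Finset.sum_singleton]
    rw [P.tail_M, Model.rewardInc, if_neg (by omega)]; ring
  | succ d ih =>
    have h := ih (k := k + 1) (by omega) (by omega) (by omega)
    have hI : ∀ f : ℕ → ℝ, ∑ j ∈ Finset.Icc k P.M, f j = f k + ∑ j ∈ Finset.Icc (k + 1) P.M, f j := by
      intro f
      rw [← Finset.insert_Icc_add_one_left_eq_Icc hkM, Finset.sum_insert (by simp)]
    rw [hI (fun i => P.rewardInc i * P.tail i), ← h, Model.Ak, Model.Ak, P.tail_eq k (by omega),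
      hI, hI, Model.rewardInc, if_neg (by omega)]
    simp only [Nat.add_sub_cancel]
    ring

theorem Model.tail_nonneg (k : ℕ) : 0 ≤ P.tail k :=
  Finset.sum_nonneg fun j _ => P.lam_fin_nonneg j

theorem Model.tail_anti {k l : ℕ} (h : k ≤ l) : P.tail l ≤ P.tail k :=
  Finset.sum_le_sum_of_subset_of_nonneg
    (fun j hj => by
      simp only [Finset.mem_filter, Finset.mem_univ, true_and] at hj ⊢; omega)
    fun j _ _ => P.lam_fin_nonneg j

/-- The term of the top class occurs in every A_k and is the only one for `k = M`, so the minimum is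
attained there. -/
theorem Model.A_eq : P.A = P.rewardInc P.M * P.lam P.M := by
  have hM := P.two_le_M
  have hAM : P.Ak P.M = P.rewardInc P.M * P.lam P.M := by
    rw [P.Ak_eq hM le_rfl]; simp [P.tail_M]
  apply le_antisymm
  · rw [← hAM]
    exact Finset.inf'_le _ (Finset.mem_Icc.mpr ⟨hM, le_rfl⟩)
  · refine Finset.le_inf' _ _ fun k hk => ?_
    rw [Finset.mem_Icc] at hk
    rw [P.Ak_eq hk.1 hk.2, ← P.tail_M]
    refine Finset.single_le_sum (f := fun i => P.rewardInc i * P.tail i) (fun i hi => ?_)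
      (Finset.mem_Icc.mpr ⟨hk.2, le_rfl⟩)
    rw [Finset.mem_Icc] at hi
    exact mul_nonneg (P.rewardInc_pos (by omega) hi.2).le (P.tail_nonneg i)

theorem Model.A_nonneg : 0 ≤ P.A := by
  rw [P.A_eq]
  have := P.two_le_M
  exact mul_nonneg (P.rewardInc_pos (by omega) le_rfl).le (P.lam_nonneg _ le_rfl)

theorem Model.A_pos (h : 0 < P.lam P.M) : 0 < P.A := by
  rw [P.A_eq]
  have := P.two_le_M
  exact mul_pos (P.rewardInc_pos (by omega) le_rfl) h

theorem Model.q_lt_one : 1 - P.lam 0 < 1 := by linarith [P.lam_zero_pos]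

theorem Model.q_nonneg : 0 ≤ 1 - P.lam 0 := by rw [← P.tail_one]; exact P.tail_nonneg 1

/-- Expected reward of one cycle that starts with `I` units on hand. -/
def Model.reward (a : Alg) (T I : ℕ) : ℝ :=
  P.cycleE T (fun H => ∑ t, P.r (H t) * (P.accept a I H t : ℝ))

/-- Expected sales of one cycle that starts with `I` units on hand. -/
def Model.sales (T I : ℕ) : ℝ := P.cycleE T (fun H => ((min I (P.count 1 H) : ℕ) : ℝ))

theorem Model.sales_eq (T I : ℕ) :
    P.sales T I = T * (1 - P.lam 0) - excess T I (1 - P.lam 0) := by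
  rw [Model.sales, P.cycleE_count T 1 (fun n => ((min I n : ℕ) : ℝ)), bern_min, P.tail_one]

theorem Model.profit_eq (a : Alg) (T I : ℕ) :
    P.cycleE T (fun H => P.profit a I H) = P.reward a T I - P.h * (I - P.sales T I) := by
  rw [Model.reward, Model.sales]
  simp only [Model.profit, Model.cycleE]
  rw [prodE_sub, prodE_const_mul]
  congr 2
  rw [← prodE_const (w := fun j : Fin (P.M + 1) => P.lam j) P.sum_lam_fin T (I : ℝ), ← prodE_sub]
  congr 1
  funext H
  rw [P.leftover_eq]
  rcases le_total I (P.count 1 H) with h | h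
  · rw [min_eq_left h, Nat.sub_eq_zero_of_le h]; simp
  · rw [min_eq_right h, Nat.cast_sub h]

theorem Model.reward_greedy_eq (hq : 0 < 1 - P.lam 0) (T I : ℕ) :
    P.reward Alg.greedy T I =
      (∑ j ∈ Finset.Icc 1 P.M, P.r j * P.lam j) / (1 - P.lam 0) * P.sales T I := by
  have := P.greedy_reward T I
  rw [Model.reward, Model.sales, div_mul_eq_mul_div, eq_div_iff hq.ne']
  exact this

theorem Model.reward_offline_eq (T I : ℕ) :
    P.reward Alg.offline T I =
      ∑ k ∈ Finset.Icc 1 P.M, P.rewardInc k * (T * P.tail k - excess T I (P.tail k)) := by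
  rw [Model.reward]
  simp only [P.offline_reward, Model.cycleE, prodE_sum, prodE_const_mul]
  refine Finset.sum_congr rfl fun k _ => ?_
  rw [← bern_min, ← P.cycleE_count T k (fun n => ((min I n : ℕ) : ℝ))]
  rfl

theorem excess_zero_prob (T I : ℕ) : excess T I 0 = 0 := by
  have : ∀ T (f : ℕ → ℝ), bern 0 T f = f 0 := by
    intro T; induction T with
    | zero => intro f; rfl
    | succ T ih => intro f; rw [bern_succ, ih, ih]; ring
  rw [excess, this]; simp

/-- Greedy earns the mean customer value per unit sold, offline earns increments class by class. The
difference is a sum over classes whose terms are nonnegative by `excess_div_mono`; the top class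
alone gives the left side. -/
theorem Model.reward_gain (hq : 0 < 1 - P.lam 0) (hp : 0 < P.lam P.M) (T I : ℕ) :
    P.A / (1 - P.lam 0) * advantage T (P.lam P.M) (1 - P.lam 0) I ≤
      P.reward Alg.offline T I - P.reward Alg.greedy T I := by
  have hM := P.two_le_M
  have h1 : P.reward Alg.offline T I - P.reward Alg.greedy T I =
      ∑ k ∈ Finset.Icc 1 P.M, P.rewardInc k *
        (P.tail k / (1 - P.lam 0) * excess T I (1 - P.lam 0) - excess T I (P.tail k)) := by
    rw [P.reward_offline_eq, P.reward_greedy_eq hq, P.sum_reward_eq, P.sales_eq,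
      Finset.sum_div, Finset.sum_mul, ← Finset.sum_sub_distrib]
    refine Finset.sum_congr rfl fun k _ => ?_
    field_simp
    ring
  rw [h1]
  have h2 : P.A / (1 - P.lam 0) * advantage T (P.lam P.M) (1 - P.lam 0) I =
      P.rewardInc P.M * (P.tail P.M / (1 - P.lam 0) * excess T I (1 - P.lam 0) -
        excess T I (P.tail P.M)) := by
    rw [P.A_eq, P.tail_M, advantage]
    field_simp
  rw [h2]
  refine Finset.single_le_sum (f := fun k => P.rewardInc k *
    (P.tail k / (1 - P.lam 0) * excess T I (1 - P.lam 0) - excess T I (P.tail k)))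
    (fun k hk => ?_) (Finset.mem_Icc.mpr ⟨by omega, le_rfl⟩)
  rw [Finset.mem_Icc] at hk
  refine mul_nonneg (P.rewardInc_pos hk.1 hk.2).le ?_
  have hk0 : 0 < P.tail k := lt_of_lt_of_le hp (by rw [← P.tail_M]; exact P.tail_anti hk.2)
  have hk1 : P.tail k ≤ 1 - P.lam 0 := by rw [← P.tail_one]; exact P.tail_anti hk.1
  have h := excess_div_mono (T := T) (I := I) hk0 hk1 P.q_lt_one.le
  rw [div_le_div_iff₀ hk0 hq] at h
  rw [sub_nonneg, div_mul_eq_mul_div, le_div_iff₀ hq]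
  linarith

theorem Model.reward_gain_nonneg (hq : 0 < 1 - P.lam 0) (T I : ℕ) :
    P.reward Alg.greedy T I ≤ P.reward Alg.offline T I := by
  rw [P.reward_offline_eq, P.reward_greedy_eq hq, P.sum_reward_eq, P.sales_eq,
    Finset.sum_div, Finset.sum_mul]
  refine Finset.sum_le_sum fun k hk => ?_
  rw [Finset.mem_Icc] at hk
  rw [mul_div_assoc, mul_assoc]
  refine mul_le_mul_of_nonneg_left ?_ (P.rewardInc_pos hk.1 hk.2).le
  have hk1 : P.tail k ≤ 1 - P.lam 0 := by rw [← P.tail_one]; exact P.tail_anti hk.1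
  -- The classes from `k` on may have probability zero, where the quotient of excess and probability
  -- says nothing and the excess itself vanishes.
  rcases (P.tail_nonneg k).eq_or_lt with h0 | hk0
  · rw [← h0, excess_zero_prob]; simp
  have h := excess_div_mono (T := T) (I := I) hk0 hk1 P.q_lt_one.le
  rw [div_le_div_iff₀ hk0 hq] at h
  rw [div_mul_eq_mul_div, div_le_iff₀ hq]
  linarith

end

/-! ### The start-of-cycle chain and its contraction -/

section

variable (P : Model)

/-- Transition operator of the start-of-cycle chain. -/
def Model.trans (T S : ℕ) (f : P.State → ℝ) (x : P.State) : ℝ :=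
  P.cycleE T (fun H => f (P.step Alg.greedy S x H))

/-- Ordering fills the inventory position up to `S`, and afterwards only sales reduce it. -/
theorem Model.step_sum {T : ℕ} (a : Alg) {S : ℕ} {x : P.State} (hx : P.Feasible S x)
    (H : P.Arrivals T) :
    ∑ l, P.step a S x H l + min (P.onHand x) (P.count 1 H) = S := by
  obtain ⟨n, hn⟩ : ∃ n, P.L = n + 1 := ⟨P.L - 1, by have := P.one_le_L; omega⟩
  have h1 : ∑ l, P.step a S x H l = (∑ l : Fin P.L, x l - P.onHand x) + P.order S x +
      P.leftover a (P.onHand x) H := by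
    simp only [Model.step, Finset.sum_add_distrib]
    congr 1
    · have e : ∀ (m : ℕ) (hm : m = n + 1) (x : Fin m → ℕ) (o : ℕ),
          ∑ l : Fin m, (if hl : (l : ℕ) + 1 < m then x ⟨(l : ℕ) + 1, hl⟩ else o) =
            (∑ l, x l - x ⟨0, by omega⟩) + o := by
        rintro m rfl x o
        rw [Fin.sum_univ_castSucc, Fin.sum_univ_succ]
        simp only [Fin.val_castSucc, Fin.val_last, lt_self_iff_false, dite_false]
        congr 1
        rw [show (⟨0, by omega⟩ : Fin (n + 1)) = 0 from rfl, Nat.add_sub_cancel_left]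
        refine Finset.sum_congr rfl fun i _ => ?_
        rw [dif_pos (by omega)]
        rfl
      exact e P.L hn x _
    · rw [Finset.sum_eq_single ⟨0, P.one_le_L⟩]
      · simp
      · intro b _ hb
        rw [if_neg]
        intro h; exact hb (Fin.ext h)
      · simp
  have h2 : P.onHand x ≤ ∑ l, x l := Finset.single_le_sum (f := x) (fun _ _ => Nat.zero_le _)
    (Finset.mem_univ (⟨0, P.one_le_L⟩ : Fin P.L))
  have h3 : ∑ l, x l ≤ S := hx
  rw [h1, P.leftover_eq, Model.order]
  omega

theorem Model.step_feasible {T : ℕ} (a : Alg) {S : ℕ} {x : P.State} (hx : P.Feasible S x)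
    (H : P.Arrivals T) : P.Feasible S (P.step a S x H) := by
  have := P.step_sum a hx H
  rw [Model.Feasible]; omega

theorem Model.feasible_finite (S : ℕ) : {x : P.State | P.Feasible S x}.Finite := by
  refine Set.Finite.subset (Set.Finite.pi (fun _ : Fin P.L => Set.finite_Iic S)) ?_
  intro x hx l _
  exact (Finset.single_le_sum (f := x) (fun _ _ => Nat.zero_le _) (Finset.mem_univ l)).trans hx

theorem Model.cycleE_mono {T : ℕ} {f g : P.Arrivals T → ℝ} (h : ∀ H, f H ≤ g H) :
    P.cycleE T f ≤ P.cycleE T g := prodE_mono (fun j => P.lam_fin_nonneg j) T h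

theorem Model.trans_mono {T S : ℕ} {f g : P.State → ℝ} (h : ∀ x, P.Feasible S x → f x ≤ g x)
    {x : P.State} (hx : P.Feasible S x) : P.trans T S f x ≤ P.trans T S g x :=
  P.cycleE_mono fun H => h _ (P.step_feasible _ hx H)

theorem Model.trans_const (T S : ℕ) (c : ℝ) : P.trans T S (fun _ => c) = fun _ => c :=
  funext fun _ => prodE_const P.sum_lam_fin T c

theorem Model.trans_add (T S : ℕ) (f g : P.State → ℝ) :
    P.trans T S (fun x => f x + g x) = fun x => P.trans T S f x + P.trans T S g x :=
  funext fun x => prodE_add (w := fun j : Fin (P.M + 1) => P.lam j) T  (fun H => f (P.step Alg.greedy S x H)) (fun H => g (P.step Alg.greedy S x H))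

theorem Model.trans_sub (T S : ℕ) (f g : P.State → ℝ) :
    P.trans T S (fun x => f x - g x) = fun x => P.trans T S f x - P.trans T S g x :=
  funext fun x => prodE_sub (w := fun j : Fin (P.M + 1) => P.lam j) T  (fun H => f (P.step Alg.greedy S x H)) (fun H => g (P.step Alg.greedy S x H))

theorem Model.trans_const_mul (T S : ℕ) (c : ℝ) (f : P.State → ℝ) :
    P.trans T S (fun x => c * f x) = fun x => c * P.trans T S f x :=
  funext fun x => prodE_const_mul (w := fun j : Fin (P.M + 1) => P.lam j) T c (fun H => f (P.step Alg.greedy S x H))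

/-- Iterates of the transition operator. -/
def Model.iter (T S n : ℕ) (f : P.State → ℝ) : P.State → ℝ := (P.trans T S)^[n] f

theorem Model.iter_zero (T S : ℕ) (f : P.State → ℝ) : P.iter T S 0 f = f := rfl

theorem Model.iter_succ (T S n : ℕ) (f : P.State → ℝ) :
    P.iter T S (n + 1) f = P.trans T S (P.iter T S n f) := Function.iterate_succ_apply' _ _ _

theorem Model.iter_succ' (T S n : ℕ) (f : P.State → ℝ) :
    P.iter T S (n + 1) f = P.iter T S n (P.trans T S f) := Function.iterate_succ_apply _ _ _

theorem Model.iter_add (T S m n : ℕ) (f : P.State → ℝ) :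
    P.iter T S (m + n) f = P.iter T S m (P.iter T S n f) := Function.iterate_add_apply _ _ _ _

theorem Model.iter_mono {T S : ℕ} (n : ℕ) {f g : P.State → ℝ}
    (h : ∀ x, P.Feasible S x → f x ≤ g x) {x : P.State} (hx : P.Feasible S x) :
    P.iter T S n f x ≤ P.iter T S n g x := by
  induction n generalizing x with
  | zero => exact h x hx
  | succ n ih => rw [P.iter_succ, P.iter_succ]; exact P.trans_mono (fun y hy => ih hy) hx

theorem Model.iter_const (T S n : ℕ) (c : ℝ) : P.iter T S n (fun _ => c) = fun _ => c := by
  induction n with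
  | zero => rfl
  | succ n ih => rw [P.iter_succ, ih, P.trans_const]

theorem Model.iter_const_mul (T S n : ℕ) (c : ℝ) (f : P.State → ℝ) :
    P.iter T S n (fun x => c * f x) = fun x => c * P.iter T S n f x := by
  induction n with
  | zero => rfl
  | succ n ih => rw [P.iter_succ, ih, P.trans_const_mul, P.iter_succ]

theorem Model.iter_add_fun (T S n : ℕ) (f g : P.State → ℝ) :
    P.iter T S n (fun x => f x + g x) = fun x => P.iter T S n f x + P.iter T S n g x := by
  induction n with
  | zero => rfl
  | succ n ih => rw [P.iter_succ, ih, P.trans_add, P.iter_succ, P.iter_succ]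

theorem Model.iter_sub_fun (T S n : ℕ) (f g : P.State → ℝ) :
    P.iter T S n (fun x => f x - g x) = fun x => P.iter T S n f x - P.iter T S n g x := by
  induction n with
  | zero => rfl
  | succ n ih => rw [P.iter_succ, ih, P.trans_sub, P.iter_succ, P.iter_succ]

/-- The state in which the whole inventory position is on hand. -/
def Model.full (S : ℕ) : P.State := fun l => if (l : ℕ) = 0 then S else 0

theorem Model.full_feasible (S : ℕ) : P.Feasible S (P.full S) := by
  rw [Model.Feasible, Finset.sum_eq_single ⟨0, P.one_le_L⟩]
  · simp [Model.full]
  · intro b _ hb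
    rw [Model.full, if_neg]
    intro h; exact hb (Fin.ext h)
  · simp

/-- The state after `n` cycles without customers. -/
def Model.idle (T S : ℕ) (x : P.State) (n : ℕ) : P.State :=
  (fun y => P.step Alg.greedy S y (fun _ : Fin T => 0))^[n] x

theorem Model.count_zero (T : ℕ) : P.count 1 (fun _ : Fin T => (0 : Fin (P.M + 1))) = 0 := by
  simp [Model.count]

/-- From the second idle cycle on the position already equals `S`, so the orders are zero. These
zeros enter at the far end of the pipeline and advance by one entry per cycle, while earlier orders
pile up on hand. -/
theorem Model.idle_spec (T : ℕ) {S : ℕ} {x : P.State} (hx : P.Feasible S x) (n : ℕ) :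
    P.Feasible S (P.idle T S x n) ∧ (1 ≤ n → ∑ l, P.idle T S x n l = S) ∧
      ∀ l : Fin P.L, 1 ≤ (l : ℕ) → P.L < l + n → P.idle T S x n l = 0 := by
  induction n with
  | zero =>
    exact ⟨hx, by omega, fun l _ h => absurd l.2 (by omega)⟩
  | succ n ih =>
    obtain ⟨h1, h2, h3⟩ := ih
    have hs : P.idle T S x (n + 1) = P.step Alg.greedy S (P.idle T S x n) (fun _ : Fin T => 0) :=
      Function.iterate_succ_apply' _ _ _
    rw [hs]
    refine ⟨P.step_feasible _ h1 _, fun _ => ?_, fun l hl hln => ?_⟩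
    · have := P.step_sum Alg.greedy h1 (fun _ : Fin T => 0)
      rw [P.count_zero] at this
      simpa using this
    · simp only [Model.step]
      rw [if_neg (by omega), add_zero]
      split_ifs with h
      · exact h3 _ (by simp) (by simp; omega)
      · rw [Model.order, h2 (by have := l.2; omega), Nat.sub_self]

theorem Model.idle_L (T : ℕ) {S : ℕ} {x : P.State} (hx : P.Feasible S x) :
    P.idle T S x P.L = P.full S := by
  obtain ⟨-, h2, h3⟩ := P.idle_spec T hx P.L
  have h0 : ∀ l : Fin P.L, l ≠ ⟨0, P.one_le_L⟩ → P.idle T S x P.L l = 0 := by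
    intro l hl
    have : 1 ≤ (l : ℕ) := by
      rw [Nat.one_le_iff_ne_zero]; intro h; exact hl (Fin.ext h)
    exact h3 l this (by omega)
  have h := h2 P.one_le_L
  rw [Finset.sum_eq_single ⟨0, P.one_le_L⟩ (fun b _ hb => h0 b hb) (by simp)] at h
  funext l
  rw [Model.full]
  split_ifs with hl
  · rw [← h]; congr 1; exact Fin.ext hl
  · exact h0 l fun h => hl (by rw [h])

theorem Model.trans_ge_idle {T S : ℕ} {f : P.State → ℝ} {x : P.State} (hx : P.Feasible S x)
    (hf : ∀ y, P.Feasible S y → 0 ≤ f y) :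
    P.lam 0 ^ T * f (P.step Alg.greedy S x (fun _ : Fin T => 0)) ≤ P.trans T S f x := by
  have := Finset.single_le_sum
    (f := fun H : P.Arrivals T => (∏ t, P.lam (H t)) * f (P.step Alg.greedy S x H))
    (fun H _ => mul_nonneg (Finset.prod_nonneg fun t _ => P.lam_fin_nonneg _)
      (hf _ (P.step_feasible _ hx H))) (Finset.mem_univ (fun _ : Fin T => (0 : Fin (P.M + 1))))
  simpa [Model.trans, Model.cycleE, prodE] using this

theorem Model.iter_ge_idle {T S : ℕ} (n : ℕ) {f : P.State → ℝ}
    (hf : ∀ y, P.Feasible S y → 0 ≤ f y) {x : P.State} (hx : P.Feasible S x) :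
    (P.lam 0 ^ T) ^ n * f (P.idle T S x n) ≤ P.iter T S n f x := by
  induction n generalizing x with
  | zero => simp [Model.iter_zero, Model.idle]
  | succ n ih =>
    have hnn : ∀ y, P.Feasible S y → 0 ≤ P.iter T S n f y := fun y hy => by
      have := P.iter_mono (T := T) n (f := fun _ => 0) hf hy
      rwa [P.iter_const] at this
    have h1 := P.trans_ge_idle (T := T) hx hnn
    rw [P.iter_succ]
    refine le_trans ?_ h1
    have h2 := ih (P.step_feasible Alg.greedy hx (fun _ : Fin T => 0))
    have h3 : P.idle T S x (n + 1) =
        P.idle T S (P.step Alg.greedy S x (fun _ : Fin T => 0)) n :=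
      Function.iterate_succ_apply _ _ _
    rw [h3, pow_succ', mul_assoc]
    exact mul_le_mul_of_nonneg_left h2 (pow_nonneg P.lam_zero_pos.le _)

/-- Contraction constant of the chain over `L` cycles. -/
def Model.minor (T : ℕ) : ℝ := (P.lam 0 ^ T) ^ P.L

theorem Model.minor_pos (T : ℕ) : 0 < P.minor T := pow_pos (pow_pos P.lam_zero_pos _) _

theorem Model.minor_le_one (T : ℕ) : P.minor T ≤ 1 := by
  have h : P.lam 0 ≤ 1 := by linarith [P.q_nonneg]
  exact pow_le_one₀ (pow_nonneg P.lam_zero_pos.le _) (pow_le_one₀ P.lam_zero_pos.le h)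

/-- Doeblin's argument: from every feasible state, `P.L` idle cycles reach the full state, with
probability at least `P.minor T`. Applying this to the nonnegative functions `f - m` and `M - f`
gives both sides. -/
theorem Model.iter_contract {T S : ℕ} {f : P.State → ℝ} {m M : ℝ}
    (hf : ∀ x, P.Feasible S x → m ≤ f x ∧ f x ≤ M) {x : P.State} (hx : P.Feasible S x) :
    m + P.minor T * (f (P.full S) - m) ≤ P.iter T S P.L f x ∧
      P.iter T S P.L f x ≤ M - P.minor T * (M - f (P.full S)) := by
  constructor
  · have h := P.iter_ge_idle (T := T) P.L (f := fun x => f x - m)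
      (fun y hy => sub_nonneg.mpr (hf y hy).1) hx
    rw [P.idle_L T hx, P.iter_sub_fun, P.iter_const] at h
    simp only [Model.minor]
    linarith
  · have h := P.iter_ge_idle (T := T) P.L (f := fun x => M - f x)
      (fun y hy => sub_nonneg.mpr (hf y hy).2) hx
    rw [P.idle_L T hx, P.iter_sub_fun, P.iter_const] at h
    simp only [Model.minor]
    linarith

theorem Model.exists_bound (S : ℕ) (f : P.State → ℝ) :
    ∃ C : ℝ, 0 ≤ C ∧ ∀ x, P.Feasible S x → |f x| ≤ C := by
  obtain ⟨C, hC⟩ := ((P.feasible_finite S).image fun x => |f x|).bddAbove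
  exact ⟨max C 0, le_max_right _ _, fun x hx =>
    (hC (Set.mem_image_of_mem _ hx)).trans (le_max_left _ _)⟩

/-- Bounds for the iterates close in geometrically. -/
theorem Model.iter_squeeze (T S : ℕ) (f : P.State → ℝ) : ∃ C : ℝ, ∀ j : ℕ, ∃ m M : ℝ,
    M - m = (1 - P.minor T) ^ j * C ∧
      ∀ n, j * P.L ≤ n → ∀ x, P.Feasible S x → m ≤ P.iter T S n f x ∧ P.iter T S n f x ≤ M := by
  obtain ⟨C, hC, hf⟩ := P.exists_bound S f
  refine ⟨2 * C, fun j => ?_⟩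
  induction j with
  | zero =>
    refine ⟨-C, C, by ring, fun n _ x hx => ⟨?_, ?_⟩⟩
    · have := P.iter_mono (T := T) n (f := fun _ => -C) (fun y hy => (abs_le.mp (hf y hy)).1) hx
      rwa [P.iter_const] at this
    · have := P.iter_mono (T := T) n (g := fun _ => C) (fun y hy => (abs_le.mp (hf y hy)).2) hx
      rwa [P.iter_const] at this
  | succ j ih =>
    obtain ⟨m, M, hmM, h⟩ := ih
    set c := P.iter T S (j * P.L) f (P.full S)
    have hb := h (j * P.L) le_rfl
    -- Both bounds move towards the value `c` at the full state by the fraction `P.minor T`, so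
    -- their distance shrinks by the factor `1 - P.minor T`.
    refine ⟨m + P.minor T * (c - m), M - P.minor T * (M - c), ?_, fun n hn x hx => ?_⟩
    · rw [pow_succ]; linear_combination (1 - P.minor T) * hmM
    · obtain ⟨d, rfl⟩ := Nat.exists_eq_add_of_le hn
      have e : P.iter T S ((j + 1) * P.L + d) f =
          P.iter T S d (P.iter T S P.L (P.iter T S (j * P.L) f)) := by
        rw [← P.iter_add, ← P.iter_add]; congr 1; ring
      rw [e]
      constructor
      · have := P.iter_mono (T := T) d (f := fun _ => m + P.minor T * (c - m))
          (fun y hy => (P.iter_contract (T := T) hb hy).1) hx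
        rwa [P.iter_const] at this
      · have := P.iter_mono (T := T) d (g := fun _ => M - P.minor T * (M - c))
          (fun y hy => (P.iter_contract (T := T) hb hy).2) hx
        rwa [P.iter_const] at this

theorem Model.exists_limit (T S : ℕ) (f : P.State → ℝ) :
    ∃ c : ℝ, ∀ x, P.Feasible S x → Tendsto (fun n => P.iter T S n f x) atTop (𝓝 c) := by
  obtain ⟨C, hC⟩ := P.iter_squeeze T S f
  have hε : ∀ ε > 0, ∃ N, ∀ n ≥ N, ∀ n' ≥ N, ∀ x x', P.Feasible S x → P.Feasible S x' →
      |P.iter T S n f x - P.iter T S n' f x'| < ε := by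
    intro ε hε
    have ht : Tendsto (fun j : ℕ => (1 - P.minor T) ^ j * C) atTop (𝓝 (0 * C)) :=
      (tendsto_pow_atTop_nhds_zero_of_lt_one (by linarith [P.minor_le_one T])
        (by linarith [P.minor_pos T])).mul_const C
    rw [zero_mul] at ht
    obtain ⟨j, hj⟩ := (ht.eventually (gt_mem_nhds hε)).exists
    obtain ⟨m, M, hmM, h⟩ := hC j
    refine ⟨j * P.L, fun n hn n' hn' x x' hx hx' => ?_⟩
    have h1 := h n hn x hx
    have h2 := h n' hn' x' hx'
    rw [abs_lt]; constructor <;> linarith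
  have hcs : CauchySeq fun n => P.iter T S n f (P.full S) := by
    rw [Metric.cauchySeq_iff]
    intro ε he
    obtain ⟨N, hN⟩ := hε ε he
    exact ⟨N, fun m hm n hn => hN m hm n hn _ _ (P.full_feasible S) (P.full_feasible S)⟩
  obtain ⟨c, hc⟩ := cauchySeq_tendsto_of_complete hcs
  refine ⟨c, fun x hx => ?_⟩
  have hd : Tendsto (fun n => P.iter T S n f x - P.iter T S n f (P.full S)) atTop (𝓝 0) := by
    rw [Metric.tendsto_atTop]
    intro ε he
    obtain ⟨N, hN⟩ := hε ε he
    exact ⟨N, fun n hn => by simpa using hN n hn n hn x _ hx (P.full_feasible S)⟩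
  simpa using hd.add hc

/-- Limit of the iterates, the mean of `f` under the stationary law. -/
def Model.statE (T S : ℕ) (f : P.State → ℝ) : ℝ := (P.exists_limit T S f).choose

theorem Model.tendsto_iter {T S : ℕ} (f : P.State → ℝ) {x : P.State} (hx : P.Feasible S x) :
    Tendsto (fun n => P.iter T S n f x) atTop (𝓝 (P.statE T S f)) :=
  (P.exists_limit T S f).choose_spec x hx

end

/-! ### Stationary law and long-run averages -/

section

variable (P : Model)

theorem Model.statE_unique {T S : ℕ} {f : P.State → ℝ} {x : P.State} (hx : P.Feasible S x) {c : ℝ}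
    (h : Tendsto (fun n => P.iter T S n f x) atTop (𝓝 c)) : P.statE T S f = c :=
  tendsto_nhds_unique (P.tendsto_iter f hx) h

theorem Model.statE_add (T S : ℕ) (f g : P.State → ℝ) :
    P.statE T S (fun x => f x + g x) = P.statE T S f + P.statE T S g := by
  refine P.statE_unique (P.full_feasible S) ?_
  simp only [P.iter_add_fun]
  exact (P.tendsto_iter f (P.full_feasible S)).add (P.tendsto_iter g (P.full_feasible S))

theorem Model.statE_sub (T S : ℕ) (f g : P.State → ℝ) :
    P.statE T S (fun x => f x - g x) = P.statE T S f - P.statE T S g := by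
  refine P.statE_unique (P.full_feasible S) ?_
  simp only [P.iter_sub_fun]
  exact (P.tendsto_iter f (P.full_feasible S)).sub (P.tendsto_iter g (P.full_feasible S))

theorem Model.statE_const_mul (T S : ℕ) (c : ℝ) (f : P.State → ℝ) :
    P.statE T S (fun x => c * f x) = c * P.statE T S f := by
  refine P.statE_unique (P.full_feasible S) ?_
  simp only [P.iter_const_mul]
  exact (P.tendsto_iter f (P.full_feasible S)).const_mul c

theorem Model.statE_const (T S : ℕ) (c : ℝ) : P.statE T S (fun _ => c) = c := by
  refine P.statE_unique (P.full_feasible S) ?_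
  simp only [P.iter_const]
  exact tendsto_const_nhds

theorem Model.statE_mono {T S : ℕ} {f g : P.State → ℝ} (h : ∀ x, P.Feasible S x → f x ≤ g x) :
    P.statE T S f ≤ P.statE T S g :=
  le_of_tendsto_of_tendsto' (P.tendsto_iter f (P.full_feasible S))
    (P.tendsto_iter g (P.full_feasible S)) fun n => P.iter_mono n h (P.full_feasible S)

theorem Model.statE_congr {T S : ℕ} {f g : P.State → ℝ} (h : ∀ x, P.Feasible S x → f x = g x) :
    P.statE T S f = P.statE T S g :=
  le_antisymm (P.statE_mono fun x hx => (h x hx).le) (P.statE_mono fun x hx => (h x hx).ge)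

theorem Model.statE_trans (T S : ℕ) (f : P.State → ℝ) :
    P.statE T S (P.trans T S f) = P.statE T S f := by
  refine P.statE_unique (P.full_feasible S) ?_
  simp only [← P.iter_succ']
  exact (P.tendsto_iter f (P.full_feasible S)).comp (tendsto_add_atTop_nat 1)

theorem Model.statE_sum {ι : Type*} (s : Finset ι) (T S : ℕ) (f : ι → P.State → ℝ) :
    P.statE T S (fun x => ∑ i ∈ s, f i x) = ∑ i ∈ s, P.statE T S (f i) := by
  classical
  induction s using Finset.induction_on with
  | empty => simpa using P.statE_const T S 0
  | insert a s ha ih => simp only [Finset.sum_insert ha, P.statE_add, ih]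

section Stationary

/-- The finite set of feasible states. -/
def Model.feasibleSet (S : ℕ) : Finset P.State := (P.feasible_finite S).toFinset

theorem Model.mem_feasibleSet {S : ℕ} {x : P.State} : x ∈ P.feasibleSet S ↔ P.Feasible S x := by
  simp [Model.feasibleSet]

theorem Model.apply_eq_sum_indicator {S : ℕ} (f : P.State → ℝ) {x : P.State}
    (hx : P.Feasible S x) :
    f x = ∑ y ∈ P.feasibleSet S, f y * (if x = y then 1 else 0) := by
  classical
  rw [Finset.sum_eq_single_of_mem x (P.mem_feasibleSet.mpr hx)]
  · simp
  · intro b _ hb; rw [if_neg hb.symm, mul_zero]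

open Classical in
/-- Stationary probability of a state. -/
def Model.statP (T S : ℕ) (y : P.State) : ℝ := P.statE T S (fun x => if x = y then 1 else 0)

theorem Model.statP_nonneg (T S : ℕ) (y : P.State) : 0 ≤ P.statP T S y := by
  rw [← P.statE_const T S 0]
  exact P.statE_mono fun x _ => by split_ifs <;> norm_num

theorem Model.statE_eq_sum (T S : ℕ) (f : P.State → ℝ) :
    P.statE T S f = ∑ y ∈ P.feasibleSet S, f y * P.statP T S y := by
  classical
  rw [P.statE_congr (g := fun x => ∑ y ∈ P.feasibleSet S, f y * (if x = y then 1 else 0))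
    fun x hx => P.apply_eq_sum_indicator f hx, P.statE_sum]
  refine Finset.sum_congr rfl fun y _ => ?_
  rw [P.statE_const_mul, Model.statP]

/-- The stationary law. -/
def Model.statLaw (T S : ℕ) : Measure P.State :=
  ∑ y ∈ P.feasibleSet S, ENNReal.ofReal (P.statP T S y) • Measure.dirac y

instance (T S : ℕ) : IsProbabilityMeasure (P.statLaw T S) := by
  constructor
  have h := P.statE_eq_sum T S (fun _ => 1)
  rw [P.statE_const] at h
  simp only [one_mul] at h
  simp only [Model.statLaw, Measure.coe_finsetSum, Finset.sum_apply, Measure.smul_apply,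
    smul_eq_mul, measure_univ, mul_one]
  rw [← ENNReal.ofReal_sum_of_nonneg fun y _ => P.statP_nonneg T S y, ← h, ENNReal.ofReal_one]

theorem Model.statLaw_feasible (T S : ℕ) : ∀ᵐ x ∂(P.statLaw T S), P.Feasible S x := by
  rw [ae_iff, Model.statLaw, Measure.coe_finsetSum, Finset.sum_apply]
  refine Finset.sum_eq_zero fun y hy => ?_
  rw [Measure.smul_apply, Measure.dirac_apply' _ (MeasurableSet.of_discrete)]
  simp [P.mem_feasibleSet.mp hy]

theorem Model.integral_step {T S : ℕ} {ν : Measure P.State} [IsProbabilityMeasure ν]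
    (hν : ∀ᵐ x ∂ν, P.Feasible S x) (f : P.State → ℝ) :
    ∫ y, f y ∂((ν.prod (P.cycleLaw T)).map (fun z => P.step Alg.greedy S z.1 z.2)) =
      ∫ x, P.trans T S f x ∂ν := by
  have hm : Measurable (fun z : P.State × P.Arrivals T => P.step Alg.greedy S z.1 z.2) :=
    Measurable.of_discrete
  rw [integral_map hm.aemeasurable (Measurable.of_discrete.aestronglyMeasurable),
    integral_prod]
  · simp only [Model.trans, P.integral_cycleLaw]
  · obtain ⟨C, -, hC⟩ := P.exists_bound S f
    refine Integrable.of_bound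
      (Measurable.of_discrete (f := fun z : P.State × P.Arrivals T =>
        f (P.step Alg.greedy S z.1 z.2))).aestronglyMeasurable C ?_
    have : ∀ᵐ z ∂(ν.prod (P.cycleLaw T)), P.Feasible S z.1 :=
      Measure.quasiMeasurePreserving_fst.ae hν
    filter_upwards [this] with z hz
    exact hC _ (P.step_feasible _ hz _)

/-- Invariance makes the integral of the iterates of `f` constant, while dominated convergence sends
it to `P.statE T S f`. Hence a stationary law is determined by these limits, which gives uniqueness.
-/
theorem Model.integral_eq_statE {a : Alg} {T S : ℕ} {ν : Measure P.State}
    (h : P.IsStationary a T S ν) (f : P.State → ℝ) : ∫ x, f x ∂ν = P.statE T S f := by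
  have hg : P.IsStationary Alg.greedy T S ν := (P.isStationary_iff a _ T S ν).mp h
  have := hg.isProbabilityMeasure
  have hi : ∀ n, ∫ x, P.iter T S n f x ∂ν = ∫ x, f x ∂ν := by
    intro n
    induction n generalizing f with
    | zero => rfl
    | succ n ih =>
      rw [P.iter_succ', ih, ← P.integral_step (T := T) hg.feasible, hg.invariant]
  have hlim : Tendsto (fun n => ∫ x, P.iter T S n f x ∂ν) atTop
      (𝓝 (∫ _, P.statE T S f ∂ν)) := by
    obtain ⟨C, -, hC⟩ := P.exists_bound S f
    refine tendsto_integral_of_dominated_convergence (fun _ => C)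
      (fun n => Measurable.of_discrete.aestronglyMeasurable) (integrable_const C) (fun n => ?_) ?_
    · filter_upwards [hg.feasible] with x hx
      rw [Real.norm_eq_abs, abs_le]
      constructor
      · have := P.iter_mono (T := T) n (f := fun _ => -C) (fun y hy => (abs_le.mp (hC y hy)).1) hx
        rwa [P.iter_const] at this
      · have := P.iter_mono (T := T) n (g := fun _ => C) (fun y hy => (abs_le.mp (hC y hy)).2) hx
        rwa [P.iter_const] at this
    · filter_upwards [hg.feasible] with x hx
      exact P.tendsto_iter f hx
  simp only [hi] at hlim
  rw [integral_const, probReal_univ, one_smul] at hlim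
  exact tendsto_nhds_unique tendsto_const_nhds hlim

theorem Model.integral_statLaw (T S : ℕ) (f : P.State → ℝ) :
    ∫ x, f x ∂(P.statLaw T S) = P.statE T S f := by
  rw [Model.statLaw, integral_finsetSum_measure
    (fun y _ => (integrable_dirac (by simp)).smul_measure (by simp)), P.statE_eq_sum]
  refine Finset.sum_congr rfl fun y _ => ?_
  rw [integral_smul_measure, integral_dirac, ENNReal.toReal_ofReal (P.statP_nonneg T S y),
    smul_eq_mul, mul_comm]

theorem Model.measure_ext_of_integral {ν ν' : Measure P.State} [IsProbabilityMeasure ν]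
    [IsProbabilityMeasure ν'] (h : ∀ f : P.State → ℝ, ∫ x, f x ∂ν = ∫ x, f x ∂ν') : ν = ν' := by
  refine Measure.ext_of_singleton fun y => ?_
  have := h (Set.indicator {y} fun _ => 1)
  rw [integral_indicator_const _ (MeasurableSet.singleton y),
    integral_indicator_const _ (MeasurableSet.singleton y)] at this
  simp only [smul_eq_mul, mul_one] at this
  exact (measureReal_eq_measureReal_iff).mp this

theorem Model.statLaw_isStationary (a : Alg) (T S : ℕ) : P.IsStationary a T S (P.statLaw T S) := by
  rw [P.isStationary_iff a Alg.greedy]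
  refine ⟨inferInstance, P.statLaw_feasible T S, ?_⟩
  have hm : Measurable (fun z : P.State × P.Arrivals T => P.step Alg.greedy S z.1 z.2) :=
    Measurable.of_discrete
  have : IsProbabilityMeasure (((P.statLaw T S).prod (P.cycleLaw T)).map
      (fun z => P.step Alg.greedy S z.1 z.2)) := Measure.isProbabilityMeasure_map hm.aemeasurable
  refine P.measure_ext_of_integral fun f => ?_
  rw [P.integral_step (P.statLaw_feasible T S), P.integral_statLaw, P.integral_statLaw,
    P.statE_trans]

theorem Model.isStationary_iff_eq (a : Alg) (T S : ℕ) (ν : Measure P.State) :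
    P.IsStationary a T S ν ↔ ν = P.statLaw T S := by
  refine ⟨fun h => ?_, fun h => h ▸ P.statLaw_isStationary a T S⟩
  have := h.isProbabilityMeasure
  refine P.measure_ext_of_integral fun f => ?_
  rw [P.integral_eq_statE h, P.integral_statLaw]

end Stationary

section Path

theorem Model.state_congr {T : ℕ} (a : Alg) (S : ℕ) (x₀ : P.State) {ω ω' : ℕ → P.Arrivals T}
    {n : ℕ} (h : ∀ i < n, ω i = ω' i) : P.state a S x₀ ω n = P.state a S x₀ ω' n := by
  induction n with
  | zero => rfl
  | succ n ih => rw [Model.state, Model.state, ih fun i hi => h i (by omega), h n (by omega)]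

theorem Model.state_feasible {T : ℕ} (a : Alg) {S : ℕ} {x₀ : P.State} (h : P.Feasible S x₀)
    (ω : ℕ → P.Arrivals T) (n : ℕ) : P.Feasible S (P.state a S x₀ ω n) := by
  induction n with
  | zero => exact h
  | succ n ih => exact P.step_feasible a ih _

/-- The state as a function of the finitely many cycles it depends on. -/
theorem Model.exists_state_restrict {T : ℕ} (a : Alg) (S : ℕ) (x₀ : P.State) (n : ℕ) :
    ∃ g : ((i : Finset.range n) → P.Arrivals T) → P.State,
      (fun ω : ℕ → P.Arrivals T => P.state a S x₀ ω n) = g ∘ fun ω i => ω i := by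
  refine ⟨fun v => P.state a S x₀
    (fun i => if h : i ∈ Finset.range n then v ⟨i, h⟩ else fun _ => 0) n, ?_⟩
  funext ω
  refine P.state_congr a S x₀ fun i hi => ?_
  simp [hi]

theorem Model.measurable_state {T : ℕ} (a : Alg) (S : ℕ) (x₀ : P.State) (n : ℕ) :
    Measurable (fun ω : ℕ → P.Arrivals T => P.state a S x₀ ω n) := by
  obtain ⟨g, hg⟩ := P.exists_state_restrict (T := T) a S x₀ n
  rw [hg]
  exact (measurable_of_finite g).comp (by fun_prop)

/-- The state at the start of cycle `n` depends only on the arrivals of earlier cycles and is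
therefore independent of `ω n`. -/
theorem Model.map_state_prod {T : ℕ} (a : Alg) (S : ℕ) (x₀ : P.State) (n : ℕ) :
    (P.pathLaw T).map (fun ω => (P.state a S x₀ ω n, ω n)) =
      ((P.pathLaw T).map fun ω => P.state a S x₀ ω n).prod (P.cycleLaw T) := by
  have hind : ProbabilityTheory.iIndepFun (fun i (ω : ℕ → P.Arrivals T) => ω i) (P.pathLaw T) :=
    ProbabilityTheory.iIndepFun_infinitePi (X := fun _ x => x) (fun _ => measurable_id)
  have h2 := hind.indepFun_finset (Finset.range n) {n} (by simp) (fun i => measurable_pi_apply i)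
  obtain ⟨g, hg⟩ := P.exists_state_restrict (T := T) a S x₀ n
  have h3 : ProbabilityTheory.IndepFun (fun ω : ℕ → P.Arrivals T => P.state a S x₀ ω n)
      (fun ω => ω n) (P.pathLaw T) := by
    rw [hg]
    have h4 : Measurable fun v : ((i : ({n} : Finset ℕ)) → P.Arrivals T) =>
        v ⟨n, Finset.mem_singleton_self n⟩ := measurable_pi_apply _
    exact h2.comp (measurable_of_finite g) h4
  rw [(ProbabilityTheory.indepFun_iff_map_prod_eq_prod_map_map
    (P.measurable_state a S x₀ n).aemeasurable (measurable_pi_apply n).aemeasurable).mp h3]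
  congr 1
  exact Measure.infinitePi_map_eval _ n

theorem Model.integral_state {T : ℕ} (a : Alg) {S : ℕ} {x₀ : P.State} (hx : P.Feasible S x₀)
    (n : ℕ) (F : P.State → P.Arrivals T → ℝ) :
    ∫ ω, F (P.state a S x₀ ω n) (ω n) ∂(P.pathLaw T) =
      ∫ x, P.cycleE T (F x) ∂((P.pathLaw T).map fun ω => P.state a S x₀ ω n) := by
  have hms := P.measurable_state (T := T) a S x₀ n
  have hm : Measurable fun ω : ℕ → P.Arrivals T => (P.state a S x₀ ω n, ω n) :=
    hms.prodMk (measurable_pi_apply n)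
  have hF : Measurable fun z : P.State × P.Arrivals T => F z.1 z.2 := Measurable.of_discrete
  have : IsProbabilityMeasure ((P.pathLaw T).map fun ω => P.state a S x₀ ω n) :=
    Measure.isProbabilityMeasure_map hms.aemeasurable
  have e : ∫ ω, F (P.state a S x₀ ω n) (ω n) ∂(P.pathLaw T) =
      ∫ z, F z.1 z.2 ∂((P.pathLaw T).map fun ω => (P.state a S x₀ ω n, ω n)) := by
    rw [integral_map hm.aemeasurable hF.aestronglyMeasurable]
  rw [e, P.map_state_prod, integral_prod]
  · simp only [P.integral_cycleLaw]
  · choose C hC0 hC using fun H : P.Arrivals T => P.exists_bound S (fun x => F x H)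
    have hCb : ∀ H, C H ≤ ∑ G, C G := fun H =>
      Finset.single_le_sum (fun G _ => hC0 G) (Finset.mem_univ H)
    refine Integrable.of_bound hF.aestronglyMeasurable (∑ G, C G) ?_
    have hfe : ∀ᵐ x ∂((P.pathLaw T).map fun ω => P.state a S x₀ ω n), P.Feasible S x := by
      rw [ae_map_iff hms.aemeasurable MeasurableSet.of_discrete]
      exact ae_of_all _ fun ω => P.state_feasible a hx ω n
    filter_upwards [Measure.quasiMeasurePreserving_fst.ae hfe] with z hz
    exact (hC z.2 z.1 hz).trans (hCb z.2)

theorem Model.integral_state_eq_iter {T : ℕ} (a : Alg) {S : ℕ} {x₀ : P.State}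
    (hx : P.Feasible S x₀) (n : ℕ) (f : P.State → ℝ) :
    ∫ ω, f (P.state a S x₀ ω n) ∂(P.pathLaw T) = P.iter T S n f x₀ := by
  induction n generalizing f with
  | zero => simp [Model.state, P.iter_zero]
  | succ n ih =>
    rw [P.iter_succ', ← ih]
    have h := P.integral_state a hx n (fun x (H : P.Arrivals T) => f (P.step a S x H))
    have hms := P.measurable_state (T := T) a S x₀ n
    rw [integral_map hms.aemeasurable Measurable.of_discrete.aestronglyMeasurable] at h
    simp only [Model.state]
    rw [h]
    simp only [Model.trans, fun x (H : P.Arrivals T) => P.step_eq a Alg.greedy S x H]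

/-- Expected profit of one cycle as a function of the state. -/
def Model.meanProfit (a : Alg) (T : ℕ) (x : P.State) : ℝ :=
  P.cycleE T (fun H => P.profit a (P.onHand x) H)

theorem Model.integrable_path {T : ℕ} (a : Alg) {S : ℕ} {x₀ : P.State} (hx : P.Feasible S x₀)
    (n : ℕ) (F : P.State → P.Arrivals T → ℝ) :
    Integrable (fun ω => F (P.state a S x₀ ω n) (ω n)) (P.pathLaw T) := by
  have hm : Measurable fun ω : ℕ → P.Arrivals T => (P.state a S x₀ ω n, ω n) :=
    (P.measurable_state (T := T) a S x₀ n).prodMk (measurable_pi_apply n)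
  have hF : Measurable fun z : P.State × P.Arrivals T => F z.1 z.2 := Measurable.of_discrete
  choose C hC0 hC using fun H : P.Arrivals T => P.exists_bound S (fun x => F x H)
  refine Integrable.of_bound (hF.comp hm).aestronglyMeasurable (∑ G, C G)
    (ae_of_all _ fun ω => ?_)
  exact (hC (ω n) _ (P.state_feasible a hx ω n)).trans
    (Finset.single_le_sum (fun G _ => hC0 G) (Finset.mem_univ (ω n)))

theorem Model.avgProfit_eq {T : ℕ} (a : Alg) {S : ℕ} {x₀ : P.State} (hx : P.Feasible S x₀)
    (N : ℕ) :
    P.avgProfit a T S x₀ N =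
      (N : ℝ)⁻¹ * ∑ n ∈ Finset.range N, P.iter T S n (P.meanProfit a T) x₀ := by
  rw [Model.avgProfit, one_div, integral_finsetSum]
  · congr 1
    refine Finset.sum_congr rfl fun n _ => ?_
    have hms := P.measurable_state (T := T) a S x₀ n
    have h := P.integral_state a hx n (fun x (H : P.Arrivals T) => P.profit a (P.onHand x) H)
    rw [integral_map hms.aemeasurable Measurable.of_discrete.aestronglyMeasurable] at h
    rw [h, ← P.integral_state_eq_iter a hx]
    rfl
  · exact fun n _ => P.integrable_path a hx n (fun x H => P.profit a (P.onHand x) H)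

/-- The expected profits of single cycles converge to the stationary mean, hence so do their Cesàro
averages. -/
theorem Model.tendsto_avgProfit {T : ℕ} (a : Alg) {S : ℕ} {x₀ : P.State} (hx : P.Feasible S x₀) :
    Tendsto (P.avgProfit a T S x₀) atTop (𝓝 (P.statE T S (P.meanProfit a T))) := by
  have h := (P.tendsto_iter (T := T) (P.meanProfit a T) hx).cesaro
  refine h.congr fun N => ?_
  rw [P.avgProfit_eq a hx]

theorem Model.longRunProfit_eq (a : Alg) (T S : ℕ) :
    P.longRunProfit a T S = P.statE T S (P.meanProfit a T) :=
  (P.tendsto_avgProfit a (by simp [Model.Feasible])).limUnder_eq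

end Path

end

/-! ### Flow balance, inventory bounds and the mean leftover -/

section

variable (P : Model)

/-- Inventory on hand after the next `k` arrivals of orders, disregarding sales; with `k = L` this
is the whole inventory position `S` after ordering. -/
def Model.reach (S k : ℕ) (x : P.State) : ℕ :=
  if k < P.L then ∑ n ∈ Finset.range (k + 1), (if h : n < P.L then x ⟨n, h⟩ else 0) else S

theorem Model.reach_zero (S : ℕ) (x : P.State) : P.reach S 0 x = P.onHand x := by
  have := P.one_le_L
  rw [Model.reach, if_pos (by omega), Finset.sum_range_one, dif_pos (by omega)]
  rfl

theorem Model.reach_L (S : ℕ) (x : P.State) : P.reach S P.L x = S := by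
  rw [Model.reach, if_neg (by omega)]

/-- During one cycle the pipeline shifts by one entry, so what was due within `k + 1` arrivals is
now due within `k`, less the units sold. -/
theorem Model.reach_step {T : ℕ} {S k : ℕ} (hk : k < P.L) {x : P.State} (hx : P.Feasible S x)
    (H : P.Arrivals T) :
    P.reach S k (P.step Alg.greedy S x H) + min (P.onHand x) (P.count 1 H) =
      P.reach S (k + 1) x := by
  by_cases hk1 : k + 1 < P.L
  · rw [Model.reach, if_pos hk, Model.reach, if_pos hk1, Finset.sum_range_succ' _ (k + 1),
      Finset.sum_range_succ', Finset.sum_range_succ' _ k]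
    have h1 : ∀ n ∈ Finset.range k, (if h : n + 1 < P.L then
        P.step Alg.greedy S x H ⟨n + 1, h⟩ else 0) =
        (if h : n + 1 + 1 < P.L then x ⟨n + 1 + 1, h⟩ else 0) := by
      intro n hn
      rw [Finset.mem_range] at hn
      rw [dif_pos (by omega), dif_pos (by omega), Model.step, dif_pos (by simp; omega),
        if_neg (by simp), add_zero]
    rw [Finset.sum_congr rfl h1, dif_pos (by omega), dif_pos (by omega), dif_pos (by omega),
      Model.step, dif_pos (by simp; omega), if_pos rfl, P.leftover_eq]
    simp only [Model.onHand, zero_add]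
    omega
  · rw [Model.reach, if_pos hk, Model.reach, if_neg hk1]
    refine Eq.trans ?_ (P.step_sum Alg.greedy hx H)
    congr 1
    rw [Finset.sum_range (n := k + 1)]
    obtain h : P.L = k + 1 := by omega
    have e : ∀ (m : ℕ) (_ : m = k + 1) (y : Fin m → ℕ),
        ∑ i : Fin (k + 1), (if h : (i : ℕ) < m then y ⟨i, h⟩ else 0) = ∑ l, y l := by
      rintro m rfl y
      exact Finset.sum_congr rfl fun i _ => by rw [dif_pos i.2]
    exact e P.L h _

/-- Mean sales per cycle in stationarity. -/
def Model.meanSales (T S : ℕ) : ℝ := P.statE T S (fun x => P.sales T (P.onHand x))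

theorem Model.cycleE_const (T : ℕ) (c : ℝ) : P.cycleE T (fun _ => c) = c :=
  prodE_const P.sum_lam_fin T c

/-- In stationarity a cycle does not change the mean of `reach k`. By `reach_step` the means of
consecutive `reach k` therefore differ by the mean sales, ending with `S` at `k = L`. -/
theorem Model.statE_reach (T S k : ℕ) (hk : k ≤ P.L) :
    P.statE T S (fun x => (P.reach S k x : ℝ)) + (P.L - k) * P.meanSales T S = S := by
  obtain ⟨d, hd⟩ := Nat.exists_eq_add_of_le hk
  induction d generalizing k with
  | zero =>
    obtain rfl : P.L = k := by omega
    simp only [P.reach_L, P.statE_const]; ring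
  | succ d ih =>
    have h := ih (k + 1) (by omega) (by omega)
    have h2 : P.statE T S (fun x => (P.reach S (k + 1) x : ℝ)) =
        P.statE T S (fun x => (P.reach S k x : ℝ)) + P.meanSales T S := by
      rw [← P.statE_trans T S (fun x => (P.reach S k x : ℝ)), Model.meanSales, ← P.statE_add]
      refine P.statE_congr fun x hx => ?_
      rw [Model.trans, Model.sales, Model.cycleE, Model.cycleE, ← prodE_add]
      rw [← P.cycleE_const T (P.reach S (k + 1) x : ℝ), Model.cycleE]
      congr 1
      funext H
      rw [← P.reach_step (by omega) hx H]
      push_cast; rfl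
    rw [h2] at h
    push_cast at h
    linarith

theorem Model.statE_onHand (T S : ℕ) :
    P.statE T S (fun x => (P.onHand x : ℝ)) = S - P.L * P.meanSales T S := by
  have := P.statE_reach T S 0 (Nat.zero_le _)
  simp only [P.reach_zero, Nat.cast_zero, sub_zero] at this
  linarith

/-- Mean leftover per cycle in stationarity. -/
theorem Model.statE_leftover (T S : ℕ) :
    P.statE T S (fun x => (P.onHand x : ℝ) - P.sales T (P.onHand x)) =
      S - (P.L + 1) * P.meanSales T S := by
  rw [P.statE_sub, P.statE_onHand, Model.meanSales]; ring

theorem bern_add_trials (s : ℝ) (T T' : ℕ) (f : ℕ → ℝ) :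
    bern s T (fun k => bern s T' (fun l => f (k + l))) = bern s (T + T') f := by
  induction T generalizing f with
  | zero => simp [bern]
  | succ T ih =>
    rw [Nat.add_right_comm, bern_succ, bern_succ, ← ih, ← ih]
    simp only [add_right_comm]

theorem Model.q_le_one : 1 - P.lam 0 ≤ 1 := P.q_lt_one.le

theorem Model.cycleE_count_one (T : ℕ) (f : ℕ → ℝ) :
    P.cycleE T (fun H => f (P.count 1 H)) = bern (1 - P.lam 0) T f := by
  rw [P.cycleE_count, P.tail_one]

/-- The on-hand inventory is at least `S` minus the demand of the last `L` cycles. -/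
theorem Model.iter_reach_le {T S : ℕ} {g : ℝ → ℝ} (hg : Antitone g) (k : ℕ) (hk : k ≤ P.L)
    {x : P.State} (hx : P.Feasible S x) :
    P.iter T S k (fun x => g (P.onHand x)) x ≤
      bern (1 - P.lam 0) (k * T) (fun n => g ((P.reach S k x : ℝ) - n)) := by
  induction k generalizing x with
  | zero => simp [P.iter_zero, P.reach_zero, bern]
  | succ k ih =>
    rw [P.iter_succ]
    have h1 := P.trans_mono (T := T) (fun y hy => ih (by omega) hy) hx
    refine h1.trans ?_
    rw [show (k + 1) * T = T + k * T by ring, ← bern_add_trials,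
      ← P.cycleE_count_one T (fun m => bern (1 - P.lam 0) (k * T)
        fun l => g ((P.reach S (k + 1) x : ℝ) - ((m + l : ℕ) : ℝ)))]
    refine P.cycleE_mono fun H => bern_mono P.q_nonneg P.q_le_one _ fun n _ => hg ?_
    rw [← P.reach_step (by omega) hx H]
    have : ((min (P.onHand x) (P.count 1 H) : ℕ) : ℝ) ≤ (P.count 1 H : ℕ) :=
      Nat.cast_le.mpr (min_le_right _ _)
    push_cast at this ⊢
    linarith

/-- Looking back `L` cycles, the current stock is `S` minus the sales since then, and sales are at
most demand. Antitone `g` turns this into a bound by a binomial variable with `L * T` trials. -/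
theorem Model.statE_onHand_le {T S : ℕ} {g : ℝ → ℝ} (hg : Antitone g) :
    P.statE T S (fun x => g (P.onHand x)) ≤
      bern (1 - P.lam 0) (P.L * T) (fun n => g ((S : ℝ) - n)) := by
  have h : ∀ k, P.statE T S (P.iter T S k (fun x => g (P.onHand x))) =
      P.statE T S (fun x => g (P.onHand x)) := by
    intro k
    induction k with
    | zero => rfl
    | succ k ih => rw [P.iter_succ, P.statE_trans, ih]
  rw [← h P.L, ← P.statE_const T S (bern (1 - P.lam 0) (P.L * T) (fun n => g ((S : ℝ) - n)))]
  refine P.statE_mono fun x hx => ?_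
  have := P.iter_reach_le (T := T) hg P.L le_rfl hx
  rwa [P.reach_L] at this

section Flux

/-- Transition operator weighted exponentially by the shortfall of sales below `b`. -/
def Model.tilt (T S : ℕ) (t b : ℝ) (f : P.State → ℝ) (x : P.State) : ℝ :=
  P.cycleE T (fun H => Real.exp (t * (b - (min (P.onHand x) (P.count 1 H) : ℕ))) *
    f (P.step Alg.greedy S x H))

theorem Model.tilt_mono {T S : ℕ} {t b : ℝ} {f g : P.State → ℝ}
    (h : ∀ x, P.Feasible S x → f x ≤ g x) {x : P.State} (hx : P.Feasible S x) :
    P.tilt T S t b f x ≤ P.tilt T S t b g x :=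
  P.cycleE_mono fun H => mul_le_mul_of_nonneg_left (h _ (P.step_feasible _ hx H))
    (Real.exp_pos _).le

theorem Model.tilt_iter_mono {T S : ℕ} {t b : ℝ} (n : ℕ) {f g : P.State → ℝ}
    (h : ∀ x, P.Feasible S x → f x ≤ g x) {x : P.State} (hx : P.Feasible S x) :
    (P.tilt T S t b)^[n] f x ≤ (P.tilt T S t b)^[n] g x := by
  induction n generalizing x with
  | zero => exact h x hx
  | succ n ih =>
    rw [Function.iterate_succ_apply', Function.iterate_succ_apply']
    exact P.tilt_mono (fun y hy => ih hy) hx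

theorem Model.tilt_add_const_mul (T S : ℕ) (t b c : ℝ) (f g : P.State → ℝ) :
    P.tilt T S t b (fun x => c * f x + g x) =
      fun x => c * P.tilt T S t b f x + P.tilt T S t b g x := by
  funext x
  simp only [Model.tilt, Model.cycleE]
  rw [← prodE_const_mul, ← prodE_add]
  congr 1; funext H; ring

theorem Model.tilt_iter_add_const_mul (T S n : ℕ) (t b c : ℝ) (f g : P.State → ℝ) :
    (P.tilt T S t b)^[n] (fun x => c * f x + g x) =
      fun x => c * (P.tilt T S t b)^[n] f x + (P.tilt T S t b)^[n] g x := by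
  induction n with
  | zero => rfl
  | succ n ih =>
    simp only [Function.iterate_succ_apply', ih, P.tilt_add_const_mul]

/-- Each cycle's sales are exactly what `reach` loses, so the exponent telescopes to a deterministic
value along every path. -/
theorem Model.tilt_iter_reach {T S : ℕ} (t b : ℝ) (k : ℕ) (hk : k ≤ P.L) {x : P.State}
    (hx : P.Feasible S x) :
    (P.tilt T S t b)^[k] (fun x => Real.exp (t * (b - P.onHand x))) x =
      Real.exp (t * ((k + 1) * b - P.reach S k x)) := by
  induction k generalizing x with
  | zero => simp [P.reach_zero]
  | succ k ih =>
    rw [Function.iterate_succ_apply', Model.tilt]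
    rw [← P.cycleE_const T (Real.exp (t * (((k + 1 : ℕ) + 1) * b - P.reach S (k + 1) x)))]
    congr 1
    funext H
    rw [ih (by omega) (P.step_feasible _ hx H), ← Real.exp_add,
      ← P.reach_step (by omega) hx H]
    congr 1
    push_cast; ring

/-- The weight at the minimum of stock and demand is one of the two weights on the right, hence at
most their sum. -/
theorem Model.tilt_one_le {T S : ℕ} {t b : ℝ} (x : P.State) :
    P.tilt T S t b (fun _ => 1) x ≤
      bern (1 - P.lam 0) T (fun k => Real.exp (t * (b - k))) +
        Real.exp (t * (b - P.onHand x)) := by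
  rw [← P.cycleE_count_one T (fun k => Real.exp (t * (b - k))),
    ← P.cycleE_const T (Real.exp (t * (b - P.onHand x))), Model.tilt, Model.cycleE, Model.cycleE,
    Model.cycleE, ← prodE_add]
  refine P.cycleE_mono fun H => ?_
  rw [mul_one]
  rcases le_total (P.onHand x) (P.count 1 H) with h | h
  · rw [min_eq_left h]; linarith [Real.exp_pos (t * (b - (P.count 1 H : ℕ)))]
  · rw [min_eq_right h]; linarith [Real.exp_pos (t * (b - (P.onHand x : ℕ)))]

/-- Among `L + 1` consecutive cycles, the weight of the last is split by `tilt_one_le`. Its demand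
part contributes the factor X. In its stock part the exponent telescopes over the preceding `L`
cycles to `(L + 1) b - S`, which vanishes for `b = S / (L + 1)`. -/
theorem Model.tilt_recursion {T S : ℕ} (t : ℝ) (n : ℕ) {x : P.State} (hx : P.Feasible S x) :
    (P.tilt T S t (S / (P.L + 1)))^[n + P.L + 1] (fun _ => 1) x ≤
      bern (1 - P.lam 0) T (fun k => Real.exp (t * ((S : ℝ) / (P.L + 1) - k))) *
        (P.tilt T S t (S / (P.L + 1)))^[n + P.L] (fun _ => 1) x +
      (P.tilt T S t (S / (P.L + 1)))^[n] (fun _ => 1) x := by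
  set b : ℝ := S / (P.L + 1) with hb
  set X := bern (1 - P.lam 0) T (fun k => Real.exp (t * (b - k)))
  have h1 : ∀ y, P.Feasible S y → (P.tilt T S t b)^[P.L + 1] (fun _ => 1) y ≤
      X * (P.tilt T S t b)^[P.L] (fun _ => 1) y + 1 := by
    intro y hy
    rw [Function.iterate_succ_apply]
    refine (P.tilt_iter_mono P.L (g := fun x => X * 1 + Real.exp (t * (b - P.onHand x)))
      (fun z _ => by rw [mul_one]; exact P.tilt_one_le z) hy).trans ?_
    rw [P.tilt_iter_add_const_mul T S P.L t b X (fun _ => 1)]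
    dsimp only
    rw [P.tilt_iter_reach t b P.L le_rfl hy,
      P.reach_L]
    have : ((P.L : ℝ) + 1) * b - S = 0 := by rw [hb]; field_simp; ring
    rw [this, mul_zero, Real.exp_zero]
  rw [add_assoc, Function.iterate_add_apply]
  refine (P.tilt_iter_mono n h1 hx).trans ?_
  rw [P.tilt_iter_add_const_mul T S n t b X, Function.iterate_add_apply]

/-- Expected cumulative shortfall of sales below `b` over `n` cycles. -/
theorem Model.exp_le_tilt {T S : ℕ} (t b : ℝ) (n : ℕ) {x : P.State} (hx : P.Feasible S x) :
    Real.exp (t * ∑ i ∈ Finset.range n,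
        (b - P.iter T S i (fun x => P.sales T (P.onHand x)) x)) ≤
      (P.tilt T S t b)^[n] (fun _ => 1) x := by
  induction n generalizing x with
  | zero => simp
  | succ n ih =>
    rw [Function.iterate_succ_apply', Model.tilt]
    set Y : P.State → ℝ := fun x => ∑ i ∈ Finset.range n,
      (b - P.iter T S i (fun x => P.sales T (P.onHand x)) x) with hY
    set u : P.Arrivals T → ℝ := fun H => t * (b - (min (P.onHand x) (P.count 1 H) : ℕ)) +
      t * Y (P.step Alg.greedy S x H) with hu
    set m : ℝ := t * ∑ i ∈ Finset.range (n + 1),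
      (b - P.iter T S i (fun x => P.sales T (P.onHand x)) x) with hm
    have hmean : P.cycleE T u = m := by
      have e1 : P.cycleE T (fun H => (b - (min (P.onHand x) (P.count 1 H) : ℕ) : ℝ)) =
          b - P.sales T (P.onHand x) := by
        rw [Model.cycleE, prodE_sub, prodE_const P.sum_lam_fin]; rfl
      have e2 : P.cycleE T (fun H => Y (P.step Alg.greedy S x H)) =
          ∑ i ∈ Finset.range n,
            (b - P.iter T S (i + 1) (fun x => P.sales T (P.onHand x)) x) := by
        rw [Model.cycleE, hY, prodE_sum]
        refine Finset.sum_congr rfl fun i _ => ?_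
        rw [prodE_sub, prodE_const P.sum_lam_fin, P.iter_succ]; rfl
      rw [hu, Model.cycleE, prodE_add, prodE_const_mul, prodE_const_mul, hm,
        Finset.sum_range_succ']
      rw [Model.cycleE] at e1 e2
      rw [e1, e2, P.iter_zero]; ring
    -- Jensen's inequality for one cycle, through the tangent of the exponential at the mean `m` of
    -- `u`.
    calc Real.exp m = P.cycleE T (fun H => Real.exp m * (1 + (u H - m))) := by
          rw [Model.cycleE, prodE_const_mul, prodE_add, prodE_sub, prodE_const P.sum_lam_fin,
            prodE_const P.sum_lam_fin]
          rw [Model.cycleE] at hmean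
          rw [hmean]; ring
      _ ≤ _ := P.cycleE_mono fun H => by
          have h1 : Real.exp m * (1 + (u H - m)) ≤ Real.exp (u H) := by
            have := Real.add_one_le_exp (u H - m)
            have h2 : Real.exp (u H) = Real.exp m * Real.exp (u H - m) := by
              rw [← Real.exp_add]; congr 1; ring
            rw [h2]
            exact mul_le_mul_of_nonneg_left (by linarith) (Real.exp_pos _).le
          refine h1.trans ?_
          rw [hu, Real.exp_add]
          exact mul_le_mul_of_nonneg_left (ih (P.step_feasible _ hx H)) (Real.exp_pos _).le

/-- The mean leftover is bounded uniformly in the lead time. -/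
theorem Model.leftover_le {T S : ℕ} {t : ℝ} (ht : 0 < t)
    (hX : bern (1 - P.lam 0) T (fun k => Real.exp (t * ((S : ℝ) / (P.L + 1) - k))) < 1) :
    S - (P.L + 1) * P.meanSales T S ≤
      -Real.log (1 - bern (1 - P.lam 0) T
        (fun k => Real.exp (t * ((S : ℝ) / (P.L + 1) - k)))) / t := by
  set b : ℝ := S / (P.L + 1) with hb
  set X := bern (1 - P.lam 0) T (fun k => Real.exp (t * (b - k))) with hXd
  have hX0 : 0 ≤ X := bern_nonneg P.q_nonneg P.q_le_one _ fun _ _ => (Real.exp_pos _).le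
  set x := P.full S
  have hx : P.Feasible S x := P.full_feasible S
  set z : ℕ → ℝ := fun n => (P.tilt T S t b)^[n] (fun _ => 1) x with hz
  have hzpos : ∀ n, 0 < z n := fun n => (Real.exp_pos _).trans_le (P.exp_le_tilt t b n hx)
  have hL : (0 : ℝ) < P.L + 1 := by positivity
  -- This growth rate satisfies `exp (-(L + 1) ℓ) = 1 - X`, which is what lets a bound `C * exp (n
  -- ℓ)` pass through the recursion `z (n + L + 1) ≤ X z (n + L) + z n`.
  set ℓ : ℝ := -Real.log (1 - X) / (P.L + 1) with hℓ
  have hℓ0 : 0 ≤ ℓ := div_nonneg (neg_nonneg.mpr (Real.log_nonpos (by linarith) (by linarith))) hL.le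
  set C : ℝ := ∑ n ∈ Finset.range (P.L + 1), z n with hC
  have hCpos : 0 < C := Finset.sum_pos (fun n _ => hzpos n) ⟨0, by simp⟩
  have hzb : ∀ n, z n ≤ C * Real.exp (n * ℓ) := by
    intro n
    induction n using Nat.strong_induction_on with
    | _ n ih =>
      by_cases hn : n < P.L + 1
      · have h1 : z n ≤ C := Finset.single_le_sum (f := z) (fun n _ => (hzpos n).le)
          (Finset.mem_range.mpr hn)
        have h2 : 1 ≤ Real.exp (n * ℓ) := Real.one_le_exp (by positivity)
        nlinarith
      · obtain ⟨d, rfl⟩ := Nat.exists_eq_add_of_le (not_lt.mp hn)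
        have hrec := P.tilt_recursion (T := T) t d hx
        rw [← hb, ← hXd] at hrec
        have e1 : z (P.L + 1 + d) ≤ X * z (d + P.L) + z d := by
          rw [show P.L + 1 + d = d + P.L + 1 by ring]; exact hrec
        have h1 := ih (d + P.L) (by omega)
        have h2 := ih d (by omega)
        have h3 : Real.exp (((d + P.L : ℕ) : ℝ) * ℓ) ≤ Real.exp (((P.L + 1 + d : ℕ) : ℝ) * ℓ) := by
          apply Real.exp_le_exp.mpr
          push_cast; nlinarith
        have h4 : Real.exp ((d : ℝ) * ℓ) = (1 - X) * Real.exp (((P.L + 1 + d : ℕ) : ℝ) * ℓ) := by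
          have h5 : ((P.L + 1 + d : ℕ) : ℝ) * ℓ = -Real.log (1 - X) + d * ℓ := by
            rw [hℓ]; push_cast; field_simp; ring
          rw [h5, Real.exp_add, Real.exp_neg, Real.exp_log (by linarith)]
          have : (1 - X) ≠ 0 := by linarith
          field_simp
        calc z (P.L + 1 + d) ≤ X * z (d + P.L) + z d := e1
          _ ≤ X * (C * Real.exp (((d + P.L : ℕ) : ℝ) * ℓ)) + C * Real.exp (d * ℓ) :=
              add_le_add (mul_le_mul_of_nonneg_left h1 hX0) h2
          _ ≤ X * (C * Real.exp (((P.L + 1 + d : ℕ) : ℝ) * ℓ)) +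
                C * ((1 - X) * Real.exp (((P.L + 1 + d : ℕ) : ℝ) * ℓ)) := by
              rw [h4]
              have := mul_le_mul_of_nonneg_left (mul_le_mul_of_nonneg_left h3 hCpos.le) hX0
              linarith
          _ = C * Real.exp (((P.L + 1 + d : ℕ) : ℝ) * ℓ) := by ring
  -- Taking logarithms compares the cumulative shortfall of expected sales with `n ℓ`; dividing by
  -- `n` then removes the constant `C`.
  have hlog : ∀ n : ℕ, t * ∑ i ∈ Finset.range n,
      (b - P.iter T S i (fun x => P.sales T (P.onHand x)) x) ≤ Real.log C + n * ℓ := by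
    intro n
    have h1 := (P.exp_le_tilt (T := T) t b n hx).trans (hzb n)
    have h2 := (Real.log_le_log (Real.exp_pos _) h1)
    rwa [Real.log_exp, Real.log_mul hCpos.ne' (Real.exp_pos _).ne', Real.log_exp] at h2
  have hces : Tendsto (fun n : ℕ => (n : ℝ)⁻¹ * ∑ i ∈ Finset.range n,
      (b - P.iter T S i (fun x => P.sales T (P.onHand x)) x)) atTop
      (𝓝 (b - P.meanSales T S)) :=
    (tendsto_const_nhds.sub (P.tendsto_iter _ hx)).cesaro
  have hlim : t * (b - P.meanSales T S) ≤ ℓ := by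
    have hR : Tendsto (fun n : ℕ => (n : ℝ)⁻¹ * Real.log C + ℓ) atTop (𝓝 (0 * Real.log C + ℓ)) :=
      (tendsto_inv_atTop_nhds_zero_nat.mul_const _).add_const _
    rw [zero_mul, zero_add] at hR
    refine le_of_tendsto_of_tendsto (hces.const_mul t) hR ?_
    filter_upwards [eventually_gt_atTop 0] with n hn
    have hn0 : (0 : ℝ) < n := Nat.cast_pos.mpr hn
    have := mul_le_mul_of_nonneg_left (hlog n) (inv_pos.mpr hn0).le
    have e : (n : ℝ)⁻¹ * (Real.log C + n * ℓ) = (n : ℝ)⁻¹ * Real.log C + ℓ := by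
      field_simp
    rw [e] at this
    linarith
  rw [le_div_iff₀ ht]
  have e1 : (S : ℝ) - (P.L + 1) * P.meanSales T S = (P.L + 1) * (b - P.meanSales T S) := by
    rw [hb]; field_simp
  have e2 : -Real.log (1 - X) = (P.L + 1) * ℓ := by rw [hℓ]; field_simp
  rw [e1, e2]
  nlinarith

end Flux

end

/-! ### Fluctuations of order √T and the bound for long cycles -/

section

theorem bern_sq (s : ℝ) (T : ℕ) (b : ℝ) :
    bern s T (fun k => ((k : ℝ) + b) ^ 2) = T * (s * (1 - s)) + (T * s + b) ^ 2 := by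
  induction T generalizing b with
  | zero => simp [bern]
  | succ T ih =>
    have h : (fun k : ℕ => (((k + 1 : ℕ) : ℝ) + b) ^ 2) = fun k : ℕ => ((k : ℝ) + (b + 1)) ^ 2 := by
      funext k; push_cast; ring
    rw [bern_succ, h, ih, ih]
    push_cast; ring

/-- Bound the positive part of x by (x² + a²) / (2a) with a = √n; the variance is at most n. -/
theorem bern_pos_part_le {s : ℝ} (h0 : 0 ≤ s) (h1 : s ≤ 1) {n : ℕ} (hn : 0 < n) {c : ℝ}
    (hc : n * s ≤ c) : bern s n (fun k => max ((k : ℝ) - c) 0) ≤ Real.sqrt n := by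
  set a := Real.sqrt n with ha
  have hn0 : (0 : ℝ) < n := Nat.cast_pos.mpr hn
  have ha0 : 0 < a := Real.sqrt_pos.mpr hn0
  have ha2 : a * a = n := Real.mul_self_sqrt hn0.le
  have h2 : ∀ k ≤ n, max ((k : ℝ) - c) 0 ≤ (2 * a)⁻¹ * (((k : ℝ) + -(n * s)) ^ 2 + a ^ 2) := by
    intro k _
    rw [inv_mul_eq_div, le_div_iff₀ (by positivity)]
    rcases le_total ((k : ℝ) - c) 0 with h | h
    · rw [max_eq_right h]; nlinarith [sq_nonneg ((k : ℝ) + -(n * s)), sq_nonneg a]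
    · rw [max_eq_left h]
      nlinarith [sq_nonneg ((k : ℝ) - n * s - a)]
  refine (bern_mono h0 h1 n h2).trans ?_
  rw [bern_const_mul, bern_add, bern_const, bern_sq, inv_mul_eq_div, div_le_iff₀ (by positivity)]
  have : s * (1 - s) ≤ 1 := by nlinarith
  nlinarith [mul_le_mul_of_nonneg_left this hn0.le]

variable (P : Model)

/-- Mean reward of a unit of sales under greedy fulfillment. -/
def Model.rbar : ℝ := (∑ j ∈ Finset.Icc 1 P.M, P.r j * P.lam j) / (1 - P.lam 0)

theorem Model.rbar_pos (hq : 0 < 1 - P.lam 0) : 0 < P.rbar := by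
  refine div_pos ?_ hq
  have h1 : ∑ j ∈ Finset.Icc 1 P.M, P.lam j = 1 - P.lam 0 := by
    rw [← P.tail_one, P.tail_eq 1 le_rfl]
  have h2 : ∀ j ∈ Finset.Icc 1 P.M, P.rewardInc 1 * P.lam j ≤ P.r j * P.lam j := by
    intro j hj
    rw [Finset.mem_Icc] at hj
    refine mul_le_mul_of_nonneg_right ?_ (P.lam_nonneg j hj.2)
    rw [← P.sum_rewardInc hj.1]
    exact Finset.single_le_sum (f := P.rewardInc)
      (fun i hi => (P.rewardInc_pos (Finset.mem_Icc.mp hi).1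
        ((Finset.mem_Icc.mp hi).2.trans hj.2)).le) (Finset.mem_Icc.mpr ⟨le_rfl, hj.1⟩)
  have h3 := Finset.sum_le_sum h2
  rw [← Finset.mul_sum, h1] at h3
  have := P.two_le_M
  exact (mul_pos (P.rewardInc_pos le_rfl (by omega)) hq).trans_le h3

theorem Model.longRun_greedy (hq : 0 < 1 - P.lam 0) (T S : ℕ) :
    P.longRunProfit Alg.greedy T S =
      P.rbar * P.meanSales T S - P.h * (S - (P.L + 1) * P.meanSales T S) := by
  have e : P.meanProfit Alg.greedy T = fun x => P.rbar * P.sales T (P.onHand x) -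
      P.h * ((P.onHand x : ℝ) - P.sales T (P.onHand x)) := by
    funext x
    rw [Model.meanProfit, P.profit_eq, P.reward_greedy_eq hq]; rfl
  rw [P.longRunProfit_eq, e, P.statE_sub, P.statE_const_mul, P.statE_const_mul, P.statE_leftover]
  rfl

theorem Model.longRun_sub (T S : ℕ) :
    P.longRunProfit Alg.offline T S - P.longRunProfit Alg.greedy T S =
      P.statE T S (fun x => P.reward Alg.offline T (P.onHand x) -
        P.reward Alg.greedy T (P.onHand x)) := by
  rw [P.longRunProfit_eq, P.longRunProfit_eq, ← P.statE_sub]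
  congr 1; funext x
  rw [Model.meanProfit, Model.meanProfit, P.profit_eq, P.profit_eq]; ring

theorem Model.longRun_gain (hq : 0 < 1 - P.lam 0) (hp : 0 < P.lam P.M) (T S : ℕ) :
    P.A / (1 - P.lam 0) *
        P.statE T S (fun x => advantage T (P.lam P.M) (1 - P.lam 0) (P.onHand x)) ≤
      P.longRunProfit Alg.offline T S - P.longRunProfit Alg.greedy T S := by
  rw [P.longRun_sub, ← P.statE_const_mul]
  exact P.statE_mono fun x _ => P.reward_gain hq hp T _

theorem Model.longRun_gain_nonneg (hq : 0 < 1 - P.lam 0) (T S : ℕ) :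
    0 ≤ P.longRunProfit Alg.offline T S - P.longRunProfit Alg.greedy T S := by
  rw [P.longRun_sub, ← P.statE_const T S 0]
  exact P.statE_mono fun x _ => sub_nonneg.mpr (P.reward_gain_nonneg hq T _)

theorem Model.onHand_sub_sales (T I : ℕ) :
    (I : ℝ) - P.sales T I = bern (1 - P.lam 0) T (fun k => ((I - k : ℕ) : ℝ)) := by
  rw [P.sales_eq, bern_sub_min]; ring

theorem Model.leftover_nonneg (T S : ℕ) : 0 ≤ S - (P.L + 1) * P.meanSales T S := by
  rw [← P.statE_leftover, ← P.statE_const T S 0]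
  refine P.statE_mono fun x _ => ?_
  rw [P.onHand_sub_sales]
  exact bern_nonneg P.q_nonneg P.q_le_one _ fun k _ => Nat.cast_nonneg _

/-- The lost sales of a cycle are the excess of its demand over the stock. Since the stock is at
least `S` minus the demand of the previous `L` cycles, they are at most the excess over `S` of the
demand of `L + 1` cycles. -/
theorem Model.meanSales_ge (T S : ℕ) :
    T * (1 - P.lam 0) -
        bern (1 - P.lam 0) ((P.L + 1) * T) (fun m => max ((m : ℝ) - S) 0) ≤ P.meanSales T S := by
  set g : ℝ → ℝ := fun y => bern (1 - P.lam 0) T (fun k => max ((k : ℝ) - y) 0) with hg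
  have hga : Antitone g := fun a b hab =>
    bern_mono P.q_nonneg P.q_le_one _ fun k _ => max_le_max (by linarith) le_rfl
  have h1 := P.statE_onHand_le (T := T) (S := S) hga
  have h2 : bern (1 - P.lam 0) (P.L * T) (fun n => g ((S : ℝ) - n)) =
      bern (1 - P.lam 0) ((P.L + 1) * T) (fun m => max ((m : ℝ) - S) 0) := by
    rw [show (P.L + 1) * T = P.L * T + T by ring, ← bern_add_trials, hg]
    dsimp only
    congr 1; funext n; congr 1; funext k
    push_cast; congr 1; ring
  rw [h2] at h1
  have h3 : P.meanSales T S = T * (1 - P.lam 0) - P.statE T S (fun x => g (P.onHand x)) := by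
    rw [← P.statE_const T S (T * (1 - P.lam 0)), ← P.statE_sub, Model.meanSales]
    congr 1; funext x
    rw [P.sales_eq, hg, excess]
    dsimp only
    congr 1
    refine bern_congr _ _ fun k _ => ?_
    rcases le_total (P.onHand x) k with h | h
    · rw [Nat.cast_sub h, max_eq_left (by rw [sub_nonneg]; exact_mod_cast h)]
    · rw [Nat.sub_eq_zero_of_le h, max_eq_right (by rw [sub_nonpos]; exact_mod_cast h)]; simp
  rw [h3]; linarith

/-- Rate of the sales deficit at the optimal greedy base-stock level. -/
def Model.rate : ℝ :=
  Real.sqrt (P.L + 1) + P.h / P.rbar * (1 + (P.L + 1) * Real.sqrt (P.L + 1))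

/-- Greedy profit is an affine function of mean sales and mean leftover. The level `S0` loses sales
and leaves stock only of order √T, and the optimal level can do no worse. -/
theorem Model.meanSales_optimal (hq : 0 < 1 - P.lam 0) {T S : ℕ} (hT : 1 ≤ T)
    (hS : P.IsOptimal Alg.greedy T S) :
    T * (1 - P.lam 0) - P.rate * Real.sqrt T ≤ P.meanSales T S := by
  set q := 1 - P.lam 0 with hqd
  have hr := P.rbar_pos hq
  have hh := P.h_pos
  -- The mean demand of `L + 1` cycles, rounded up: then only random fluctuations cause lost sales,
  -- and `1 ≤ √T` covers the rounding.
  set S0 := ⌈((P.L : ℝ) + 1) * T * q⌉₊ with hS0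
  have hc1 : ((P.L : ℝ) + 1) * T * q ≤ S0 := Nat.le_ceil _
  have hc2 : (S0 : ℝ) < ((P.L : ℝ) + 1) * T * q + 1 := Nat.ceil_lt_add_one (by positivity)
  have hs0 : T * q - Real.sqrt (P.L + 1) * Real.sqrt T ≤ P.meanSales T S0 := by
    refine le_trans ?_ (P.meanSales_ge T S0)
    have := bern_pos_part_le (n := (P.L + 1) * T) P.q_nonneg P.q_le_one (by positivity)
      (c := (S0 : ℝ)) (by push_cast; exact hc1)
    rw [← Real.sqrt_mul (by positivity)]
    push_cast at this
    linarith
  have hopt := hS S0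
  rw [P.longRun_greedy hq, P.longRun_greedy hq] at hopt
  have hln := P.leftover_nonneg T S
  have hT1 : (1 : ℝ) ≤ Real.sqrt T := Real.one_le_sqrt.mpr (by exact_mod_cast hT)
  have hL0 : (0 : ℝ) ≤ P.L := Nat.cast_nonneg _
  set b := Real.sqrt ((P.L : ℝ) + 1)
  set w := Real.sqrt (T : ℝ)
  have hb : 0 ≤ b := Real.sqrt_nonneg _
  have h5 : P.rbar * (T * q - b * w) - P.h * (1 + (P.L + 1) * b) * w ≤
      P.rbar * P.meanSales T S := by
    have e1 : P.rbar * (T * q - b * w) ≤ P.rbar * P.meanSales T S0 :=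
      mul_le_mul_of_nonneg_left hs0 hr.le
    have e2 : (S0 : ℝ) - (P.L + 1) * P.meanSales T S0 ≤ (1 + (P.L + 1) * b) * w := by
      have := mul_le_mul_of_nonneg_left hs0 (by positivity : (0 : ℝ) ≤ P.L + 1)
      nlinarith
    have e3 := mul_le_mul_of_nonneg_left e2 hh.le
    have e4 := mul_nonneg hh.le hln
    linarith
  have h6 : P.rbar * (T * q - P.rate * w) =
      P.rbar * (T * q - b * w) - P.h * (1 + (P.L + 1) * b) * w := by
    rw [Model.rate]; field_simp; ring
  rw [← h6] at h5
  exact le_of_mul_le_mul_left h5 hr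

theorem Model.interior_q_pos {T S : ℕ} (hT : 1 ≤ T) (h : P.Interior T S) : 0 < 1 - P.lam 0 := by
  have hT0 : (0 : ℝ) < T := by exact_mod_cast hT
  have h2 := (Nat.cast_nonneg S).trans_lt h.2
  exact pos_of_mul_pos_right h2 (by positivity)

theorem Model.interior_lt {T S : ℕ} (hT : 1 ≤ T) (h : P.Interior T S) :
    P.lam P.M < 1 - P.lam 0 := by
  have hT0 : (0 : ℝ) < T := by exact_mod_cast hT
  exact lt_of_mul_lt_mul_left (h.1.trans h.2) (by positivity)

theorem Model.rate_pos (hq : 0 < 1 - P.lam 0) : 0 < P.rate := by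
  have := P.rbar_pos hq
  have := P.h_pos
  rw [Model.rate]; positivity

/-- Mean leftover is nonnegative, so `S` is at least `L + 1` times the mean sales, which at the
optimum miss mean demand by at most order √T. -/
theorem Model.slack_le (hq : 0 < 1 - P.lam 0) {T S : ℕ} (hT : 1 ≤ T)
    (hS : P.IsOptimal Alg.greedy T S) : P.slack T S ≤ (P.L + 1) * P.rate * Real.sqrt T := by
  have h1 := P.meanSales_optimal hq hT hS
  have h2 := P.leftover_nonneg T S
  have := mul_le_mul_of_nonneg_left h1 (by positivity : (0 : ℝ) ≤ P.L + 1)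
  rw [Model.slack]; nlinarith

/-- Uses |I - b| = (I - b) + 2 (b - I)⁺. The mean of I - b is known from flow balance, and the
negative part is controlled by the demand of the last `L` cycles. -/
theorem Model.statE_abs_le (hq : 0 < 1 - P.lam 0) {T S : ℕ} (hT : 1 ≤ T)
    (hS : P.IsOptimal Alg.greedy T S) (hint : P.Interior T S) :
    P.statE T S (fun x => |(P.onHand x : ℝ) - S / (P.L + 1)|) ≤
      (3 * P.L * P.rate + 2 * Real.sqrt P.L) * Real.sqrt T := by
  set q := 1 - P.lam 0 with hqd
  have hL : (0 : ℝ) < P.L + 1 := by positivity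
  set b : ℝ := S / (P.L + 1) with hb
  have hbS : (P.L + 1) * b = S := by rw [hb]; field_simp
  have hbq : b < T * q := by
    have := hint.2
    rw [← hbS] at this
    nlinarith
  have hms := P.meanSales_optimal hq hT hS
  set g : ℝ → ℝ := fun y => max (b - y) 0 with hg
  have hga : Antitone g := fun x y hxy => max_le_max (by linarith) le_rfl
  have hneg : P.statE T S (fun x => g (P.onHand x)) ≤
      Real.sqrt P.L * Real.sqrt T + P.L * (P.rate * Real.sqrt T) := by
    refine (P.statE_onHand_le hga).trans ?_
    have h1 : ∀ n ≤ P.L * T, g ((S : ℝ) - n) ≤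
        max ((n : ℝ) - P.L * T * q) 0 + P.L * (P.rate * Real.sqrt T) := by
      intro n _
      have h2 : b - ((S : ℝ) - n) ≤ ((n : ℝ) - P.L * T * q) + P.L * (P.rate * Real.sqrt T) := by
        have h3 : (P.meanSales T S) ≤ b := by
          have := P.leftover_nonneg T S
          rw [← hbS] at this
          nlinarith
        have h4 : T * q - b ≤ P.rate * Real.sqrt T := by linarith
        have := mul_le_mul_of_nonneg_left h4 (Nat.cast_nonneg P.L : (0 : ℝ) ≤ P.L)
        rw [← hbS]; linarith
      have h5 : (0 : ℝ) ≤ P.L * (P.rate * Real.sqrt T) := by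
        have := P.rate_pos hq; positivity
      refine max_le (h2.trans (by gcongr; exact le_max_left _ _)) ?_
      have := le_max_right ((n : ℝ) - P.L * T * q) 0
      linarith
    refine (bern_mono P.q_nonneg P.q_le_one _ h1).trans ?_
    rw [bern_add, bern_const, ← Real.sqrt_mul (Nat.cast_nonneg _)]
    have := bern_pos_part_le (n := P.L * T) P.q_nonneg P.q_le_one
      (Nat.mul_pos P.one_le_L (by omega)) (c := P.L * T * q) (by push_cast; exact le_rfl)
    push_cast at this
    linarith
  have habs : P.statE T S (fun x => |(P.onHand x : ℝ) - b|) =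
      (P.statE T S (fun x => (P.onHand x : ℝ)) - b) + 2 * P.statE T S (fun x => g (P.onHand x)) := by
    rw [← P.statE_const T S b, ← P.statE_sub, ← P.statE_const_mul, ← P.statE_add]
    congr 1; funext x
    simp only [P.statE_const, hg]
    rcases le_total (b : ℝ) (P.onHand x) with h | h
    · rw [abs_of_nonneg (by linarith), max_eq_right (by linarith)]; ring
    · rw [abs_of_nonpos (by linarith), max_eq_left (by linarith)]; ring
  rw [habs, P.statE_onHand]
  have h6 : (S : ℝ) - P.L * P.meanSales T S - b ≤ P.L * (P.rate * Real.sqrt T) := by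
    have h7 : b - P.meanSales T S ≤ P.rate * Real.sqrt T := by linarith
    have := mul_le_mul_of_nonneg_left h7 (Nat.cast_nonneg P.L : (0 : ℝ) ≤ P.L)
    rw [← hbS]; linarith
  linarith

theorem Model.exists_concentration {Sgr : ℕ → ℕ}
    (hgr : ∀ T : ℕ, 1 ≤ T → P.IsOptimal Alg.greedy T (Sgr T)) :
    ∃ K₂ : ℝ, P.Concentration Sgr K₂ := by
  refine ⟨3 * P.L * P.rate + 2 * Real.sqrt P.L, fun T hT hint ν hν => ?_⟩
  rw [P.integral_eq_statE hν]
  exact P.statE_abs_le (P.interior_q_pos hT hint) hT (hgr T hT) hint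

theorem Model.M₁_pos (hp : 0 < P.lam P.M) (hp1 : P.lam P.M < 1) : 0 < P.M₁ := by
  have hM := P.two_le_M
  refine Finset.sum_pos' (fun j _ => Real.sqrt_nonneg _)
    ⟨P.M, Finset.mem_Icc.mpr ⟨by omega, le_rfl⟩, Real.sqrt_pos.mpr (mul_pos hp (by linarith))⟩

theorem Model.M₁_nonneg : 0 ≤ P.M₁ := Finset.sum_nonneg fun _ _ => Real.sqrt_nonneg _

/-- Applies x⁺ ≤ (x + c)² / (4c) to top-class demand of one cycle plus total demand of `L` cycles,
minus `S`. This quantity has mean `-c`, so only its variance, at most (L + 1) T, remains. -/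
theorem Model.statE_excess_le {T S : ℕ} {c : ℝ}
    (hc : c = T * ((1 - P.lam 0) - P.lam P.M) - P.slack T S) (hc0 : 0 < c)
    (hp1 : P.lam P.M ≤ 1) :
    P.statE T S (fun x => excess T (P.onHand x) (P.lam P.M)) ≤ (P.L + 1) * T / (4 * c) := by
  set q := 1 - P.lam 0 with hq
  set p := P.lam P.M with hpd
  have hp0 : 0 ≤ p := P.lam_nonneg _ le_rfl
  set g : ℝ → ℝ := fun y => bern p T (fun k => max ((k : ℝ) - y) 0) with hg
  have hga : Antitone g := fun a b hab =>
    bern_mono hp0 hp1 _ fun k _ => max_le_max (by linarith) le_rfl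
  have h0 : P.statE T S (fun x => excess T (P.onHand x) p) =
      P.statE T S (fun x => g (P.onHand x)) := by
    congr 1; funext x
    rw [excess, hg]
    refine bern_congr _ _ fun k _ => ?_
    rcases le_total (P.onHand x) k with h | h
    · rw [Nat.cast_sub h, max_eq_left (by rw [sub_nonneg]; exact_mod_cast h)]
    · rw [Nat.sub_eq_zero_of_le h, max_eq_right (by rw [sub_nonpos]; exact_mod_cast h)]; simp
  rw [h0]
  refine (P.statE_onHand_le hga).trans ?_
  have h1 : ∀ n ≤ P.L * T, g ((S : ℝ) - n) ≤ (4 * c)⁻¹ *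
      (T * (p * (1 - p)) + ((n : ℝ) + (T * p - S + c)) ^ 2) := by
    intro n _
    have h2 : ∀ k ≤ T, max ((k : ℝ) - (S - n)) 0 ≤
        (4 * c)⁻¹ * ((k : ℝ) + (n - S + c)) ^ 2 := by
      intro k _
      rw [inv_mul_eq_div, le_div_iff₀ (by positivity)]
      rcases le_total ((k : ℝ) - (S - n)) 0 with h | h
      · rw [max_eq_right h]; nlinarith [sq_nonneg ((k : ℝ) + (n - S + c))]
      · rw [max_eq_left h]
        nlinarith [sq_nonneg ((k : ℝ) - (S - n) - c)]
    refine (bern_mono hp0 hp1 T h2).trans ?_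
    rw [bern_const_mul, bern_sq]
    apply le_of_eq; ring
  refine (bern_mono P.q_nonneg P.q_le_one _ h1).trans ?_
  rw [bern_const_mul, bern_add, bern_const, bern_sq, inv_mul_eq_div]
  refine div_le_div_of_nonneg_right ?_ (by positivity)
  have h3 : ((P.L * T : ℕ) : ℝ) * q + (T * p - S + c) = 0 := by
    rw [hc, Model.slack]; push_cast; ring
  rw [h3]
  have h4 : p * (1 - p) ≤ 1 := by nlinarith
  have h5 : q * (1 - q) ≤ 1 := by nlinarith [P.q_nonneg, P.q_le_one]
  have h6 := mul_le_mul_of_nonneg_left h4 (Nat.cast_nonneg T : (0 : ℝ) ≤ T)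
  have h7 := mul_le_mul_of_nonneg_left h5 (Nat.cast_nonneg (P.L * T) : (0 : ℝ) ≤ (P.L * T : ℕ))
  push_cast at h7 ⊢
  linarith

theorem le_excess {T I : ℕ} {q : ℝ} (h0 : 0 ≤ q) (h1 : q ≤ 1) : T * q - I ≤ excess T I q := by
  have := bern_nonneg h0 h1 T (f := fun k => ((I - k : ℕ) : ℝ)) fun _ _ => Nat.cast_nonneg _
  rw [bern_sub_min] at this
  linarith

theorem Model.long_cycles {Soff Sgr : ℕ → ℕ}
    (hoff : ∀ T : ℕ, 1 ≤ T → P.IsOptimal Alg.offline T (Soff T))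
    (hgr : ∀ T : ℕ, 1 ≤ T → P.IsOptimal Alg.greedy T (Sgr T))
    (hint : ∀ᶠ T : ℕ in atTop, P.Interior T (Sgr T)) {K₂ : ℝ} (hK : P.Concentration Sgr K₂) :
    ∃ T₁ : ℕ, ∀ T : ℕ, T₁ ≤ T →
      P.A / (2 * (1 - P.lam 0) * ((P.L : ℝ) + 1)) * P.slack T (Sgr T) -
          (P.A * K₂ / (1 - P.lam 0) + P.M₁) * Real.sqrt T ≤
        P.longRunProfit Alg.offline T (Soff T) - P.longRunProfit Alg.greedy T (Sgr T) := by
  rw [← eventually_atTop]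
  have hT1 : ∀ᶠ T : ℕ in atTop, 1 ≤ T := eventually_ge_atTop 1
  obtain ⟨T₀, h₀, h₀1⟩ := (hint.and hT1).exists
  have hq := P.interior_q_pos h₀1 h₀
  have hpq := P.interior_lt h₀1 h₀
  set q := 1 - P.lam 0 with hqd
  set p := P.lam P.M with hpd
  have hq1 : q ≤ 1 := P.q_le_one
  rcases (P.lam_nonneg P.M le_rfl).eq_or_lt with hp0 | hp
  -- Without top-class customers the slack term vanishes, and a nonnegative gain suffices.
  · have hA : P.A = 0 := by rw [P.A_eq, ← hp0, mul_zero]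
    filter_upwards [hT1] with T hT
    rw [hA]
    have h1 := P.longRun_gain_nonneg hq T (Sgr T)
    have h2 := hoff T hT (Sgr T)
    have h3 := mul_nonneg P.M₁_nonneg (Real.sqrt_nonneg (T : ℝ))
    simp only [zero_div, zero_mul, zero_add]
    linarith
  · have hM1 := P.M₁_pos hp (by linarith)
    have hrate := P.rate_pos hq
    have hsq : Tendsto (fun T : ℕ => Real.sqrt (T : ℝ)) atTop atTop :=
      Real.tendsto_sqrt_atTop.comp tendsto_natCast_atTop_atTop
    -- The first condition keeps the slack below half of `T (q - p)`, which bounds the mean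
    -- top-class excess uniformly in `T`. The second makes the resulting constant at most `M₁ √T`.
    have hE1 : ∀ᶠ T : ℕ in atTop, 2 * ((P.L + 1) * P.rate) / (q - p) ≤ Real.sqrt T :=
      hsq.eventually_ge_atTop _
    have hE2 : ∀ᶠ T : ℕ in atTop, P.A / p * ((P.L + 1) / (2 * (q - p))) / P.M₁ ≤ Real.sqrt T :=
      hsq.eventually_ge_atTop _
    filter_upwards [hT1, hint, hE1, hE2] with T hT hi hE1 hE2
    have hT0 : (0 : ℝ) < T := by exact_mod_cast hT
    set S := Sgr T with hS
    have hA := P.A_nonneg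
    have hsl := P.slack_le hq hT (hgr T hT)
    have hqp : 0 < q - p := by linarith
    have hss : Real.sqrt (T : ℝ) * Real.sqrt T = T := Real.mul_self_sqrt hT0.le
    have hsqT : 0 < Real.sqrt (T : ℝ) := Real.sqrt_pos.mpr hT0
    have hc : T * (q - p) / 2 ≤ T * (q - p) - P.slack T S := by
      rw [div_le_iff₀ hqp] at hE1
      have := mul_le_mul_of_nonneg_right hE1 hsqT.le
      nlinarith
    have hc0 : 0 < T * (q - p) - P.slack T S := lt_of_lt_of_le (by positivity) hc
    have hex := P.statE_excess_le (T := T) (S := S) rfl hc0 (by linarith)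
    have hex2 : P.statE T S (fun x => excess T (P.onHand x) p) ≤ (P.L + 1) / (2 * (q - p)) := by
      refine hex.trans ?_
      rw [div_le_div_iff₀ (by positivity) (by positivity)]
      have := mul_le_mul_of_nonneg_left hc (by positivity : (0 : ℝ) ≤ (P.L + 1) * 4)
      nlinarith
    have hconc : P.statE T S (fun x => |(P.onHand x : ℝ) - S / (P.L + 1)|) ≤
        K₂ * Real.sqrt T := by
      rw [← P.integral_statLaw]
      exact hK T hT hi _ (P.statLaw_isStationary _ _ _)
    have hadv : P.slack T S / (P.L + 1) - K₂ * Real.sqrt T - q / p * ((P.L + 1) / (2 * (q - p))) ≤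
        P.statE T S (fun x => advantage T p q (P.onHand x)) := by
      have h1 : P.statE T S (fun x => ((T * q - S / (P.L + 1)) +
          (-1) * |(P.onHand x : ℝ) - S / (P.L + 1)|) +
          (-(q / p)) * excess T (P.onHand x) p) ≤
          P.statE T S (fun x => advantage T p q (P.onHand x)) := by
        refine P.statE_mono fun x _ => ?_
        have h2 := le_excess (T := T) (I := P.onHand x) hq.le hq1
        have h3 := le_abs_self ((P.onHand x : ℝ) - S / (P.L + 1))
        rw [advantage]; linarith
      rw [P.statE_add, P.statE_add, P.statE_const, P.statE_const_mul, P.statE_const_mul] at h1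
      have h4 : P.slack T S / (P.L + 1) = T * q - S / (P.L + 1) := by
        rw [Model.slack]; field_simp; rfl
      rw [h4]
      have h5 := mul_le_mul_of_nonneg_left hex2 (by positivity : 0 ≤ q / p)
      linarith
    have hfin := P.longRun_gain hq hp T S
    have h2 := hoff T hT S
    have h6 := mul_le_mul_of_nonneg_left hadv (by positivity : 0 ≤ P.A / q)
    have h7 : P.A / p * ((P.L + 1) / (2 * (q - p))) ≤ P.M₁ * Real.sqrt T := by
      rw [div_le_iff₀ hM1] at hE2
      linarith
    have hslack : 0 ≤ P.slack T S := by
      have := hi.2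
      rw [Model.slack]; linarith
    -- The argument yields twice the claimed multiple of the slack; one copy is dropped at the end
    -- as nonnegative.
    have e1 : P.A / q * (P.slack T S / (P.L + 1) - K₂ * Real.sqrt T -
        q / p * ((P.L + 1) / (2 * (q - p)))) =
        2 * (P.A / (2 * q * ((P.L : ℝ) + 1)) * P.slack T S) - P.A * K₂ / q * Real.sqrt T -
          P.A / p * ((P.L + 1) / (2 * (q - p))) := by
      field_simp
    rw [e1] at h6
    have h8 : 0 ≤ P.A / (2 * q * ((P.L : ℝ) + 1)) * P.slack T S := by positivity
    linarith

theorem Model.orders_of_magnitude {Sgr : ℕ → ℕ}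
    (hint : ∀ᶠ T : ℕ in atTop, P.Interior T (Sgr T)) {K₂ : ℝ} (hK : P.Concentration Sgr K₂)
    (hp : 0 < P.lam P.M) {β : ℝ}
    (hβ : Asymptotics.IsTheta atTop (fun T : ℕ => P.slack T (Sgr T)) (fun T : ℕ => (T : ℝ) ^ β)) :
    Asymptotics.IsTheta atTop
        (fun T : ℕ => P.A / (2 * (1 - P.lam 0) * ((P.L : ℝ) + 1)) * P.slack T (Sgr T))
        (fun T : ℕ => (T : ℝ) ^ β) ∧
      Asymptotics.IsTheta atTop
        (fun T : ℕ => (P.A * K₂ / (1 - P.lam 0) + P.M₁) * Real.sqrt T)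
        (fun T : ℕ => Real.sqrt T) := by
  obtain ⟨T₀, h₀, h₀1⟩ := (hint.and (eventually_ge_atTop 1)).exists
  have hq := P.interior_q_pos h₀1 h₀
  have hpq := P.interior_lt h₀1 h₀
  have hA := P.A_pos hp
  have hM := P.M₁_pos hp (hpq.trans P.q_lt_one)
  -- `K₂ √T` dominates a mean absolute value at one interior `T`, which exists by `hint`. Hence the
  -- coefficient of √T is positive.
  have hK0 : 0 ≤ K₂ := by
    have h1 := hK T₀ h₀1 h₀ _ (P.statLaw_isStationary _ _ _)
    have h2 := (integral_nonneg (μ := P.statLaw T₀ (Sgr T₀)) fun x => abs_nonneg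
      ((P.onHand x : ℝ) - (Sgr T₀ : ℝ) / ((P.L : ℝ) + 1))).trans h1
    exact nonneg_of_mul_nonneg_left h2 (Real.sqrt_pos.mpr (by exact_mod_cast h₀1))
  constructor
  · exact (Asymptotics.isTheta_const_mul_left (by positivity)).mpr hβ
  · exact (Asymptotics.isTheta_const_mul_left (by positivity)).mpr
      (Asymptotics.isTheta_refl _ _)

end

/-! ### Weak duality, tails at an integer mean, and first bounds on the advantage -/

section

/-- Expected shortfall of a binomial variable below `I`. -/
def shortfall (T I : ℕ) (s : ℝ) : ℝ := bern s T (fun k => ((I - k : ℕ) : ℝ))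

theorem shortfall_eq (T I : ℕ) (s : ℝ) : shortfall T I s = I - T * s + excess T I s :=
  bern_sub_min T I s

theorem shortfall_nonneg {T I : ℕ} {s : ℝ} (h0 : 0 ≤ s) (h1 : s ≤ 1) : 0 ≤ shortfall T I s :=
  bern_nonneg h0 h1 _ fun _ _ => Nat.cast_nonneg _

theorem shortfall_mono {T : ℕ} {s : ℝ} (h0 : 0 ≤ s) (h1 : s ≤ 1) {I J : ℕ} (h : I ≤ J) :
    shortfall T I s ≤ shortfall T J s :=
  bern_mono h0 h1 _ fun k _ => by exact_mod_cast Nat.sub_le_sub_right h k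

/-- For every demand k, (I - k)⁺ / I is nondecreasing in I. -/
theorem mul_shortfall_le {T : ℕ} {s : ℝ} (h0 : 0 ≤ s) (h1 : s ≤ 1) {I J : ℕ} (h : I ≤ J) :
    J * shortfall T I s ≤ I * shortfall T J s := by
  rw [shortfall, shortfall, ← bern_const_mul, ← bern_const_mul]
  refine bern_mono h0 h1 _ fun k _ => ?_
  have : J * (I - k) ≤ I * (J - k) := by
    rcases le_total I k with hk | hk
    · simp [Nat.sub_eq_zero_of_le hk]
    · obtain ⟨a, rfl⟩ := Nat.exists_eq_add_of_le hk
      obtain ⟨b, rfl⟩ := Nat.exists_eq_add_of_le h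
      have h1 : k + a - k = a := by omega
      have h2 : k + a + b - k = a + b := by omega
      rw [h1, h2]; nlinarith [Nat.zero_le (k * b)]
  exact_mod_cast this

theorem excess_anti {T : ℕ} {s : ℝ} (h0 : 0 ≤ s) (h1 : s ≤ 1) {I J : ℕ} (h : I ≤ J) :
    excess T J s ≤ excess T I s :=
  bern_mono h0 h1 _ fun k _ => by exact_mod_cast Nat.sub_le_sub_left h k

theorem advantage_eq_shortfall (T I : ℕ) (p q : ℝ) :
    advantage T p q I = T * q - I + shortfall T I q - q / p * excess T I p := by
  rw [advantage, shortfall_eq]; ring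

/-- Weak duality: in stationarity the mean stock is at least `b = S / (L + 1)` and the mean leftover
is at most `E`, so the minorant of `f` has nonnegative mean. -/
theorem Model.statE_nonneg_of_dual (P : Model) {T S : ℕ} {f : ℕ → ℝ} {c E : ℝ} (hc : 0 ≤ c)
    (hS : (0 : ℝ) < S) (hE : S - (P.L + 1) * P.meanSales T S ≤ E)
    (h : ∀ I : ℕ, c * (E * I / (S / (P.L + 1)) - shortfall T I (1 - P.lam 0)) ≤ f I) :
    0 ≤ P.statE T S (fun x => f (P.onHand x)) := by
  have hL : (0 : ℝ) < P.L + 1 := by positivity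
  set b : ℝ := S / (P.L + 1) with hb
  have hb0 : 0 < b := by positivity
  have hbS : (P.L + 1) * b = S := by rw [hb]; field_simp
  have h0 := P.leftover_nonneg T S
  have hm : P.meanSales T S ≤ b := by
    have : (P.L + 1) * P.meanSales T S ≤ (P.L + 1) * b := by linarith
    exact le_of_mul_le_mul_left this hL
  have hI : b ≤ P.statE T S (fun x => (P.onHand x : ℝ)) := by
    rw [P.statE_onHand]
    have : (P.L : ℝ) * P.meanSales T S ≤ P.L * b := mul_le_mul_of_nonneg_left hm (by positivity)
    linarith
  have hR : P.statE T S (fun x => shortfall T (P.onHand x) (1 - P.lam 0)) ≤ E := by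
    refine le_trans (le_of_eq ?_) hE
    rw [← P.statE_leftover]
    exact P.statE_congr fun x _ => (P.onHand_sub_sales _ _).symm
  have hE0 : 0 ≤ E := h0.trans hE
  have key : P.statE T S (fun x => c * (E / b * P.onHand x - shortfall T (P.onHand x) (1 - P.lam 0)))
      ≤ P.statE T S (fun x => f (P.onHand x)) :=
    P.statE_mono fun x _ => by
      refine le_trans (le_of_eq ?_) (h (P.onHand x))
      rw [div_mul_eq_mul_div]
  refine le_trans ?_ key
  rw [P.statE_const_mul, P.statE_sub, P.statE_const_mul]
  have h1 : E / b * b ≤ E / b * P.statE T S (fun x => (P.onHand x : ℝ)) :=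
    mul_le_mul_of_nonneg_left hI (by positivity)
  have h2 : E / b * b = E := by field_simp
  exact mul_nonneg hc (by linarith)

/-- Binomial point probabilities. -/
def point (T I : ℕ) (s : ℝ) : ℝ := bern s T (fun k => if k = I then 1 else 0)

theorem point_eq (T I : ℕ) (s : ℝ) : point T I s = T.choose I * s ^ I * (1 - s) ^ (T - I) := by
  induction T generalizing I with
  | zero => cases I <;> simp [point, bern]
  | succ T ih =>
    rw [point, bern_succ]
    cases I with
    | zero =>
      have h1 : bern s T (fun k => if k + 1 = 0 then (1 : ℝ) else 0) = 0 := by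
        simpa using bern_const s T 0
      have h2 := ih 0
      rw [point] at h2
      rw [h1, h2]; simp [pow_succ]; ring
    | succ I =>
      have h1 := ih I
      have h2 := ih (I + 1)
      rw [point] at h1 h2
      simp only [add_left_inj, h1, h2, Nat.choose_succ_succ, Nat.cast_add, Nat.add_sub_add_right]
      rcases lt_or_ge T (I + 1) with h | h
      · rw [Nat.choose_eq_zero_of_lt h]; simp; ring
      · have : T - I = (T - (I + 1)) + 1 := by omega
        rw [this, pow_succ s I, pow_succ]; ring

theorem point_succ (T I : ℕ) (s : ℝ) :
    point (T + 1) (I + 1) s = s * point T I s + (1 - s) * point T (I + 1) s := by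
  simp only [point, bern_succ, add_left_inj]

theorem exceed_succ (T I : ℕ) (s : ℝ) :
    exceed (T + 1) (I + 1) s = exceed T (I + 1) s + s * point T (I + 1) s := by
  rw [exceed, bern_succ, exceed, point]
  have : bern s T (fun k => if I + 1 < k + 1 then (1 : ℝ) else 0) =
      bern s T (fun k => if I + 1 < k then 1 else 0) + bern s T (fun k => if k = I + 1 then 1 else 0) := by
    rw [← bern_add]
    refine bern_congr _ _ fun k _ => ?_
    split_ifs <;> first | omega | norm_num
  rw [this]; ring

theorem hasDerivAt_exceed (T I : ℕ) (s : ℝ) :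
    HasDerivAt (exceed (T + 1) I) ((T + 1) * point T I s) s := by
  refine (hasDerivAt_bern T (fun k => if I < k then 1 else 0) s).congr_deriv ?_
  rw [point]
  congr 1
  refine bern_congr _ _ fun k _ => ?_
  split_ifs <;> first | omega | norm_num

theorem hasDerivAt_point (T I : ℕ) (s : ℝ) :
    HasDerivAt (point (T + 1) (I + 1)) ((T + 1) * (point T I s - point T (I + 1) s)) s := by
  refine (hasDerivAt_bern T (fun k => if k = I + 1 then 1 else 0) s).congr_deriv ?_
  rw [bern_sub, point, point]
  simp only [add_left_inj]

theorem point_nonneg {T I : ℕ} {s : ℝ} (h0 : 0 ≤ s) (h1 : s ≤ 1) : 0 ≤ point T I s :=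
  bern_nonneg h0 h1 _ fun _ _ => by split_ifs <;> norm_num

/-- The ratio of consecutive point probabilities is at most 1 once the index has passed `(T + 1) s`.
-/
theorem point_anti_of_le {T I : ℕ} {s : ℝ} (h0 : 0 ≤ s) (h1 : s ≤ 1) (h : (T + 1) * s ≤ I + 1) :
    point T (I + 1) s ≤ point T I s := by
  rcases lt_or_ge T (I + 1) with hT | hT
  · have := point_nonneg (T := T) (I := I) h0 h1
    rw [point_eq T (I + 1), Nat.choose_eq_zero_of_lt hT]
    simpa using this
  · rw [point_eq, point_eq]
    obtain ⟨d, rfl⟩ := Nat.exists_eq_add_of_le hT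
    have e1 : I + 1 + d - (I + 1) = d := by omega
    have e2 : I + 1 + d - I = d + 1 := by omega
    rw [e1, e2]
    have hc : ((I + 1 + d).choose (I + 1) : ℝ) * (I + 1) = (I + 1 + d).choose I * (d + 1) := by
      have := Nat.choose_succ_right_eq (I + 1 + d) I
      rw [e2] at this
      exact_mod_cast this
    have hI : (0 : ℝ) < I + 1 := by positivity
    have h1s : 0 ≤ 1 - s := by linarith
    push_cast at h
    have hs : (d + 1) * s ≤ (I + 1) * (1 - s) := by nlinarith
    refine le_of_mul_le_mul_left ?_ hI
    calc (I + 1 : ℝ) * ((I + 1 + d).choose (I + 1) * s ^ (I + 1) * (1 - s) ^ d)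
        = ((I + 1 + d).choose (I + 1) * (I + 1)) * (s ^ I * (1 - s) ^ d) * s := by ring
      _ = ((I + 1 + d).choose I * (s ^ I * (1 - s) ^ d)) * ((d + 1) * s) := by rw [hc]; ring
      _ ≤ ((I + 1 + d).choose I * (s ^ I * (1 - s) ^ d)) * ((I + 1) * (1 - s)) :=
        mul_le_mul_of_nonneg_left hs (by positivity)
      _ = _ := by ring

/-- Probability that a binomial variable with integer mean `I` exceeds its mean. -/
def upper (T I : ℕ) : ℝ := exceed T I (I / T)

/-- Keeping the integer mean `I`, one trial is added. The function `G` below equals `upper T I` at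
`s = I / T` and `upper (T + 1) I` at `s = I / (T + 1)`, and it decreases between these two points.
-/
theorem upper_mono {T I : ℕ} (hI : 1 ≤ I) (h : I ≤ T) : upper T I ≤ upper (T + 1) I := by
  obtain ⟨J, rfl⟩ := Nat.exists_eq_add_of_le' hI
  obtain ⟨U, rfl⟩ := Nat.exists_eq_add_of_le' (hI.trans h)
  have hT0 : (0 : ℝ) < (U + 1 : ℕ) := by positivity
  have hI0 : (0 : ℝ) < (J + 1 : ℕ) := by positivity
  set a : ℝ := (J + 1 : ℕ) / ((U + 1 + 1 : ℕ) : ℝ) with ha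
  set b : ℝ := (J + 1 : ℕ) / ((U + 1 : ℕ) : ℝ) with hb
  have hab : a ≤ b := by
    rw [ha, hb]; gcongr; omega
  have ha0 : 0 ≤ a := by positivity
  have hb1 : b ≤ 1 := by
    rw [hb, div_le_one hT0]; exact_mod_cast h
  -- The correction vanishes at `b`. At `a` its factor equals `a`, so that by `exceed_succ` it
  -- supplies exactly the additional trial.
  let G : ℝ → ℝ := fun s => exceed (U + 1) (J + 1) s + ((J + 1 : ℕ) - (U + 1 : ℕ) * s) * point (U + 1) (J + 1) s
  have hd : ∀ s, HasDerivAt G (((U : ℝ) + 1) * ((J + 1) - (U + 1) * s - s) *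
      (point U J s - point U (J + 1) s)) s := by
    intro s
    have h1 := (hasDerivAt_exceed U (J + 1) s).add
      (((hasDerivAt_const s ((J + 1 : ℕ) : ℝ)).sub ((hasDerivAt_id s).const_mul ((U + 1 : ℕ) : ℝ))).mul
        (hasDerivAt_point U J s))
    refine h1.congr_deriv ?_
    simp only [Pi.sub_apply, id, point_succ]
    push_cast; ring
  have hanti : AntitoneOn G (Set.Icc a b) := by
    refine antitoneOn_of_deriv_nonpos (convex_Icc a b)
      (fun s _ => (hd s).continuousAt.continuousWithinAt)
      (fun s _ => (hd s).differentiableAt.differentiableWithinAt) fun s hs => ?_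
    rw [interior_Icc] at hs
    rw [(hd s).deriv]
    have hs0 : 0 ≤ s := ha0.trans hs.1.le
    have hs1 : s ≤ 1 := hs.2.le.trans hb1
    have h1 : ((U : ℝ) + 1) * s ≤ J + 1 := by
      have := hs.2.le
      rw [hb, le_div_iff₀ hT0] at this
      push_cast at this; linarith
    have h2 : (J : ℝ) + 1 - (U + 1) * s - s ≤ 0 := by
      have := hs.1.le
      rw [ha, div_le_iff₀ (by positivity)] at this
      push_cast at this; linarith
    have h3 := point_anti_of_le (T := U) (I := J) hs0 hs1 h1
    exact mul_nonpos_of_nonpos_of_nonneg (mul_nonpos_of_nonneg_of_nonpos (by positivity) h2) (by linarith)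
  have hG := hanti ⟨le_rfl, hab⟩ ⟨hab, le_rfl⟩ hab
  have hGb : G b = upper (U + 1) (J + 1) := by
    have : ((J + 1 : ℕ) : ℝ) - (U + 1 : ℕ) * b = 0 := by rw [hb]; field_simp; ring
    change exceed (U + 1) (J + 1) b + (((J + 1 : ℕ) : ℝ) - (U + 1 : ℕ) * b) *
      point (U + 1) (J + 1) b = _
    rw [this, zero_mul, add_zero]; rfl
  have hGa : G a = upper (U + 1 + 1) (J + 1) := by
    have : ((J + 1 : ℕ) : ℝ) - (U + 1 : ℕ) * a = a := by
      have h3 : ((U + 1 + 1 : ℕ) : ℝ) * a = (J + 1 : ℕ) := by rw [ha]; field_simp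
      push_cast at h3 ⊢; linarith
    change exceed (U + 1) (J + 1) a + (((J + 1 : ℕ) : ℝ) - (U + 1 : ℕ) * a) *
      point (U + 1) (J + 1) a = _
    rw [this]; exact (exceed_succ (U + 1) J a).symm
  rw [hGa, hGb] at hG
  exact hG

theorem upper_mono_add {T I : ℕ} (hI : 1 ≤ I) (h : I ≤ T) (d : ℕ) : upper T I ≤ upper (T + d) I := by
  induction d with
  | zero => exact le_rfl
  | succ d ih => exact ih.trans (upper_mono hI (by omega))

theorem exceed_eq_zero (T I : ℕ) (h : T ≤ I) (s : ℝ) : exceed T I s = 0 := by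
  rw [exceed, bern_congr (g := fun _ => 0) _ _ fun k hk => if_neg (by omega), bern_const]


/-- By `upper_mono` the smallest case is `T = I + 1`, where the value is (1 - 1/T)^T. Bernoulli's
inequality with exponent T/2 bounds its square root below by 1/2. -/
theorem upper_ge_quarter {T I : ℕ} (hI : 1 ≤ I) (h : I < T) : 1 / 4 ≤ upper T I := by
  obtain ⟨d, rfl⟩ := Nat.exists_eq_add_of_le (show I + 1 ≤ T from h)
  refine le_trans ?_ (upper_mono_add hI (Nat.le_succ I) d)
  obtain ⟨J, rfl⟩ := Nat.exists_eq_add_of_le' hI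
  rw [upper, exceed_succ, exceed_eq_zero _ _ le_rfl, point_eq, Nat.choose_self, Nat.sub_self,
    pow_zero]
  set s : ℝ := (J + 1 : ℕ) / ((J + 1 + 1 : ℕ) : ℝ) with hs
  have hn : (0 : ℝ) < J + 2 := by positivity
  have hs1 : s = 1 + -(1 / (J + 2)) := by rw [hs]; push_cast; field_simp; ring
  have hs0 : 0 ≤ s := by positivity
  have hJ : (0 : ℝ) ≤ J := Nat.cast_nonneg J
  have hb := one_add_mul_self_le_rpow_one_add (s := -(1 / (J + 2 : ℝ))) (p := (J + 2) / 2)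
    (by rw [neg_le_neg_iff, div_le_one hn]; linarith) (by linarith)
  have e : 1 + ((J : ℝ) + 2) / 2 * -(1 / (J + 2)) = 1 / 2 := by field_simp; norm_num
  rw [e, ← hs1] at hb
  have h2 : s ^ (J + 2) = (s ^ (((J : ℝ) + 2) / 2)) ^ 2 := by
    rw [← Real.rpow_natCast, ← Real.rpow_natCast, ← Real.rpow_mul hs0]
    congr 1; push_cast; ring
  have h3 : 0 + s * ((1 : ℕ) * s ^ (J + 1) * 1) = s ^ (J + 2) := by push_cast; ring
  rw [h3, h2]
  nlinarith

/-- Equality holds at `n = 4`. Small `n` are computed; from 16 on the power is at least exp(-15/7) ≥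
1/9. -/
theorem base_pow_ge (n : ℕ) (hn : 4 ≤ n) :
    (5 : ℝ) / 16 ≤ (1 - 2 / n) ^ (n - 1) * (3 - 2 / n) := by
  rcases lt_or_ge n 16 with h | h
  · interval_cases n <;> norm_num
  · obtain ⟨k, rfl⟩ := Nat.exists_eq_add_of_le h
    have hk : (0 : ℝ) ≤ k := Nat.cast_nonneg k
    have e : (1 : ℝ) - 2 / ((16 + k : ℕ) : ℝ) = (1 + 2 / (14 + (k : ℝ)))⁻¹ := by
      push_cast; field_simp; ring
    have h1 : (1 + 2 / (14 + k) : ℝ) ^ (16 + k - 1) ≤ Real.exp (15 / 7) := by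
      have h2 : (1 + 2 / (14 + k) : ℝ) ≤ Real.exp (2 / (14 + k)) := by
        have := Real.add_one_le_exp (2 / (14 + k : ℝ)); linarith
      refine (pow_le_pow_left₀ (by positivity) h2 _).trans ?_
      rw [← Real.exp_nat_mul]
      apply Real.exp_le_exp.mpr
      have : 16 + k - 1 = 15 + k := by omega
      rw [this]; push_cast
      rw [mul_div_assoc', div_le_div_iff₀ (by positivity) (by norm_num)]
      nlinarith
    have h3 : Real.exp (15 / 7) ≤ 9 := by
      have h4 : Real.exp (15 / 7) ^ 7 = Real.exp 1 ^ 15 := by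
        rw [← Real.exp_nat_mul, ← Real.exp_nat_mul]; norm_num
      have h5 : Real.exp 1 ^ 15 ≤ 2.7182818286 ^ 15 :=
        pow_le_pow_left₀ (Real.exp_pos 1).le Real.exp_one_lt_d9.le 15
      by_contra! hc
      have h6 : (9 : ℝ) ^ 7 < Real.exp (15 / 7) ^ 7 := pow_lt_pow_left₀ hc (by norm_num) (by norm_num)
      rw [h4] at h6
      norm_num at h5 h6
      linarith
    have h7 : (1 / 9 : ℝ) ≤ (1 - 2 / (16 + k : ℕ)) ^ (16 + k - 1) := by
      rw [e, inv_pow, one_div]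
      exact inv_anti₀ (by positivity) (h1.trans h3)
    have h8 : (23 / 8 : ℝ) ≤ 3 - 2 / (16 + k : ℕ) := by
      have : (2 : ℝ) / (16 + k : ℕ) ≤ 1 / 8 := by
        rw [div_le_div_iff₀ (by positivity) (by norm_num)]; push_cast; linarith
      linarith
    nlinarith

/-- As for the bound 1/4, but with base case `T = I + 2`. The surplus of 5/16 over 1/4 is what the
dual argument spends. -/
theorem upper_ge {T I : ℕ} (hI : 2 ≤ I) (h : I + 2 ≤ T) : 5 / 16 ≤ upper T I := by
  obtain ⟨d, rfl⟩ := Nat.exists_eq_add_of_le h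
  refine le_trans ?_ (upper_mono_add (by omega) (by omega) d)
  obtain ⟨J, rfl⟩ := Nat.exists_eq_add_of_le' (show 1 ≤ I by omega)
  refine (base_pow_ge (J + 1 + 2) (by omega)).trans (le_of_eq ?_)
  rw [upper, exceed_succ, exceed_succ, exceed_eq_zero _ _ le_rfl, point_eq, point_eq]
  have e1 : J + 1 + 1 - (J + 1) = 1 := by omega
  have e2 : J + 1 + 2 - 1 = J + 2 := by omega
  have e3 : (J + 1 + 1).choose (J + 1) = J + 2 := Nat.choose_succ_self_right (J + 1)
  rw [Nat.choose_self, Nat.sub_self, pow_zero, e1, e2, e3]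
  set s : ℝ := (J + 1 : ℕ) / ((J + 1 + 2 : ℕ) : ℝ) with hs
  have hn : (0 : ℝ) < J + 3 := by positivity
  have hs1 : (1 : ℝ) - 2 / (J + 1 + 2 : ℕ) = s := by rw [hs]; push_cast; field_simp; ring
  have hs2 : (2 : ℝ) / (J + 1 + 2 : ℕ) = 1 - s := by rw [← hs1]; ring
  have hs3 : ((J : ℝ) + 3) * (1 - s) = 2 := by
    rw [← hs2]; push_cast; field_simp; ring
  have e4 : 3 - 2 / ((J + 1 + 2 : ℕ) : ℝ) = s + ((J : ℝ) + 3) * (1 - s) := by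
    rw [hs3, hs2]; ring
  rw [e4, hs1]
  push_cast; ring

theorem upper_nonneg {T I : ℕ} (h : I ≤ T) : 0 ≤ upper T I :=
  exceed_nonneg (by positivity) (div_le_one_of_le₀ (by exact_mod_cast h) (by positivity))

/-- Integrates the derivative of excess divided by `s` from `p` to `q`: since `I ≤ T s` there, P(B_s
> I) is at least `upper T I`. -/
theorem advantage_ge_upper {T I : ℕ} {p q : ℝ} (hT : 0 < T) (hp : 0 < p) (hI : (I : ℝ) ≤ T * p)
    (hpq : p ≤ q) (hq : q ≤ 1) : I * upper T I * (q - p) / p ≤ advantage T p q I := by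
  have hT0 : (0 : ℝ) < T := by exact_mod_cast hT
  have hq0 := hp.trans_le hpq
  have hd : ∀ s, s ≠ 0 → HasDerivAt (fun s => excess T I s / s + I * upper T I * s⁻¹)
      (I * exceed T I s / s ^ 2 + I * upper T I * (-(s ^ 2)⁻¹)) s := fun s hs =>
    (hasDerivAt_excess_div T I hs).add ((hasDerivAt_inv hs).const_mul _)
  have hm : MonotoneOn (fun s => excess T I s / s + I * upper T I * s⁻¹) (Set.Icc p q) := by
    refine monotoneOn_of_deriv_nonneg (convex_Icc p q)
      (fun s hs => (hd s (hp.trans_le hs.1).ne').continuousAt.continuousWithinAt)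
      (fun s hs => ?_) fun s hs => ?_
    · rw [interior_Icc] at hs
      exact (hd s (hp.trans hs.1).ne').differentiableAt.differentiableWithinAt
    · rw [interior_Icc] at hs
      have hs0 := hp.trans hs.1
      rw [(hd s hs0.ne').deriv]
      have hu : upper T I ≤ exceed T I s := by
        refine exceed_mono (by positivity) ?_ (hs.2.le.trans hq)
        rw [div_le_iff₀ hT0]; nlinarith [hs.1]
      have : I * exceed T I s / s ^ 2 + I * upper T I * (-(s ^ 2)⁻¹) =
          I * (exceed T I s - upper T I) / s ^ 2 := by field_simp; ring
      rw [this]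
      have := sub_nonneg.mpr hu
      positivity
  have h := hm ⟨le_rfl, hpq⟩ ⟨hpq, le_rfl⟩ hpq
  simp only at h
  have h2 := mul_le_mul_of_nonneg_left h hq0.le
  have e1 : q * (excess T I p / p + I * upper T I * p⁻¹) =
      q / p * excess T I p + I * upper T I * (q - p) / p + I * upper T I := by field_simp; ring
  have e2 : q * (excess T I q / q + I * upper T I * q⁻¹) = excess T I q + I * upper T I := by
    field_simp
  rw [e1, e2] at h2
  rw [advantage]; linarith

/-- Raising `p` to `I / T` only lowers the advantage and brings the previous bound to its boundary
case. -/
theorem advantage_ge_of_le {T I : ℕ} {p q : ℝ} (hI : 1 ≤ I) (hp : 0 < p) (hpI : T * p ≤ I)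
    (hIq : (I : ℝ) < T * q) (hq : q ≤ 1) : upper T I * (T * q - I) ≤ advantage T p q I := by
  have hT : 0 < T := by
    rcases Nat.eq_zero_or_pos T with h | h
    · subst h; simp at hIq; exact absurd hIq (by have := Nat.cast_nonneg (α := ℝ) I; linarith)
    · exact h
  have hT0 : (0 : ℝ) < T := by exact_mod_cast hT
  have hI0 : (0 : ℝ) < I := by exact_mod_cast hI
  have h1 : p ≤ I / T := by rw [le_div_iff₀ hT0]; linarith
  have h2 : (I : ℝ) / T ≤ q := by rw [div_le_iff₀ hT0]; linarith
  refine le_trans (le_of_eq ?_) ((advantage_ge_upper hT (p := I / T) (q := q) (by positivity)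
    (le_of_eq (by field_simp)) h2 hq).trans
    (advantage_anti hp h1 (h2.trans hq) ((by positivity : (0 : ℝ) ≤ I / T).trans h2)))
  field_simp

theorem excess_one (T : ℕ) (s : ℝ) : excess T 1 s = T * s - 1 + (1 - s) ^ T := by
  have h := bern_sub_min T 1 s
  have h2 : bern s T (fun k => ((1 - k : ℕ) : ℝ)) = point T 0 s :=
    bern_congr _ _ fun k _ => by cases k <;> simp
  rw [h2, point_eq] at h
  simp only [Nat.choose_zero_right, Nat.cast_one, pow_zero, Nat.sub_zero, one_mul] at h
  linarith

/-- For one unit the excess is explicit, and 1 - 1/e > 0.632 improves on the factor 1/4. -/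
theorem advantage_one_ge {T : ℕ} {p q : ℝ} (hp : 0 < p) (hpI : T * p ≤ 1)
    (hIq : 1 < T * q) (hq : q ≤ 1) : 0.632 * (T * q) - 1 ≤ advantage T p q 1 := by
  have hq0 : 0 < q := by
    by_contra! h
    have : (T : ℝ) * q ≤ 0 := mul_nonpos_of_nonneg_of_nonpos (Nat.cast_nonneg _) h
    linarith
  have hT0 : (0 : ℝ) < T := by
    rcases Nat.eq_zero_or_pos T with h | h
    · subst h; simp at hIq; linarith
    · exact_mod_cast h
  have h1 : p ≤ 1 / T := by rw [le_div_iff₀ hT0]; linarith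
  have h2 : (1 : ℝ) / T ≤ q := by rw [div_le_iff₀ hT0]; linarith
  refine le_trans ?_ (advantage_anti (I := 1) hp h1 (h2.trans hq) hq0.le)
  rw [advantage, excess_one, excess_one]
  have h3 : (1 - 1 / (T : ℝ)) ^ T ≤ Real.exp (-1) :=
    Real.one_sub_div_pow_le_exp_neg (n := T) (t := 1) (by
      have : (1 : ℝ) / T ≤ 1 := h2.trans hq
      rwa [div_le_one hT0] at this)
  have h4 : Real.exp (-1) ≤ 0.368 := by
    have := Real.exp_neg_one_lt_d9; linarith
  have h5 : 0 ≤ (1 - q) ^ T := pow_nonneg (by linarith) _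
  have h6 : q / (1 / T) * (T * (1 / T) - 1 + (1 - 1 / (T : ℝ)) ^ T) =
      T * q * (1 - 1 / (T : ℝ)) ^ T := by field_simp; ring
  rw [h6]
  have := mul_le_mul_of_nonneg_left (h3.trans h4) (by positivity : 0 ≤ T * q)
  linarith

/-- Expected excess at the smaller success probability `b / T`, rescaled to `q`. -/
def inflated (T I : ℕ) (b q : ℝ) : ℝ := q / (b / T) * excess T I (b / T)

/-- Where `T * q - I` equals the target `(T * q - b) / 4`, reaching the target means exactly that
the inflated excess is at most the shortfall. -/
theorem advantage_eq_inflated (T I : ℕ) (b q : ℝ) :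
    advantage T (b / T) q I = T * q - I + shortfall T I q - inflated T I b q :=
  advantage_eq_shortfall T I _ q

end

/-! ### Balance of shortfall and inflated excess: sign lemmas and boundary values -/

section

/-- A function that starts nonnegative and nondecreasing cannot become negative before a point where
it is nonnegative, if its second derivative is antitone. -/
theorem nonneg_of_deriv_three_nonpos {N N₁ N₂ N₃ : ℝ → ℝ} {l : ℝ}
    (h01 : ∀ y, HasDerivAt N (N₁ y) y) (h12 : ∀ y, HasDerivAt N₁ (N₂ y) y)
    (h23 : ∀ y, HasDerivAt N₂ (N₃ y) y) (h0 : 0 ≤ N 0) (h1 : 0 ≤ N₁ 0) (hl : 0 ≤ N l)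
    (h3 : ∀ y, 0 < y → y < l → N₃ y ≤ 0) {y : ℝ} (hy0 : 0 ≤ y) (hyl : y ≤ l) : 0 ≤ N y := by
  by_contra! hneg
  have hy0 : 0 < y := hy0.lt_of_ne (by rintro rfl; linarith)
  have hyl : y < l := hyl.lt_of_ne (by rintro rfl; linarith)
  have c0 : Continuous N := continuous_iff_continuousAt.mpr fun y => (h01 y).continuousAt
  have c1 : Continuous N₁ := continuous_iff_continuousAt.mpr fun y => (h12 y).continuousAt
  have c2 : Continuous N₂ := continuous_iff_continuousAt.mpr fun y => (h23 y).continuousAt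
  obtain ⟨c, hc, ec⟩ := exists_hasDerivAt_eq_slope N N₁ hy0 c0.continuousOn fun x _ => h01 x
  obtain ⟨d, hd, ed⟩ := exists_hasDerivAt_eq_slope N N₁ hyl c0.continuousOn fun x _ => h01 x
  have hc1 : N₁ c < 0 := by rw [ec]; exact div_neg_of_neg_of_pos (by linarith) (by linarith)
  have hd1 : 0 < N₁ d := by rw [ed]; exact div_pos (by linarith) (by linarith)
  have hcd : c < d := hc.2.trans hd.1
  obtain ⟨u, hu, eu⟩ := exists_hasDerivAt_eq_slope N₁ N₂ hc.1 c1.continuousOn fun x _ => h12 x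
  obtain ⟨v, hv, ev⟩ := exists_hasDerivAt_eq_slope N₁ N₂ hcd c1.continuousOn fun x _ => h12 x
  have hu1 : N₂ u < 0 := by
    rw [eu]; exact div_neg_of_neg_of_pos (by linarith) (by linarith [hc.1])
  have hv1 : 0 < N₂ v := by rw [ev]; exact div_pos (by linarith) (by linarith)
  have huv : u < v := hu.2.trans hv.1
  obtain ⟨w, hw, ew⟩ := exists_hasDerivAt_eq_slope N₂ N₃ huv c2.continuousOn fun x _ => h23 x
  have hw1 : 0 < N₃ w := by rw [ew]; exact div_pos (by linarith) (by linarith)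
  have := h3 w (hu.1.trans hw.1) (hw.2.trans (hv.2.trans hd.2))
  linarith

/-- A negative value forces, by mean values together with the boundary data, the signs -, + in `N₁`,
then -, +, - in `N₂`, then +, -, + in `N₃`. The last pattern is excluded by `h3`. -/
theorem nonneg_of_deriv_three_pattern {N N₁ N₂ N₃ : ℝ → ℝ} {l : ℝ}
    (h01 : ∀ y, HasDerivAt N (N₁ y) y) (h12 : ∀ y, HasDerivAt N₁ (N₂ y) y)
    (h23 : ∀ y, HasDerivAt N₂ (N₃ y) y) (h0 : 0 ≤ N 0) (h1 : 0 ≤ N₁ 0) (hl : 0 ≤ N l)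
    (hl1 : N₁ l ≤ 0) (hl2 : 0 ≤ N₂ l)
    (h3 : ∀ x y z, 0 < x → x < y → y < z → z < l → 0 < N₃ x → 0 < N₃ z → 0 ≤ N₃ y)
    {y : ℝ} (hy0 : 0 ≤ y) (hyl : y ≤ l) : 0 ≤ N y := by
  by_contra! hneg
  have hy0 : 0 < y := hy0.lt_of_ne (by rintro rfl; linarith)
  have hyl : y < l := hyl.lt_of_ne (by rintro rfl; linarith)
  have c0 : Continuous N := continuous_iff_continuousAt.mpr fun y => (h01 y).continuousAt
  have c1 : Continuous N₁ := continuous_iff_continuousAt.mpr fun y => (h12 y).continuousAt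
  have c2 : Continuous N₂ := continuous_iff_continuousAt.mpr fun y => (h23 y).continuousAt
  obtain ⟨c, hc, ec⟩ := exists_hasDerivAt_eq_slope N N₁ hy0 c0.continuousOn fun x _ => h01 x
  obtain ⟨d, hd, ed⟩ := exists_hasDerivAt_eq_slope N N₁ hyl c0.continuousOn fun x _ => h01 x
  have hc1 : N₁ c < 0 := by rw [ec]; exact div_neg_of_neg_of_pos (by linarith) (by linarith)
  have hd1 : 0 < N₁ d := by rw [ed]; exact div_pos (by linarith) (by linarith)
  have hcd : c < d := hc.2.trans hd.1
  obtain ⟨u, hu, eu⟩ := exists_hasDerivAt_eq_slope N₁ N₂ hc.1 c1.continuousOn fun x _ => h12 x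
  obtain ⟨v, hv, ev⟩ := exists_hasDerivAt_eq_slope N₁ N₂ hcd c1.continuousOn fun x _ => h12 x
  obtain ⟨w, hw, ew⟩ := exists_hasDerivAt_eq_slope N₁ N₂ hd.2 c1.continuousOn fun x _ => h12 x
  have hu1 : N₂ u < 0 := by
    rw [eu]; exact div_neg_of_neg_of_pos (by linarith) (by linarith [hc.1])
  have hv1 : 0 < N₂ v := by rw [ev]; exact div_pos (by linarith) (by linarith)
  have hw1 : N₂ w < 0 := by
    rw [ew]; exact div_neg_of_neg_of_pos (by linarith) (by linarith [hd.2])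
  have huv : u < v := hu.2.trans hv.1
  have hvw : v < w := hv.2.trans hw.1
  obtain ⟨r, hr, er⟩ := exists_hasDerivAt_eq_slope N₂ N₃ huv c2.continuousOn fun x _ => h23 x
  obtain ⟨s, hs, es⟩ := exists_hasDerivAt_eq_slope N₂ N₃ hvw c2.continuousOn fun x _ => h23 x
  obtain ⟨t, ht, et⟩ := exists_hasDerivAt_eq_slope N₂ N₃ hw.2 c2.continuousOn fun x _ => h23 x
  have hr1 : 0 < N₃ r := by rw [er]; exact div_pos (by linarith) (by linarith)
  have hs1 : N₃ s < 0 := by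
    rw [es]; exact div_neg_of_neg_of_pos (by linarith) (by linarith)
  have ht1 : 0 < N₃ t := by rw [et]; exact div_pos (by linarith) (by linarith [hw.2])
  have := h3 r s t (hu.1.trans hr.1) (hr.2.trans hs.1) (hs.2.trans ht.1) ht.2 hr1 ht1
  linarith

theorem hasDerivAt_excess' (U J : ℕ) (s : ℝ) :
    HasDerivAt (excess (U + 2) (J + 1)) ((U + 2) * exceed (U + 1) J s) s := by
  refine (hasDerivAt_excess (U + 1) (J + 1) s).congr_deriv ?_
  rw [exceed]
  push_cast
  have : ((U : ℝ) + 1 + 1) = U + 2 := by ring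
  rw [this]
  congr 1

/-- At the point where the binomial mean is `I`, the excess is a difference of two tails. -/
theorem excess_eq_of_mean (U J : ℕ) {s : ℝ} (hs : (U + 2) * s = J + 1) :
    excess (U + 2) (J + 1) s =
      (J + 1) * exceed (U + 1) J s - (J + 1) * exceed (U + 2) (J + 1) s := by
  have hb := bern_size_bias s (U + 1) (fun k => if J + 1 < k then (1 : ℝ) else 0)
  have h2 : ((J + 1 : ℕ) : ℝ) * exceed (U + 2) (J + 1) s =
      bern s (U + 1 + 1) (fun k => k * (if J + 1 < k then (1 : ℝ) else 0)) -
        excess (U + 2) (J + 1) s := by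
    rw [exceed, excess, ← bern_const_mul, ← bern_sub]
    refine bern_congr _ _ fun k _ => ?_
    split_ifs with hk
    · rw [Nat.cast_sub hk.le]; ring
    · rw [Nat.sub_eq_zero_of_le (by omega)]; simp
  have h3 : bern s (U + 1) (fun k => if J + 1 < k + 1 then (1 : ℝ) else 0) = exceed (U + 1) J s :=
    bern_congr _ _ fun k _ => by simp
  rw [hb, h3] at h2
  push_cast at h2
  have : ((U : ℝ) + 1 + 1) * s = J + 1 := by rw [← hs]; ring
  rw [this] at h2
  linarith

theorem exceed_zero_prob (T I : ℕ) : exceed T I 0 = 0 := by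
  induction T with
  | zero => simp [exceed, bern]
  | succ T ih => rw [exceed] at ih ⊢; rw [bern_succ, ih]; simp

section Balance

variable (U J : ℕ)

/-- The balance between shortfall above and excess below the mean `J + 1`, cleared of
denominators, at the offsets `y` and `-3y`. -/
def balance (y : ℝ) : ℝ :=
  (J + 1 - 3 * y) * (excess (U + 2) (J + 1) ((J + 1 + y) / (U + 2)) - y) -
    (J + 1 + y) * excess (U + 2) (J + 1) ((J + 1 - 3 * y) / (U + 2))

def balance₁ (y : ℝ) : ℝ :=
  -3 * (excess (U + 2) (J + 1) ((J + 1 + y) / (U + 2)) - y) +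
    (J + 1 - 3 * y) * (exceed (U + 1) J ((J + 1 + y) / (U + 2)) - 1) -
    excess (U + 2) (J + 1) ((J + 1 - 3 * y) / (U + 2)) +
    3 * (J + 1 + y) * exceed (U + 1) J ((J + 1 - 3 * y) / (U + 2))

def balance₂ (y : ℝ) : ℝ :=
  -6 * (exceed (U + 1) J ((J + 1 + y) / (U + 2)) - 1) +
    (J + 1 - 3 * y) * ((U + 1) / (U + 2) * point U J ((J + 1 + y) / (U + 2))) +
    6 * exceed (U + 1) J ((J + 1 - 3 * y) / (U + 2)) -
    9 * (J + 1 + y) * ((U + 1) / (U + 2) * point U J ((J + 1 - 3 * y) / (U + 2)))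

theorem hasDerivAt_up (y : ℝ) :
    HasDerivAt (fun y : ℝ => ((J : ℝ) + 1 + y) / (U + 2)) (1 / (U + 2)) y :=
  ((hasDerivAt_id y).const_add _).div_const _

theorem hasDerivAt_down (y : ℝ) :
    HasDerivAt (fun y : ℝ => ((J : ℝ) + 1 - 3 * y) / (U + 2)) (-3 / (U + 2)) y := by
  refine ((((hasDerivAt_id y).const_mul 3).const_sub ((J : ℝ) + 1)).div_const _).congr_deriv ?_
  ring

theorem hasDerivAt_balance (y : ℝ) : HasDerivAt (balance U J) (balance₁ U J y) y := by
  have hT : (U : ℝ) + 2 ≠ 0 := by positivity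
  have a1 := (hasDerivAt_excess' U J _).comp y (hasDerivAt_up U J y)
  have a2 := (hasDerivAt_excess' U J _).comp y (hasDerivAt_down U J y)
  have b1 := ((hasDerivAt_id y).const_mul 3).const_sub ((J : ℝ) + 1)
  have b2 := (hasDerivAt_id y).const_add ((J : ℝ) + 1)
  refine ((b1.mul (a1.sub (hasDerivAt_id y))).sub (b2.mul a2)).congr_deriv ?_
  simp only [Function.comp, id, balance₁, Pi.sub_apply]
  field_simp
  ring

theorem hasDerivAt_balance₁ (y : ℝ) : HasDerivAt (balance₁ U J) (balance₂ U J y) y := by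
  have hT : (U : ℝ) + 2 ≠ 0 := by positivity
  have a1 := (hasDerivAt_excess' U J _).comp y (hasDerivAt_up U J y)
  have a2 := (hasDerivAt_excess' U J _).comp y (hasDerivAt_down U J y)
  have c1 := (hasDerivAt_exceed U J _).comp y (hasDerivAt_up U J y)
  have c2 := (hasDerivAt_exceed U J _).comp y (hasDerivAt_down U J y)
  have b1 := ((hasDerivAt_id y).const_mul 3).const_sub ((J : ℝ) + 1)
  have b2 := ((hasDerivAt_id y).const_add ((J : ℝ) + 1)).const_mul 3
  refine (((((a1.sub (hasDerivAt_id y)).const_mul (-3)).add (b1.mul (c1.sub_const 1))).sub a2).add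
    (b2.mul c2)).congr_deriv ?_
  simp only [Function.comp, id, balance₂]
  field_simp
  ring

theorem hasDerivAt_balance₂ {v : ℝ → ℝ} (hv : ∀ s, HasDerivAt (point U J) (v s) s) (y : ℝ) :
    HasDerivAt (balance₂ U J) ((U + 1) / (U + 2) *
      (-9 * point U J ((J + 1 + y) / (U + 2)) +
        (J + 1 - 3 * y) / (U + 2) * v ((J + 1 + y) / (U + 2)) -
        27 * point U J ((J + 1 - 3 * y) / (U + 2)) +
        27 * (J + 1 + y) / (U + 2) * v ((J + 1 - 3 * y) / (U + 2)))) y := by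
  have hT : (U : ℝ) + 2 ≠ 0 := by positivity
  have c1 := (hasDerivAt_exceed U J _).comp y (hasDerivAt_up U J y)
  have c2 := (hasDerivAt_exceed U J _).comp y (hasDerivAt_down U J y)
  have d1 := ((hv _).comp y (hasDerivAt_up U J y)).const_mul (((U : ℝ) + 1) / (U + 2))
  have d2 := ((hv _).comp y (hasDerivAt_down U J y)).const_mul (((U : ℝ) + 1) / (U + 2))
  have b1 := ((hasDerivAt_id y).const_mul 3).const_sub ((J : ℝ) + 1)
  have b2 := ((hasDerivAt_id y).const_add ((J : ℝ) + 1)).const_mul 9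
  refine (((((c1.sub_const 1).const_mul (-6)).add (b1.mul d1)).add (c2.const_mul 6)).sub
    (b2.mul d2)).congr_deriv ?_
  simp only [Function.comp, id]
  field_simp
  ring

theorem balance_zero : balance U J 0 = 0 := by
  simp [balance]

/-- The derivative at 0 equals the mean `J + 1` times `4 * upper - 1`, so the bound 1/4 is just what
the offsets `y` and `-3y` require. -/
theorem balance₁_zero (h : J ≤ U) : 0 ≤ balance₁ U J 0 := by
  have hT : (U : ℝ) + 2 ≠ 0 := by positivity
  have h1 := excess_eq_of_mean U J (s := (J + 1) / (U + 2)) (by field_simp)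
  have h2 := upper_ge_quarter (T := U + 2) (I := J + 1) (by omega) (by omega)
  rw [upper] at h2
  push_cast at h2
  simp only [balance₁, mul_zero, sub_zero, add_zero]
  rw [h1]
  have : (0 : ℝ) ≤ J + 1 := by positivity
  nlinarith

theorem balance_end : balance U J ((J + 1) / 3) = 0 := by
  have : ((J : ℝ) + 1 - 3 * ((J + 1) / 3)) = 0 := by ring
  rw [balance, this]
  have h := excess_zero_prob (U + 2) (J + 1)
  simp [h]

/-- With I = J + 1 and T = U + 2 this is where I ≤ 3 (T - I) enters: the upper mean 4I/3 at the end
of the range must not exceed T. -/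
theorem end_le_one (h : J + 1 ≤ 3 * (U + 1 - J)) :
    ((J : ℝ) + 1 + (J + 1) / 3) / (U + 2) ≤ 1 := by
  rw [div_le_one (by positivity)]
  rcases le_or_gt J (U + 1) with h2 | h2
  · obtain ⟨d, hd⟩ := Nat.exists_eq_add_of_le h2
    have h3 : J + 1 ≤ 3 * d := by omega
    have h4 : (J : ℝ) + 1 ≤ 3 * d := by exact_mod_cast h3
    have h5 : (U : ℝ) + 1 = J + d := by exact_mod_cast hd
    linarith
  · omega

/-- At `y = (J + 1) / 3` the lower mean is zero, and what remains is -3 times a shortfall. -/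
theorem balance₁_end (h : J + 1 ≤ 3 * (U + 1 - J)) : balance₁ U J ((J + 1) / 3) ≤ 0 := by
  have e : ((J : ℝ) + 1 - 3 * ((J + 1) / 3)) = 0 := by ring
  rw [balance₁, e, zero_div, excess_zero_prob, exceed_zero_prob]
  have h1 := shortfall_nonneg (T := U + 2) (I := J + 1) (by positivity) (end_le_one U J h)
  rw [shortfall_eq] at h1
  have hT : (U : ℝ) + 2 ≠ 0 := by positivity
  have h2 : ((U + 2 : ℕ) : ℝ) * (((J : ℝ) + 1 + (J + 1) / 3) / (U + 2)) = J + 1 + (J + 1) / 3 := by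
    push_cast; field_simp
  rw [h2] at h1
  push_cast at h1
  linarith

theorem balance₂_end (hJ : 1 ≤ J) (h : J + 1 ≤ 3 * (U + 1 - J)) :
    0 ≤ balance₂ U J ((J + 1) / 3) := by
  have e : ((J : ℝ) + 1 - 3 * ((J + 1) / 3)) = 0 := by ring
  rw [balance₂, e, zero_div, exceed_zero_prob, point_eq U J 0, zero_pow (by omega)]
  have h1 := exceed_le_one (T := U + 1) (I := J) (by positivity) (end_le_one U J h)
  linarith

/-- For mean 1 the relevant point probability decreases in `s`, so every term of the third
derivative is nonpositive and the simpler sign lemma suffices. -/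
theorem balance_nonneg_one (hU : 1 ≤ U) {y : ℝ} (hy0 : 0 ≤ y) (hy : y ≤ 1 / 3) :
    0 ≤ balance U 0 y := by
  obtain ⟨m, rfl⟩ := Nat.exists_eq_add_of_le' hU
  have hv : ∀ s, HasDerivAt (point (m + 1) 0) (-((m + 1) * (1 - s) ^ m)) s := by
    intro s
    have h1 : point (m + 1) 0 = fun s => (1 - s) ^ (m + 1) := by
      funext s; rw [point_eq]; simp
    rw [h1]
    refine (((hasDerivAt_id s).const_sub 1).pow (m + 1)).congr_deriv ?_
    simp
  have h := hasDerivAt_balance₂ (m + 1) 0 hv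
  refine nonneg_of_deriv_three_nonpos (hasDerivAt_balance _ _) (hasDerivAt_balance₁ _ _) h
    (balance_zero _ _).ge (balance₁_zero _ _ (by omega)) (by
      have := balance_end (m + 1) 0
      rw [this]) ?_ hy0 (l := (((0 : ℕ) : ℝ) + 1) / 3) (by simpa using hy)
  intro x hx0 hx
  have hm : (0 : ℝ) < ((m + 1 : ℕ) : ℝ) + 2 := by positivity
  simp only [Nat.cast_zero, zero_add] at hx ⊢
  have q0 : 0 ≤ (1 + x) / (((m + 1 : ℕ) : ℝ) + 2) := by positivity
  have q1 : (1 + x) / (((m + 1 : ℕ) : ℝ) + 2) ≤ 1 := by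
    rw [div_le_one hm]; push_cast; linarith [(Nat.cast_nonneg m : (0 : ℝ) ≤ m)]
  have s0 : 0 ≤ (1 - 3 * x) / (((m + 1 : ℕ) : ℝ) + 2) := div_nonneg (by linarith) hm.le
  have s1 : (1 - 3 * x) / (((m + 1 : ℕ) : ℝ) + 2) ≤ 1 := by
    rw [div_le_one hm]; push_cast; linarith [(Nat.cast_nonneg m : (0 : ℝ) ≤ m)]
  have p1 := point_nonneg (T := m + 1) (I := 0) q0 q1
  have p2 := point_nonneg (T := m + 1) (I := 0) s0 s1
  have r1 : 0 ≤ (1 - (1 + x) / (((m + 1 : ℕ) : ℝ) + 2)) ^ m := pow_nonneg (by linarith) _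
  have r2 : 0 ≤ (1 - (1 - 3 * x) / (((m + 1 : ℕ) : ℝ) + 2)) ^ m := pow_nonneg (by linarith) _
  have t1 : 0 ≤ (1 - 3 * x) / (((m + 1 : ℕ) : ℝ) + 2) *
    ((m + 1) * (1 - (1 + x) / (((m + 1 : ℕ) : ℝ) + 2)) ^ m) := by positivity
  have t2 : 0 ≤ 27 * (1 + x) / (((m + 1 : ℕ) : ℝ) + 2) *
    ((m + 1) * (1 - (1 - 3 * x) / (((m + 1 : ℕ) : ℝ) + 2)) ^ m) := by positivity
  refine mul_nonpos_of_nonneg_of_nonpos (by positivity) ?_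
  linarith

end Balance

end

/-! ### Curvature of the ratio of the two terms in the third derivative -/

section

/-- A convex quadratic that is positive at a point and nonpositive at distance `h` to its left is
real-rooted, with a root within distance `h`. The second derivative of its logarithm is minus the
sum of the inverse squared distances to the roots. -/
theorem quad_log_second_le {B B₁ B₂ h : ℝ} (hB : 0 < B) (hh : 0 < h) (h2 : 0 ≤ B₂)
    (hle : B - B₁ * h + B₂ * h ^ 2 / 2 ≤ 0) : (B₂ * B - B₁ ^ 2) / B ^ 2 ≤ -(1 / h ^ 2) := by
  rw [div_le_iff₀ (by positivity), ← sub_nonneg]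
  have h1 : B + B₂ * h ^ 2 / 2 ≤ B₁ * h := by linarith
  have h3 : (B + B₂ * h ^ 2 / 2) ^ 2 ≤ (B₁ * h) ^ 2 := pow_le_pow_left₀ (by positivity) h1 2
  have : -(1 / h ^ 2) * B ^ 2 - (B₂ * B - B₁ ^ 2) =
      ((B₁ * h) ^ 2 - B ^ 2 - B₂ * h ^ 2 * B) / h ^ 2 := by field_simp; ring
  rw [this]
  refine div_nonneg ?_ (by positivity)
  nlinarith [sq_nonneg (B₂ * h ^ 2)]

/-- A concave quadratic that is nonnegative at the points `h` to the left and `k` to the right has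
roots at distances at least `h` and `k`, which bounds minus the second derivative of its logarithm.
-/
theorem quad_log_second_ge {Q Q₁ w h k : ℝ} (hQ : 0 < Q) (hh : 0 < h) (hk : 0 < k) (hw : 0 ≤ w)
    (h1 : 0 ≤ Q - Q₁ * h - w * h ^ 2) (h2 : 0 ≤ Q + Q₁ * k - w * k ^ 2) :
    (Q₁ ^ 2 + 2 * w * Q) / Q ^ 2 ≤ 1 / h ^ 2 + 1 / k ^ 2 := by
  have hwQ : w * h * k ≤ Q := by
    have e1 := mul_nonneg h1 hk.le
    have e2 := mul_nonneg h2 hh.le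
    have : 0 ≤ (h + k) * (Q - w * h * k) := by nlinarith
    have := nonneg_of_mul_nonneg_right this (by positivity)
    linarith
  rw [div_le_iff₀ (by positivity)]
  have e : (1 / h ^ 2 + 1 / k ^ 2) * Q ^ 2 = (Q / h) ^ 2 + (Q / k) ^ 2 := by field_simp
  rw [e]
  rcases le_total 0 Q₁ with h0 | h0
  · have b1 : Q₁ ≤ Q / h - w * h := by
      rw [le_sub_iff_add_le, le_div_iff₀ hh]; nlinarith
    have b2 : Q₁ ^ 2 ≤ (Q / h - w * h) ^ 2 := pow_le_pow_left₀ h0 b1 2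
    have b3 : w * h ≤ Q / k := by rw [le_div_iff₀ hk]; exact hwQ
    have b4 : (w * h) ^ 2 ≤ (Q / k) ^ 2 := pow_le_pow_left₀ (by positivity) b3 2
    have b5 : (Q / h) * (w * h) = w * Q := by field_simp
    nlinarith
  · have b1 : -Q₁ ≤ Q / k - w * k := by
      rw [le_sub_iff_add_le, le_div_iff₀ hk]; nlinarith
    have b2 : (-Q₁) ^ 2 ≤ (Q / k - w * k) ^ 2 := pow_le_pow_left₀ (by linarith) b1 2
    have b3 : w * k ≤ Q / h := by rw [le_div_iff₀ hh]; nlinarith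
    have b4 : (w * k) ^ 2 ≤ (Q / h) ^ 2 := pow_le_pow_left₀ (by positivity) b3 2
    have b5 : (Q / k) * (w * k) = w * Q := by field_simp
    nlinarith

/-- The quadratic factors of the third derivative of the balance. -/
def quadUp (i a y : ℝ) : ℝ := 9 * (a - y) * (i + y) + (i - 3 * y) * (a - i + (a + i - 2) * y)

def quadDown (i a y : ℝ) : ℝ :=
  (i + y) * (i - a + 3 * (a + i - 2) * y) - (i - 3 * y) * (a + 3 * y)

def quadUp₁ (i a y : ℝ) : ℝ :=
  9 * (a - i - 2 * y) - 3 * (a - i + (a + i - 2) * y) + (i - 3 * y) * (a + i - 2)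

def quadDown₁ (i a y : ℝ) : ℝ :=
  (i - a + 3 * (a + i - 2) * y) + 3 * (i + y) * (a + i - 2) + 3 * (a + 3 * y) - 3 * (i - 3 * y)

theorem hasDerivAt_quadUp (i a y : ℝ) : HasDerivAt (quadUp i a) (quadUp₁ i a y) y := by
  have h1 := ((hasDerivAt_id y).const_sub a).const_mul 9
  have h2 := (hasDerivAt_id y).const_add i
  have h3 := ((hasDerivAt_id y).const_mul 3).const_sub i
  have h4 := ((hasDerivAt_id y).const_mul (a + i - 2)).const_add (a - i)
  refine ((h1.mul h2).add (h3.mul h4)).congr_deriv ?_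
  simp only [id, quadUp₁]; ring

theorem hasDerivAt_quadDown (i a y : ℝ) : HasDerivAt (quadDown i a) (quadDown₁ i a y) y := by
  have h2 := (hasDerivAt_id y).const_add i
  have h3 := ((hasDerivAt_id y).const_mul 3).const_sub i
  have h4 := ((hasDerivAt_id y).const_mul (3 * (a + i - 2))).const_add (i - a)
  have h1 := ((hasDerivAt_id y).const_mul 3).const_add a
  refine ((h2.mul h4).sub (h3.mul h1)).congr_deriv ?_
  simp only [id, quadDown₁]; ring

theorem hasDerivAt_quadUp₁ (i a y : ℝ) :
    HasDerivAt (quadUp₁ i a) (-2 * (9 + 3 * (a + i - 2))) y := by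
  have h1 := (((hasDerivAt_id y).const_mul 2).const_sub (a - i)).const_mul 9
  have h3 := (((hasDerivAt_id y).const_mul 3).const_sub i).mul_const (a + i - 2)
  have h4 := (((hasDerivAt_id y).const_mul (a + i - 2)).const_add (a - i)).const_mul 3
  refine ((h1.sub h4).add h3).congr_deriv ?_
  ring

theorem hasDerivAt_quadDown₁ (i a y : ℝ) :
    HasDerivAt (quadDown₁ i a) (6 * (a + i - 2) + 18) y := by
  have h4 := ((hasDerivAt_id y).const_mul (3 * (a + i - 2))).const_add (i - a)
  have h2 := (((hasDerivAt_id y).const_add i).const_mul 3).mul_const (a + i - 2)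
  have h1 := (((hasDerivAt_id y).const_mul 3).const_add a).const_mul 3
  have h3 := (((hasDerivAt_id y).const_mul 3).const_sub i).const_mul 3
  refine (((h4.add h2).add h1).sub h3).congr_deriv ?_
  ring

theorem quadUp_pos {i a y : ℝ} (hi : 2 ≤ i) (ha : 2 ≤ a) (hia : i ≤ 3 * a) (hy0 : 0 < y)
    (hy : 3 * y < i) : 0 < quadUp i a y := by
  have h0 : 0 < quadUp i a 0 := by rw [quadUp]; nlinarith
  have h1 : 0 ≤ quadUp i a (i / 3) := by
    rw [quadUp]
    have : i - 3 * (i / 3) = 0 := by ring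
    rw [this]; nlinarith
  -- The concave quadratic is its chord between 0 and `i / 3` plus a positive multiple of `y (i / 3
  -- - y)`.
  have e : i ^ 2 * quadUp i a y = i * (i - 3 * y) * quadUp i a 0 +
      i * (3 * y) * quadUp i a (i / 3) +
      i ^ 2 * (9 + 3 * (a + i - 2)) * (y * (i / 3 - y)) := by
    simp only [quadUp]; ring
  have h2 : 0 < i * (i - 3 * y) * quadUp i a 0 :=
    mul_pos (mul_pos (by linarith) (by linarith)) h0
  have h3 : 0 ≤ i * (3 * y) * quadUp i a (i / 3) := mul_nonneg (by positivity) h1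
  have h4 : 0 ≤ i ^ 2 * (9 + 3 * (a + i - 2)) * (y * (i / 3 - y)) :=
    mul_nonneg (mul_nonneg (by positivity) (by linarith)) (mul_nonneg hy0.le (by linarith))
  have : 0 < i ^ 2 * quadUp i a y := by linarith
  exact pos_of_mul_pos_right this (by positivity)

/-- Curvature of the logarithm of the ratio of the two terms of the third derivative. -/
def curv (i a y : ℝ) : ℝ :=
  ((6 * (a + i - 2) + 18) * quadDown i a y - quadDown₁ i a y ^ 2) / quadDown i a y ^ 2 +
    (quadUp₁ i a y ^ 2 + 2 * (9 + 3 * (a + i - 2)) * quadUp i a y) / quadUp i a y ^ 2 -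
    (i - 2) * (9 / (i - 3 * y) ^ 2) - (a - 2) * (9 / (a + 3 * y) ^ 2) +
    (i - 2) * (1 / (i + y) ^ 2) + (a - 2) * (1 / (a - y) ^ 2)

/-- `quadDown` is nonpositive and `quadUp` nonnegative at -1, so their contributions 1 / (y + 1)²
cancel. Measured in units of 1 / (i/3 - y)², the rest is at most 1 - (i - 2) + (i - 2)/9 + (8i -
25)/9 = 0. -/
theorem curv_nonpos_of_four_le {i a y : ℝ} (hi : 4 ≤ i) (ha : 2 ≤ a) (hia : i ≤ 3 * a)
    (hy0 : 0 < y) (hy : 3 * y < i) (hB : 0 < quadDown i a y) : curv i a y ≤ 0 := by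
  have hQ := quadUp_pos (by linarith) ha hia hy0 hy
  have hh : 0 < y + 1 := by linarith
  have hk : 0 < i / 3 - y := by linarith
  have b1 := quad_log_second_le (B₁ := quadDown₁ i a y) (B₂ := 6 * (a + i - 2) + 18) hB hh
    (by linarith) (by
      have : quadDown i a y - quadDown₁ i a y * (y + 1) + (6 * (a + i - 2) + 18) * (y + 1) ^ 2 / 2 =
        (i - 1) * (6 - 2 * i - 4 * a) - (i + 3) * (a - 3) := by
        simp only [quadDown, quadDown₁]; ring
      rw [this]; nlinarith)
  have b2 := quad_log_second_ge (Q₁ := quadUp₁ i a y) (w := 9 + 3 * (a + i - 2)) hQ hh hk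
    (by linarith) (by
      have : quadUp i a y - quadUp₁ i a y * (y + 1) - (9 + 3 * (a + i - 2)) * (y + 1) ^ 2 =
        (i - 1) * (9 * a + 3 - 2 * i) := by
        simp only [quadUp, quadUp₁]; ring
      rw [this]; exact mul_nonneg (by linarith) (by linarith)) (by
      have : quadUp i a y + quadUp₁ i a y * (i / 3 - y) -
        (9 + 3 * (a + i - 2)) * (i / 3 - y) ^ 2 = 12 * i * (a - i / 3) := by
        simp only [quadUp, quadUp₁]; ring
      rw [this]; exact mul_nonneg (by linarith) (by linarith))
  have c1 : 9 / (i - 3 * y) ^ 2 = 1 / (i / 3 - y) ^ 2 := by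
    have : i - 3 * y ≠ 0 := by linarith
    have : i - 3 * y = 3 * (i / 3 - y) := by ring
    rw [this, mul_pow]; field_simp; norm_num
  have c2 : 0 ≤ (a - 2) * (9 / (a + 3 * y) ^ 2) := mul_nonneg (by linarith) (by positivity)
  have c3 : (i - 2) * (1 / (i + y) ^ 2) ≤ (i - 2) / 9 * (1 / (i / 3 - y) ^ 2) := by
    have : 1 / (i + y) ^ 2 ≤ 1 / (3 * (i / 3 - y)) ^ 2 :=
      one_div_le_one_div_of_le (by positivity) (pow_le_pow_left₀ (by positivity) (by linarith) 2)
    calc (i - 2) * (1 / (i + y) ^ 2) ≤ (i - 2) * (1 / (3 * (i / 3 - y)) ^ 2) :=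
          mul_le_mul_of_nonneg_left this (by linarith)
      _ = _ := by rw [mul_pow]; field_simp; norm_num
  have hay : 0 < a - y := by linarith
  have c4 : (a - 2) * (1 / (a - y) ^ 2) ≤ (8 * i - 25) / 9 * (1 / (i / 3 - y) ^ 2) := by
    rw [mul_one_div, mul_one_div, div_le_div_iff₀ (by positivity) (by positivity)]
    obtain ⟨g, hg⟩ : ∃ g, g = a - i / 3 := ⟨_, rfl⟩
    obtain ⟨k, hkd⟩ : ∃ k, k = i / 3 - y := ⟨_, rfl⟩
    have hg0 : 0 ≤ g := by linarith
    have e1 : a - 2 = i / 3 + g - 2 := by linarith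
    have e2 : a - y = k + g := by linarith
    rw [← hkd] at hk ⊢
    rw [e1, e2]
    have k1 : g * k * k ≤ g * k * (i / 3) := mul_le_mul_of_nonneg_left (by linarith) (by positivity)
    have k2 : 0 ≤ (8 * i - 25) / 9 * g ^ 2 := mul_nonneg (by linarith) (by positivity)
    have k3 : 0 ≤ ((8 * i - 25) / 9 - (i / 3 - 2)) * k ^ 2 := mul_nonneg (by linarith) (by positivity)
    have k4 : 0 ≤ (2 * ((8 * i - 25) / 9) - i / 3) * (k * g) :=
      mul_nonneg (by linarith) (by positivity)
    nlinarith
  rw [curv, c1]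
  nlinarith

/-- For `i = 3` the budget `8i - 25` of the general case is negative. Instead `quadDown` is
evaluated at 0, and 1 / y² - 1 / (y + 1)² ≥ 3/4 covers the remaining terms, at most 1/9 + 1/4. -/
theorem curv_nonpos_three {a y : ℝ} (ha : 2 ≤ a) (hy0 : 0 < y) (hy : 3 * y < 3)
    (hB : 0 < quadDown 3 a y) : curv 3 a y ≤ 0 := by
  have hQ := quadUp_pos (i := 3) (by norm_num) ha (by linarith) hy0 hy
  have hh : 0 < y + 1 := by linarith
  have hk : 0 < 1 - y := by linarith
  have b1 := quad_log_second_le (B₁ := quadDown₁ 3 a y) (B₂ := 6 * (a + 3 - 2) + 18) hB hy0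
    (by linarith) (by
      have : quadDown 3 a y - quadDown₁ 3 a y * y + (6 * (a + 3 - 2) + 18) * y ^ 2 / 2 =
        3 * (3 - 2 * a) := by
        simp only [quadDown, quadDown₁]; ring
      rw [this]; linarith)
  have b2 := quad_log_second_ge (Q₁ := quadUp₁ 3 a y) (w := 9 + 3 * (a + 3 - 2)) hQ hh hk
    (by linarith) (by
      have : quadUp 3 a y - quadUp₁ 3 a y * (y + 1) - (9 + 3 * (a + 3 - 2)) * (y + 1) ^ 2 =
        2 * (9 * a - 3) := by
        simp only [quadUp, quadUp₁]; ring
      rw [this]; linarith) (by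
      have : quadUp 3 a y + quadUp₁ 3 a y * (1 - y) -
        (9 + 3 * (a + 3 - 2)) * (1 - y) ^ 2 = 36 * (a - 1) := by
        simp only [quadUp, quadUp₁]; ring
      rw [this]; linarith)
  have c1 : 9 / (3 - 3 * y) ^ 2 = 1 / (1 - y) ^ 2 := by
    have : 3 - 3 * y = 3 * (1 - y) := by ring
    rw [this, mul_pow]; field_simp; norm_num
  have c2 : 0 ≤ (a - 2) * (9 / (a + 3 * y) ^ 2) := mul_nonneg (by linarith) (by positivity)
  have c3 : 1 / (3 + y) ^ 2 ≤ 1 / 3 ^ 2 :=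
    one_div_le_one_div_of_le (by positivity) (pow_le_pow_left₀ (by positivity) (by linarith) 2)
  have c4 : (a - 2) * (1 / (a - y) ^ 2) ≤ 1 / 4 := by
    have : 0 < a - y := by linarith
    rw [mul_one_div, div_le_div_iff₀ (by positivity) (by norm_num)]
    nlinarith [sq_nonneg (a - 3), mul_pos hk (by linarith : 0 < a - 1)]
  have c5 : 3 / 4 ≤ 1 / y ^ 2 - 1 / (y + 1) ^ 2 := by
    rw [div_sub_div _ _ (by positivity) (by positivity), div_le_div_iff₀ (by norm_num) (by positivity)]
    have h1 : y ^ 2 * (y + 1) ^ 2 ≤ y ^ 2 * 4 := by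
      refine mul_le_mul_of_nonneg_left ?_ (by positivity)
      nlinarith
    nlinarith
  rw [curv, c1, show (3 : ℝ) - 2 = 1 by norm_num]
  have c6 : (1 : ℝ) / 3 ^ 2 = 1 / 9 := by norm_num
  rw [c6] at c3
  linarith

/-- Logarithm of the ratio of the two terms of the third derivative, and its derivative. -/
def logRatio (i a y : ℝ) : ℝ := Real.log (quadDown i a y) - Real.log (quadUp i a y) +
      (i - 2) * Real.log (i - 3 * y) + (a - 2) * Real.log (a + 3 * y) -
      (i - 2) * Real.log (i + y) - (a - 2) * Real.log (a - y)

def logRatio₁ (i a y : ℝ) : ℝ := quadDown₁ i a y / quadDown i a y - quadUp₁ i a y / quadUp i a y +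
      (i - 2) * (-3 / (i - 3 * y)) + (a - 2) * (3 / (a + 3 * y)) -
      (i - 2) * (1 / (i + y)) - (a - 2) * (-1 / (a - y))

theorem hasDerivAt_logRatio {i a y : ℝ} (hB : 0 < quadDown i a y) (hQ : 0 < quadUp i a y)
    (h1 : 0 < i - 3 * y) (h2 : 0 < a + 3 * y) (h3 : 0 < i + y) (h4 : 0 < a - y) :
    HasDerivAt (logRatio i a) (logRatio₁ i a y) y := by
  have d1 : HasDerivAt (fun y => i - 3 * y) (-3) y := by
    simpa using ((hasDerivAt_id y).const_mul 3).const_sub i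
  have d2 : HasDerivAt (fun y => a + 3 * y) 3 y := by
    simpa using ((hasDerivAt_id y).const_mul 3).const_add a
  have d3 : HasDerivAt (fun y => i + y) 1 y := (hasDerivAt_id y).const_add i
  have d4 : HasDerivAt (fun y => a - y) (-1) y := (hasDerivAt_id y).const_sub a
  exact ((((((hasDerivAt_quadDown i a y).log hB.ne').sub ((hasDerivAt_quadUp i a y).log hQ.ne')).add
    ((d1.log h1.ne').const_mul _)).add ((d2.log h2.ne').const_mul _)).sub
    ((d3.log h3.ne').const_mul _)).sub ((d4.log h4.ne').const_mul _)

theorem hasDerivAt_logRatio₁ {i a y : ℝ} (hB : 0 < quadDown i a y) (hQ : 0 < quadUp i a y)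
    (h1 : 0 < i - 3 * y) (h2 : 0 < a + 3 * y) (h3 : 0 < i + y) (h4 : 0 < a - y) :
    HasDerivAt (logRatio₁ i a) (curv i a y) y := by
  have d1 : HasDerivAt (fun y => i - 3 * y) (-3) y := by
    simpa using ((hasDerivAt_id y).const_mul 3).const_sub i
  have d2 : HasDerivAt (fun y => a + 3 * y) 3 y := by
    simpa using ((hasDerivAt_id y).const_mul 3).const_add a
  have d3 : HasDerivAt (fun y => i + y) 1 y := (hasDerivAt_id y).const_add i
  have d4 : HasDerivAt (fun y => a - y) (-1) y := (hasDerivAt_id y).const_sub a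
  have e1 := (hasDerivAt_quadDown₁ i a y).div (hasDerivAt_quadDown i a y) hB.ne'
  have e2 := (hasDerivAt_quadUp₁ i a y).div (hasDerivAt_quadUp i a y) hQ.ne'
  have k1 := ((hasDerivAt_const y (-3 : ℝ)).div d1 h1.ne').const_mul (i - 2)
  have k2 := ((hasDerivAt_const y (3 : ℝ)).div d2 h2.ne').const_mul (a - 2)
  have k3 := ((hasDerivAt_const y (1 : ℝ)).div d3 h3.ne').const_mul (i - 2)
  have k4 := ((hasDerivAt_const y (-1 : ℝ)).div d4 h4.ne').const_mul (a - 2)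
  refine (((((e1.sub e2).add k1).add k2).sub k3).sub k4).congr_deriv ?_
  rw [curv]
  ring

/-- `quadDown` is convex and nonpositive at -1, so it increases once it has become positive. -/
theorem quadDown_pos_of_le {i a x y : ℝ} (hi : 2 ≤ i) (ha : 2 ≤ a) (hx : 0 < x) (hxy : x ≤ y)
    (h : 0 < quadDown i a x) : 0 < quadDown i a y := by
  have h0 : quadDown i a 0 = i * (i - 2 * a) := by rw [quadDown]; ring
  have hm : quadDown i a (-1) ≤ 0 := by rw [quadDown]; nlinarith
  have hd : quadDown i a x - quadDown i a (-1) = (x + 1) * (quadDown₁ i a 0 +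
      (3 * (a + i - 2) + 9) * (x - 1)) := by
    simp only [quadDown, quadDown₁]; ring
  have hd2 : quadDown i a y - quadDown i a x = (y - x) * (quadDown₁ i a 0 +
      (3 * (a + i - 2) + 9) * (x + y)) := by
    simp only [quadDown, quadDown₁]; ring
  have h1 : 0 < quadDown₁ i a 0 + (3 * (a + i - 2) + 9) * (x - 1) := by
    have : 0 < (x + 1) * (quadDown₁ i a 0 + (3 * (a + i - 2) + 9) * (x - 1)) := by linarith
    exact pos_of_mul_pos_right this (by linarith)
  have h2 : 0 ≤ (3 * (a + i - 2) + 9) * (y + 1) := mul_nonneg (by linarith) (by linarith)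
  have h3 : 0 ≤ (y - x) * (quadDown₁ i a 0 + (3 * (a + i - 2) + 9) * (x + y)) :=
    mul_nonneg (by linarith) (by linarith)
  linarith

end

/-! ### Comparison in the regime I ≤ 3 (T - I) -/

section

theorem curv_nonpos {K : ℕ} (hK : 1 ≤ K) {a y : ℝ} (ha : 2 ≤ a) (hia : (K : ℝ) + 2 ≤ 3 * a)
    (hy0 : 0 < y) (hy : 3 * y < K + 2) (hB : 0 < quadDown (K + 2) a y) : curv (K + 2) a y ≤ 0 := by
  rcases hK.eq_or_lt with h | h
  · subst h
    have e : ((1 : ℕ) : ℝ) + 2 = 3 := by norm_num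
    rw [e] at hy hB ⊢
    exact curv_nonpos_three ha hy0 hy hB
  · have h1 : (2 : ℝ) ≤ K := by exact_mod_cast h
    exact curv_nonpos_of_four_le (by linarith) ha hia hy0 hy hB

/-- The logarithm of the ratio of the two terms is concave by `curv_nonpos`, so it exceeds -log 27
between two points at which it does. Here `K = I - 2` and `m = T - I - 2`. -/
theorem third_pattern {K m : ℕ} {x y z : ℝ} (hia : (K : ℝ) + 2 ≤ 3 * (m + 2)) (hx : 0 < x)
    (hxy : x < y) (hyz : y < z) (hz : 3 * z < K + 2)
    (h1 : (K + 2 + x) ^ K * (m + 2 - x) ^ m * quadUp (K + 2) (m + 2) x <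
      27 * ((K + 2 - 3 * x) ^ K * (m + 2 + 3 * x) ^ m * quadDown (K + 2) (m + 2) x))
    (h3 : (K + 2 + z) ^ K * (m + 2 - z) ^ m * quadUp (K + 2) (m + 2) z <
      27 * ((K + 2 - 3 * z) ^ K * (m + 2 + 3 * z) ^ m * quadDown (K + 2) (m + 2) z)) :
    (K + 2 + y) ^ K * (m + 2 - y) ^ m * quadUp (K + 2) (m + 2) y ≤
      27 * ((K + 2 - 3 * y) ^ K * (m + 2 + 3 * y) ^ m * quadDown (K + 2) (m + 2) y) := by
  obtain ⟨a, ha⟩ : ∃ a : ℝ, a = m + 2 := ⟨_, rfl⟩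
  have hm0 : (0 : ℝ) ≤ m := Nat.cast_nonneg m
  have hK0 : (0 : ℝ) ≤ K := Nat.cast_nonneg K
  have ha2 : 2 ≤ a := by linarith
  have hma : (m : ℝ) = a - 2 := by linarith
  have hQ : ∀ t, 0 < t → t ≤ z → 0 < quadUp (K + 2) a t := fun t h0 ht =>
    quadUp_pos (by linarith) ha2 (by linarith) h0 (by linarith)
  rw [← ha] at hia h1 h3 ⊢
  have hBx : 0 < quadDown (K + 2) a x := by
    by_contra! hc
    have e1 : 0 ≤ (K + 2 + x) ^ K * (a - x) ^ m * quadUp (K + 2) a x :=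
      mul_nonneg (mul_nonneg (pow_nonneg (by linarith) _) (pow_nonneg (by linarith) _))
        (hQ x hx (by linarith)).le
    have e2 : (K + 2 - 3 * x) ^ K * (a + 3 * x) ^ m * quadDown (K + 2) a x ≤ 0 :=
      mul_nonpos_of_nonneg_of_nonpos
        (mul_nonneg (pow_nonneg (by linarith) _) (pow_nonneg (by linarith) _)) hc
    linarith
  have hB : ∀ t, x ≤ t → 0 < quadDown (K + 2) a t := fun t ht =>
    quadDown_pos_of_le (by linarith) ha2 hx ht hBx
  -- For `K = 0` the curvature bound is not at hand, but the ratio is nondecreasing: its power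
  -- factors are monotone, and the quotient of the quadratics is by cross multiplication.
  rcases Nat.eq_zero_or_pos K with h | h
  · subst h
    simp only [Nat.cast_zero, zero_add, pow_zero, one_mul] at *
    have hQx := hQ x hx (by linarith)
    have hQy := hQ y (by linarith) hyz.le
    have hcross : quadDown 2 a x * quadUp 2 a y ≤ quadDown 2 a y * quadUp 2 a x := by
      have e : quadDown 2 a y * quadUp 2 a x - quadDown 2 a x * quadUp 2 a y =
          (y - x) * (((8 * a - 4) * (20 * a - 4) + (4 * a - 4) * (8 * a - 12)) +
            (3 * a + 9) * (16 * a) * (x + y) + (3 * a + 9) * (16 * a - 16) * (x * y)) := by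
        simp only [quadDown, quadUp]; ring
      have p1 : 0 ≤ (8 * a - 4) * (20 * a - 4) + (4 * a - 4) * (8 * a - 12) := by nlinarith
      have p2 : 0 ≤ (3 * a + 9) * (16 * a) * (x + y) := by
        have : 0 < x + y := by linarith
        positivity
      have p3 : 0 ≤ (3 * a + 9) * (16 * a - 16) * (x * y) :=
        mul_nonneg (mul_nonneg (by linarith) (by linarith))
          (mul_nonneg hx.le (by linarith))
      have := mul_nonneg (by linarith : 0 ≤ y - x) (by linarith : 0 ≤
        ((8 * a - 4) * (20 * a - 4) + (4 * a - 4) * (8 * a - 12)) +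
            (3 * a + 9) * (16 * a) * (x + y) + (3 * a + 9) * (16 * a - 16) * (x * y))
      linarith
    have s1 : (a - y) ^ m ≤ (a - x) ^ m := pow_le_pow_left₀ (by linarith) (by linarith) m
    have s2 : (a + 3 * x) ^ m ≤ (a + 3 * y) ^ m := pow_le_pow_left₀ (by linarith) (by linarith) m
    refine le_of_mul_le_mul_right ?_ hQx
    calc (a - y) ^ m * quadUp 2 a y * quadUp 2 a x
        ≤ (a - x) ^ m * quadUp 2 a y * quadUp 2 a x := by gcongr
      _ = (a - x) ^ m * quadUp 2 a x * quadUp 2 a y := by ring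
      _ ≤ 27 * ((a + 3 * x) ^ m * quadDown 2 a x) * quadUp 2 a y := by gcongr
      _ ≤ 27 * ((a + 3 * y) ^ m * quadDown 2 a x) * quadUp 2 a y := by gcongr
      _ = 27 * (a + 3 * y) ^ m * (quadDown 2 a x * quadUp 2 a y) := by ring
      _ ≤ 27 * (a + 3 * y) ^ m * (quadDown 2 a y * quadUp 2 a x) := by
          have h27 : 0 ≤ 27 * (a + 3 * y) ^ m := mul_nonneg (by norm_num) (pow_nonneg (by linarith) _)
          exact mul_le_mul_of_nonneg_left hcross h27
      _ = _ := by ring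
  · have e2 : ((K : ℝ) + 2) - 2 = K := by ring
    set F : ℝ → ℝ := logRatio (K + 2) a with hF
    have hconc : ConcaveOn ℝ (Set.Icc x z) F := by
      refine concaveOn_of_hasDerivWithinAt2_nonpos (f' := logRatio₁ (K + 2) a)
        (f'' := curv (K + 2) a) (convex_Icc x z) ?_ (fun t ht => ?_)
        (fun t ht => ?_) (fun t ht => ?_)
      · intro t ht
        exact (hasDerivAt_logRatio (hB t ht.1) (hQ t (by linarith [ht.1]) ht.2)
          (by linarith [ht.2]) (by linarith [ht.1]) (by linarith [ht.1])
          (by linarith [ht.2])).continuousAt.continuousWithinAt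
      · rw [interior_Icc] at ht
        exact (hasDerivAt_logRatio (hB t ht.1.le) (hQ t (by linarith [ht.1]) ht.2.le)
          (by linarith [ht.2]) (by linarith [ht.1]) (by linarith [ht.1])
          (by linarith [ht.2])).hasDerivWithinAt
      · rw [interior_Icc] at ht
        exact (hasDerivAt_logRatio₁ (hB t ht.1.le) (hQ t (by linarith [ht.1]) ht.2.le)
          (by linarith [ht.2]) (by linarith [ht.1]) (by linarith [ht.1])
          (by linarith [ht.2])).hasDerivWithinAt
      · rw [interior_Icc] at ht
        exact curv_nonpos h ha2 hia (by linarith [ht.1]) (by linarith [ht.2]) (hB t ht.1.le)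
    have hexp : ∀ t, x ≤ t → t ≤ z → F t =
        Real.log ((K + 2 - 3 * t) ^ K * (a + 3 * t) ^ m * quadDown (K + 2) a t) -
        Real.log ((K + 2 + t) ^ K * (a - t) ^ m * quadUp (K + 2) a t) := by
      intro t h1 h2
      have p1 := pow_pos (by linarith : 0 < (K : ℝ) + 2 - 3 * t) K
      have p2 := pow_pos (by linarith : 0 < a + 3 * t) m
      have p3 := pow_pos (by linarith : 0 < (K : ℝ) + 2 + t) K
      have p4 := pow_pos (by linarith : 0 < a - t) m
      have p5 := hB t h1
      have p6 := hQ t (by linarith) h2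
      rw [Real.log_mul (by positivity) (by positivity), Real.log_mul (by positivity) (by positivity),
        Real.log_mul (by positivity) (by positivity), Real.log_mul (by positivity) (by positivity),
        Real.log_pow, Real.log_pow, Real.log_pow, Real.log_pow, hF, logRatio, hma, e2]
      ring
    have hpos : ∀ t, x ≤ t → t ≤ z →
        0 < (K + 2 - 3 * t) ^ K * (a + 3 * t) ^ m * quadDown (K + 2) a t ∧
        0 < (K + 2 + t) ^ K * (a - t) ^ m * quadUp (K + 2) a t := by
      intro t h1 h2
      exact ⟨mul_pos (mul_pos (pow_pos (by linarith) K) (pow_pos (by linarith) m)) (hB t h1),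
        mul_pos (mul_pos (pow_pos (by linarith) K) (pow_pos (by linarith) m))
          (hQ t (by linarith) h2)⟩
    have hge : ∀ t, x ≤ t → t ≤ z → (K + 2 + t) ^ K * (a - t) ^ m * quadUp (K + 2) a t <
        27 * ((K + 2 - 3 * t) ^ K * (a + 3 * t) ^ m * quadDown (K + 2) a t) →
        -Real.log 27 < F t := by
      intro t h1 h2 h3
      have := hpos t h1 h2
      have h4 := Real.log_lt_log this.2 h3
      rw [Real.log_mul (by norm_num) this.1.ne'] at h4
      rw [hexp t h1 h2]; linarith
    have hmin := hconc.min_le_of_mem_Icc ⟨le_rfl, by linarith⟩ ⟨by linarith, le_rfl⟩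
      (⟨hxy.le, hyz.le⟩ : y ∈ Set.Icc x z)
    have hFy : -Real.log 27 < F y :=
      (lt_min (hge x le_rfl (by linarith) h1) (hge z (by linarith) le_rfl h3)).trans_le hmin
    have := hpos y hxy.le hyz.le
    rw [hexp y hxy.le hyz.le] at hFy
    refine ((Real.log_le_log_iff this.2 (by linarith)).mp ?_)
    rw [Real.log_mul (by norm_num) this.1.ne']
    linarith

theorem hasDerivAt_point_mid (K m : ℕ) (s : ℝ) :
    HasDerivAt (point (K + m + 2) (K + 1)) ((K + m + 2).choose (K + 1) *
      (s ^ K * (1 - s) ^ m * ((K + 1) * (1 - s) - (m + 1) * s))) s := by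
  have h1 : point (K + m + 2) (K + 1) =
      fun s => ((K + m + 2).choose (K + 1) : ℝ) * (s ^ (K + 1) * (1 - s) ^ (m + 1)) := by
    funext s; rw [point_eq, show K + m + 2 - (K + 1) = m + 1 by omega]; ring
  rw [h1]
  refine ((((hasDerivAt_id s).pow (K + 1)).mul
    (((hasDerivAt_id s).const_sub 1).pow (m + 1))).const_mul _).congr_deriv ?_
  simp only [id, Pi.pow_apply, Nat.add_sub_cancel]
  push_cast
  ring

/-- The sign-pattern lemma, with the boundary values above and `third_pattern` for the third
derivative. -/
theorem balance_nonneg_mid (K m : ℕ) (hia : K + 2 ≤ 3 * (m + 2)) {y : ℝ} (hy0 : 0 ≤ y)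
    (hy : 3 * y ≤ K + 2) : 0 ≤ balance (K + m + 2) (K + 1) y := by
  have hia' : (K : ℝ) + 2 ≤ 3 * (m + 2) := by exact_mod_cast hia
  have hT : (0 : ℝ) < ((K + m + 2 : ℕ) : ℝ) + 2 := by positivity
  have h := hasDerivAt_balance₂ (K + m + 2) (K + 1) (hasDerivAt_point_mid K m)
  -- After clearing denominators the third derivative is a positive constant times the difference
  -- compared in `third_pattern`.
  obtain ⟨κ, hκ, hN⟩ : ∃ κ : ℝ, 0 < κ ∧ ∀ y : ℝ, ((K + m + 2 : ℕ) + 1 : ℝ) / ((K + m + 2 : ℕ) + 2) *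
      (-9 * point (K + m + 2) (K + 1) (((K + 1 : ℕ) + 1 + y) / ((K + m + 2 : ℕ) + 2)) +
        ((K + 1 : ℕ) + 1 - 3 * y) / ((K + m + 2 : ℕ) + 2) * ((K + m + 2).choose (K + 1) *
      ((((K + 1 : ℕ) + 1 + y) / ((K + m + 2 : ℕ) + 2)) ^ K *
        (1 - (((K + 1 : ℕ) + 1 + y) / ((K + m + 2 : ℕ) + 2))) ^ m *
        ((K + 1) * (1 - (((K + 1 : ℕ) + 1 + y) / ((K + m + 2 : ℕ) + 2))) -
        (m + 1) * (((K + 1 : ℕ) + 1 + y) / ((K + m + 2 : ℕ) + 2))))) -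
        27 * point (K + m + 2) (K + 1) (((K + 1 : ℕ) + 1 - 3 * y) / ((K + m + 2 : ℕ) + 2)) +
        27 * ((K + 1 : ℕ) + 1 + y) / ((K + m + 2 : ℕ) + 2) * ((K + m + 2).choose (K + 1) *
      ((((K + 1 : ℕ) + 1 - 3 * y) / ((K + m + 2 : ℕ) + 2)) ^ K *
        (1 - (((K + 1 : ℕ) + 1 - 3 * y) / ((K + m + 2 : ℕ) + 2))) ^ m *
        ((K + 1) * (1 - (((K + 1 : ℕ) + 1 - 3 * y) / ((K + m + 2 : ℕ) + 2))) -
        (m + 1) * (((K + 1 : ℕ) + 1 - 3 * y) / ((K + m + 2 : ℕ) + 2)))))) =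
      κ * (27 * ((K + 2 - 3 * y) ^ K * (m + 2 + 3 * y) ^ m * quadDown (K + 2) (m + 2) y) -
        (K + 2 + y) ^ K * (m + 2 - y) ^ m * quadUp (K + 2) (m + 2) y) := by
    obtain ⟨τ, hτ⟩ : ∃ τ : ℝ, τ = ((K + m + 2 : ℕ) : ℝ) + 2 := ⟨_, rfl⟩
    rw [← hτ] at hT ⊢
    refine ⟨((K + m + 2 : ℕ) + 1 : ℝ) / τ * (K + m + 2).choose (K + 1) / τ ^ (K + m + 2), ?_,
      fun y => ?_⟩
    · have : 0 < (K + m + 2).choose (K + 1) := Nat.choose_pos (by omega)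
      positivity
    · have e3 : τ = K + m + 4 := by rw [hτ]; push_cast; ring
      have f1 : 1 - ((K + 1 : ℕ) + 1 + y) / τ = (m + 2 - y) / τ := by
        field_simp; rw [e3]; push_cast; ring
      have f2 : 1 - ((K + 1 : ℕ) + 1 - 3 * y) / τ = (m + 2 + 3 * y) / τ := by
        field_simp; rw [e3]; push_cast; ring
      have f3 : ((K + 1 : ℕ) : ℝ) + 1 + y = K + 2 + y := by push_cast; ring
      have f4 : ((K + 1 : ℕ) : ℝ) + 1 - 3 * y = K + 2 - 3 * y := by push_cast; ring
      rw [point_eq, point_eq, show K + m + 2 - (K + 1) = m + 1 by omega, f1, f2, f3, f4]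
      simp only [quadUp, quadDown, div_pow, pow_succ, pow_add]
      field_simp
      ring
  have hend := balance₂_end (K + m + 2) (K + 1) (by omega) (by omega)
  refine nonneg_of_deriv_three_pattern (hasDerivAt_balance _ _) (hasDerivAt_balance₁ _ _) h
    (balance_zero _ _).ge (balance₁_zero _ _ (by omega)) (balance_end _ _).ge
    (balance₁_end _ _ (by omega)) hend ?_ hy0 (by push_cast; linarith)
  intro x y z hx hxy hyz hz h1 h3
  push_cast at hz
  rw [hN] at h1 h3
  rw [hN]
  have h1' := pos_of_mul_pos_right h1 hκ.le
  have h3' := pos_of_mul_pos_right h3 hκ.le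
  exact mul_nonneg hκ.le (sub_nonneg.mpr (third_pattern hia' hx hxy hyz (by linarith)
    (sub_pos.mp h1') (sub_pos.mp h3')))

theorem balance_eq {T I U J : ℕ} (hT : T = U + 2) (hI : I = J + 1) (y : ℝ) :
    balance U J y = (I - 3 * y) * shortfall T I ((I + y) / T) -
      (I + y) * excess T I ((I - 3 * y) / T) := by
  subst hT hI
  rw [balance, shortfall_eq]
  have : ((U + 2 : ℕ) : ℝ) * (((J + 1 : ℕ) + y) / (U + 2 : ℕ)) = (J + 1 : ℕ) + y := by
    field_simp
  rw [this]
  push_cast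
  ring

theorem inflated_le_shortfall_mid {T I : ℕ} (hI : 1 ≤ I) (hIT : I + 2 ≤ T) (h3 : I ≤ 3 * (T - I))
    {y : ℝ} (hy0 : 0 ≤ y) (hy : 3 * y < I) :
    inflated T I (I - 3 * y) ((I + y) / T) ≤ shortfall T I ((I + y) / T) := by
  have hT0 : (0 : ℝ) < T := by exact_mod_cast (by omega : 0 < T)
  have key : 0 ≤ (I - 3 * y) * shortfall T I ((I + y) / T) -
      (I + y) * excess T I ((I - 3 * y) / T) := by
    rcases hI.eq_or_lt with h | h
    · rw [← balance_eq (U := T - 2) (J := 0) (by omega) (by omega)]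
      exact balance_nonneg_one _ (by omega) hy0 (by rw [← h] at hy; push_cast at hy; linarith)
    · obtain ⟨K, rfl⟩ := Nat.exists_eq_add_of_le' (show 2 ≤ I from h)
      obtain ⟨m, rfl⟩ := Nat.exists_eq_add_of_le hIT
      rw [← balance_eq (U := K + m + 2) (J := K + 1) (by omega) (by omega)]
      exact balance_nonneg_mid K m (by omega) hy0 (by push_cast at hy; linarith)
  have h1 : (0 : ℝ) < I - 3 * y := by linarith
  have e : inflated T I (I - 3 * y) ((I + y) / T) =
      (I + y) * excess T I ((I - 3 * y) / T) / (I - 3 * y) := by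
    rw [inflated]; field_simp
  rw [e, div_le_iff₀ h1]
  linarith

end

/-! ### Comparison term by term -/

section

theorem log_le_half_sub_inv {t : ℝ} (ht : 1 ≤ t) : Real.log t ≤ (t - t⁻¹) / 2 := by
  rw [← Real.sinh_log (by linarith)]
  exact Real.self_le_sinh_iff.mpr (Real.log_nonneg ht)

theorem half_sub_inv_le_log {t : ℝ} (h0 : 0 < t) (ht : t ≤ 1) : (t - t⁻¹) / 2 ≤ Real.log t := by
  rw [← Real.sinh_log h0]
  exact Real.sinh_le_self_iff.mpr (Real.log_nonpos h0.le ht)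

theorem two_mul_div_le_log {t : ℝ} (ht : 1 ≤ t) : 2 * (t - 1) / (t + 1) ≤ Real.log t := by
  have h := Real.le_log_one_add_of_nonneg (sub_nonneg.mpr ht)
  rw [show t - 1 + 2 = t + 1 by ring, show 1 + (t - 1) = t by ring] at h
  exact h

theorem bern_eq_sum (s : ℝ) (T : ℕ) (f : ℕ → ℝ) :
    bern s T f = ∑ j ∈ Finset.range (T + 1), f j * point T j s := by
  have h : ∀ S : Finset ℕ, bern s T (fun k => ∑ j ∈ S, f j * (if k = j then 1 else 0)) =
      ∑ j ∈ S, f j * point T j s := by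
    intro S
    induction S using Finset.induction_on with
    | empty => simpa using bern_const s T 0
    | insert a S ha ih =>
      simp only [Finset.sum_insert ha]
      rw [bern_add, bern_const_mul, ih]; rfl
  rw [← h]
  refine bern_congr _ _ fun k hk => ?_
  simp [Finset.sum_ite_eq, Nat.lt_succ_of_le hk]

theorem excess_eq_sum (I a : ℕ) (s : ℝ) :
    excess (I + a) I s = ∑ k ∈ Finset.range (a + 1), k * point (I + a) (I + k) s := by
  rw [excess, bern_eq_sum, add_assoc, Finset.sum_range_add]
  rw [Finset.sum_eq_zero, zero_add]
  · refine Finset.sum_congr rfl fun k _ => ?_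
    rw [Nat.add_sub_cancel_left]
  · intro k hk
    rw [Nat.sub_eq_zero_of_le (Finset.mem_range.mp hk).le]; simp

theorem shortfall_eq_sum (I a : ℕ) (s : ℝ) :
    shortfall (I + a) I s = ∑ k ∈ Finset.range (I + 1), k * point (I + a) (I - k) s := by
  rw [shortfall, bern_eq_sum, show I + a + 1 = I + 1 + a by omega, Finset.sum_range_add,
    ← Finset.sum_flip]
  rw [Finset.sum_eq_zero (s := Finset.range a), add_zero]
  · refine Finset.sum_congr rfl fun k hk => ?_
    rw [Nat.sub_sub_self (Nat.lt_succ_iff.mp (Finset.mem_range.mp hk))]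
  · intro k _
    rw [Nat.sub_eq_zero_of_le (by omega)]; simp

theorem point_ratio {T j : ℕ} (hj : j < T) (s : ℝ) :
    point T (j + 1) s * ((j + 1) * (1 - s)) = point T j s * ((T - j : ℕ) * s) := by
  obtain ⟨d, rfl⟩ := Nat.exists_eq_add_of_le (show j + 1 ≤ T from hj)
  have hc : ((j + 1 + d).choose (j + 1) : ℝ) * (j + 1) = (j + 1 + d).choose j * (d + 1) := by
    have := Nat.choose_succ_right_eq (j + 1 + d) j
    rw [show j + 1 + d - j = d + 1 by omega] at this
    exact_mod_cast this
  rw [point_eq, point_eq, show j + 1 + d - (j + 1) = d by omega,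
    show j + 1 + d - j = d + 1 by omega]
  push_cast
  calc _ = ((j + 1 + d).choose (j + 1) * (j + 1 : ℝ)) * (s ^ (j + 1) * (1 - s) ^ (d + 1)) := by ring
    _ = _ := by rw [hc]; ring

/-- Pairs the excess term at I + k with the shortfall term at I - k. `h1` is the case k = 1, and the
ratios of consecutive terms carry it to larger k. The shortfall sum is longer because `a ≤ I`, and
its extra terms are nonnegative. -/
theorem inflated_le_shortfall_of_terms {I a : ℕ} (haI : a ≤ I) {b q : ℝ} (hb0 : 0 < b)
    (hbT : b < I + a) (hq0 : 0 < q) (hq1 : q < 1)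
    (h1 : q / (b / (I + a)) * point (I + a) (I + 1) (b / (I + a)) ≤ point (I + a) (I - 1) q)
    (h2 : (a : ℝ) ^ 2 + a - 2 ≤ (I + a) * (1 - q) * (I + a - b))
    (h3 : (I + a) * q * b ≤ (I : ℝ) ^ 2 + I - 2) :
    inflated (I + a) I b q ≤ shortfall (I + a) I q := by
  have hT0 : (0 : ℝ) < I + a := hb0.trans hbT
  obtain ⟨σ, hσ⟩ : ∃ σ, σ = b / ((I : ℝ) + a) := ⟨_, rfl⟩
  have hσ0 : 0 < σ := by rw [hσ]; positivity
  have hσ1 : σ < 1 := by rw [hσ, div_lt_one hT0]; exact hbT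
  have hbσ : b = (I + a) * σ := by rw [hσ]; field_simp
  rw [← hσ] at h1
  have hterm : ∀ k, k + 1 ≤ a → q / σ * point (I + a) (I + (k + 1)) σ ≤
      point (I + a) (I - (k + 1)) q := by
    intro k
    induction k with
    | zero => exact fun _ => h1
    | succ k ih =>
      intro hk
      have ih := ih (by omega)
      have r1 := point_ratio (T := I + a) (j := I + (k + 1)) (by omega) σ
      have r2 := point_ratio (T := I + a) (j := I - (k + 1 + 1)) (by omega) q
      rw [show I - (k + 1 + 1) + 1 = I - (k + 1) by omega] at r2
      rw [show I + (k + 1) + 1 = I + (k + 1 + 1) by omega] at r1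
      obtain ⟨i', hi'⟩ := Nat.exists_eq_add_of_le (show k + 1 + 1 ≤ I by omega)
      obtain ⟨a', ha'⟩ := Nat.exists_eq_add_of_le (show k + 1 + 1 ≤ a by omega)
      have c1 : ((I + a - (I + (k + 1)) : ℕ) : ℝ) = a' + 1 := by
        rw [show I + a - (I + (k + 1)) = a' + 1 by omega]; push_cast; ring
      have c2 : ((I + a - (I - (k + 1 + 1)) : ℕ) : ℝ) = a + k + 2 := by
        rw [show I + a - (I - (k + 1 + 1)) = a + k + 2 by omega]; push_cast; ring
      have c3 : ((I - (k + 1 + 1) : ℕ) : ℝ) = i' := by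
        rw [show I - (k + 1 + 1) = i' by omega]
      rw [c1] at r1
      rw [c2, c3] at r2
      have hIr : (I : ℝ) = k + 2 + i' := by rw [hi']; push_cast; ring
      have har : (a : ℝ) = k + 2 + a' := by rw [ha']; push_cast; ring
      push_cast at r1
      obtain ⟨P0, hP0⟩ : ∃ P0, P0 = point (I + a) (I - (k + 1)) q := ⟨_, rfl⟩
      obtain ⟨P1, hP1⟩ : ∃ P1, P1 = point (I + a) (I - (k + 1 + 1)) q := ⟨_, rfl⟩
      obtain ⟨D0, hD0⟩ : ∃ D0, D0 = point (I + a) (I + (k + 1)) σ := ⟨_, rfl⟩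
      obtain ⟨D1, hD1⟩ : ∃ D1, D1 = point (I + a) (I + (k + 1 + 1)) σ := ⟨_, rfl⟩
      have P1n : 0 ≤ P1 := by rw [hP1]; exact point_nonneg hq0.le hq1.le
      rw [← hP0, ← hD0] at ih
      rw [← hD0, ← hD1] at r1
      rw [← hP0, ← hP1] at r2
      rw [← hP1, ← hD1]
      have hk0 : (0 : ℝ) ≤ k := Nat.cast_nonneg k
      -- Of all ratio conditions the first is the strictest: (a² + a - κ) / (I² + I - κ) decreases
      -- in κ = (k + 1)(k + 2) because a ≤ I. `h2` and `h3` bound the numerator and the denominator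
      -- at κ = 2.
      have hcross : ((a' : ℝ) + 1) * (a + k + 2) * (q * σ) ≤
          (i' + 1) * (I + (k + 1) + 1) * ((1 - q) * (1 - σ)) := by
        have e1 : ((a' : ℝ) + 1) * (a + k + 2) = a ^ 2 + a - (k + 1) * (k + 2) := by
          rw [har]; ring
        have e2 : ((i' : ℝ) + 1) * (I + (k + 1) + 1) = I ^ 2 + I - (k + 1) * (k + 2) := by
          rw [hIr]; ring
        have haI' : (a : ℝ) ≤ I := by exact_mod_cast haI
        have g1 : ((a : ℝ) ^ 2 + a - (k + 1) * (k + 2)) * (I ^ 2 + I - 2) ≤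
            (I ^ 2 + I - (k + 1) * (k + 2)) * (a ^ 2 + a - 2) := by
          have : 0 ≤ ((k : ℝ) ^ 2 + 3 * k) * ((I ^ 2 + I) - (a ^ 2 + a)) := by
            refine mul_nonneg (by positivity) ?_
            have : (a : ℝ) ^ 2 ≤ I ^ 2 := pow_le_pow_left₀ (Nat.cast_nonneg a) haI' 2
            linarith
          nlinarith
        have n1 : 0 ≤ (a : ℝ) ^ 2 + a - (k + 1) * (k + 2) := by rw [← e1]; positivity
        have n2 : 0 ≤ (I : ℝ) ^ 2 + I - (k + 1) * (k + 2) := by rw [← e2]; positivity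
        rw [e1, e2]
        have g2 := mul_le_mul_of_nonneg_left h3 n1
        have g3 := mul_le_mul_of_nonneg_left h2 n2
        have e3 : (I + a) * q * b = (I + a) ^ 2 * (q * σ) := by rw [hbσ]; ring
        have e4 : (I + a) * (1 - q) * (I + a - b) = (I + a) ^ 2 * ((1 - q) * (1 - σ)) := by
          rw [hbσ]; ring
        rw [e3] at g2
        rw [e4] at g3
        have hT2 : (0 : ℝ) < (I + a) ^ 2 := by positivity
        refine le_of_mul_le_mul_left ?_ hT2
        linarith
      have hden : 0 < (I + (k + 1) + 1 : ℝ) * (1 - σ) * ((i' + 1) * (1 - q)) := by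
        have : 0 < 1 - σ := by linarith
        have : 0 < 1 - q := by linarith
        positivity
      refine le_of_mul_le_mul_right ?_ hden
      calc q / σ * D1 * ((I + (k + 1) + 1 : ℝ) * (1 - σ) * ((i' + 1) * (1 - q)))
          = q / σ * (D1 * ((I + (k + 1) + 1 : ℝ) * (1 - σ))) * ((i' + 1) * (1 - q)) := by ring
        _ = q / σ * D0 * ((a' + 1) * σ * ((i' + 1) * (1 - q))) := by rw [r1]; ring
        _ ≤ P0 * ((a' + 1) * σ * ((i' + 1) * (1 - q))) := by
            refine mul_le_mul_of_nonneg_right ih ?_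
            have : 0 < 1 - q := by linarith
            positivity
        _ = P0 * ((i' + 1) * (1 - q)) * ((a' + 1) * σ) := by ring
        _ = P1 * (((a' : ℝ) + 1) * (a + k + 2) * (q * σ)) := by rw [r2]; ring
        _ ≤ P1 * ((i' + 1) * (I + (k + 1) + 1) * ((1 - q) * (1 - σ))) :=
            mul_le_mul_of_nonneg_left hcross P1n
        _ = _ := by ring
  have hTc : ((I + a : ℕ) : ℝ) = I + a := by push_cast; ring
  rw [inflated, hTc, ← hσ, excess_eq_sum, shortfall_eq_sum, Finset.mul_sum]
  calc ∑ k ∈ Finset.range (a + 1), q / σ * (k * point (I + a) (I + k) σ)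
      ≤ ∑ k ∈ Finset.range (a + 1), k * point (I + a) (I - k) q := by
        refine Finset.sum_le_sum fun k hk => ?_
        cases k with
        | zero => simp
        | succ k =>
          have := hterm k (Nat.lt_succ_iff.mp (Finset.mem_range.mp hk))
          have h5 := mul_le_mul_of_nonneg_left this (Nat.cast_nonneg (α := ℝ) (k + 1))
          linarith
    _ ≤ ∑ k ∈ Finset.range (I + 1), k * point (I + a) (I - k) q :=
        Finset.sum_le_sum_of_subset_of_nonneg
          (Finset.range_subset_range.mpr (by omega))
          fun k _ _ => mul_nonneg (Nat.cast_nonneg _) (point_nonneg hq0.le hq1.le)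

/-- Comparison of the two terms next to the mean, in logarithmic form. -/
theorem first_term_le {J c : ℕ} {b q : ℝ} (hb0 : 0 < b) (hbT : b < J + c + 3) (hq0 : 0 < q)
    (h : ((c : ℝ) + 1) * (c + 2) * (b ^ (J + 2) * (J + c + 3 - b) ^ c) ≤
      ((J : ℝ) + 2) * (J + 3) * (((J + c + 3) * q) ^ J * ((J + c + 3) * (1 - q)) ^ (c + 2))) :
    q / (b / (J + c + 3)) * point (J + c + 3) (J + 3) (b / (J + c + 3)) ≤
      point (J + c + 3) (J + 1) q := by
  have hT0 : (0 : ℝ) < J + c + 3 := hb0.trans hbT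
  obtain ⟨τ, hτ⟩ : ∃ τ : ℝ, τ = J + c + 3 := ⟨_, rfl⟩
  have c1 : ((J + c + 3).choose (J + 2) : ℝ) * (J + 2) = (J + c + 3).choose (J + 1) * (c + 2) := by
    have := Nat.choose_succ_right_eq (J + c + 3) (J + 1)
    rw [show J + c + 3 - (J + 1) = c + 2 by omega] at this
    exact_mod_cast this
  have c2 : ((J + c + 3).choose (J + 3) : ℝ) * (J + 3) = (J + c + 3).choose (J + 2) * (c + 1) := by
    have := Nat.choose_succ_right_eq (J + c + 3) (J + 2)
    rw [show J + c + 3 - (J + 2) = c + 1 by omega] at this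
    exact_mod_cast this
  rw [← hτ] at h hbT hT0 ⊢
  rw [point_eq, point_eq, show J + c + 3 - (J + 3) = c by omega,
    show J + c + 3 - (J + 1) = c + 2 by omega]
  obtain ⟨C1, hC1⟩ : ∃ C1 : ℝ, C1 = (J + c + 3).choose (J + 1) := ⟨_, rfl⟩
  obtain ⟨C3, hC3⟩ : ∃ C3 : ℝ, C3 = (J + c + 3).choose (J + 3) := ⟨_, rfl⟩
  have hC : C3 * ((J + 2) * (J + 3)) = C1 * ((c + 1) * (c + 2)) := by
    rw [hC1, hC3]
    linear_combination ((J : ℝ) + 2) * c2 + ((c : ℝ) + 1) * c1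
  rw [← hC1, ← hC3]
  have hC1n : 0 ≤ C1 := by rw [hC1]; positivity
  have hpos : (0 : ℝ) < (J + 2) * (J + 3) := by positivity
  refine le_of_mul_le_mul_right ?_ hpos
  have e1 : q / (b / τ) * (C3 * (b / τ) ^ (J + 3) * (1 - b / τ) ^ c) * ((J + 2) * (J + 3)) =
      q * (C3 * ((J + 2) * (J + 3))) * (b ^ (J + 2) * (τ - b) ^ c) / τ ^ (J + 2 + c) := by
    have : 1 - b / τ = (τ - b) / τ := by field_simp
    rw [this]
    simp only [div_pow, pow_add, pow_succ]
    field_simp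
  have e2 : C1 * q ^ (J + 1) * (1 - q) ^ (c + 2) * ((J + 2) * (J + 3)) =
      q * C1 * (((J : ℝ) + 2) * (J + 3) * ((τ * q) ^ J * (τ * (1 - q)) ^ (c + 2))) /
        τ ^ (J + 2 + c) := by
    simp only [mul_pow, pow_add, pow_succ]
    field_simp
  rw [e1, e2, hC]
  refine div_le_div_of_nonneg_right ?_ (by positivity)
  have := mul_le_mul_of_nonneg_left h (mul_nonneg hq0.le hC1n)
  linarith

end

/-! ### Regime 3 (T - I) < I with offset between 1/2 and (T - I) / 2 -/

section

theorem log_mul_pow_mul_pow {w u v : ℝ} (hw : 0 < w) (hu : 0 < u) (hv : 0 < v) (m n : ℕ) :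
    Real.log (w * (u ^ m * v ^ n)) = Real.log w + (m * Real.log u + n * Real.log v) := by
  rw [Real.log_mul hw.ne' (by positivity), Real.log_mul (by positivity) (by positivity),
    Real.log_pow, Real.log_pow]

theorem log_sub_half_ge {a : ℝ} (ha : 1 ≤ a) :
    Real.log a - (4 * a - 1) / (4 * a * (2 * a - 1)) ≤ Real.log (a - 1 / 2) := by
  have h := half_sub_inv_le_log (t := (a - 1 / 2) / a) (div_pos (by linarith) (by linarith))
    (by rw [div_le_one (by linarith)]; linarith)
  rw [Real.log_div (by linarith) (by linarith)] at h
  have h1 : 0 < a - 1 / 2 := by linarith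
  have h2 : 0 < 2 * a - 1 := by linarith
  have e : ((a - 1 / 2) / a - ((a - 1 / 2) / a)⁻¹) / 2 = -((4 * a - 1) / (4 * a * (2 * a - 1))) := by
    rw [show a - 1 / 2 = (2 * a - 1) / 2 by ring]
    field_simp
    ring
  linarith

theorem log_add_le {a v : ℝ} (ha : 0 < a) (hv : 0 ≤ v) :
    Real.log (a + v) ≤ Real.log a + v * (2 * a + v) / (2 * a * (a + v)) := by
  have h := log_le_half_sub_inv (t := (a + v) / a) (by rw [le_div_iff₀ ha]; linarith)
  rw [Real.log_div (by linarith) (by linarith)] at h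
  have e : ((a + v) / a - ((a + v) / a)⁻¹) / 2 = v * (2 * a + v) / (2 * a * (a + v)) := by
    have : 0 < a + v := by linarith
    field_simp
    ring
  linarith

/-- What the estimates for log (a - 1/2), log (a + 3/2) and log (a + 1) leave to prove. The first
summand is a reserve, dropped in `tail_terms_le` and spent in `half_point_tail`. -/
theorem log_margin {a : ℝ} (ha : 2 ≤ a) :
    81 / 100 / (3 * a + 2) + (a + 1) * ((4 * a - 1) / (4 * a * (2 * a - 1))) +
      (a - 1) * (3 / 2 * (2 * a + 3 / 2) / (2 * a * (a + 3 / 2))) +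
      1 * (2 * a + 1) / (2 * a * (a + 1)) ≤ 2 := by
  obtain ⟨c, rfl⟩ : ∃ c, a = c + 2 := ⟨a - 2, by ring⟩
  have hc : 0 ≤ c := by linarith
  have h1 : 0 < 2 * (c + 2) - 1 := by linarith
  rw [← sub_nonneg]
  have e : 2 - (81 / 100 / (3 * (c + 2) + 2) + (c + 2 + 1) * ((4 * (c + 2) - 1) /
      (4 * (c + 2) * (2 * (c + 2) - 1))) +
      (c + 2 - 1) * (3 / 2 * (2 * (c + 2) + 3 / 2) / (2 * (c + 2) * (c + 2 + 3 / 2))) +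
      1 * (2 * (c + 2) + 1) / (2 * (c + 2) * (c + 2 + 1))) =
      (2 * (100 * (3 * c + 8) * (4 * (c + 2)) * (2 * c + 3) * (2 * c + 7) * (c + 3)) -
        (81 * (4 * (c + 2)) * (2 * c + 3) * (2 * c + 7) * (c + 3) +
        (c + 3) * (4 * c + 7) * (100 * (3 * c + 8)) * (2 * c + 7) * (c + 3) +
        (c + 1) * (12 * c + 33) * (100 * (3 * c + 8)) * (2 * c + 3) * (c + 3) +
        (4 * c + 10) * (100 * (3 * c + 8)) * (2 * c + 3) * (2 * c + 7))) /
      (100 * (3 * c + 8) * (4 * (c + 2)) * (2 * c + 3) * (2 * c + 7) * (c + 3)) := by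
    have : 2 * (c + 2) - 1 = 2 * c + 3 := by ring
    have h3 : c + 2 + 3 / 2 = (2 * c + 7) / 2 := by ring
    rw [this, h3]
    field_simp
    ring
  rw [e]
  refine div_nonneg ?_ (by positivity)
  ring_nf
  positivity

/-- The first-term inequality splits at the common quantity 4y into a part in `a` and a part in `I`;
this is the part in `a`. The difference of its sides increases on [1/2, a/2], so only `y = 1/2` has
to be checked. -/
theorem tail_terms_le {a y : ℝ} (ha : 2 ≤ a) (hy : 1 / 2 ≤ y) (hya : y ≤ a / 2) :
    Real.log (a * (a + 1)) + (a - 1) * Real.log (a + 3 * y) ≤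
      4 * y + (a + 1) * Real.log (a - y) := by
  have hd : ∀ t, 0 < a - t → 0 < a + 3 * t → HasDerivAt
      (fun t => 4 * t + (a + 1) * Real.log (a - t) - (a - 1) * Real.log (a + 3 * t))
      (4 + (a + 1) * (-1 / (a - t)) - (a - 1) * (3 / (a + 3 * t))) t := by
    intro t h1 h2
    have d1 : HasDerivAt (fun t => a - t) (-1) t := (hasDerivAt_id t).const_sub a
    have d2 : HasDerivAt (fun t => a + 3 * t) 3 t := by
      simpa using ((hasDerivAt_id t).const_mul 3).const_add a
    have d3 : HasDerivAt (fun t : ℝ => 4 * t) 4 t := by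
      simpa using (hasDerivAt_id t).const_mul (4 : ℝ)
    exact (d3.add ((d1.log h1.ne').const_mul _)).sub ((d2.log h2.ne').const_mul _)
  have hm : MonotoneOn (fun t => 4 * t + (a + 1) * Real.log (a - t) -
      (a - 1) * Real.log (a + 3 * t)) (Set.Icc (1 / 2) (a / 2)) := by
    refine monotoneOn_of_deriv_nonneg (convex_Icc _ _) (fun t ht => ?_) (fun t ht => ?_)
      fun t ht => ?_
    · exact (hd t (by linarith [ht.2]) (by linarith [ht.1])).continuousAt.continuousWithinAt
    · rw [interior_Icc] at ht
      exact (hd t (by linarith [ht.2])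
        (by linarith [ht.1])).differentiableAt.differentiableWithinAt
    · rw [interior_Icc] at ht
      have h1 : 0 < a - t := by linarith [ht.2]
      have h2 : 0 < a + 3 * t := by linarith [ht.1]
      rw [(hd t h1 h2).deriv]
      have e : 4 + (a + 1) * (-1 / (a - t)) - (a - 1) * (3 / (a + 3 * t)) =
          (4 * t * (2 * a - 3 * t) + 2 * (a - 3 * t)) / ((a - t) * (a + 3 * t)) := by
        have h1' := h1.ne'
        have h2' : a + t * 3 ≠ 0 := by rw [mul_comm t]; exact h2.ne'
        field_simp
        ring
      rw [e]
      refine div_nonneg ?_ (by positivity)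
      have h3 := ht.1
      have h4 := ht.2
      nlinarith
  have h := hm ⟨le_rfl, by linarith⟩ ⟨hy, hya⟩ hy
  simp only at h
  have g1 := log_sub_half_ge (a := a) (by linarith)
  have g2 := log_add_le (a := a) (v := 3 / 2) (by linarith) (by norm_num)
  have g3 := log_add_le (a := a) (v := 1) (by linarith) (by norm_num)
  have g4 := log_margin ha
  have g5 : 0 ≤ 81 / 100 / (3 * a + 2) := by positivity
  rw [Real.log_mul (by linarith) (by linarith)]
  have k1 := mul_le_mul_of_nonneg_left g1 (by linarith : 0 ≤ a + 1)
  have k2 := mul_le_mul_of_nonneg_left g2 (by linarith : 0 ≤ a - 1)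
  norm_num at h k1 k2 g3 g4 ⊢
  linarith

/-- The part in `I`. The logarithm of (I + y) / (I - 3y), times I, is at least 4y + 4y²/I, and the
second summand pays for replacing (I + y)² by I (I + 1). -/
theorem head_terms_le {I y : ℝ} (hI : 0 < I) (hy0 : 0 ≤ y) (hy : 3 * y < I) :
    4 * y + I * Real.log (I - 3 * y) + 2 * Real.log (I + y) ≤
      Real.log (I * (I + 1)) + I * Real.log (I + y) := by
  have h1 : 0 < I - 3 * y := by linarith
  have h2 : 0 < I + y := by linarith
  have h3 : 0 < I - y := by linarith
  have h := two_mul_div_le_log (t := (I + y) / (I - 3 * y)) (by rw [le_div_iff₀ h1]; linarith)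
  rw [Real.log_div h2.ne' h1.ne'] at h
  have e : 2 * ((I + y) / (I - 3 * y) - 1) / ((I + y) / (I - 3 * y) + 1) = 4 * y / (I - y) := by
    have h1' : I - y * 3 ≠ 0 := by rw [mul_comm y]; exact h1.ne'
    have h3' := h3.ne'
    have k1 : (I + y) / (I - 3 * y) - 1 = 4 * y / (I - 3 * y) := by field_simp; ring
    have k2 : (I + y) / (I - 3 * y) + 1 = 2 * (I - y) / (I - 3 * y) := by field_simp; ring
    rw [k1, k2]
    field_simp
  rw [e] at h
  have h4 : 4 * y + 4 * y ^ 2 / I ≤ I * (4 * y / (I - y)) := by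
    rw [← sub_nonneg]
    have : I * (4 * y / (I - y)) - (4 * y + 4 * y ^ 2 / I) = 4 * y ^ 3 / (I * (I - y)) := by
      field_simp; ring
    rw [this]; positivity
  have h5 := mul_le_mul_of_nonneg_left h hI.le
  have h6 : 2 * Real.log (I + y) ≤ Real.log (I * (I + 1)) + 4 * y ^ 2 / I := by
    have k1 : (I + y) ^ 2 ≤ I * (I + 1) * Real.exp (4 * y ^ 2 / I) := by
      have k2 := Real.add_one_le_exp (4 * y ^ 2 / I)
      have k3 : (I + y) ^ 2 ≤ I * (I + 1) * (4 * y ^ 2 / I + 1) := by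
        have : I * (I + 1) * (4 * y ^ 2 / I + 1) = (I + 1) * (4 * y ^ 2 + I) := by
          field_simp
        rw [this]
        nlinarith [sq_nonneg (2 * y - 1), mul_nonneg hI.le (sq_nonneg (2 * y - 1)),
          mul_nonneg hI.le hy0, mul_nonneg hI.le (sq_nonneg y)]
      exact k3.trans (mul_le_mul_of_nonneg_left k2 (by positivity))
    have := Real.log_le_log (by positivity) k1
    rw [Real.log_mul (by positivity) (Real.exp_pos _).ne', Real.log_exp, Real.log_pow] at this
    push_cast at this
    exact this
  nlinarith

/-- The logarithm of the condition of `first_term_le`. The exponent of `(I + a) * q` there is `I -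
2`; the two missing powers are moved to the left. -/
theorem first_term_of_log {I a : ℕ} (hI : 2 ≤ I) (ha : 1 ≤ a) {b q : ℝ} (hb : 0 < b)
    (hbT : b < I + a) (hq0 : 0 < q) (hq1 : q < 1)
    (h : Real.log ((a : ℝ) * (a + 1)) + I * Real.log b + (a - 1) * Real.log (I + a - b) +
      2 * Real.log ((I + a) * q) ≤ Real.log ((I : ℝ) * (I + 1)) + I * Real.log ((I + a) * q) +
        (a + 1) * Real.log ((I + a) * (1 - q))) :
    q / (b / (I + a)) * point (I + a) (I + 1) (b / (I + a)) ≤ point (I + a) (I - 1) q := by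
  obtain ⟨J, rfl⟩ := Nat.exists_eq_add_of_le' hI
  obtain ⟨c, rfl⟩ := Nat.exists_eq_add_of_le' ha
  have e1 : (((J + 2 : ℕ) : ℝ) + (c + 1 : ℕ)) = J + c + 3 := by push_cast; ring
  rw [e1] at hbT h ⊢
  have e2 : J + 2 + (c + 1) = J + c + 3 := by omega
  rw [e2]
  push_cast at h
  have p1 : 0 < (J : ℝ) + c + 3 - b := by linarith
  have p2 : 0 < 1 - q := by linarith
  refine first_term_le hb hbT hq0 ?_
  refine (Real.log_le_log_iff (by positivity) (by positivity)).mp ?_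
  rw [log_mul_pow_mul_pow (by positivity) hb p1,
    log_mul_pow_mul_pow (by positivity) (by positivity) (by positivity)]
  push_cast
  have e3 : ((c : ℝ) + 1 + 1) = c + 2 := by ring
  have e4 : ((J : ℝ) + 2 + 1) = J + 3 := by ring
  rw [e3, e4] at h
  linarith

theorem inflated_le_shortfall_far {I a : ℕ} (ha : 2 ≤ a) (haI : 3 * a < I) {y : ℝ}
    (hy : 1 / 2 ≤ y) (hya : y ≤ a / 2) :
    inflated (I + a) I (I - 3 * y) ((I + y) / (I + a)) ≤
      shortfall (I + a) I ((I + y) / (I + a)) := by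
  have ha' : (2 : ℝ) ≤ a := by exact_mod_cast ha
  have haI' : 3 * (a : ℝ) + 1 ≤ I := by exact_mod_cast haI
  have hT : (0 : ℝ) < I + a := by linarith
  have hq : ((I : ℝ) + a) * ((I + y) / (I + a)) = I + y := by field_simp
  have hq' : ((I : ℝ) + a) * (1 - (I + y) / (I + a)) = a - y := by field_simp; ring
  have hq0 : 0 < ((I : ℝ) + y) / (I + a) := div_pos (by linarith) hT
  have hq1 : ((I : ℝ) + y) / (I + a) < 1 := by rw [div_lt_one hT]; linarith
  refine inflated_le_shortfall_of_terms (by omega) (by linarith) (by linarith) hq0 hq1 ?_ ?_ ?_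
  · refine first_term_of_log (by omega) (by omega) (by linarith) (by linarith) hq0 hq1 ?_
    have t1 := tail_terms_le ha' hy hya
    have t2 := head_terms_le (I := (I : ℝ)) (y := y) (by linarith) (by linarith) (by linarith)
    rw [hq, hq', show (I : ℝ) + a - (I - 3 * y) = a + 3 * y by ring]
    linarith
  · rw [hq']
    have k1 := mul_nonneg (by linarith : 0 ≤ y - 1 / 2) (by linarith : 0 ≤ (a : ℝ) / 2 - y)
    rcases le_total (a : ℝ) 3 with h3 | h3
    · have k2 := mul_nonneg (by linarith : 0 ≤ y - 1 / 2) (by linarith : 0 ≤ (a : ℝ) - 2)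
      nlinarith
    · have k2 := mul_nonneg (by linarith : 0 ≤ y - 1 / 2) (by linarith : 0 ≤ (a : ℝ) - 3)
      nlinarith
  · rw [hq]
    nlinarith

end

/-! ### Concavity along reciprocal probabilities -/

section

/-- Shortfall minus inflated excess, relative to `q`, along the path on which the reciprocal success
probabilities move linearly. -/
def pathGap (T I : ℕ) (θ : ℝ) : ℝ :=
  -I * θ + excess T I (T / I - θ)⁻¹ / (T / I - θ)⁻¹ -
    excess T I (T / I + 3 * θ)⁻¹ / (T / I + 3 * θ)⁻¹

def pathGap₁ (T I : ℕ) (θ : ℝ) : ℝ :=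
  -I + I * exceed T I (T / I - θ)⁻¹ + 3 * I * exceed T I (T / I + 3 * θ)⁻¹

/-- In the variable 1/s the derivative of excess divided by s is -I · P(B_s > I), without
denominators. This is why the path is linear in the reciprocals. -/
theorem hasDerivAt_pathGap {T I : ℕ} {θ : ℝ} (h1 : (T : ℝ) / I - θ ≠ 0)
    (h2 : (T : ℝ) / I + 3 * θ ≠ 0) :
    HasDerivAt (pathGap T I) (pathGap₁ T I θ) θ := by
  have d1 : HasDerivAt (fun θ : ℝ => (T : ℝ) / I - θ) (-1) θ := (hasDerivAt_id θ).const_sub _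
  have d2 : HasDerivAt (fun θ : ℝ => (T : ℝ) / I + 3 * θ) 3 θ := by
    simpa using ((hasDerivAt_id θ).const_mul 3).const_add ((T : ℝ) / I)
  have d3 : HasDerivAt (fun θ : ℝ => -(I : ℝ) * θ) (-I) θ := by
    simpa using (hasDerivAt_id θ).const_mul (-(I : ℝ))
  have e1 := (hasDerivAt_excess_div T I (inv_ne_zero h1)).comp θ (d1.inv h1)
  have e2 := (hasDerivAt_excess_div T I (inv_ne_zero h2)).comp θ (d2.inv h2)
  refine ((d3.add e1).sub e2).congr_deriv ?_
  rw [pathGap₁]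
  clear e1 e2 d1 d2 d3
  generalize (T : ℝ) / I - θ = r at *
  generalize (T : ℝ) / I + 3 * θ = r' at *
  field_simp
  ring

theorem hasDerivAt_pathGap₁ {U I : ℕ} {θ : ℝ} (h1 : ((U + 1 : ℕ) : ℝ) / I - θ ≠ 0)
    (h2 : ((U + 1 : ℕ) : ℝ) / I + 3 * θ ≠ 0) :
    HasDerivAt (pathGap₁ (U + 1) I) (I * (U + 1) *
      (point U I ((U + 1 : ℕ) / I - θ)⁻¹ * (((U + 1 : ℕ) / I - θ)⁻¹) ^ 2 -
        9 * (point U I ((U + 1 : ℕ) / I + 3 * θ)⁻¹ * (((U + 1 : ℕ) / I + 3 * θ)⁻¹) ^ 2))) θ := by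
  have d1 : HasDerivAt (fun θ : ℝ => ((U + 1 : ℕ) : ℝ) / I - θ) (-1) θ :=
    (hasDerivAt_id θ).const_sub _
  have d2 : HasDerivAt (fun θ : ℝ => ((U + 1 : ℕ) : ℝ) / I + 3 * θ) 3 θ := by
    simpa using ((hasDerivAt_id θ).const_mul 3).const_add (((U + 1 : ℕ) : ℝ) / I)
  have e1 := ((hasDerivAt_exceed U I _).comp θ (d1.inv h1)).const_mul (I : ℝ)
  have e2 := ((hasDerivAt_exceed U I _).comp θ (d2.inv h2)).const_mul (3 * (I : ℝ))
  refine ((e1.const_add (-(I : ℝ))).add e2).congr_deriv ?_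
  simp only [Pi.inv_apply]
  clear e1 e2 d1 d2
  generalize ((U + 1 : ℕ) : ℝ) / I - θ = r at *
  generalize ((U + 1 : ℕ) : ℝ) / I + 3 * θ = r' at *
  field_simp
  ring

theorem pathGap_zero (T I : ℕ) : pathGap T I 0 = 0 := by simp [pathGap]

theorem pathGap_eq {T I : ℕ} (hT : (0 : ℝ) < T) {θ : ℝ} (h1 : 0 < (T : ℝ) / I - θ)
    (hI : (I : ℝ) ≠ 0) :
    pathGap T I θ = (shortfall T I (T / I - θ)⁻¹ -
      inflated T I (T / (T / I + 3 * θ)) (T / I - θ)⁻¹) * (T / I - θ) := by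
  have e : T / ((T : ℝ) / I + 3 * θ) / T = ((T : ℝ) / I + 3 * θ)⁻¹ := by
    rw [div_right_comm, div_self hT.ne', one_div]
  rw [inflated, e, shortfall_eq, pathGap]
  obtain ⟨r, hr⟩ : ∃ r, r = (T : ℝ) / I - θ := ⟨_, rfl⟩
  obtain ⟨r', hr'⟩ : ∃ r', r' = (T : ℝ) / I + 3 * θ := ⟨_, rfl⟩
  have hθ : (I : ℝ) * θ = T - I * r := by rw [hr]; field_simp; ring
  rw [← hr] at h1 ⊢
  rw [← hr']
  have : -(I : ℝ) * θ = -(T - I * r) := by rw [← hθ]; ring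
  rw [this]
  field_simp
  ring

/-- The power tends to e² < 9. The bound 9 is the square of the ratio 3 of the speeds of the two
reciprocals. -/
theorem pow_ratio_le {I : ℕ} (hI : 7 ≤ I) : ((I + 2 : ℝ) / I) ^ (I + 1) ≤ 9 := by
  have hI' : (7 : ℝ) ≤ I := by exact_mod_cast hI
  have h0 : (0 : ℝ) < I := by linarith
  refine (Real.log_le_log_iff (by positivity) (by norm_num)).mp ?_
  rw [Real.log_pow]
  have h1 := log_le_half_sub_inv (t := (I + 2 : ℝ) / I) (by rw [le_div_iff₀ h0]; linarith)
  have h2 : (21 : ℝ) / 10 ≤ Real.log 9 := by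
    rw [Real.le_log_iff_exp_le (by norm_num)]
    have h4 : Real.exp (21 / 10) ^ 10 = Real.exp 1 ^ 21 := by
      rw [← Real.exp_nat_mul, ← Real.exp_nat_mul]; norm_num
    have h5 : Real.exp 1 ^ 21 ≤ 2.7182818286 ^ 21 :=
      pow_le_pow_left₀ (Real.exp_pos 1).le Real.exp_one_lt_d9.le 21
    refine le_of_pow_le_pow_left₀ (n := 10) (by norm_num) (by norm_num) ?_
    rw [h4]
    refine h5.trans ?_
    norm_num
  refine le_trans ?_ h2
  have h3 := mul_le_mul_of_nonneg_left h1 (by positivity : (0 : ℝ) ≤ (I + 1 : ℕ))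
  refine h3.trans ?_
  have e : ((I + 1 : ℕ) : ℝ) * (((I + 2 : ℝ) / I - ((I + 2 : ℝ) / I)⁻¹) / 2) =
      2 + 2 / (I * (I + 2)) := by
    push_cast; field_simp; ring
  rw [e]
  have : (2 : ℝ) / (I * (I + 2)) ≤ 1 / 10 := by
    rw [div_le_div_iff₀ (by positivity) (by norm_num)]
    nlinarith
  linarith

/-- The end of the concavity interval, where the larger mean is `I + 1 / 2`. -/
theorem path_bounds {T I : ℕ} (hI : 7 ≤ I) (hT : 3 * T + 1 ≤ 4 * I) {θ : ℝ}
    (hθ : θ ≤ T / (I * (2 * I + 1))) : (T : ℝ) / I + 3 * θ ≤ (I + 2) / I * (T / I - θ) ∧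
      (T : ℝ) / I + 3 * θ ≤ 2 := by
  have hI' : (7 : ℝ) ≤ I := by exact_mod_cast hI
  have hI0 : (0 : ℝ) < I := by linarith
  have hT' : 3 * (T : ℝ) + 1 ≤ 4 * I := by exact_mod_cast hT
  rw [le_div_iff₀ (by positivity)] at hθ
  constructor
  · rw [← sub_nonneg]
    have e : ((I : ℝ) + 2) / I * (T / I - θ) - (T / I + 3 * θ) =
        2 * (T - θ * (I * (2 * I + 1))) / I ^ 2 := by field_simp; ring
    rw [e]
    exact div_nonneg (by linarith) (by positivity)
  · have h1 : (T : ℝ) * (2 * I + 1) + 3 * T ≤ 2 * (I * (2 * I + 1)) := by nlinarith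
    have h2 : ((T : ℝ) / I + 3 * θ) * (I * (2 * I + 1)) ≤ 2 * (I * (2 * I + 1)) := by
      have : ((T : ℝ) / I + 3 * θ) * (I * (2 * I + 1)) =
        T * (2 * I + 1) + 3 * (θ * (I * (2 * I + 1))) := by field_simp
      rw [this]; linarith
    exact le_of_mul_le_mul_right h2 (by positivity)

/-- Compares the two point probabilities, each times a squared probability, with weights 1 and 9:
the larger success probability exceeds the smaller by a factor of at most (I + 2) / I, controlled by
`pow_ratio_le`. -/
theorem pathGap_second_nonpos {U I : ℕ} (hI : 7 ≤ I) (hIU : I + 1 ≤ U)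
    (hT : 3 * (U + 1) + 1 ≤ 4 * I) {θ : ℝ} (h0 : 0 ≤ θ)
    (hθ : θ ≤ (U + 1 : ℕ) / (I * (2 * I + 1))) (h1 : 1 < ((U + 1 : ℕ) : ℝ) / I - θ) :
    point U I ((U + 1 : ℕ) / I - θ)⁻¹ * (((U + 1 : ℕ) / I - θ)⁻¹) ^ 2 -
      9 * (point U I ((U + 1 : ℕ) / I + 3 * θ)⁻¹ * (((U + 1 : ℕ) / I + 3 * θ)⁻¹) ^ 2) ≤ 0 := by
  obtain ⟨b1, b2⟩ := path_bounds hI hT hθ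
  obtain ⟨r, hr⟩ : ∃ r, r = ((U + 1 : ℕ) : ℝ) / I - θ := ⟨_, rfl⟩
  obtain ⟨r', hr'⟩ : ∃ r', r' = ((U + 1 : ℕ) : ℝ) / I + 3 * θ := ⟨_, rfl⟩
  have hrr : r ≤ r' := by rw [hr, hr']; linarith
  rw [← hr] at h1 b1 ⊢
  rw [← hr'] at b1 b2 ⊢
  have hI0 : (0 : ℝ) < I := by
    have : (7 : ℝ) ≤ I := by exact_mod_cast hI
    linarith
  obtain ⟨q, hq⟩ : ∃ q, q = r⁻¹ := ⟨_, rfl⟩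
  obtain ⟨s, hs⟩ : ∃ s, s = r'⁻¹ := ⟨_, rfl⟩
  have hr0 : 0 < r := by linarith
  have hr0' : 0 < r' := by linarith
  have hs0 : 0 < s := by rw [hs]; positivity
  have hsq : s ≤ q := by rw [hs, hq]; exact inv_anti₀ hr0 hrr
  have hq1 : q < 1 := by rw [hq]; exact inv_lt_one_of_one_lt₀ h1
  have hs2 : 1 / 2 ≤ s := by
    rw [hs, one_div]; exact inv_anti₀ hr0' b2
  have hqs : q ≤ (I + 2) / I * s := by
    have e : r' = s⁻¹ := by rw [hs, inv_inv]
    have e' : r = q⁻¹ := by rw [hq, inv_inv]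
    have hq0 : 0 < q := hs0.trans_le hsq
    rw [e, e', ← one_div, ← one_div, div_le_iff₀ hs0] at b1
    have : (I + 2) / I * (1 / q) * s = (I + 2) / I * s / q := by ring
    rw [this, le_div_iff₀ hq0] at b1
    linarith
  rw [← hq, ← hs, point_eq, point_eq]
  obtain ⟨c, hc⟩ := Nat.exists_eq_add_of_le hIU
  have hc1 : U - I = c + 1 := by omega
  rw [hc1]
  have hq0 : 0 < q := hs0.trans_le hsq
  -- Both probabilities are at least 1/2, where x (1 - x) decreases.
  have hodds : q * (1 - q) ≤ s * (1 - s) := by nlinarith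
  have k1 : (1 - q) ^ c ≤ (1 - s) ^ c := pow_le_pow_left₀ (by linarith) (by linarith) c
  have k2 : q ^ (I + 1) ≤ 9 * s ^ (I + 1) := by
    calc q ^ (I + 1) ≤ ((I + 2) / I * s) ^ (I + 1) := pow_le_pow_left₀ hq0.le hqs _
      _ = ((I + 2) / I) ^ (I + 1) * s ^ (I + 1) := mul_pow _ _ _
      _ ≤ 9 * s ^ (I + 1) := mul_le_mul_of_nonneg_right (pow_ratio_le hI) (by positivity)
  have h1q : 0 ≤ 1 - q := by linarith
  have h1s : 0 ≤ 1 - s := by linarith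
  have key : q ^ (I + 1) * (q * (1 - q)) * (1 - q) ^ c ≤
      9 * s ^ (I + 1) * (s * (1 - s)) * (1 - s) ^ c := by
    gcongr
  have := mul_le_mul_of_nonneg_left key (Nat.cast_nonneg (α := ℝ) (U.choose I))
  rw [sub_nonpos]
  calc _ = (U.choose I : ℝ) * (q ^ (I + 1) * (q * (1 - q)) * (1 - q) ^ c) := by ring
    _ ≤ _ := this
    _ = _ := by ring

/-- Analogue of `tail_terms_le` at the end of the path, where the smaller mean is I - 3I / (2I + 4)
rather than I - 3/2. Here 2 - 2 / (I + 1) takes the role of 4y, and the reserve in `log_margin` pays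
for the changes. -/
theorem half_point_tail {I a : ℝ} (ha : 3 ≤ a) (hIa : 3 * a + 1 ≤ I) :
    Real.log (a * (a + 1)) + (a - 1) * Real.log (a + 3 * I / (2 * I + 4)) +
      1 / (4 * I * (I + 1)) ≤ 2 - 2 / (I + 1) + (a + 1) * Real.log (a - 1 / 2) := by
  have hI : 10 ≤ I := by linarith
  have g1 := log_sub_half_ge (a := a) (by linarith)
  have g2 := log_add_le (a := a) (v := 3 / 2) (by linarith) (by norm_num)
  have g3 := log_add_le (a := a) (v := 1) (by linarith) (by norm_num)
  have g4 := log_margin (a := a) (by linarith)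
  have hI2 : 0 < 2 * I + 4 := by linarith
  have e : a + 3 * I / (2 * I + 4) = a + 3 / 2 - 3 / (I + 2) := by
    have : I + 2 ≠ 0 := by linarith
    rw [show 2 * I + 4 = 2 * (I + 2) by ring]
    field_simp
    ring
  have hpos : 0 < a + 3 * I / (2 * I + 4) := by positivity
  have g5 : Real.log (a + 3 * I / (2 * I + 4)) ≤
      Real.log (a + 3 / 2) - 3 / (I + 2) / (a + 3 / 2) := by
    have h := Real.log_le_sub_one_of_pos (div_pos hpos (by linarith : 0 < a + 3 / 2))
    rw [Real.log_div hpos.ne' (by linarith)] at h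
    have : (a + 3 * I / (2 * I + 4)) / (a + 3 / 2) - 1 = -(3 / (I + 2) / (a + 3 / 2)) := by
      rw [e]; field_simp; ring
    linarith
  rw [Real.log_mul (by linarith) (by linarith)]
  have k1 := mul_le_mul_of_nonneg_left g1 (by linarith : 0 ≤ a + 1)
  have k2 := mul_le_mul_of_nonneg_left g2 (by linarith : 0 ≤ a - 1)
  have k3 := mul_le_mul_of_nonneg_left g5 (by linarith : 0 ≤ a - 1)
  have k4 : 2 / (I + 1) - (a - 1) * (3 / (I + 2) / (a + 3 / 2)) + 1 / (4 * I * (I + 1)) ≤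
      81 / 100 / (3 * a + 2) := by
    have m1 : 4 / 3 / (I + 2) ≤ (a - 1) * (3 / (I + 2) / (a + 3 / 2)) := by
      rw [← sub_nonneg]
      have : (a - 1) * (3 / (I + 2) / (a + 3 / 2)) - 4 / 3 / (I + 2) =
          (5 / 3 * a - 5) / ((I + 2) * (a + 3 / 2)) := by field_simp; ring
      rw [this]
      exact div_nonneg (by linarith) (by positivity)
    have m2 : 11 / 12 / (I + 1) ≤ 1 / (I + 2) := by
      rw [div_le_div_iff₀ (by linarith) (by linarith)]; linarith
    have m3 : 1 / (4 * I * (I + 1)) ≤ 1 / 40 / (I + 1) := by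
      rw [div_div]
      exact one_div_le_one_div_of_le (by positivity)
        (mul_le_mul_of_nonneg_right (by linarith) (by linarith))
    have m4 : 81 / 100 / (I + 1) ≤ 81 / 100 / (3 * a + 2) :=
      div_le_div_of_nonneg_left (by norm_num) (by linarith) (by linarith)
    have m5 : 2 / (I + 1) - 4 / 3 * (11 / 12 / (I + 1)) + 1 / 40 / (I + 1) ≤
        81 / 100 / (I + 1) := by
      rw [← sub_nonneg]
      have : 81 / 100 / (I + 1) - (2 / (I + 1) - 4 / 3 * (11 / 12 / (I + 1)) + 1 / 40 / (I + 1)) =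
        (81 / 100 - (2 - 11 / 9 + 1 / 40)) / (I + 1) := by field_simp; ring
      rw [this]
      exact div_nonneg (by norm_num) (by linarith)
    have m6 : 4 / 3 / (I + 2) = 4 / 3 * (1 / (I + 2)) := by ring
    linarith
  linarith

theorem half_point_head {I : ℝ} (hI : 1 ≤ I) :
    2 * Real.log (I + 1 / 2) + 2 - 2 / (I + 1) ≤
      Real.log (I * (I + 1)) + I * Real.log ((I + 2) / I) + 1 / (4 * I * (I + 1)) := by
  have h := two_mul_div_le_log (t := (I + 2) / I) (by rw [le_div_iff₀ (by linarith)]; linarith)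
  have h2 := mul_le_mul_of_nonneg_left h (by linarith : 0 ≤ I)
  have e : I * (2 * ((I + 2) / I - 1) / ((I + 2) / I + 1)) = 2 - 2 / (I + 1) := by
    have k1 : (I + 2) / I - 1 = 2 / I := by field_simp; ring
    have k2 : (I + 2) / I + 1 = 2 * (I + 1) / I := by field_simp; ring
    rw [k1, k2]; field_simp; ring
  have h3 : 2 * Real.log (I + 1 / 2) ≤ Real.log (I * (I + 1)) + 1 / (4 * I * (I + 1)) := by
    have hp : 0 < I * (I + 1) := by positivity
    have h := Real.log_le_sub_one_of_pos (div_pos (by positivity : 0 < (I + 1 / 2) ^ 2) hp)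
    rw [Real.log_div (by positivity) hp.ne', Real.log_pow] at h
    have : (I + 1 / 2) ^ 2 / (I * (I + 1)) - 1 = 1 / (4 * I * (I + 1)) := by field_simp; ring
    push_cast at h
    linarith
  linarith

end

/-! ### Regime 3 (T - I) < I with offset at most 1/2 -/

section

theorem inflated_mono {T I : ℕ} {b b' q : ℝ} (hq : 0 ≤ q) (hb : 0 < b) (hbb : b ≤ b')
    (hbT : b' ≤ T) : inflated T I b q ≤ inflated T I b' q := by
  have hT : (0 : ℝ) < T := by linarith
  have h := excess_div_mono (T := T) (I := I) (p := b / T) (q := b' / T) (by positivity)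
    (by gcongr) (by rw [div_le_one hT]; exact hbT)
  have e : ∀ c, inflated T I c q = q * (excess T I (c / T) / (c / T)) := fun c => by
    rw [inflated]; ring
  rw [e, e]
  exact mul_le_mul_of_nonneg_left h hq

/-- `half_point_tail` needs `a ≥ 3`; this is the exponentiated inequality for `a = 2`, computed for
small I and otherwise using ((I + 2) / I)^I ≥ 56/9. -/
theorem half_point_two {I : ℕ} (hI : 7 ≤ I) :
    6 * (2 + 3 * (I : ℝ) / (2 * I + 4)) * (I + 1 / 2) ^ 2 ≤
      I * (I + 1) * ((I + 2) / I) ^ I * (3 / 2) ^ 3 := by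
  rcases lt_or_ge I 12 with h | h
  · interval_cases I <;> norm_num
  · have hI' : (12 : ℝ) ≤ I := by exact_mod_cast h
    have hI0 : (0 : ℝ) < I := by linarith
    have h1 : (56 : ℝ) / 9 ≤ ((I + 2) / I) ^ I := by
      refine (Real.log_le_log_iff (by norm_num) (by positivity)).mp ?_
      rw [Real.log_pow]
      have h2 := two_mul_div_le_log (t := (I + 2 : ℝ) / I) (by rw [le_div_iff₀ hI0]; linarith)
      have h3 := mul_le_mul_of_nonneg_left h2 hI0.le
      have e : I * (2 * ((I + 2 : ℝ) / I - 1) / ((I + 2) / I + 1)) = 2 - 2 / (I + 1) := by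
        have k1 : ((I : ℝ) + 2) / I - 1 = 2 / I := by field_simp; ring
        have k2 : ((I : ℝ) + 2) / I + 1 = 2 * (I + 1) / I := by field_simp; ring
        rw [k1, k2]; field_simp; ring
      have h4 : (2 : ℝ) / (I + 1) ≤ 2 / 13 :=
        div_le_div_of_nonneg_left (by norm_num) (by norm_num) (by linarith)
      have h5 : Real.log (56 / 9) ≤ 24 / 13 := by
        rw [Real.log_le_iff_le_exp (by norm_num)]
        refine le_of_pow_le_pow_left₀ (n := 13) (by norm_num) (Real.exp_pos _).le ?_
        have h6 : Real.exp (24 / 13) ^ 13 = Real.exp 1 ^ 24 := by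
          rw [← Real.exp_nat_mul, ← Real.exp_nat_mul]; norm_num
        rw [h6]
        refine le_trans ?_ (pow_le_pow_left₀ (by norm_num) Real.exp_one_gt_d9.le 24)
        norm_num
      linarith
    have h2 : 6 * (2 + 3 * (I : ℝ) / (2 * I + 4)) * (I + 1 / 2) ^ 2 ≤
        I * (I + 1) * (56 / 9) * (3 / 2) ^ 3 := by
      have e : 6 * (2 + 3 * (I : ℝ) / (2 * I + 4)) * (I + 1 / 2) ^ 2 =
          3 * (7 * I + 8) * (2 * I + 1) ^ 2 / (4 * (I + 2)) := by
        rw [show 2 * (I : ℝ) + 4 = 2 * (I + 2) by ring]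
        field_simp; ring
      rw [e, div_le_iff₀ (by positivity)]
      nlinarith [mul_pos hI0 hI0]
    refine h2.trans ?_
    gcongr

theorem half_point_log {I a : ℕ} (ha : 2 ≤ a) (haI : 3 * a < I) :
    Real.log ((a : ℝ) * (a + 1)) + (a - 1) * Real.log (a + 3 * I / (2 * I + 4)) +
      2 * Real.log (I + 1 / 2) ≤
      Real.log ((I : ℝ) * (I + 1)) + I * Real.log ((I + 2) / I) + (a + 1) * Real.log (a - 1 / 2) := by
  have haI' : 3 * (a : ℝ) + 1 ≤ I := by exact_mod_cast haI
  rcases ha.eq_or_lt with h | h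
  · subst h
    have hI : 7 ≤ I := by omega
    have hI0 : (0 : ℝ) < I := by
      have : (7 : ℝ) ≤ I := by exact_mod_cast hI
      linarith
    have h := Real.log_le_log (by positivity) (half_point_two hI)
    rw [Real.log_mul (by positivity) (by positivity), Real.log_mul (by positivity) (by positivity),
      Real.log_mul (by positivity) (by positivity), Real.log_mul (by positivity) (by positivity),
      Real.log_pow, Real.log_pow, Real.log_pow] at h
    push_cast at h ⊢
    norm_num at h ⊢
    linarith
  · have h1 := half_point_tail (I := (I : ℝ)) (a := (a : ℝ)) (by exact_mod_cast h) haI'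
    have h2 := half_point_head (I := (I : ℝ)) (by linarith [Nat.cast_nonneg (α := ℝ) a])
    linarith

theorem inflated_le_shortfall_half {I a : ℕ} (ha : 2 ≤ a) (haI : 3 * a < I) :
    inflated (I + a) I (I * (2 * I + 1) / (2 * I + 4)) ((I + 1 / 2) / (I + a)) ≤
      shortfall (I + a) I ((I + 1 / 2) / (I + a)) := by
  have ha' : (2 : ℝ) ≤ a := by exact_mod_cast ha
  have haI' : 3 * (a : ℝ) + 1 ≤ I := by exact_mod_cast haI
  have hT : (0 : ℝ) < I + a := by linarith
  have hI0 : (0 : ℝ) < I := by linarith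
  have hq : ((I : ℝ) + a) * ((I + 1 / 2) / (I + a)) = I + 1 / 2 := by field_simp
  have hq' : ((I : ℝ) + a) * (1 - (I + 1 / 2) / (I + a)) = a - 1 / 2 := by field_simp; ring
  have hq0 : 0 < ((I : ℝ) + 1 / 2) / (I + a) := div_pos (by linarith) hT
  have hq1 : ((I : ℝ) + 1 / 2) / (I + a) < 1 := by rw [div_lt_one hT]; linarith
  have hb : (I : ℝ) * (2 * I + 1) / (2 * I + 4) = I - 3 * I / (2 * I + 4) := by field_simp; ring
  have hx : 0 < 3 * (I : ℝ) / (2 * I + 4) := by positivity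
  have hx2 : 7 / 6 ≤ 3 * (I : ℝ) / (2 * I + 4) := by
    rw [div_le_div_iff₀ (by norm_num) (by positivity)]; linarith
  refine inflated_le_shortfall_of_terms (by omega) (by positivity) (by rw [hb]; linarith) hq0 hq1
    ?_ ?_ ?_
  · refine first_term_of_log (by omega) (by omega) (by positivity) (by rw [hb]; linarith) hq0 hq1 ?_
    have h := half_point_log ha haI
    have e1 : (I : ℝ) + a - I * (2 * I + 1) / (2 * I + 4) = a + 3 * I / (2 * I + 4) := by
      rw [hb]; ring
    have e2 : Real.log ((I : ℝ) * (2 * I + 1) / (2 * I + 4)) =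
        Real.log (I + 1 / 2) - Real.log ((I + 2) / I) := by
      rw [← Real.log_div (by positivity) (by positivity)]
      congr 1
      rw [show 2 * (I : ℝ) + 4 = 2 * (I + 2) by ring]
      field_simp
    rw [hq, hq', e1, e2]
    linarith
  · rw [hq', hb]
    have e : 3 * (I : ℝ) / (2 * I + 4) = 3 / 2 - 3 / (I + 2) := by
      rw [show 2 * (I : ℝ) + 4 = 2 * (I + 2) by ring]
      field_simp; ring
    have h5 : (a : ℝ) * (3 / (I + 2)) ≤ 1 := by
      rw [mul_div_assoc', div_le_one (by linarith)]; linarith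
    rw [e]
    have h6 : 0 < 3 / ((I : ℝ) + 2) := by positivity
    nlinarith
  · rw [hq, hb]
    nlinarith

/-- `pathGap` is concave up to the point where the larger mean is I + 1/2. It vanishes at the start
and is nonnegative at the end, hence nonnegative in between. -/
theorem inflated_le_shortfall_near {I a : ℕ} (ha : 2 ≤ a) (haI : 3 * a < I) {y : ℝ}
    (hy0 : 0 ≤ y) (hy : y ≤ 1 / 2) :
    inflated (I + a) I (I - 3 * y) ((I + y) / (I + a)) ≤
      shortfall (I + a) I ((I + y) / (I + a)) := by
  obtain ⟨U, hU⟩ := Nat.exists_eq_add_of_le' (show 1 ≤ I + a by omega)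
  have ha' : (2 : ℝ) ≤ a := by exact_mod_cast ha
  have haI' : 3 * (a : ℝ) + 1 ≤ I := by exact_mod_cast haI
  have hI0 : (0 : ℝ) < I := by linarith
  have hTc : ((U + 1 : ℕ) : ℝ) = I + a := by rw [← hU]; push_cast; ring
  have hT : (0 : ℝ) < I + a := by linarith
  have half := inflated_le_shortfall_half ha haI
  rw [hU] at half ⊢
  obtain ⟨τ, hτ⟩ : ∃ τ : ℝ, τ = I + a := ⟨_, rfl⟩
  rw [← hτ] at hT hTc half ⊢
  have hτI : (I : ℝ) + 2 ≤ τ := by linarith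
  set θ₁ : ℝ := τ / (I * (2 * I + 1)) with hθ₁
  have r1 : τ / I - θ₁ = τ / (I + 1 / 2) := by rw [hθ₁]; field_simp; ring
  have r1' : τ / I + 3 * θ₁ = τ * (2 * I + 4) / (I * (2 * I + 1)) := by
    rw [hθ₁]; field_simp; ring
  have hθ0 : 0 ≤ θ₁ := by positivity
  have hr : ∀ θ ≤ θ₁, 1 < τ / I - θ := by
    intro θ h
    have : 1 < τ / (I + 1 / 2) := by rw [lt_div_iff₀ (by positivity)]; linarith
    linarith
  have hr' : ∀ θ, 0 ≤ θ → 0 < τ / I + 3 * θ := by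
    intro θ h
    have : 0 < τ / I := by positivity
    linarith
  have hconc : ConcaveOn ℝ (Set.Icc 0 θ₁) (pathGap (U + 1) I) := by
    refine concaveOn_of_hasDerivWithinAt2_nonpos (f' := pathGap₁ (U + 1) I)
      (f'' := fun θ => I * (U + 1) *
      (point U I ((U + 1 : ℕ) / I - θ)⁻¹ * (((U + 1 : ℕ) / I - θ)⁻¹) ^ 2 -
        9 * (point U I ((U + 1 : ℕ) / I + 3 * θ)⁻¹ * (((U + 1 : ℕ) / I + 3 * θ)⁻¹) ^ 2)))
      (convex_Icc 0 θ₁) (fun θ h => ?_) (fun θ h => ?_) (fun θ h => ?_) (fun θ h => ?_)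
    · exact (hasDerivAt_pathGap (by rw [hTc]; linarith [hr θ h.2])
        (by rw [hTc]; exact (hr' θ h.1).ne')).continuousAt.continuousWithinAt
    · rw [interior_Icc] at h
      exact (hasDerivAt_pathGap (by rw [hTc]; linarith [hr θ h.2.le])
        (by rw [hTc]; exact (hr' θ h.1.le).ne')).hasDerivWithinAt
    · rw [interior_Icc] at h
      exact (hasDerivAt_pathGap₁ (by rw [hTc]; linarith [hr θ h.2.le])
        (by rw [hTc]; exact (hr' θ h.1.le).ne')).hasDerivWithinAt
    · rw [interior_Icc] at h
      refine mul_nonpos_of_nonneg_of_nonpos (by positivity) ?_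
      exact pathGap_second_nonpos (by omega) (by omega) (by omega) h.1.le
        (by rw [hTc]; exact h.2.le) (by rw [hTc]; exact hr θ h.2.le)
  have hend : 0 ≤ pathGap (U + 1) I θ₁ := by
    rw [pathGap_eq (by rw [hTc]; exact hT) (by rw [hTc]; linarith [hr θ₁ le_rfl]) hI0.ne', hTc, r1,
      r1']
    have e1 : (τ / ((I : ℝ) + 1 / 2))⁻¹ = (I + 1 / 2) / τ := inv_div _ _
    have e2 : τ / (τ * (2 * I + 4) / (I * (2 * I + 1))) = I * (2 * I + 1) / (2 * (I : ℝ) + 4) := by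
      field_simp
    rw [e1, e2]
    exact mul_nonneg (by linarith) (by positivity)
  set θ : ℝ := τ * y / (I * (I + y)) with hθ
  have hIy : 0 < (I : ℝ) + y := by linarith
  have hθ00 : 0 ≤ θ := by positivity
  have hθle : θ ≤ θ₁ := by
    rw [hθ, hθ₁, div_le_div_iff₀ (by positivity) (by positivity)]
    have : y * (2 * I + 1) ≤ I + y := by nlinarith
    have := mul_le_mul_of_nonneg_left this (by positivity : 0 ≤ τ * I)
    linarith
  have s1 : τ / I - θ = τ / (I + y) := by rw [hθ]; field_simp; ring
  have s1' : τ / I + 3 * θ = τ * (I + 4 * y) / (I * (I + y)) := by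
    rw [hθ]; field_simp; ring
  have hmin := hconc.min_le_of_mem_Icc ⟨le_rfl, hθ0⟩ ⟨hθ0, le_rfl⟩
    (⟨hθ00, hθle⟩ : θ ∈ Set.Icc 0 θ₁)
  rw [pathGap_zero] at hmin
  have hge : 0 ≤ pathGap (U + 1) I θ := (le_min le_rfl hend).trans hmin
  rw [pathGap_eq (by rw [hTc]; exact hT) (by rw [hTc]; linarith [hr θ hθle]) hI0.ne', hTc, s1,
    s1'] at hge
  have e1 : (τ / ((I : ℝ) + y))⁻¹ = (I + y) / τ := inv_div _ _
  have h4 : 0 < (I : ℝ) + 4 * y := by linarith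
  have e2 : τ / (τ * (I + 4 * y) / (I * (I + y))) = I * (I + y) / ((I : ℝ) + 4 * y) := by
    field_simp
  rw [e1, e2] at hge
  have h5 := nonneg_of_mul_nonneg_left hge (by positivity)
  -- The smaller mean on the path lies above `I - 3 * y`, so monotonicity in `b` transfers the
  -- inequality.
  have h6 : inflated (U + 1) I (I - 3 * y) ((I + y) / τ) ≤
      inflated (U + 1) I (I * (I + y) / (I + 4 * y)) ((I + y) / τ) := by
    refine inflated_mono (by positivity) (by linarith) ?_ ?_
    · rw [le_div_iff₀ h4]; nlinarith [sq_nonneg y]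
    · rw [hTc, div_le_iff₀ h4]; nlinarith
  linarith

end

/-! ### The case T = I + 1 and the combined comparison -/

section

/-- A negative value before `m` would give slopes of signs -, +, ≤ 0, hence a positive and later a
negative second derivative, contrary to `hs`. -/
theorem nonneg_of_concave_convex {h h₁ h₂ : ℝ → ℝ} {m l : ℝ} (h01 : ∀ y, HasDerivAt h (h₁ y) y)
    (h12 : ∀ y, HasDerivAt h₁ (h₂ y) y) (h0 : 0 ≤ h 0) (hm : 0 ≤ h m) (hl : h l ≤ 0) (hml : m < l)
    (hs : ∀ x y, 0 < x → x < y → y < l → 0 < h₂ x → 0 ≤ h₂ y) {y : ℝ} (hy0 : 0 ≤ y)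
    (hym : y ≤ m) : 0 ≤ h y := by
  by_contra! hneg
  have hy0 : 0 < y := hy0.lt_of_ne (by rintro rfl; linarith)
  have hym : y < m := hym.lt_of_ne (by rintro rfl; linarith)
  have c0 : Continuous h := continuous_iff_continuousAt.mpr fun y => (h01 y).continuousAt
  have c1 : Continuous h₁ := continuous_iff_continuousAt.mpr fun y => (h12 y).continuousAt
  obtain ⟨c, hc, ec⟩ := exists_hasDerivAt_eq_slope h h₁ hy0 c0.continuousOn fun x _ => h01 x
  obtain ⟨d, hd, ed⟩ := exists_hasDerivAt_eq_slope h h₁ hym c0.continuousOn fun x _ => h01 x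
  obtain ⟨e, he, ee⟩ := exists_hasDerivAt_eq_slope h h₁ hml c0.continuousOn fun x _ => h01 x
  have hc1 : h₁ c < 0 := by rw [ec]; exact div_neg_of_neg_of_pos (by linarith) (by linarith)
  have hd1 : 0 < h₁ d := by rw [ed]; exact div_pos (by linarith) (by linarith)
  have he1 : h₁ e ≤ 0 := by
    rw [ee]; exact div_nonpos_of_nonpos_of_nonneg (by linarith) (by linarith)
  have hcd : c < d := hc.2.trans hd.1
  have hde : d < e := hd.2.trans he.1
  obtain ⟨u, hu, eu⟩ := exists_hasDerivAt_eq_slope h₁ h₂ hcd c1.continuousOn fun x _ => h12 x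
  obtain ⟨v, hv, ev⟩ := exists_hasDerivAt_eq_slope h₁ h₂ hde c1.continuousOn fun x _ => h12 x
  have hu1 : 0 < h₂ u := by rw [eu]; exact div_pos (by linarith) (by linarith)
  have hv1 : h₂ v < 0 := by
    rw [ev]; exact div_neg_of_neg_of_pos (by linarith) (by linarith)
  have := hs u v (hc.1.trans hu.1) (hu.2.trans hv.1) (hv.2.trans he.2) hu1
  linarith

/-- Shortfall minus inflated excess with `n + 3` trials and mean near `n + 2`. -/
def topGap (n : ℕ) (y : ℝ) : ℝ :=
  ((n + 2 + y) / (n + 3)) ^ (n + 3) - y -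
    (n + 2 + y) / (n + 3) * ((n + 2 - 3 * y) / (n + 3)) ^ (n + 2)

def topGap₁ (n : ℕ) (y : ℝ) : ℝ :=
  ((n + 2 + y) / (n + 3)) ^ (n + 2) - 1 - ((n + 2 - 3 * y) / (n + 3)) ^ (n + 2) / (n + 3) +
    3 * (n + 2) / (n + 3) * ((n + 2 + y) / (n + 3) * ((n + 2 - 3 * y) / (n + 3)) ^ (n + 1))

theorem hasDerivAt_topGap (n : ℕ) (y : ℝ) : HasDerivAt (topGap n) (topGap₁ n y) y := by
  have d1 : HasDerivAt (fun y : ℝ => ((n : ℝ) + 2 + y) / (n + 3)) (1 / (n + 3)) y :=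
    ((hasDerivAt_id y).const_add _).div_const _
  have d2 : HasDerivAt (fun y : ℝ => ((n : ℝ) + 2 - 3 * y) / (n + 3)) (-3 / (n + 3)) y := by
    simpa using (((hasDerivAt_id y).const_mul 3).const_sub ((n : ℝ) + 2)).div_const ((n : ℝ) + 3)
  refine (((d1.pow (n + 3)).sub (hasDerivAt_id y)).sub (d1.mul (d2.pow (n + 2)))).congr_deriv ?_
  have : (n : ℝ) + 3 ≠ 0 := by positivity
  simp only [topGap₁, Pi.pow_apply, show n + 3 - 1 = n + 2 by omega,
    show n + 2 - 1 = n + 1 by omega]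
  push_cast
  generalize ((n : ℝ) + 2 + y) / (n + 3) = q
  generalize ((n : ℝ) + 2 - 3 * y) / (n + 3) = s
  field_simp
  ring

theorem hasDerivAt_topGap₁ (n : ℕ) (y : ℝ) : HasDerivAt (topGap₁ n) ((n + 2) / (n + 3) ^ 2 *
    ((n + 3) * ((n + 2 + y) / (n + 3)) ^ (n + 1) + 6 * ((n + 2 - 3 * y) / (n + 3)) ^ (n + 1) -
      9 * (n + 1) * ((n + 2 + y) / (n + 3) * ((n + 2 - 3 * y) / (n + 3)) ^ n))) y := by
  have d1 : HasDerivAt (fun y : ℝ => ((n : ℝ) + 2 + y) / (n + 3)) (1 / (n + 3)) y :=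
    ((hasDerivAt_id y).const_add _).div_const _
  have d2 : HasDerivAt (fun y : ℝ => ((n : ℝ) + 2 - 3 * y) / (n + 3)) (-3 / (n + 3)) y := by
    simpa using (((hasDerivAt_id y).const_mul 3).const_sub ((n : ℝ) + 2)).div_const ((n : ℝ) + 3)
  refine ((((d1.pow (n + 2)).sub_const 1).sub ((d2.pow (n + 2)).div_const ((n : ℝ) + 3))).add
    ((d1.mul (d2.pow (n + 1))).const_mul (3 * ((n : ℝ) + 2) / (n + 3)))).congr_deriv ?_
  have : (n : ℝ) + 3 ≠ 0 := by positivity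
  simp only [Pi.pow_apply, Nat.add_sub_cancel, show n + 2 - 1 = n + 1 by omega]
  push_cast
  generalize ((n : ℝ) + 2 + y) / (n + 3) = q
  generalize ((n : ℝ) + 2 - 3 * y) / (n + 3) = s
  field_simp
  ring

/-- Divided by q sⁿ the expression depends only on r = q / s. It increases for r ≥ 1, and r grows
along the path. -/
theorem topGap_second_sign {n : ℕ} (hn : 2 ≤ n) {q s q' s' : ℝ} (hs' : 0 < s') (hss : s' ≤ s)
    (hsq : s ≤ q) (hqq : q ≤ q')
    (h : 0 < ((n : ℝ) + 3) * q ^ (n + 1) + 6 * s ^ (n + 1) - 9 * (n + 1) * (q * s ^ n)) :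
    0 ≤ ((n : ℝ) + 3) * q' ^ (n + 1) + 6 * s' ^ (n + 1) - 9 * (n + 1) * (q' * s' ^ n) := by
  have hs : 0 < s := hs'.trans_le hss
  have hq : 0 < q := hs.trans_le hsq
  have hq' : 0 < q' := hq.trans_le hqq
  have form : ∀ q s : ℝ, 0 < q → 0 < s →
      ((n : ℝ) + 3) * q ^ (n + 1) + 6 * s ^ (n + 1) - 9 * (n + 1) * (q * s ^ n) =
      q * s ^ n * ((n + 3) * (q / s) ^ n + 6 / (q / s) - 9 * (n + 1)) := by
    intro q s hq hs
    rw [div_pow]; field_simp; ring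
  rw [form q s hq hs] at h
  rw [form q' s' hq' hs']
  have h2 := pos_of_mul_pos_right h (by positivity)
  refine mul_nonneg (by positivity) ?_
  obtain ⟨r, hr⟩ : ∃ r, r = q / s := ⟨_, rfl⟩
  obtain ⟨r', hr'⟩ : ∃ r', r' = q' / s' := ⟨_, rfl⟩
  have r1 : 1 ≤ r := by rw [hr, le_div_iff₀ hs]; linarith
  have rr : r ≤ r' := by rw [hr, hr']; exact div_le_div₀ hq'.le hqq hs' hss
  rw [← hr] at h2
  rw [← hr']
  obtain ⟨k, rfl⟩ := Nat.exists_eq_add_of_le' hn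
  have p1 : 1 ≤ r ^ k := one_le_pow₀ r1
  have p2 : r ^ k ≤ r' ^ k := pow_le_pow_left₀ (by linarith) rr k
  have p3 : r' ^ 2 - r ^ 2 ≤ r' ^ (k + 2) - r ^ (k + 2) := by
    rw [pow_add, pow_add]
    nlinarith [mul_nonneg (sub_nonneg.mpr p2) (sq_nonneg r'),
      mul_nonneg (sub_nonneg.mpr p1) (by nlinarith : 0 ≤ r' ^ 2 - r ^ 2)]
  have p4 : 6 / r - 6 / r' ≤ 6 * (r' - r) := by
    rw [div_sub_div _ _ (by linarith) (by linarith), div_le_iff₀ (by nlinarith)]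
    nlinarith [mul_nonneg (sub_nonneg.mpr rr) (by nlinarith : 0 ≤ r * r' - 1)]
  have p5 : 2 * (r' - r) ≤ r' ^ 2 - r ^ 2 := by nlinarith
  have p6 : 6 * (r' - r) ≤ (((k + 2 : ℕ) : ℝ) + 3) * (r' ^ (k + 2) - r ^ (k + 2)) := by
    have : (3 : ℝ) ≤ ((k + 2 : ℕ) : ℝ) + 3 := by
      have := Nat.cast_nonneg (α := ℝ) (k + 2); linarith
    have h0 : 0 ≤ r' ^ (k + 2) - r ^ (k + 2) := by linarith
    nlinarith
  linarith

/-- For large n the two powers are close to e^(-9/25) and e^(-73/25), which leaves a small positive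
margin at y = 16/25; small n are computed. -/
theorem topGap_end {n : ℕ} (hn : 2 ≤ n) : 0 ≤ topGap n (16 / 25) := by
  rw [topGap]
  rcases lt_or_ge n 13 with h | h
  · interval_cases n <;> norm_num
  · have hn' : (13 : ℝ) ≤ n := by exact_mod_cast h
    obtain ⟨τ, hτ⟩ : ∃ τ : ℝ, τ = n + 3 := ⟨_, rfl⟩
    have hτ16 : 16 ≤ τ := by linarith
    rw [← hτ, show (n : ℝ) + 2 + 16 / 25 = τ - 9 / 25 by rw [hτ]; ring,
      show (n : ℝ) + 2 - 3 * (16 / 25) = τ - 73 / 25 by rw [hτ]; ring]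
    have hq : 0 < (τ - 9 / 25) / τ := div_pos (by linarith) (by linarith)
    have hq1 : (τ - 9 / 25) / τ ≤ 1 := by rw [div_le_one (by linarith)]; linarith
    have hs : 0 < (τ - 73 / 25) / τ := div_pos (by linarith) (by linarith)
    have e1 : Real.exp (-(3642 / 10000)) ≤ ((τ - 9 / 25) / τ) ^ (n + 3) := by
      rw [← Real.le_log_iff_exp_le (by positivity), Real.log_pow]
      have h1 := half_sub_inv_le_log hq hq1
      have h2 := mul_le_mul_of_nonneg_left h1 (by linarith : 0 ≤ τ)
      have h3 : -(3642 / 10000) ≤ τ * (((τ - 9 / 25) / τ - ((τ - 9 / 25) / τ)⁻¹) / 2) := by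
        have : τ * (((τ - 9 / 25) / τ - ((τ - 9 / 25) / τ)⁻¹) / 2) =
            -((9 / 25) * (2 * τ - 9 / 25) / (2 * (τ - 9 / 25))) := by
          have : τ - 9 / 25 ≠ 0 := by linarith
          rw [inv_div]
          field_simp
          ring
        rw [this, neg_le_neg_iff, div_le_iff₀ (by linarith)]
        linarith
      have : ((n + 3 : ℕ) : ℝ) = τ := by rw [hτ]; push_cast; ring
      rw [this]; linarith
    have e2 : ((τ - 73 / 25) / τ) ^ (n + 2) ≤ Real.exp (-(73 / 25)) := by
      rw [← Real.log_le_iff_le_exp (by positivity), Real.log_pow]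
      have h1 : Real.log ((τ - 73 / 25) / τ) ≤ -(73 / 25 / τ) - (73 / 25 / τ) ^ 2 / 2 := by
        have := two_mul_div_le_log (t := τ / (τ - 73 / 25))
          (by rw [le_div_iff₀ (by linarith)]; linarith)
        rw [← inv_div, Real.log_inv]
        have h3 : ∀ c : ℝ, 0 < c → 0 < τ - c → c / τ + (c / τ) ^ 2 / 2 ≤
            2 * (τ / (τ - c) - 1) / (τ / (τ - c) + 1) := by
          intro c hc h5
          have h6 : 0 < 2 * τ - c := by linarith
          have hτ0 : 0 < τ := by linarith
          have k1 : τ / (τ - c) - 1 = c / (τ - c) := by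
            rw [div_sub_one h5.ne']; ring
          have k2 : τ / (τ - c) + 1 = (2 * τ - c) / (τ - c) := by
            rw [div_add_one h5.ne']; ring
          have k3 : 2 * (τ / (τ - c) - 1) / (τ / (τ - c) + 1) = 2 * c / (2 * τ - c) := by
            rw [k1, k2, mul_div_assoc', div_div_div_cancel_right₀ h5.ne']
          rw [k3, ← sub_nonneg]
          have : 2 * c / (2 * τ - c) - (c / τ + (c / τ) ^ 2 / 2) =
              c ^ 3 / (2 * τ ^ 2 * (2 * τ - c)) := by
            field_simp [h6.ne']; ring
          rw [this]; positivity
        have h4 := h3 (73 / 25) (by norm_num) (by linarith)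
        linarith
      have h2 := mul_le_mul_of_nonneg_left h1 (by linarith : 0 ≤ τ - 1)
      have : ((n + 2 : ℕ) : ℝ) = τ - 1 := by rw [hτ]; push_cast; ring
      rw [this]
      refine h2.trans ?_
      rw [← sub_nonneg]
      have hτ0 : 0 < τ := by linarith
      have : -(73 / 25) - (τ - 1) * (-(73 / 25 / τ) - (73 / 25 / τ) ^ 2 / 2) =
          (73 / 25) * ((23 / 50) * τ - 73 / 50) / τ ^ 2 := by field_simp; ring
      rw [this]
      exact div_nonneg (mul_nonneg (by norm_num) (by linarith)) (by positivity)
    have e3 : (6945 : ℝ) / 10000 ≤ Real.exp (-(3642 / 10000)) := by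
      rw [Real.exp_neg, ← one_div, div_le_div_iff₀ (by norm_num) (Real.exp_pos _)]
      have h := Real.exp_bound' (x := 3642 / 10000) (by norm_num) (by norm_num) (n := 4) (by norm_num)
      norm_num [Finset.sum_range_succ, Nat.factorial] at h
      linarith
    have e4 : Real.exp (-(73 / 25)) ≤ 542 / 10000 := by
      rw [Real.exp_neg, inv_le_comm₀ (Real.exp_pos _) (by norm_num)]
      have h1 : Real.exp (73 / 25) = Real.exp 1 ^ 3 * Real.exp (-(2 / 25)) := by
        rw [← Real.exp_nat_mul, ← Real.exp_add]; norm_num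
      have h2 := Real.add_one_le_exp (-(2 / 25 : ℝ))
      have h3 := pow_le_pow_left₀ (by norm_num) Real.exp_one_gt_d9.le 3
      rw [h1]
      refine le_trans ?_ (mul_le_mul h3 h2 (by norm_num) (by positivity))
      norm_num
    have e5 : (τ - 9 / 25) / τ * ((τ - 73 / 25) / τ) ^ (n + 2) ≤ 1 * (542 / 10000) :=
      mul_le_mul hq1 (e2.trans e4) (by positivity) (by norm_num)
    linarith

theorem topGap_nonneg {n : ℕ} (hn : 2 ≤ n) {y : ℝ} (hy0 : 0 ≤ y) (hy : y ≤ 16 / 25) :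
    0 ≤ topGap n y := by
  have hT : (0 : ℝ) < n + 3 := by positivity
  have hn' : (2 : ℝ) ≤ n := by exact_mod_cast hn
  refine nonneg_of_concave_convex (m := 16 / 25) (l := 1) (hasDerivAt_topGap n)
    (hasDerivAt_topGap₁ n) ?_ (topGap_end hn) ?_ (by norm_num) ?_ hy0 hy
  · rw [topGap]; apply le_of_eq; simp; ring
  · rw [topGap]
    have e1 : ((n : ℝ) + 2 + 1) / (n + 3) = 1 := by
      rw [div_eq_one_iff_eq hT.ne']; ring
    have : 0 ≤ (((n : ℝ) + 2 - 3 * 1) / (n + 3)) ^ (n + 2) :=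
      pow_nonneg (div_nonneg (by linarith) hT.le) _
    rw [e1, one_pow, one_mul]; linarith
  · intro x z hx hxz hz h
    have h' := pos_of_mul_pos_right h (by positivity)
    refine mul_nonneg (by positivity) (topGap_second_sign hn ?_ ?_ ?_ ?_ h')
    · exact div_pos (by linarith) hT
    · gcongr
    · gcongr; linarith
    · gcongr

theorem excess_top (I : ℕ) (s : ℝ) : excess (I + 1) I s = s ^ (I + 1) := by
  rw [excess_eq_sum, Finset.sum_range_succ, Finset.sum_range_one, point_eq]
  simp [point_eq]

theorem inflated_le_shortfall_top {I : ℕ} (hI : 1 ≤ I) {y : ℝ} (hy0 : 0 ≤ y)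
    (hyI : 3 * y < I) (hy : 4 ≤ I → y ≤ 16 / 25) :
    inflated (I + 1) I (I - 3 * y) ((I + y) / (I + 1)) ≤
      shortfall (I + 1) I ((I + y) / (I + 1)) := by
  have hT : (0 : ℝ) < I + 1 := by positivity
  have hb : 0 < (I : ℝ) - 3 * y := by linarith
  rw [inflated, shortfall_eq, excess_top, excess_top]
  have e1 : ((I + 1 : ℕ) : ℝ) * ((I + y) / (I + 1)) = I + y := by push_cast; field_simp
  have e2 : ((I + 1 : ℕ) : ℝ) = I + 1 := by push_cast; ring
  rw [e1, e2]
  obtain ⟨s, hs⟩ : ∃ s, s = ((I : ℝ) - 3 * y) / (I + 1) := ⟨_, rfl⟩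
  have hs0 : 0 < s := by rw [hs]; positivity
  have e3 : ((I : ℝ) + y) / (I + 1) / s * s ^ (I + 1) = (I + y) / (I + 1) * s ^ I := by
    rw [pow_succ]; field_simp
  rw [← hs, e3, hs]
  suffices h : 0 ≤ ((I + y) / ((I : ℝ) + 1)) ^ (I + 1) - y -
      (I + y) / ((I : ℝ) + 1) * ((I - 3 * y) / (I + 1)) ^ I by linarith
  rcases lt_or_ge I 4 with h | h
  · interval_cases I
    · have : ((((1 : ℕ) : ℝ) + y) / (((1 : ℕ) : ℝ) + 1)) ^ (1 + 1) - y - (((1 : ℕ) : ℝ) + y) /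
        (((1 : ℕ) : ℝ) + 1) * ((((1 : ℕ) : ℝ) - 3 * y) / (((1 : ℕ) : ℝ) + 1)) ^ 1 = y ^ 2 := by
        push_cast; ring
      rw [this]; positivity
    · have : ((((2 : ℕ) : ℝ) + y) / (((2 : ℕ) : ℝ) + 1)) ^ (2 + 1) - y - (((2 : ℕ) : ℝ) + y) /
        (((2 : ℕ) : ℝ) + 1) * ((((2 : ℕ) : ℝ) - 3 * y) / (((2 : ℕ) : ℝ) + 1)) ^ 2 =
        y * (5 - 8 * y ^ 2) / 27 := by
        push_cast; ring
      rw [this]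
      push_cast at hyI
      refine div_nonneg (mul_nonneg hy0 ?_) (by norm_num)
      nlinarith
    · have : ((((3 : ℕ) : ℝ) + y) / (((3 : ℕ) : ℝ) + 1)) ^ (3 + 1) - y - (((3 : ℕ) : ℝ) + y) /
        (((3 : ℕ) : ℝ) + 1) * ((((3 : ℕ) : ℝ) - 3 * y) / (((3 : ℕ) : ℝ) + 1)) ^ 3 =
        4 * y * (1 - y) ^ 2 * (17 + 7 * y) / 256 := by
        push_cast; ring
      rw [this]; positivity
  · obtain ⟨n, rfl⟩ := Nat.exists_eq_add_of_le' (show 2 ≤ I by omega)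
    have := topGap_nonneg (n := n) (by omega) hy0 (hy h)
    rw [topGap] at this
    push_cast
    rw [show (n : ℝ) + 2 + 1 = n + 3 by ring]
    exact this

/-- The shortfall at the larger mean dominates the inflated excess at three times the distance. -/
theorem inflated_le_shortfall {I a : ℕ} (hI : 1 ≤ I) (ha : 1 ≤ a) {y : ℝ} (hy0 : 0 ≤ y)
    (hyI : 3 * y < I) (h1 : 3 * a < I → a = 1 → y ≤ 16 / 25)
    (h2 : 3 * a < I → 2 ≤ a → y ≤ a / 2) :
    inflated (I + a) I (I - 3 * y) ((I + y) / (I + a : ℕ)) ≤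
      shortfall (I + a) I ((I + y) / (I + a : ℕ)) := by
  rcases ha.eq_or_lt with h | h
  · subst h
    push_cast
    exact inflated_le_shortfall_top hI hy0 hyI fun h4 => h1 (by omega) rfl
  · rcases Nat.lt_or_ge (3 * a) I with h3 | h3
    · push_cast
      rcases le_total y (1 / 2) with h4 | h4
      · exact inflated_le_shortfall_near h h3 hy0 h4
      · exact inflated_le_shortfall_far h h3 h4 (h2 h3 h)
    · exact inflated_le_shortfall_mid hI (by omega) (by omega) hy0 hyI

end

/-! ### From the comparison to the target for the advantage -/

section

/-- The advantage over [b/T, q] is that over [q₀, q] plus q / q₀ times that over [b/T, q₀]; the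
first part is bounded by `advantage_ge_upper`. -/
theorem advantage_ge_of_advantage_ge {T I : ℕ} {b q q₀ : ℝ} (hT : 0 < T) (hb : 0 < b)
    (hq₀ : 0 < q₀) (hI : (I : ℝ) ≤ T * q₀) (hqq : q₀ ≤ q) (hq : q ≤ 1)
    (h : (T * q₀ - b) / 4 ≤ advantage T (b / T) q₀ I) :
    (T * q - b) / 4 + (I * upper T I - b / 4) * (q - q₀) / q₀ ≤ advantage T (b / T) q I := by
  have h1 := advantage_ge_upper hT hq₀ hI hqq hq
  have h2 := mul_le_mul_of_nonneg_left h (by have := hq₀.trans_le hqq; positivity : 0 ≤ q / q₀)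
  have e : advantage T (b / T) q I =
      advantage T q₀ q I + q / q₀ * advantage T (b / T) q₀ I := by
    simp only [advantage]; field_simp; ring
  have e2 : (T * q - b) / 4 + (I * upper T I - b / 4) * (q - q₀) / q₀ =
      I * upper T I * (q - q₀) / q₀ + q / q₀ * ((T * q₀ - b) / 4) := by
    field_simp; ring
  rw [e, e2]
  exact add_le_add h1 h2

/-- Starts from T q₀ = I + y with y = (I - b) / 3, where T q₀ - I is exactly a quarter of T q₀ - b,
so that `inflated_le_shortfall` gives the target. The extra term comes from passing to q. -/
theorem advantage_ge_of_near {I a : ℕ} {b q : ℝ} (hI : 1 ≤ I) (ha : 1 ≤ a) (hb : 0 < b)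
    (hbI : b < I) (hq : q ≤ 1) (hx : (I : ℝ) - b ≤ 3 * ((I + a : ℕ) * q - I))
    (h1 : 3 * a < I → a = 1 → (I - b) / 3 ≤ 16 / 25)
    (h2 : 3 * a < I → 2 ≤ a → (I - b) / 3 ≤ a / 2) :
    ((I + a : ℕ) * q - b) / 4 + (4 * (I * upper (I + a) I) - b) *
      (((I + a : ℕ) * q - I) - ((I + a : ℕ) * q - b) / 4) / (4 * I - b) ≤
      advantage (I + a) (b / (I + a : ℕ)) q I := by
  obtain ⟨y, hy⟩ : ∃ y : ℝ, y = (I - b) / 3 := ⟨_, rfl⟩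
  have hT : (0 : ℝ) < (I + a : ℕ) := by positivity
  have hG := inflated_le_shortfall hI ha (y := y) (by rw [hy]; linarith) (by rw [hy]; linarith)
    (by rwa [hy]) (by rwa [hy])
  have eb : (I : ℝ) - 3 * y = b := by rw [hy]; ring
  rw [eb] at hG
  have hIy : 0 < (I : ℝ) + y := by rw [hy]; linarith
  have eT : ((I + a : ℕ) : ℝ) * ((I + y) / (I + a : ℕ)) = I + y := by field_simp
  have hb4 : 0 < 4 * (I : ℝ) - b := by linarith
  have h := advantage_ge_of_advantage_ge (T := I + a) (I := I) (q₀ := (I + y) / (I + a : ℕ)) (by omega) hb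
    (by positivity) (by rw [eT, hy]; linarith)
    (by rw [div_le_iff₀ hT, hy]; linarith) hq
    (by rw [eT, advantage_eq_inflated, eT]; linarith)
  refine le_trans (le_of_eq ?_) h
  have e3 : (q - (I + y) / ((I + a : ℕ) : ℝ)) / ((I + y) / ((I + a : ℕ) : ℝ)) =
      ((I + a : ℕ) * q - (I + y)) / (I + y) := by field_simp
  rw [mul_div_assoc _ (q - _), e3, hy]
  have : (I : ℝ) + (I - b) / 3 = (4 * I - b) / 3 := by ring
  rw [this]
  field_simp
  ring

/-- The excess over `I ≥ T s` is at most `T - I` times the next point probability. -/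
theorem excess_le_mul_point {T I : ℕ} {s : ℝ} (hI : I < T) (h0 : 0 ≤ s) (h1 : s ≤ 1)
    (hs : T * s ≤ I) : excess T I s ≤ (T - I) * point T (I + 1) s := by
  obtain ⟨U, rfl⟩ := Nat.exists_eq_add_of_le' (Nat.one_le_of_lt hI)
  have hb := bern_size_bias s U (fun k => if I < k then (1 : ℝ) else 0)
  have hp := bern_size_bias s U (fun k => if k = I + 1 then (1 : ℝ) else 0)
  have p1 : bern s (U + 1) (fun k => k * (if k = I + 1 then (1 : ℝ) else 0)) =
      (I + 1) * point (U + 1) (I + 1) s := by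
    rw [point, ← bern_const_mul]
    refine bern_congr _ _ fun k _ => ?_
    split_ifs with h
    · rw [h]; push_cast; ring
    · simp
  have p2 : bern s U (fun k => if k + 1 = I + 1 then (1 : ℝ) else 0) = point U I s :=
    bern_congr _ _ fun k _ => by simp
  rw [p1, p2] at hp
  have h2 : (I : ℝ) * exceed (U + 1) I s =
      bern s (U + 1) (fun k => k * (if I < k then (1 : ℝ) else 0)) - excess (U + 1) I s := by
    rw [exceed, excess, ← bern_const_mul, ← bern_sub]
    refine bern_congr _ _ fun k _ => ?_
    split_ifs with hk
    · rw [Nat.cast_sub hk.le]; ring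
    · rw [Nat.sub_eq_zero_of_le (by omega)]; simp
  have h3 : bern s U (fun k => if I < k + 1 then (1 : ℝ) else 0) =
      exceed (U + 1) I s + (1 - s) * point U I s := by
    have e : bern s U (fun k => if I < k + 1 then (1 : ℝ) else 0) =
        bern s U (fun k => if I < k then 1 else 0) + point U I s := by
      rw [point, ← bern_add]
      refine bern_congr _ _ fun k _ => ?_
      split_ifs <;> first | omega | norm_num
    rw [exceed, bern_succ, e]; ring
  rw [hb, h3] at h2
  have h4 : point (U + 1) (I + 1) s ≤ exceed (U + 1) I s :=
    bern_mono h0 h1 _ fun k _ => by split_ifs <;> first | omega | norm_num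
  have h5 : 0 ≤ point (U + 1) (I + 1) s := point_nonneg h0 h1
  have h6 : (I : ℝ) + 1 ≤ U + 1 := by exact_mod_cast hI
  push_cast at hs ⊢
  have h7 := mul_le_mul_of_nonneg_left h4 (sub_nonneg.mpr hs)
  have h8 := mul_nonneg (mul_nonneg (sub_nonneg.mpr h6) (sub_nonneg.mpr h1)) h5
  have h9 : ((U : ℝ) + 1) * s * ((1 - s) * point U I s) =
      (1 - s) * ((I + 1) * point (U + 1) (I + 1) s) := by rw [hp]; ring
  nlinarith

/-- With x = I - T s, uses z⁺ ≤ (z + x)² / (4x) at z = k - I and the binomial variance. -/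
theorem excess_le_variance {T I : ℕ} {s : ℝ} (h0 : 0 ≤ s) (h1 : s ≤ 1)
    (hs : T * s < I) : excess T I s ≤ T * s * (1 - s) / (4 * (I - T * s)) := by
  have hx : 0 < 4 * (I - T * s) := by linarith
  rw [le_div_iff₀ hx, mul_comm, excess, ← bern_const_mul]
  have e := bern_sq s T (-(T * s))
  rw [add_neg_cancel, zero_pow two_ne_zero, add_zero] at e
  rw [mul_assoc, ← e]
  refine bern_mono h0 h1 _ fun k _ => ?_
  rcases le_total I k with h | h
  · rw [Nat.cast_sub h]; nlinarith [sq_nonneg ((k : ℝ) - I - (I - T * s))]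
  · rw [Nat.sub_eq_zero_of_le h]; simp; positivity

theorem inflated_le_variance {T I : ℕ} {b q : ℝ} (hT : 0 < T) (hb : 0 < b) (hbI : b < I)
    (hbT : b ≤ T) (hq0 : 0 ≤ q) : inflated T I b q ≤ q * (T - b) / (4 * (I - b)) := by
  have hT0 : (0 : ℝ) < T := by exact_mod_cast hT
  have e : (T : ℝ) * (b / T) = b := by field_simp
  have h := excess_le_variance (T := T) (I := I) (s := b / T) (by positivity)
    ((div_le_one hT0).mpr hbT) (by rw [e]; exact hbI)
  rw [e] at h
  have h2 := mul_le_mul_of_nonneg_left h (by positivity : 0 ≤ q / (b / T))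
  refine h2.trans (le_of_eq ?_)
  have : (I : ℝ) - b ≠ 0 := by linarith
  field_simp

/-- The margin 1/24 below the last admissible stock level is what the dual minorant may use there.
-/
theorem advantage_ge_add {T I : ℕ} {b q : ℝ} (hb : 0 < b) (hbI : b < I) (hq : q < 1)
    (hIT : I + 2 ≤ T) (hI : (I : ℝ) + 1 ≤ T * q - (T * q - b) / 4)
    (h1 : I = 1 → 3 ≤ T * q - 1) :
    (T * q - b) / 4 + 1 / 24 ≤ advantage T (b / T) q I := by
  have hI0 : (0 : ℝ) < I := hb.trans hbI
  have hI1 : 1 ≤ I := by exact_mod_cast hI0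
  obtain ⟨a, rfl⟩ := Nat.exists_eq_add_of_le (show I ≤ T by omega)
  have ha : 2 ≤ a := by omega
  have ha' : (2 : ℝ) ≤ a := by exact_mod_cast ha
  have hT : (0 : ℝ) < (I + a : ℕ) := by positivity
  have hq0 : 0 < q := by
    have : 0 < ((I + a : ℕ) : ℝ) * q := by linarith
    exact pos_of_mul_pos_right this hT.le
  rcases hI1.eq_or_lt with h | h
  · subst h
    have h3 := h1 rfl
    have h2 := advantage_one_ge (T := 1 + a) (p := b / (1 + a : ℕ)) (by positivity)
      (by rw [mul_div_cancel₀ _ hT.ne']; simpa using hbI.le) (by linarith) hq.le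
    refine le_trans ?_ h2
    linarith
  -- If the comparison of shortfall and inflated excess is unavailable, the latter is at most 5/12
  -- by the variance bound, while `T * q - I` exceeds the target by at least 1.
  by_cases hfar : 3 * a < I ∧ (a : ℝ) / 2 < (I - b) / 3
  · obtain ⟨_, h4⟩ := hfar
    have h5 := inflated_le_variance (T := I + a) (q := q) (by omega) hb hbI
      (by push_cast; linarith) hq0.le
    have h6 : q * (((I + a : ℕ) : ℝ) - b) / (4 * (I - b)) ≤ 5 / 12 := by
      rw [div_le_iff₀ (by linarith)]
      have h7 : q * (((I + a : ℕ) : ℝ) - b) ≤ 1 * (((I + a : ℕ) : ℝ) - b) :=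
        mul_le_mul_of_nonneg_right hq.le (by push_cast; linarith)
      push_cast at h7 ⊢
      linarith
    have h8 := shortfall_nonneg (T := I + a) (I := I) hq0.le hq.le
    rw [advantage_eq_inflated]
    linarith
  · have h3 := advantage_ge_of_near hI1 (by omega) hb hbI hq.le (by linarith)
      (fun _ h => by omega) (fun h4 _ => not_lt.mp fun h5 => hfar ⟨h4, h5⟩)
    refine le_trans (add_le_add_right ?_ _) h3
    have hu := upper_ge h hIT
    have hu2 : (5 : ℝ) / 4 * I ≤ 4 * (I * upper (I + a) I) := by nlinarith
    rw [le_div_iff₀ (by linarith)]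
    have hd : 1 ≤ ((I + a : ℕ) : ℝ) * q - I - (((I + a : ℕ) : ℝ) * q - b) / 4 := by linarith
    have := mul_le_mul hu2 hd zero_le_one (by linarith)
    nlinarith

/-- Failure of the target is possible only outside the range of `inflated_le_shortfall`; the
thresholds for `I - b` are three times those for the offset `y`. -/
theorem far_of_advantage_lt {I a : ℕ} {b q : ℝ} (hI : 1 ≤ I) (ha : 1 ≤ a) (hb : 0 < b)
    (hbI : b < I) (hq : q ≤ 1)
    (hx : (I : ℝ) ≤ (I + a : ℕ) * q - ((I + a : ℕ) * q - b) / 4)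
    (hbad : advantage (I + a) (b / (I + a : ℕ)) q I < ((I + a : ℕ) * q - b) / 4) :
    3 * a < I ∧ (a = 1 → 48 / 25 < I - b) ∧ (2 ≤ a → 3 / 2 * a < I - b) := by
  by_contra! hcon
  have h := advantage_ge_of_near hI ha hb hbI hq (by linarith)
    (fun h1 h2 => by
      by_contra! h3
      obtain ⟨h4, h5⟩ := hcon h1 fun _ => by linarith
      omega)
    (fun h1 h2 => by
      obtain ⟨h4, h5⟩ := hcon h1 fun h => by omega
      linarith)
  have hu := upper_ge_quarter hI (show I < I + a by omega)
  have hI0 : (0 : ℝ) < I := hb.trans hbI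
  have : 0 ≤ (4 * (I * upper (I + a) I) - b) *
      (((I + a : ℕ) * q - I) - ((I + a : ℕ) * q - b) / 4) / (4 * I - b) :=
    div_nonneg (mul_nonneg (by nlinarith) (by linarith)) (by linarith)
  linarith

end

/-! ### Exponential tilting and point probabilities -/

section

theorem bern_pow (s r : ℝ) (T : ℕ) : bern s T (fun k => r ^ k) = (s * r + (1 - s)) ^ T := by
  induction T with
  | zero => simp [bern]
  | succ T ih =>
    have : (fun k : ℕ => r ^ (k + 1)) = fun k => r * r ^ k := by funext k; ring
    rw [bern_succ, this, bern_const_mul, ih]; ring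

/-- `exp t` is the odds at `q` divided by the odds at `b / T`, so the weight turns the binomial law
with probability `q` into the one with mean `b`. -/
theorem bern_tilt {T : ℕ} {b q t : ℝ} (hbT : b < T) (hq0 : 0 < q) (hq1 : q < 1)
    (ht : Real.exp t = q * (T - b) / (b * (1 - q))) :
    bern q T (fun k => Real.exp (t * (b - k))) =
      Real.exp (t * b) * (T * (1 - q) / (T - b)) ^ T := by
  have h1 : (fun k : ℕ => Real.exp (t * (b - k))) =
      fun k : ℕ => Real.exp (t * b) * Real.exp (-t) ^ k := by
    funext k
    rw [← Real.exp_nat_mul, ← Real.exp_add]; congr 1; ring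
  have h2 : (T : ℝ) - b ≠ 0 := by linarith
  have h3 : (1 : ℝ) - q ≠ 0 := by linarith
  rw [h1, bern_const_mul, bern_pow, Real.exp_neg, ht]
  congr 2
  field_simp
  ring

theorem bern_tilt_le {T : ℕ} {b q t : ℝ} (hb : 0 < b) (hbT : b < T) (hq0 : 0 < q) (hq1 : q < 1)
    (ht : Real.exp t = q * (T - b) / (b * (1 - q))) :
    bern q T (fun k => Real.exp (t * (b - k))) ≤
      Real.exp ((T * q - b) - (T - b) * Real.log ((T - b) / (T * (1 - q)))) := by
  have hT : (0 : ℝ) < T := hb.trans hbT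
  have hA : 0 < (T : ℝ) - b := by linarith
  have hm : 0 < T * (1 - q) := mul_pos hT (by linarith)
  have hQ : 0 < T * q := mul_pos hT hq0
  rw [bern_tilt hbT hq0 hq1 ht, ← inv_div, ← Real.exp_log (inv_pos.mpr (div_pos hA hm)),
    ← Real.exp_nat_mul, ← Real.exp_add, Real.log_inv]
  apply Real.exp_le_exp.mpr
  have e : t = Real.log (T * q / b) + Real.log ((T - b) / (T * (1 - q))) := by
    rw [← Real.log_mul (by positivity) (by positivity), ← Real.log_exp t, ht]
    congr 1
    field_simp
  have h := Real.log_le_sub_one_of_pos (div_pos hQ hb)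
  have h2 := mul_le_mul_of_nonneg_left h hb.le
  have h3 : b * (T * q / b - 1) = T * q - b := by field_simp
  rw [h3] at h2
  rw [e]
  linarith

/-- The change of measure read off at the single value `J`. It converts the bound on the leftover
into a multiple of a point probability at `q`. -/
theorem bern_tilt_mul_point {J a : ℕ} {b q t : ℝ} (hb : 0 < b) (hbT : b < (J + a : ℕ))
    (hq0 : 0 < q) (hq1 : q < 1)
    (ht : Real.exp t = q * ((J + a : ℕ) - b) / (b * (1 - q))) :
    bern q (J + a) (fun k => Real.exp (t * (b - k))) * point (J + a) J (b / (J + a : ℕ)) =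
      Real.exp (t * (b - J)) * point (J + a) J q := by
  have hT : (0 : ℝ) < (J + a : ℕ) := hb.trans hbT
  have hA : 0 < ((J + a : ℕ) : ℝ) - b := by linarith
  have hm : 0 < 1 - q := by linarith
  have e1 : Real.exp (t * (b - J)) = Real.exp (t * b) / Real.exp t ^ J := by
    rw [← Real.exp_nat_mul, ← Real.exp_sub]; congr 1; ring
  have e2 : 1 - b / ((J + a : ℕ) : ℝ) = ((J + a : ℕ) - b) / (J + a : ℕ) := by field_simp
  rw [bern_tilt hbT hq0 hq1 ht, e1, ht, point_eq, point_eq, Nat.add_sub_cancel_left, e2]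
  generalize ((J + a : ℕ) : ℝ) - b = A at hA
  generalize ((J + a : ℕ) : ℝ) = τ at hT
  rw [pow_add]
  simp only [div_pow, mul_pow]
  field_simp

/-- A lower bound for the binomial coefficient: of the factors of its falling factorial, `c` are at
least 3/4 of the number of trials because `c + 1` is at most a third of `J + 1`. -/
theorem point_ge {J c : ℕ} (h : 3 * (c + 1) ≤ J + 1) {b : ℝ} (hb : 0 < b)
    (hbT : b < (J + (c + 2) : ℕ)) :
    (J + 1) * ((b / (J + (c + 2) : ℕ)) ^ (J + 1) *
      ((3 / 4) ^ c * ((J + (c + 2) : ℕ) - b) ^ (c + 2) / (c + 2).factorial)) ≤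
      b * point (J + (c + 2)) J (b / (J + (c + 2) : ℕ)) := by
  obtain ⟨τ, hτ⟩ : ∃ τ : ℝ, τ = (J + (c + 2) : ℕ) := ⟨_, rfl⟩
  have h1 : (J + 1) * (τ * (3 / 4 * τ) ^ c) ≤
      (c + 2).factorial * ((J + (c + 2)).choose J : ℝ) := by
    have e : (J + (c + 2)).choose J = (J + (c + 2)).choose (c + 2) := by
      rw [Nat.choose_symm_add]
    have e2 : (c + 2).factorial * (J + (c + 2)).choose J = (J + c + 2) *
        ((J + 1) * (J + c + 1).descFactorial c) := by
      rw [e, ← Nat.descFactorial_eq_factorial_mul_choose, show J + (c + 2) = J + c + 1 + 1 by omega,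
        Nat.succ_descFactorial_succ, Nat.descFactorial_succ, show J + c + 1 - c = J + 1 by omega]
    have e3 : (J + 2) ^ c ≤ (J + c + 1).descFactorial c := by
      have := Nat.pow_sub_le_descFactorial (J + c + 1) c
      rwa [show J + c + 1 + 1 - c = J + 2 by omega] at this
    have e4 : (3 / 4 * τ) ^ c ≤ ((J + c + 1).descFactorial c : ℝ) := by
      refine le_trans (pow_le_pow_left₀ (by rw [hτ]; positivity) (b := (J : ℝ) + 2) ?_ c)
        (by exact_mod_cast e3)
      have : (3 : ℝ) * (c + 1) ≤ J + 1 := by exact_mod_cast h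
      rw [hτ]; push_cast; linarith
    have e5 : ((c + 2).factorial * (J + (c + 2)).choose J : ℝ) = τ *
        ((J + 1) * (J + c + 1).descFactorial c) := by
      rw [hτ]; exact_mod_cast e2
    rw [e5]
    have hτ0 : 0 ≤ τ := by rw [hτ]; positivity
    have := mul_le_mul_of_nonneg_left e4 (by positivity : 0 ≤ ((J : ℝ) + 1) * τ)
    linarith
  rw [point_eq, Nat.add_sub_cancel_left, ← hτ]
  rw [← hτ] at hbT
  have hτ0 : 0 < τ := hb.trans hbT
  have hA : 0 < τ - b := by linarith
  have e2 : 1 - b / τ = (τ - b) / τ := by field_simp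
  have hf : (0 : ℝ) < (c + 2).factorial := by positivity
  rw [e2]
  have h2 := mul_le_mul_of_nonneg_left h1
    (by positivity : 0 ≤ b * (b / τ) ^ J * ((τ - b) / τ) ^ (c + 2) / (c + 2).factorial)
  refine le_trans (le_of_eq ?_) (h2.trans (le_of_eq ?_))
  · rw [mul_pow, pow_succ (b / τ), div_pow (τ - b), pow_add τ c 2]
    field_simp
  · field_simp

theorem log_one_add_le {z : ℝ} (hz : 0 ≤ z) :
    Real.log (1 + z) ≤ z * (6 + z) / (6 + 4 * z) := by
  have hd : ∀ x : ℝ, 0 ≤ x → HasDerivAt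
      (fun x : ℝ => x * (6 + x) / (6 + 4 * x) - Real.log (1 + x))
      (((1 * (6 + x) + x * 1) * (6 + 4 * x) - x * (6 + x) * (4 * 1)) / (6 + 4 * x) ^ 2 -
        1 / (1 + x)) x := fun x hx =>
    (((hasDerivAt_id x).mul ((hasDerivAt_id x).const_add 6)).div
      (((hasDerivAt_id x).const_mul 4).const_add 6) (by simp; linarith)).sub
      (((hasDerivAt_id x).const_add 1).log (by simp; linarith))
  have hm : MonotoneOn (fun x : ℝ => x * (6 + x) / (6 + 4 * x) - Real.log (1 + x))
      (Set.Icc 0 z) := by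
    refine monotoneOn_of_deriv_nonneg (convex_Icc 0 z)
      (fun x hx => (hd x hx.1).continuousAt.continuousWithinAt) (fun x hx => ?_) fun x hx => ?_
    · rw [interior_Icc] at hx
      exact (hd x hx.1.le).differentiableAt.differentiableWithinAt
    · rw [interior_Icc] at hx
      have hx0 := hx.1
      rw [(hd x hx0.le).deriv]
      have : ((1 * (6 + x) + x * 1) * (6 + 4 * x) - x * (6 + x) * (4 * 1)) / (6 + 4 * x) ^ 2 -
          1 / (1 + x) = 4 * x ^ 3 / ((6 + 4 * x) ^ 2 * (1 + x)) := by field_simp; ring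
      rw [this]; positivity
  have := hm ⟨le_rfl, hz⟩ ⟨hz, le_rfl⟩ hz
  simp at this
  linarith

theorem mul_log_one_add_div_le {A b : ℝ} (hA : 0 ≤ A) (hb : 0 < b)
    (h : 6 * b + A ≤ 3 * A * b) : (b + 1) * Real.log (1 + A / b) ≤ A := by
  have h1 := mul_le_mul_of_nonneg_left (log_one_add_le (z := A / b) (by positivity))
    (by linarith : 0 ≤ b + 1)
  refine h1.trans ?_
  have : (b + 1) * (A / b * (6 + A / b) / (6 + 4 * (A / b))) =
      A * ((b + 1) * (6 * b + A)) / (b * (6 * b + 4 * A)) := by field_simp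
  rw [this, div_le_iff₀ (by positivity)]
  refine mul_le_mul_of_nonneg_left ?_ hA
  nlinarith

theorem point_le_shortfall {T J : ℕ} {s : ℝ} (h0 : 0 ≤ s) (h1 : s ≤ 1) :
    point T J s ≤ shortfall T (J + 1) s :=
  bern_mono h0 h1 _ fun k _ => by
    split_ifs with h
    · rw [h]; simp
    · positivity

/-- The excess over `J + 1` is at most `c + 1` times the next point probability, and two steps of
the ratio formula lead from there down to `J`. -/
theorem inflated_le_mul_point {J c : ℕ} {b q : ℝ} (hb : 0 < b) (hbJ : b ≤ J + 1) (hq0 : 0 ≤ q) :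
    inflated (J + (c + 2)) (J + 1) b q ≤ (J + (c + 2) : ℕ) * q * b * (c + 1) ^ 2 * (c + 2) /
      ((J + 1) * (J + 2) * ((J + (c + 2) : ℕ) - b) ^ 2) *
      point (J + (c + 2)) J (b / (J + (c + 2) : ℕ)) := by
  have hT : (0 : ℝ) < (J + (c + 2) : ℕ) := by positivity
  have hA : 0 < ((J + (c + 2) : ℕ) : ℝ) - b := by push_cast; linarith [Nat.cast_nonneg (α := ℝ) c]
  have eT : ((J + (c + 2) : ℕ) : ℝ) * (b / (J + (c + 2) : ℕ)) = b := by field_simp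
  have h := excess_le_mul_point (T := J + (c + 2)) (I := J + 1) (s := b / (J + (c + 2) : ℕ))
    (by omega) (by positivity) (by rw [div_le_one hT]; linarith) (by rw [eT]; push_cast; exact hbJ)
  have r1 := point_ratio (T := J + (c + 2)) (j := J) (by omega) (b / (J + (c + 2) : ℕ))
  have r2 := point_ratio (T := J + (c + 2)) (j := J + 1) (by omega) (b / (J + (c + 2) : ℕ))
  rw [show J + (c + 2) - J = c + 2 by omega] at r1
  rw [show J + (c + 2) - (J + 1) = c + 1 by omega] at r2
  have ec : ((J + (c + 2) : ℕ) : ℝ) - (J + 1 : ℕ) = c + 1 := by push_cast; ring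
  rw [ec] at h
  have e2 : 1 - b / ((J + (c + 2) : ℕ) : ℝ) = ((J + (c + 2) : ℕ) - b) / (J + (c + 2) : ℕ) := by
    field_simp
  rw [e2] at r1 r2
  rw [inflated]
  refine (mul_le_mul_of_nonneg_left h (by positivity)).trans (le_of_eq ?_)
  obtain ⟨τ, hτ⟩ : ∃ τ : ℝ, τ = (J + (c + 2) : ℕ) := ⟨_, rfl⟩
  rw [← hτ] at hT hA r1 r2 ⊢
  obtain ⟨A, hA'⟩ : ∃ A : ℝ, A = τ - b := ⟨_, rfl⟩
  rw [← hA'] at hA r1 r2 ⊢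
  generalize point (J + (c + 2)) J (b / τ) = p0 at r1 ⊢
  generalize point (J + (c + 2)) (J + 1) (b / τ) = p1 at r1 r2
  generalize point (J + (c + 2)) (J + 1 + 1) (b / τ) = p2 at r2 ⊢
  push_cast at r1 r2
  have k1 : p1 = p0 * ((c + 2) * b) / ((J + 1) * A) := by
    rw [eq_div_iff (by positivity)]
    field_simp at r1
    linarith
  have k2 : p2 = p1 * ((c + 1) * b) / ((J + 2) * A) := by
    rw [eq_div_iff (by positivity)]
    field_simp at r2
    linarith
  rw [k2, k1]
  field_simp

end

/-! ### The dual constraint from three numerical conditions -/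

section

theorem neg_log_one_sub_le {X : ℝ} (h0 : 0 ≤ X) (h1 : X ≤ 1 / 20) :
    -Real.log (1 - X) ≤ 20 / 19 * X := by
  have k1 := Real.one_sub_inv_le_log_of_pos (show 0 < 1 - X by linarith)
  have k2 : (1 - X)⁻¹ ≤ 1 + 20 / 19 * X := by
    rw [inv_le_iff_one_le_mul₀ (by linarith)]
    nlinarith [mul_nonneg h0 (by linarith : 0 ≤ 1 - 20 * X)]
  linarith

/-- Here I = J + 1 and T - I = c + 1, and all quantities are measured by p₁, the probability of `J`
at success probability `q`, which is at most the shortfall. `h1` makes the tilted moment at most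
1/20. `h3` gives E I / b ≤ p₁ / 2, and `h4` bounds the inflated excess times E I / b by p₁ / 48. The
constants 40/19 and 960/19 are 2 and 48 times the 20/19 of `neg_log_one_sub_le`. -/
theorem exists_tilt_of_bounds {J c : ℕ} {b q ℓ : ℝ} (hb : 0 < b) (hbJ : b < J + 1)
    (hq0 : 0 < q) (hq1 : q < 1) (hJ : 3 * (c + 1) ≤ J + 1)
    (hℓ : ℓ = Real.log (((J + (c + 2) : ℕ) - b) / ((J + (c + 2) : ℕ) * (1 - q))))
    (h6 : 6 * b + ((J + (c + 2) : ℕ) - b) ≤ 3 * ((J + (c + 2) : ℕ) - b) * b)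
    (h1 : 3 ≤ ((J + (c + 2) : ℕ) - b) * (ℓ - 1)) (h2 : 0 < ℓ) (hbq : b < (J + (c + 2) : ℕ) * q)
    (h3 : 40 / 19 * Real.exp (((J + (c + 2) : ℕ) - b) - (J - b) *
      Real.log (q * (((J + (c + 2) : ℕ) - b) / ((J + (c + 2) : ℕ) * (1 - q))))) ≤
      ℓ * ((3 / 4) ^ c * ((J + (c + 2) : ℕ) - b) ^ (c + 2) / (c + 2).factorial))
    (h4 : ∀ t, ℓ ≤ t → Real.exp t = q * ((J + (c + 2) : ℕ) - b) / (b * (1 - q)) →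
      960 / 19 * ((J + (c + 2) : ℕ) * q) * (c + 1) ^ 2 * (c + 2) * Real.exp (t * (b - J)) ≤
        t * (J + 2) * ((J + (c + 2) : ℕ) - b) ^ 2) :
    0 < shortfall (J + (c + 2)) (J + 1) q ∧ ∃ t : ℝ, 0 < t ∧
      bern q (J + (c + 2)) (fun k => Real.exp (t * (b - k))) < 1 ∧ ∃ E : ℝ,
      E = -Real.log (1 - bern q (J + (c + 2)) (fun k => Real.exp (t * (b - k)))) / t ∧
      E * (J + 1 : ℕ) / b ≤ shortfall (J + (c + 2)) (J + 1) q / 2 ∧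
      (inflated (J + (c + 2)) (J + 1) b q - shortfall (J + (c + 2)) (J + 1) q) *
        (E * (J + 1 : ℕ) / b) ≤
        (shortfall (J + (c + 2)) (J + 1) q - E * (J + 1 : ℕ) / b) / 24 := by
  have hτ : (b : ℝ) < (J + (c + 2) : ℕ) := by
    push_cast; linarith [Nat.cast_nonneg (α := ℝ) c]
  have hG := point_ge hJ hb hτ
  have hD := inflated_le_mul_point (c := c) hb hbJ.le hq0.le
  have hR := point_le_shortfall (T := J + (c + 2)) (J := J) hq0.le hq1.le
  have hp1 : 0 < point (J + (c + 2)) J q := by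
    rw [point_eq]
    have := Nat.choose_pos (show J ≤ J + (c + 2) by omega)
    have : 0 < 1 - q := by linarith
    positivity
  obtain ⟨τ, eτ⟩ : ∃ τ : ℝ, τ = (J + (c + 2) : ℕ) := ⟨_, rfl⟩
  obtain ⟨t, et⟩ : ∃ t, t = Real.log (q * (τ - b) / (b * (1 - q))) := ⟨_, rfl⟩
  have hτ0 : 0 < τ := by rw [eτ]; exact hb.trans hτ
  have hA : 0 < τ - b := by rw [eτ]; linarith
  have hm : 0 < 1 - q := by linarith
  have ht : Real.exp t = q * (τ - b) / (b * (1 - q)) := by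
    rw [et, Real.exp_log (by positivity)]
  have hX := bern_tilt_le (t := t) hb hτ hq0 hq1 (by rw [← eτ]; exact ht)
  have hXP := bern_tilt_mul_point (t := t) hb hτ hq0 hq1 (by rw [← eτ]; exact ht)
  have h4 := h4 t
  simp only [← eτ] at h4 hX hXP hG hD h1 h3 h6 hℓ hbq
  obtain ⟨X, eX⟩ : ∃ X, X = bern q (J + (c + 2)) (fun k => Real.exp (t * (b - k))) := ⟨_, rfl⟩
  have hX0 : 0 ≤ X := by rw [eX]; exact bern_nonneg hq0.le hq1.le _ fun _ _ => (Real.exp_pos _).le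
  rw [← eX] at hX hXP
  -- Since T q - b is less than T - b, `h1` makes the exponent at most -3.
  have hX1 : X ≤ 1 / 20 := by
    rw [← hℓ] at hX
    refine hX.trans ((Real.exp_le_exp.mpr (?_ : _ ≤ (-3 : ℝ))).trans ?_)
    · have : 0 < τ * (1 - q) := by positivity
      linarith
    · rw [Real.exp_neg, one_div]
      refine inv_anti₀ (by norm_num) ?_
      have : Real.exp 3 = Real.exp 1 ^ 3 := by rw [← Real.exp_nat_mul]; norm_num
      rw [this]
      exact le_trans (by norm_num) (pow_le_pow_left₀ (by norm_num) Real.exp_one_gt_d9.le 3)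
  have tℓ : ℓ ≤ t := by
    rw [hℓ, et]
    refine Real.log_le_log (by positivity) ?_
    rw [div_le_div_iff₀ (by positivity) (by positivity)]
    have := mul_le_mul_of_nonneg_right hbq.le (by positivity : 0 ≤ (τ - b) * (1 - q))
    linarith
  have ht0 : 0 < t := h2.trans_le tℓ
  have h4 := h4 tℓ ht
  obtain ⟨lam, elam⟩ : ∃ lam, lam = Real.log (1 + (τ - b) / b) := ⟨_, rfl⟩
  obtain ⟨v, ev⟩ : ∃ v, v = Real.log (q * ((τ - b) / (τ * (1 - q)))) := ⟨_, rfl⟩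
  have e1 : 1 + (τ - b) / b = τ / b := by field_simp; ring
  have tsum : t = lam + v := by
    rw [et, elam, ev, e1, ← Real.log_mul (by positivity) (by positivity)]
    congr 1; field_simp
  have hlam : (b + 1) * lam ≤ τ - b := by
    rw [elam]; exact mul_log_one_add_div_le hA.le hb (by linarith)
  obtain ⟨H, eH⟩ : ∃ H : ℝ, H = (3 / 4) ^ c * (τ - b) ^ (c + 2) / (c + 2).factorial := ⟨_, rfl⟩
  have hH : 0 < H := by rw [eH]; positivity
  rw [← ev, ← eH] at h3
  rw [← eH] at hG
  obtain ⟨w, ew⟩ : ∃ w, w = Real.exp (t * (b - J)) := ⟨_, rfl⟩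
  have hw : 0 < w := by rw [ew]; exact Real.exp_pos _
  rw [← ew] at hXP h4
  have e2 : (b / τ) ^ (J + 1) = Real.exp (-((J + 1) * lam)) := by
    rw [elam, e1, ← Real.exp_log (by positivity : 0 < b / τ), ← Real.exp_nat_mul, ← inv_div b τ,
      Real.log_inv]
    congr 1; push_cast; ring
  have hwG : 40 / 19 * w ≤ t * ((b / τ) ^ (J + 1) * H) := by
    have k1 : 40 / 19 * w = Real.exp (-((J - b) * lam) - (τ - b)) *
        (40 / 19 * Real.exp ((τ - b) - (J - b) * v)) := by
      rw [mul_left_comm, ← Real.exp_add, ew, tsum]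
      congr 2; ring
    have k2 : Real.exp (-((J - b) * lam) - (τ - b)) ≤ (b / τ) ^ (J + 1) := by
      rw [e2]; apply Real.exp_le_exp.mpr; linarith
    rw [k1]
    refine (mul_le_mul k2 h3 (by positivity) (by positivity)).trans ?_
    have := mul_le_mul_of_nonneg_right tℓ (by positivity : 0 ≤ (b / τ) ^ (J + 1) * H)
    linarith
  obtain ⟨P, eP⟩ : ∃ P, P = point (J + (c + 2)) J (b / τ) := ⟨_, rfl⟩
  obtain ⟨p1, ep1⟩ : ∃ p1, p1 = point (J + (c + 2)) J q := ⟨_, rfl⟩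
  obtain ⟨R, eR⟩ : ∃ R, R = shortfall (J + (c + 2)) (J + 1) q := ⟨_, rfl⟩
  obtain ⟨D, eD⟩ : ∃ D, D = inflated (J + (c + 2)) (J + 1) b q := ⟨_, rfl⟩
  rw [← eP] at hG hD hXP
  rw [← ep1] at hXP hR hp1
  rw [← eR] at hR ⊢
  rw [← eD] at hD ⊢
  have hP : 0 < P := by
    have : 0 < b * P := lt_of_lt_of_le (by positivity) hG
    exact pos_of_mul_pos_right this hb.le
  refine ⟨hp1.trans_le hR, t, ht0, by rw [← eX]; linarith, _, rfl, ?_⟩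
  rw [← eX]
  have hE : -Real.log (1 - X) / t ≤ 20 / 19 * X / t := by
    exact div_le_div_of_nonneg_right (neg_log_one_sub_le hX0 hX1) ht0.le
  obtain ⟨ε, eε⟩ : ∃ ε, ε = -Real.log (1 - X) / t * ((J + 1 : ℕ) : ℝ) / b := ⟨_, rfl⟩
  rw [← eε]
  have hJ1 : (0 : ℝ) < J + 1 := by positivity
  have hε : ε ≤ 20 / 19 * w * p1 * (J + 1) / (P * t * b) := by
    have k1 : ε ≤ 20 / 19 * X / t * (J + 1) / b := by
      rw [eε]; push_cast; gcongr
    refine k1.trans (le_of_eq ?_)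
    have : X = w * p1 / P := by rw [eq_div_iff hP.ne', hXP]
    rw [this]; field_simp
  have hε0 : 0 ≤ ε := by
    rw [eε]
    have : 0 ≤ -Real.log (1 - X) := by
      have := Real.log_nonpos (show 0 ≤ 1 - X by linarith) (by linarith); linarith
    positivity
  have hε1 : ε ≤ p1 / 2 := by
    refine hε.trans ?_
    rw [div_le_iff₀ (by positivity)]
    have k1 := mul_le_mul_of_nonneg_right hwG (by positivity : 0 ≤ (J + 1) * p1)
    have k2 := mul_le_mul_of_nonneg_right hG (by positivity : 0 ≤ t * p1)
    linarith
  have hDε : D * ε ≤ p1 / 48 := by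
    refine (mul_le_mul_of_nonneg_right hD hε0).trans
      ((mul_le_mul_of_nonneg_left hε (by positivity)).trans ?_)
    have k1 : τ * q * b * (c + 1) ^ 2 * (c + 2) / ((J + 1) * (J + 2) * (τ - b) ^ 2) * P *
        (20 / 19 * w * p1 * (J + 1) / (P * t * b)) =
        960 / 19 * (τ * q) * (c + 1) ^ 2 * (c + 2) * w * (p1 / 48) /
          (t * (J + 2) * (τ - b) ^ 2) := by
      field_simp; norm_num
    rw [k1, div_le_iff₀ (by positivity), mul_comm (p1 / 48)]
    exact mul_le_mul_of_nonneg_right h4 (by positivity)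
  refine ⟨by linarith, ?_⟩
  have : 0 ≤ R * ε := mul_nonneg (hp1.le.trans hR) hε0
  linarith

end

/-! ### Checking the conditions in the exceptional range -/

section

theorem factorial_add_two_le {c : ℕ} (hc : 1 ≤ c) :
    4 * (c + 2).factorial ≤ 3 * (c + 1) ^ (c + 2) := by
  induction c, hc using Nat.le_induction with
  | base => decide
  | succ c hc ih =>
    have h1 : (c + 1) ^ (c + 1) * ((c + 1) * (c + 3)) ≤ (c + 2) ^ (c + 1) * (c + 2) ^ 2 :=
      Nat.mul_le_mul (Nat.pow_le_pow_left (by omega) _) (by nlinarith)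
    calc 4 * (c + 1 + 2).factorial = (c + 3) * (4 * (c + 2).factorial) := by
          rw [show c + 1 + 2 = c + 2 + 1 by omega, Nat.factorial_succ]; ring
      _ ≤ (c + 3) * (3 * (c + 1) ^ (c + 2)) := Nat.mul_le_mul_left _ ih
      _ = 3 * ((c + 1) ^ (c + 1) * ((c + 1) * (c + 3))) := by ring
      _ ≤ 3 * ((c + 2) ^ (c + 1) * (c + 2) ^ 2) := Nat.mul_le_mul_left _ h1
      _ = _ := by ring

theorem exp_le_inv_one_sub {z : ℝ} (hz : z < 1) : Real.exp z ≤ (1 - z)⁻¹ := by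
  have h := Real.add_one_le_exp (-z)
  rw [Real.exp_neg] at h
  exact (le_inv_comm₀ (by linarith) (Real.exp_pos z)).mp (by linarith)

theorem exp_two_bounds : 7.389 ≤ Real.exp 2 ∧ Real.exp 2 ≤ 7.3891 := by
  have : Real.exp 2 = Real.exp 1 ^ 2 := by rw [← Real.exp_nat_mul]; norm_num
  rw [this]
  constructor
  · exact le_trans (by norm_num) (pow_le_pow_left₀ (by norm_num) Real.exp_one_gt_d9.le 2)
  · exact le_trans (pow_le_pow_left₀ (by positivity) Real.exp_one_lt_d9.le 2) (by norm_num)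

/-- For `T = I + 1` the hypotheses force T (1 - q) ≤ 9/25 and T - b ≥ 73/25, so the ratio inside the
logarithm is at least 73/9 > e². -/
theorem exists_tilt_top {J : ℕ} {b q : ℝ} (hb : 0 < b) (hJ : 4 ≤ J + 1)
    (hq0 : 0 < q) (hq1 : q < 1) (hx : 48 / 25 < (J : ℝ) + 1 - b)
    (hy : (J : ℝ) + 1 - b ≤ 3 * ((J + 2) * q - (J + 1))) :
    0 < shortfall (J + (0 + 2)) (J + 1) q ∧ ∃ t : ℝ, 0 < t ∧
      bern q (J + (0 + 2)) (fun k => Real.exp (t * (b - k))) < 1 ∧ ∃ E : ℝ,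
      E = -Real.log (1 - bern q (J + (0 + 2)) (fun k => Real.exp (t * (b - k)))) / t ∧
      E * (J + 1 : ℕ) / b ≤ shortfall (J + (0 + 2)) (J + 1) q / 2 ∧
      (inflated (J + (0 + 2)) (J + 1) b q - shortfall (J + (0 + 2)) (J + 1) q) *
        (E * (J + 1 : ℕ) / b) ≤
        (shortfall (J + (0 + 2)) (J + 1) q - E * (J + 1 : ℕ) / b) / 24 := by
  obtain ⟨e2l, e2u⟩ := exp_two_bounds
  have hJ' : (4 : ℝ) ≤ J + 1 := by exact_mod_cast hJ
  have eτ : ((J + (0 + 2) : ℕ) : ℝ) = J + 2 := by push_cast; ring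
  obtain ⟨m, hm⟩ : ∃ m, m = ((J : ℝ) + 2) * (1 - q) := ⟨_, rfl⟩
  have hm0 : 0 < m := by rw [hm]; exact mul_pos (by linarith) (by linarith)
  have hQ : ((J : ℝ) + 2) * q = J + 2 - m := by rw [hm]; ring
  obtain ⟨A, hA⟩ : ∃ A, A = (J : ℝ) + 2 - b := ⟨_, rfl⟩
  have hA1 : 73 / 25 ≤ A := by rw [hA]; linarith
  have hm1 : m ≤ 9 / 25 := by linarith
  have hq2 : 116 / 125 ≤ q := by
    by_contra! h
    have := mul_lt_mul_of_pos_left h (by linarith : (0 : ℝ) < J + 2)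
    linarith
  have hr : 73 / 9 ≤ A / m := by rw [le_div_iff₀ hm0]; linarith
  have hℓ : 41 / 20 ≤ Real.log (A / m) := by
    rw [Real.le_log_iff_exp_le (by positivity)]
    have h1 := exp_le_inv_one_sub (z := 1 / 20) (by norm_num)
    have h2 : Real.exp (41 / 20) = Real.exp 2 * Real.exp (1 / 20) := by
      rw [← Real.exp_add]; norm_num
    have h3 := mul_le_mul e2u h1 (Real.exp_pos _).le (by norm_num)
    rw [h2]
    norm_num at h3 ⊢
    linarith
  have hv : 2 ≤ Real.log (q * (A / m)) := by
    rw [Real.le_log_iff_exp_le (by positivity)]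
    have := mul_le_mul hq2 hr (by norm_num) hq0.le
    linarith
  have hA2 : (73 / 25) ^ 2 ≤ A ^ 2 := pow_le_pow_left₀ (by norm_num) hA1 2
  refine exists_tilt_of_bounds (ℓ := Real.log (A / m)) hb (by linarith) hq0 hq1 (by omega) ?_ ?_ ?_
    (by linarith) ?_ ?_ ?_
  · rw [eτ, hA, hm]
  · rw [eτ, ← hA]
    rcases le_total b 2 with h | h
    · nlinarith
    · nlinarith
  · rw [eτ, ← hA]; nlinarith
  · rw [eτ, hQ]; linarith
  · rw [eτ, ← hA, ← hm]
    have h1 : Real.exp (A - (J - b) * Real.log (q * (A / m))) ≤ Real.exp (27 / 25) := by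
      apply Real.exp_le_exp.mpr
      have := mul_le_mul_of_nonneg_left hv (by linarith : 0 ≤ (J : ℝ) - b)
      linarith
    have h2 : Real.exp (27 / 25) = Real.exp 1 * Real.exp (2 / 25) := by
      rw [← Real.exp_add]; norm_num
    have h3 := exp_le_inv_one_sub (z := 2 / 25) (by norm_num)
    have h4 := mul_le_mul Real.exp_one_lt_d9.le h3 (Real.exp_pos _).le (by norm_num)
    have h5 := mul_le_mul hℓ hA2 (by norm_num) (by linarith)
    norm_num [Nat.factorial] at h4 h5 ⊢
    linarith
  · intro t ht _
    rw [eτ, ← hA, hQ]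
    have h1 : Real.exp (t * (b - J)) ≤ Real.exp (-(943 / 500)) := by
      apply Real.exp_le_exp.mpr
      have := mul_le_mul (hℓ.trans ht) (by linarith : 23 / 25 ≤ (J : ℝ) - b) (by norm_num)
        (by linarith)
      linarith
    have h2 : Real.exp (-(943 / 500)) ≤ (6.5 : ℝ)⁻¹ := by
      rw [Real.exp_neg]
      refine inv_anti₀ (by norm_num) ?_
      have h3 : Real.exp (943 / 500) = Real.exp 2 * Real.exp (-(57 / 500)) := by
        rw [← Real.exp_add]; norm_num
      have h4 := Real.add_one_le_exp (-(57 / 500 : ℝ))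
      have h5 := mul_le_mul e2l h4 (by norm_num) (Real.exp_pos _).le
      rw [h3]
      norm_num at h5 ⊢
      linarith
    have h3 : 960 / 19 * ((J : ℝ) + 2 - m) * ((0 : ℕ) + 1) ^ 2 * ((0 : ℕ) + 2) *
        Real.exp (t * (b - J)) ≤ (J + 2) * (1920 / 19 * (6.5 : ℝ)⁻¹) := by
      have := mul_le_mul (by linarith : (J : ℝ) + 2 - m ≤ J + 2) (h1.trans h2) (Real.exp_pos _).le
        (by linarith)
      push_cast
      linarith
    refine h3.trans ?_
    have h6 := mul_le_mul (hℓ.trans ht) hA2 (by norm_num) (by linarith)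
    have h7 := mul_le_mul_of_nonneg_left
      (le_trans (by norm_num : 1920 / 19 * (6.5 : ℝ)⁻¹ ≤ 41 / 20 * (73 / 25) ^ 2) h6)
      (by linarith : 0 ≤ (J : ℝ) + 2)
    linarith

/-- For a = T - I = c + 1 the hypotheses force T (1 - q) ≤ a / 2 and T - b ≥ 5a / 2, so the ratio
inside the logarithm is at least 5. -/
theorem exists_tilt_far {J c : ℕ} {b q : ℝ} (hc : 1 ≤ c) (hb : 0 < b) (hJ : 3 * (c + 1) < J + 1)
    (hq0 : 0 < q) (hq1 : q < 1) (hx : 3 / 2 * ((c : ℝ) + 1) < (J : ℝ) + 1 - b)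
    (hy : (J : ℝ) + 1 - b ≤ 3 * ((J + (c + 2) : ℕ) * q - (J + 1))) :
    0 < shortfall (J + (c + 2)) (J + 1) q ∧ ∃ t : ℝ, 0 < t ∧
      bern q (J + (c + 2)) (fun k => Real.exp (t * (b - k))) < 1 ∧ ∃ E : ℝ,
      E = -Real.log (1 - bern q (J + (c + 2)) (fun k => Real.exp (t * (b - k)))) / t ∧
      E * (J + 1 : ℕ) / b ≤ shortfall (J + (c + 2)) (J + 1) q / 2 ∧
      (inflated (J + (c + 2)) (J + 1) b q - shortfall (J + (c + 2)) (J + 1) q) *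
        (E * (J + 1 : ℕ) / b) ≤
        (shortfall (J + (c + 2)) (J + 1) q - E * (J + 1 : ℕ) / b) / 24 := by
  obtain ⟨e2l, e2u⟩ := exp_two_bounds
  have hc' : (1 : ℝ) ≤ c := by exact_mod_cast hc
  have hJ' : 3 * ((c : ℝ) + 1) + 1 ≤ J + 1 := by exact_mod_cast hJ
  have eτ : ((J + (c + 2) : ℕ) : ℝ) = J + c + 2 := by push_cast; ring
  rw [eτ] at hy
  have hτ0 : 0 < (J : ℝ) + c + 2 := by positivity
  obtain ⟨m, hm⟩ : ∃ m, m = ((J : ℝ) + c + 2) * (1 - q) := ⟨_, rfl⟩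
  have hm0 : 0 < m := by rw [hm]; exact mul_pos hτ0 (by linarith)
  have hQ : ((J : ℝ) + c + 2) * q = J + c + 2 - m := by rw [hm]; ring
  obtain ⟨A, hA⟩ : ∃ A, A = (J : ℝ) + c + 2 - b := ⟨_, rfl⟩
  have hA1 : 5 / 2 * ((c : ℝ) + 1) ≤ A := by rw [hA]; linarith
  have hm1 : m ≤ ((c : ℝ) + 1) / 2 := by linarith
  have hb1 : 1 ≤ b := by linarith
  have hA0 : 0 < A := by linarith
  have hq2 : 7 / 8 ≤ q := by
    by_contra! h
    have := mul_lt_mul_of_pos_left h hτ0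
    linarith
  have hr : 5 ≤ A / m := by rw [le_div_iff₀ hm0]; linarith
  have hℓ : 8 / 5 ≤ Real.log (A / m) := by
    rw [Real.le_log_iff_exp_le (by positivity)]
    refine le_trans ?_ hr
    have h1 : Real.exp (8 / 5) ^ 5 = Real.exp 2 ^ 4 := by
      rw [← Real.exp_nat_mul, ← Real.exp_nat_mul]; norm_num
    have h2 := pow_le_pow_left₀ (Real.exp_pos _).le e2u 4
    refine le_of_pow_le_pow_left₀ (n := 5) (by norm_num) (by norm_num) ?_
    rw [h1]; exact h2.trans (by norm_num)
  have hv : 29 / 20 ≤ Real.log (q * (A / m)) := by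
    rw [Real.le_log_iff_exp_le (by positivity)]
    refine le_trans ?_ (mul_le_mul hq2 hr (by norm_num) hq0.le)
    have h1 : Real.exp (29 / 20) ^ 4 = Real.exp 2 ^ 3 * (Real.exp (1 / 5))⁻¹ := by
      rw [← Real.exp_nat_mul, ← Real.exp_nat_mul, ← Real.exp_neg, ← Real.exp_add]; norm_num
    have h2 := Real.add_one_le_exp (1 / 5 : ℝ)
    have h3 := mul_le_mul (pow_le_pow_left₀ (Real.exp_pos _).le e2u 3)
      (inv_anti₀ (by norm_num) h2) (by positivity) (by norm_num)
    refine le_of_pow_le_pow_left₀ (n := 4) (by norm_num) (by norm_num) ?_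
    rw [h1]; exact h3.trans (by norm_num)
  refine exists_tilt_of_bounds (ℓ := Real.log (A / m)) hb (by linarith) hq0 hq1 (by omega) ?_ ?_ ?_
    (by linarith) ?_ ?_ ?_
  · rw [eτ, hA, hm]
  · rw [eτ, ← hA]; nlinarith
  · rw [eτ, ← hA]; nlinarith
  · rw [eτ, hQ]; linarith
  · rw [eτ, ← hA, ← hm]
    have h1 : Real.exp (A - (J - b) * Real.log (q * (A / m))) ≤
        Real.exp (71 / 40) * Real.exp (13 / 40) ^ c := by
      rw [← Real.exp_nat_mul, ← Real.exp_add]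
      apply Real.exp_le_exp.mpr
      have := mul_le_mul_of_nonneg_left hv (by linarith : 0 ≤ (J : ℝ) - b)
      linarith
    have h2 : Real.exp (71 / 40) ≤ 6.1 := by
      have h3 : Real.exp (71 / 40) = Real.exp 2 * (Real.exp (9 / 40))⁻¹ := by
        rw [← Real.exp_neg, ← Real.exp_add]; norm_num
      have h4 := Real.add_one_le_exp (9 / 40 : ℝ)
      rw [h3]
      exact (mul_le_mul e2u (inv_anti₀ (by norm_num) h4) (by positivity) (by norm_num)).trans
        (by norm_num)
    have h3 : Real.exp (13 / 40) ≤ 15 / 8 :=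
      (exp_le_inv_one_sub (by norm_num)).trans (by norm_num)
    have h4 : 40 / 19 * Real.exp (A - (J - b) * Real.log (q * (A / m))) ≤
        40 / 3 * (15 / 8) ^ c := by
      have := h1.trans (mul_le_mul h2 (pow_le_pow_left₀ (Real.exp_pos _).le h3 c) (by positivity)
        (by norm_num))
      have hp : (0 : ℝ) < (15 / 8) ^ c := by positivity
      linarith
    refine h4.trans ?_
    have hf : (0 : ℝ) < (c + 2).factorial := by positivity
    have h5 : 4 * ((c + 2).factorial : ℝ) ≤ 3 * ((c : ℝ) + 1) ^ (c + 2) := by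
      exact_mod_cast factorial_add_two_le hc
    have h6 : 25 / 3 * (15 / 8) ^ c ≤ (3 / 4) ^ c * A ^ (c + 2) / (c + 2).factorial := by
      rw [le_div_iff₀ hf]
      have h7 := pow_le_pow_left₀ (by positivity) hA1 (c + 2)
      have h8 : (3 / 4 : ℝ) ^ c * (5 / 2 * ((c : ℝ) + 1)) ^ (c + 2) =
          25 / 4 * (15 / 8) ^ c * ((c : ℝ) + 1) ^ (c + 2) := by
        rw [mul_pow, pow_add (5 / 2 : ℝ) c 2, show (15 / 8 : ℝ) = 3 / 4 * (5 / 2) by norm_num,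
          mul_pow (3 / 4 : ℝ)]
        ring
      have h9 := mul_le_mul_of_nonneg_left h7 (by positivity : (0 : ℝ) ≤ (3 / 4) ^ c)
      have h10 := mul_le_mul_of_nonneg_left h5 (by positivity : (0 : ℝ) ≤ (15 / 8) ^ c)
      linarith
    have h7 := mul_le_mul hℓ h6 (by positivity) (by linarith)
    linarith
  · intro t ht et
    have ht1 := hℓ.trans ht
    rw [eτ, ← hA] at *
    have h1 : (J + c + 2) * q * Real.exp (-t) ≤ (J + 2) / 5 := by
      have h2 : (J + c + 2) * q * Real.exp (-t) = b * (m / A) := by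
        rw [Real.exp_neg, et, hm]; field_simp
      have h3 : m / A ≤ 1 / 5 := by rw [div_le_iff₀ hA0]; linarith
      rw [h2]
      have := mul_le_mul (by linarith : b ≤ J + 2) h3 (by positivity) (by linarith)
      linarith
    have h2 : Real.exp (t * (b - J + 1)) * (c + 2) ≤ 95 / 96 := by
      have h3 : Real.exp (t * (b - J + 1)) ≤ Real.exp (-(8 / 5)) * Real.exp (-(12 / 5 * (c - 1))) := by
        rw [← Real.exp_add]
        apply Real.exp_le_exp.mpr
        have := mul_le_mul ht1 (by linarith : 3 / 2 * (c : ℝ) - 1 / 2 ≤ J - b - 1) (by linarith)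
          (by linarith)
        linarith
      have h4 := Real.quadratic_le_exp_of_nonneg (x := 8 / 5) (by norm_num)
      have h5 := Real.add_one_le_exp (12 / 5 * ((c : ℝ) - 1))
      have h6 : Real.exp (-(8 / 5)) * Real.exp (-(12 / 5 * ((c : ℝ) - 1))) ≤
          (3.88 : ℝ)⁻¹ * (12 / 5 * ((c : ℝ) - 1) + 1)⁻¹ := by
        rw [Real.exp_neg, Real.exp_neg]
        refine mul_le_mul (inv_anti₀ (by norm_num) ?_) (inv_anti₀ (by linarith) h5) (by positivity)
          (by norm_num)
        norm_num at h4 ⊢; linarith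
      refine (mul_le_mul_of_nonneg_right (h3.trans h6) (by positivity)).trans ?_
      rw [← mul_inv, inv_mul_le_iff₀ (mul_pos (by norm_num) (by linarith))]
      linarith
    have h3 : Real.exp (t * (b - J)) = Real.exp (-t) * Real.exp (t * (b - J + 1)) := by
      rw [← Real.exp_add]; congr 1; ring
    have h4 := mul_le_mul h1 h2 (by positivity) (by positivity)
    have h5 := pow_le_pow_left₀ (by positivity) hA1 2
    have h6 : 8 / 5 * (5 / 2 * ((c : ℝ) + 1)) ^ 2 ≤ t * A ^ 2 :=
      mul_le_mul ht1 h5 (by positivity) (by linarith)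
    have h7 := mul_le_mul_of_nonneg_left h6 (by positivity : 0 ≤ (J : ℝ) + 2)
    have h8 := mul_le_mul_of_nonneg_left h4 (by positivity : 0 ≤ 960 / 19 * ((c : ℝ) + 1) ^ 2)
    calc _ = 960 / 19 * ((c : ℝ) + 1) ^ 2 * ((J + c + 2) * q * Real.exp (-t) *
          (Real.exp (t * (b - J + 1)) * (c + 2))) := by rw [h3]; ring
      _ ≤ 960 / 19 * ((c : ℝ) + 1) ^ 2 * ((J + 2) / 5 * (95 / 96)) := h8
      _ = (J + 2) * (8 / 5 * (5 / 2 * ((c : ℝ) + 1)) ^ 2) := by ring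
      _ ≤ (J + 2) * (t * A ^ 2) := h7
      _ = _ := by ring

theorem exists_tilt {T I : ℕ} {b q : ℝ} (hb : 0 < b) (hbI : b < I) (hq : q < 1)
    (hI : (I : ℝ) ≤ T * q - (T * q - b) / 4)
    (hbad : advantage T (b / T) q I < (T * q - b) / 4) :
    2.56 ≤ T * q - b ∧ 4 ≤ I ∧ 0 < shortfall T I q ∧ ∃ t : ℝ, 0 < t ∧
      bern q T (fun k => Real.exp (t * (b - k))) < 1 ∧ ∃ E : ℝ,
      E = -Real.log (1 - bern q T (fun k => Real.exp (t * (b - k)))) / t ∧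
      E * I / b ≤ shortfall T I q / 2 ∧
      (inflated T I b q - shortfall T I q) * (E * I / b) ≤
        (shortfall T I q - E * I / b) / 24 := by
  have hI0 : (0 : ℝ) < I := hb.trans hbI
  have hI1 : 1 ≤ I := by exact_mod_cast hI0
  have hTq : (I : ℝ) < T * q := by linarith
  have hT0 : (0 : ℝ) < T := by
    refine (Nat.cast_nonneg T).lt_of_ne fun h => ?_
    rw [← h] at hTq; linarith
  have hq0 : 0 < q := pos_of_mul_pos_right (hI0.trans hTq) hT0.le
  have hIT : I < T := by
    have : (T : ℝ) * q < T * 1 := mul_lt_mul_of_pos_left hq hT0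
    exact_mod_cast (show (I : ℝ) < T by linarith)
  obtain ⟨J, rfl⟩ := Nat.exists_eq_add_of_le' hI1
  obtain ⟨c, rfl⟩ : ∃ c, T = J + 1 + (c + 1) := ⟨T - J - 2, by omega⟩
  obtain ⟨f1, f2, f3⟩ := far_of_advantage_lt hI1 (Nat.le_add_left 1 c) hb hbI hq.le hI hbad
  have e : J + 1 + (c + 1) = J + (c + 2) := by omega
  rw [e] at hI hbad hTq ⊢
  push_cast at f2 f3 hbI
  rcases Nat.eq_zero_or_pos c with hc | hc
  · subst hc
    have f2 := f2 rfl
    -- The bound 2.56 is 4/3 of 48/25, because `hI` gives T q - b ≥ (4/3) (I - b).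
    refine ⟨?_, by omega, exists_tilt_top hb (by omega) hq0 hq f2 ?_⟩
    · push_cast at hI ⊢; linarith
    · push_cast at hI ⊢; linarith
  · have f3 := f3 (by omega)
    have hc' : (1 : ℝ) ≤ c := by exact_mod_cast hc
    refine ⟨?_, by omega, exists_tilt_far hc hb f1 hq0 hq f3 ?_⟩
    · push_cast at hI ⊢; linarith
    · push_cast at hI ⊢; linarith

end

/-! ### The dual minorant and its stationary mean -/

section

theorem inflated_anti {T : ℕ} {b q : ℝ} (hb : 0 ≤ b) (hbT : b ≤ T) (hq : 0 ≤ q) {I J : ℕ}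
    (h : I ≤ J) : inflated T J b q ≤ inflated T I b q :=
  mul_le_mul_of_nonneg_left
    (excess_anti (by positivity) (div_le_one_of_le₀ hbT (by positivity)) h) (by positivity)

/-- Stock levels below `T * p` have target zero, but the minorant may be positive there, at most `I
/ J / 24`; the advantage grows in proportion to `I` as well. -/
theorem advantage_ge_small {T I J : ℕ} {p q b : ℝ} (hT : 0 < T) (hp : 0 < p)
    (hI : (I : ℝ) ≤ T * p) (hpb : T * p < b) (hq : q < 1) (hJ : (0 : ℝ) < J) (hbJ : b ≤ J)
    (hbq : 2.56 ≤ T * q - b) (hu : 1 / 4 ≤ upper T I) :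
    (I : ℝ) / J * (1 / 24) ≤ advantage T p q I := by
  have hT0 : (0 : ℝ) < T := by exact_mod_cast hT
  have hb : 0 < b := (by positivity : (0 : ℝ) ≤ T * p).trans_lt hpb
  have hpq : p ≤ q := by nlinarith
  refine le_trans ?_ (advantage_ge_upper (I := I) hT hp hI hpq hq.le)
  have h5 : (T * q - b) / b ≤ (q - p) / p := by
    rw [div_le_div_iff₀ hb hp]; nlinarith
  have h7 : 2.56 / J ≤ (T * q - b) / b := by
    rw [div_le_div_iff₀ hJ hb]; nlinarith
  have h8 : (2.56 : ℝ) / J ≤ (q - p) / p := h7.trans h5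
  have h9 : (I : ℝ) * (1 / 4) ≤ I * upper T I := mul_le_mul_of_nonneg_left hu (Nat.cast_nonneg _)
  have h10 := mul_le_mul h9 h8 (by positivity) ((by positivity : (0 : ℝ) ≤ I * (1 / 4)).trans h9)
  rw [mul_div_assoc]
  refine le_trans ?_ h10
  have : (0 : ℝ) ≤ I / J := by positivity
  have e : (I : ℝ) * (1 / 4) * (2.56 / J) = I / J * 0.64 := by ring
  rw [e]
  linarith

open Classical in
set_option maxHeartbeats 1000000 in
/-- A linear minorant of the advantage in excess of its target, in terms of the inventory and the
expected leftover. -/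
theorem exists_dual {T : ℕ} {p q b : ℝ} (hp : 0 < p) (hpb : T * p < b) (hbq : b < T * q)
    (hq : q < 1) : ∃ c : ℝ, 0 ≤ c ∧ (c = 0 ∨ ∃ t : ℝ, 0 < t ∧
      bern q T (fun k => Real.exp (t * (b - k))) < 1 ∧ ∀ I : ℕ,
        c * (-Real.log (1 - bern q T (fun k => Real.exp (t * (b - k)))) / t * I / b -
          shortfall T I q) ≤ advantage T p q I -
          (T * q - b) / 4 * (if T * p < I ∧ (I : ℝ) ≤ T * q - (T * q - b) / 4 then 1 else 0)) ∧
      (c = 0 → ∀ I : ℕ, 0 ≤ advantage T p q I -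
          (T * q - b) / 4 * (if T * p < I ∧ (I : ℝ) ≤ T * q - (T * q - b) / 4 then 1 else 0)) := by
  set δ := (T * q - b) / 4 with hδ
  have hδ0 : 0 < δ := by rw [hδ]; linarith
  have hT : 0 < T := by
    rcases Nat.eq_zero_or_pos T with h | h
    · subst h; simp at hpb hbq; linarith
    · exact h
  have hT0 : (0 : ℝ) < T := by exact_mod_cast hT
  have hb : 0 < b := (by positivity : (0 : ℝ) ≤ T * p).trans_lt hpb
  have hpσ : p ≤ b / T := by rw [le_div_iff₀ hT0]; linarith
  have hσq : b / T ≤ q := by rw [div_le_iff₀ hT0]; linarith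
  have hpq : p ≤ q := hpσ.trans hσq
  have hq0 : 0 < q := hp.trans_le hpq
  have hqT : T * q < T := by nlinarith
  have hanti : ∀ I, advantage T (b / T) q I ≤ advantage T p q I := fun I =>
    advantage_anti hp hpσ (hσq.trans hq.le) hq0.le
  have hnn : ∀ I, 0 ≤ advantage T p q I := fun I => advantage_nonneg hp hpq hq.le
  have hlow : ∀ I : ℕ, T * p < I → (I : ℝ) ≤ b → 4 * upper T I * δ ≤ advantage T p q I := by
    intro I h1 h2
    have hI1 : 1 ≤ I := by
      have : (0 : ℝ) < I := (by positivity : (0 : ℝ) ≤ T * p).trans_lt h1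
      exact_mod_cast this
    have hIT : I ≤ T := by
      have : (I : ℝ) ≤ T := by linarith
      exact_mod_cast this
    have := advantage_ge_of_le hI1 hp h1.le (h2.trans_lt hbq) hq.le
    have h3 := mul_le_mul_of_nonneg_left (show 4 * δ ≤ T * q - I by rw [hδ]; linarith)
      (upper_nonneg hIT)
    linarith
  have hquarter : ∀ I : ℕ, 0 < I → (I : ℝ) ≤ b → 1 / 4 ≤ upper T I := by
    intro I h1 h2
    refine upper_ge_quarter h1 ?_
    have : (I : ℝ) < T := by linarith
    exact_mod_cast this
  by_cases hbad : ∃ I : ℕ, b < I ∧ (I : ℝ) ≤ T * q - δ ∧ advantage T (b / T) q I < δ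
  -- Some stock level above `b` may miss the target and a genuine dual multiplier is needed;
  -- otherwise the pointwise bound holds and `c = 0` serves.
  · obtain ⟨I₀, hbI, hIδ, hlt⟩ := hbad
    obtain ⟨hδ1, hI4, hR, t, ht, hX, E, hE, hρ, hτ⟩ := exists_tilt hb hbI hq hIδ hlt
    set R := shortfall T I₀ q with hRd
    set D := inflated T I₀ b q with hDd
    have hI0 : (0 : ℝ) < I₀ := by
      have : (4 : ℝ) ≤ I₀ := by exact_mod_cast hI4
      linarith
    have hDR : 0 < D - R := by
      rw [advantage_eq_inflated] at hlt
      linarith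
    have hden : 0 < R - E * I₀ / b := by linarith
    have hE0 : 0 ≤ E := by
      rw [hE]
      refine div_nonneg (neg_nonneg.mpr (Real.log_nonpos (by linarith) ?_)) ht.le
      have : 0 ≤ bern q T (fun k => Real.exp (t * (b - k))) :=
        bern_nonneg hq0.le hq.le _ fun _ _ => (Real.exp_pos _).le
      linarith
    -- This multiplier makes the minorant equal to `R - D` at `I₀`, which bounds the advantage minus
    -- its target there from below.
    set c := (D - R) / (R - E * I₀ / b) with hc
    have hc0 : 0 < c := div_pos hDR hden
    refine ⟨c, hc0.le, Or.inr ⟨t, ht, hX, fun I => ?_⟩, fun h => absurd h hc0.ne'⟩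
    rw [← hE]
    have hcR : c * (R - E * I₀ / b) = D - R := div_mul_cancel₀ _ hden.ne'
    have hcE : c * (E * I₀ / b) ≤ 1 / 24 := by
      rw [hc, div_mul_eq_mul_div, div_le_iff₀ hden]; linarith
    have hIT0 : I₀ < T := by
      have : (I₀ : ℝ) < T := by linarith
      exact_mod_cast this
    have hRn : 0 ≤ shortfall T I q := shortfall_nonneg hq0.le hq.le
    have hsmall : c * (E * I / b - shortfall T I q) ≤ I / I₀ * (1 / 24) := by
      calc c * (E * I / b - shortfall T I q) ≤ c * (E * I / b) :=
            mul_le_mul_of_nonneg_left (by linarith) hc0.le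
        _ = I / I₀ * (c * (E * I₀ / b)) := by field_simp
        _ ≤ I / I₀ * (1 / 24) := mul_le_mul_of_nonneg_left hcE (by positivity)
    rcases le_or_gt I₀ I with h | h
    -- Beyond `I₀` the minorant stays at or below `R - D` because shortfall per unit of stock is
    -- nondecreasing, while shortfall minus inflated excess only improves.
    · have hII : (1 : ℝ) ≤ I / I₀ := by
        rw [le_div_iff₀ hI0, one_mul]; exact_mod_cast h
      have h1 : c * (E * I / b - shortfall T I q) ≤ -(D - R) := by
        have h2 := mul_shortfall_le hq0.le hq.le (T := T) h
        have h3 : I / I₀ * R ≤ shortfall T I q := by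
          rw [div_mul_eq_mul_div, div_le_iff₀ hI0]; linarith
        have h4 : c * (E * I / b - shortfall T I q) ≤ c * (I / I₀ * -(R - E * I₀ / b)) := by
          refine mul_le_mul_of_nonneg_left ?_ hc0.le
          have : E * I / b = I / I₀ * (E * I₀ / b) := by field_simp
          rw [this]; nlinarith
        have h5 : c * (I / I₀ * -(R - E * I₀ / b)) = -(I / I₀ * (D - R)) := by
          rw [← hcR]; ring
        rw [h5] at h4
        nlinarith
      split_ifs with hE2
      · have h2 := hanti I
        rw [advantage_eq_inflated] at h2
        have h3 := shortfall_mono hq0.le hq.le (T := T) h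
        have h4 := inflated_anti hb.le (by linarith : b ≤ T) hq0.le h
        linarith [hE2.2]
      · have := hnn I
        linarith
    -- Below `I₀` the minorant is at most 1/24 of `I / I₀`. This is covered by the factor 5/4 from
    -- `upper_ge` for 2 ≤ I ≤ b, by the explicit bound for one unit, by `advantage_ge_add` above `b`
    -- and by `advantage_ge_small` up to `T * p`.
    · have hII : (I : ℝ) / I₀ ≤ 1 := by
        rw [div_le_one hI0]; exact_mod_cast h.le
      have hI1 : (I : ℝ) + 1 ≤ I₀ := by exact_mod_cast h
      have hle : c * (E * I / b - shortfall T I q) ≤ 1 / 24 := by linarith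
      rcases le_or_gt (I : ℝ) b with hIb | hIb
      · rcases lt_or_ge (T * p) (I : ℝ) with hpI | hpI
        · rw [if_pos ⟨hpI, by linarith⟩, mul_one]
          have hIpos : 0 < I := by
            have : (0 : ℝ) < I := (by positivity : (0 : ℝ) ≤ T * p).trans_lt hpI
            exact_mod_cast this
          rcases Nat.lt_or_ge 1 I with h2 | h2
          · have h3 := hlow I hpI hIb
            have h4 := upper_ge (T := T) h2 (by omega)
            have := mul_le_mul_of_nonneg_right h4 hδ0.le
            linarith
          · have h5 : I = 1 := by omega
            subst h5
            have hb1 : (1 : ℝ) ≤ b := by simpa using hIb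
            have h6 := advantage_one_ge hp (by simpa using hpI.le) (by linarith) hq.le
            linarith
        · rw [if_neg (fun h => absurd h.1 (not_lt.mpr hpI)), mul_zero, sub_zero]
          refine hsmall.trans ?_
          rcases Nat.eq_zero_or_pos I with h2 | h2
          · subst h2; simpa using hnn 0
          · exact advantage_ge_small hT hp hpI hpb hq hI0 hbI.le (by linarith) (hquarter I h2 hIb)
      · rw [if_pos ⟨by linarith, by linarith⟩, mul_one]
        have := advantage_ge_add (T := T) (I := I) hb hIb hq (by omega) (by linarith) (by
          intro h2
          have : (4 : ℝ) ≤ I₀ := by exact_mod_cast hI4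
          linarith)
        have := hanti I
        linarith
  · push Not at hbad
    have key : ∀ I : ℕ, 0 ≤ advantage T p q I -
        δ * (if T * p < I ∧ (I : ℝ) ≤ T * q - δ then 1 else 0) := by
      intro I
      split_ifs with hE
      · rw [mul_one, sub_nonneg]
        rcases le_or_gt (I : ℝ) b with hIb | hIb
        · have hIpos : 0 < I := by
            have : (0 : ℝ) < I := (by positivity : (0 : ℝ) ≤ T * p).trans_lt hE.1
            exact_mod_cast this
          have h3 := hlow I hE.1 hIb
          have := mul_le_mul_of_nonneg_right (hquarter I hIpos hIb) hδ0.le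
          linarith
        · exact (hbad I hIb hE.2).trans (hanti I)
      · rw [mul_zero, sub_zero]; exact hnn I
    exact ⟨0, le_rfl, Or.inl rfl, fun _ => key⟩

variable (P : Model)

-- Combines `exists_dual` with the leftover bound for the same tilt `t`; the indicator has the
-- stationary probability of the event as its mean.
open Classical in
theorem Model.statE_advantage_ge {T S : ℕ} (hT : 1 ≤ T) (hint : P.Interior T S)
    (hp : 0 < P.lam P.M) :
    P.slack T S / (4 * (P.L + 1)) * P.statE T S (fun x =>
      if T * P.lam P.M < (P.onHand x : ℝ) ∧
        (P.onHand x : ℝ) ≤ T * (1 - P.lam 0) - P.slack T S / (4 * (P.L + 1)) then 1 else 0) ≤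
    P.statE T S (fun x => advantage T (P.lam P.M) (1 - P.lam 0) (P.onHand x)) := by
  have hT0 : (0 : ℝ) < T := by exact_mod_cast hT
  set q := 1 - P.lam 0 with hqd
  set p := P.lam P.M with hpd
  have hL : (0 : ℝ) < P.L + 1 := by positivity
  have hS : (0 : ℝ) < S := lt_of_le_of_lt (by positivity) hint.1
  set b : ℝ := S / (P.L + 1) with hb
  have hδ : P.slack T S / (4 * (P.L + 1)) = (T * q - b) / 4 := by
    rw [Model.slack, hb]; field_simp; rfl
  have hpb : T * p < b := by rw [hb, lt_div_iff₀ hL]; linarith [hint.1]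
  have hbq : b < T * q := by rw [hb, div_lt_iff₀ hL]; linarith [hint.2]
  rw [hδ, ← P.statE_const_mul, ← sub_nonneg, ← P.statE_sub]
  obtain ⟨c, hc, h1, h2⟩ := exists_dual hp hpb hbq P.q_lt_one
  set f : ℕ → ℝ := fun I => advantage T p q I -
    (T * q - b) / 4 * (if T * p < I ∧ (I : ℝ) ≤ T * q - (T * q - b) / 4 then 1 else 0) with hf
  change 0 ≤ P.statE T S (fun x => f (P.onHand x))
  rcases h1 with h1 | ⟨t, ht, hX, h1⟩
  · exact (P.statE_const T S 0).symm.trans_le (P.statE_mono fun x _ => h2 h1 (P.onHand x))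
  · have hE := P.leftover_le (T := T) (S := S) ht hX
    exact P.statE_nonneg_of_dual (f := f) hc hS hE h1

end

/-! ### The bound for every cycle length -/

section

variable (P : Model)

/-- The main term alone is already a lower bound; `M₁ √T` is nonnegative and only weakens it.
Evaluating offline at the level `S` suffices because its own optimum earns at least as much. -/
theorem Model.every_cycle {T Soff S : ℕ} (hT : 1 ≤ T) (hoff : P.IsOptimal Alg.offline T Soff)
    (hint : P.Interior T S) {ν : Measure P.State} (hν : P.IsStationary Alg.greedy T S ν) :
    P.A / (1 - P.lam 0) * (P.slack T S / (4 * ((P.L : ℝ) + 1))) *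
        ν.real {x | (T : ℝ) * P.lam P.M < (P.onHand x : ℝ) ∧
          (P.onHand x : ℝ) ≤ (T : ℝ) * (1 - P.lam 0) - P.slack T S / (4 * ((P.L : ℝ) + 1))} -
        P.M₁ * Real.sqrt T ≤
      P.longRunProfit Alg.offline T Soff - P.longRunProfit Alg.greedy T S := by
  classical
  have hq := P.interior_q_pos hT hint
  have h1 := P.longRun_gain_nonneg hq T S
  have h2 := hoff S
  have h3 := mul_nonneg P.M₁_nonneg (Real.sqrt_nonneg (T : ℝ))
  rcases (P.lam_nonneg P.M le_rfl).eq_or_lt with hp0 | hp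
  · have hA : P.A = 0 := by rw [P.A_eq, ← hp0, mul_zero]
    rw [hA]
    simp only [zero_div, zero_mul]
    linarith
  · set E := {x : P.State | (T : ℝ) * P.lam P.M < (P.onHand x : ℝ) ∧
      (P.onHand x : ℝ) ≤ (T : ℝ) * (1 - P.lam 0) - P.slack T S / (4 * ((P.L : ℝ) + 1))} with hE
    have h4 : ν.real E = P.statE T S (fun x => if x ∈ E then 1 else 0) := by
      rw [← P.integral_eq_statE hν, ← mul_one (ν.real E), ← smul_eq_mul,
        ← integral_indicator_const (1 : ℝ) (MeasurableSet.of_discrete (s := E))]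
      congr 1
      funext x
      exact Set.indicator_apply _ _ _
    have h5 := P.statE_advantage_ge hT hint hp
    have h6 := P.longRun_gain hq hp T S
    have h7 := mul_le_mul_of_nonneg_left h5 (div_nonneg P.A_nonneg hq.le)
    rw [h4, mul_assoc]
    simp only [hE, Set.mem_ofPred_eq]
    linarith

end

end InvFul

end

theorem mainTheorem6 (P : InvFul.Model) (Soff Sgr : ℕ → ℕ)
    (hoff : ∀ T : ℕ, 1 ≤ T → P.IsOptimal InvFul.Alg.offline T (Soff T))
    (hgr : ∀ T : ℕ, 1 ≤ T → P.IsOptimal InvFul.Alg.greedy T (Sgr T)) :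
    -- the stationary law is unique and common to both algorithms, and the long-run averages exist
    -- and do not depend on the initial state
    (∀ T S : ℕ, 1 ≤ T →
      (∃ ν : Measure P.State, ∀ (a : InvFul.Alg) (ν' : Measure P.State),
        P.IsStationary a T S ν' ↔ ν' = ν) ∧
      ∀ (a : InvFul.Alg) (x₀ : P.State), P.Feasible S x₀ →
        Tendsto (P.avgProfit a T S x₀) atTop (𝓝 (P.longRunProfit a T S))) ∧
    (0 < P.lam P.M → 0 < P.A) ∧
    -- the bound for every cycle length
    (∀ T : ℕ, 1 ≤ T → P.Interior T (Sgr T) → ∀ ν : Measure P.State,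
      P.IsStationary InvFul.Alg.greedy T (Sgr T) ν →
        P.A / (1 - P.lam 0) * (P.slack T (Sgr T) / (4 * ((P.L : ℝ) + 1))) *
            ν.real {x | (T : ℝ) * P.lam P.M < (P.onHand x : ℝ) ∧
              (P.onHand x : ℝ) ≤
                (T : ℝ) * (1 - P.lam 0) - P.slack T (Sgr T) / (4 * ((P.L : ℝ) + 1))} -
            P.M₁ * Real.sqrt T ≤
          P.longRunProfit InvFul.Alg.offline T (Soff T) -
            P.longRunProfit InvFul.Alg.greedy T (Sgr T)) ∧
    -- the bound for long cycles
    ((∀ᶠ T : ℕ in atTop, P.Interior T (Sgr T)) →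
      (∃ K₂ : ℝ, P.Concentration Sgr K₂) ∧
      ∀ K₂ : ℝ, P.Concentration Sgr K₂ →
        (∃ T₁ : ℕ, ∀ T : ℕ, T₁ ≤ T →
          P.A / (2 * (1 - P.lam 0) * ((P.L : ℝ) + 1)) * P.slack T (Sgr T) -
              (P.A * K₂ / (1 - P.lam 0) + P.M₁) * Real.sqrt T ≤
            P.longRunProfit InvFul.Alg.offline T (Soff T) -
              P.longRunProfit InvFul.Alg.greedy T (Sgr T)) ∧
        -- orders of magnitude of the two terms
        (0 < P.lam P.M → ∀ β : ℝ, 0 ≤ β → β ≤ 1 →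
          Asymptotics.IsTheta atTop (fun T : ℕ => P.slack T (Sgr T)) (fun T : ℕ => (T : ℝ) ^ β) →
            Asymptotics.IsTheta atTop
              (fun T : ℕ => P.A / (2 * (1 - P.lam 0) * ((P.L : ℝ) + 1)) * P.slack T (Sgr T))
              (fun T : ℕ => (T : ℝ) ^ β) ∧
            Asymptotics.IsTheta atTop
              (fun T : ℕ => (P.A * K₂ / (1 - P.lam 0) + P.M₁) * Real.sqrt T)
              (fun T : ℕ => Real.sqrt T))) := by
  refine ⟨fun T S _ => ⟨⟨P.statLaw T S, fun a ν' => P.isStationary_iff_eq a T S ν'⟩,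
    fun a x₀ hx => ?_⟩, P.A_pos, fun T hT hint ν hν => P.every_cycle hT (hoff T hT) hint hν,
    fun hint => ⟨P.exists_concentration hgr, fun K₂ hK =>
      ⟨P.long_cycles hoff hgr hint hK, fun hp β _ _ hβ => P.orders_of_magnitude hint hK hp hβ⟩⟩⟩
  rw [P.longRunProfit_eq]
  exact P.tendsto_avgProfit a hx
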